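/- Let $p\ge 2$, let $a_0,\dots,a_p\in\mathbb R$, and let $(Q_n)_{n\ge0}$ be the monic polynomials defined by $$\lambda Q_n(\lambda)=Q_{n+1}(\lambda)+a_0Q_n(\lambda)+\cdots+a_pQ_{n-p}(\lambda),\qquad Q_0=1,\quad Q_{-1}=\cdots=Q_{-p}=0 .$$ Put $a(z)=z^{-1}+a_0+a_1z+\cdots+a_pz^p$ and $r(z)=a(1/z)$, and assume that $$q(z)=z^{p+1}r'(z)=z^{p+1}-a_1z^{p-1}-2a_2z^{p-2}-\cdots-pa_p$$ has only real simple zeros, $p$ of one sign and one of the other. Label them so that either $x_1<\cdots<x_p<0<x_{p+1}$ or $x_{p+1}<0<x_p<\cdots<x_1$, and put $\lambda_k=r(x_k)$. For $\lambda\in\mathbb C$ let $z_0(\lambda),\dots,z_p(\lambda)$ be the solutions of $a(z)=\lambda$, repeated according to multiplicity and ordered so that $|z_0(\lambda)|\le\cdots\le|z_p(\lambda)|$ (ties are broken arbitrarily), and let $\Gamma_k=\{\lambda\in\mathbb C:|z_{k-1}(\lambda)|=|z_k(\lambda)|\}$ for $k=1,\dots,p$. Let $A$ be the operator on $\ell^2$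 whose matrix has entries $1$ on the first superdiagonal, $a_k$ on the $k$-th subdiagonal for $0\le k\le p$ ($k=0$ being the main diagonal), and $0$ elsewhere. With $e_0,e_1,\dots$ the standard unit vectors, let $g_k(\lambda)=((\lambda I-A)^{-1}e_{k-1},e_0)$, $k=1,\dots,p$, for $\lambda$ in the resolvent set of $A$. Let $f_-(x)$ denote the boundary value of $f$ at $x\in\mathbb R$ from the lower half-plane, and for a real measure $\beta$ on $\mathbb R$ let $\widehat\beta(\lambda)=\int\frac{d\beta(t)}{\lambda-t}$. Define absolutely continuous measures $\rho_j$ on $\Gamma_j$ by $$\frac{d\rho_1}{dx}=\frac{\operatorname{Im}z_{0,-}(x)}{\pi},\quad x\in\Gamma_1,\qquad \frac{d\rho_j}{dx}=\frac{\operatorname{Im}z_{j-1,-}(x)}{\pi(x-\lambda_j)},\quad x\in\Gamma_j,\ j=2,\dots,p,$$ for measures $\beta_j$ on $\Gamma_j$ and $\beta_{j+1}$ on $\Gamma_{j+1}$ put $d\langle\beta_j,\beta_{j+1}\rangle(x)=(x-\lambda_{j+1})\widehat\beta_{j+1}(x)\,d\beta_j(x)$, and let $\sigma_1=\rho_1$,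 $\sigma_2=\langle\rho_1,\rho_2\rangle$, $\sigma_3=\langle\rho_1,\langle\rho_2,\rho_3\rangle\rangle$, …, $\sigma_p=\langle\rho_1,\langle\rho_2,\dots,\rho_p\rangle\rangle$. Then: (i) If $q$ has $p$ negative zeros, then $\lambda_1<\lambda_{p+1}$ and $\Gamma_1=[\lambda_1,\lambda_{p+1}]$; if $q$ has $p$ positive zeros, then $\lambda_{p+1}<\lambda_1$ and $\Gamma_1=[\lambda_{p+1},\lambda_1]$. For $k=2,\dots,p$ the point $x_k$ is a local maximum or a local minimum of $r$; in the first case $\Gamma_k=[\lambda_k,+\infty)$, in the second $\Gamma_k=(-\infty,\lambda_k]$. The measures above are well defined: for $1\le j\le p$ the boundary values $z_{j-1,-}$ exist on $\Gamma_j$, the Cauchy transforms in the products converge absolutely, $\sigma_1,\dots,\sigma_p$ are finite, and for $1\le j\le k\le p$ the density of $\langle\rho_j,\langle\rho_{j+1},\dots,\rho_k\rangle\rangle$ is either positive or negative throughout the interior of $\Gamma_j$. The system $(\sigma_1,\dots,\sigma_p)$ is called the generalized Nikishin system generated by $(\rho_1,\dots,\rho_p)$. (ii) There are finite signed measures $\mu_1,\dots,\mu_p$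 supported on $\Gamma_1$, absolutely continuous with respect to Lebesgue measure, such that $g_k=\widehat\mu_k$ on the resolvent set of $A$, which does not meet $\Gamma_1$, and $z_0^k=\widehat\mu_k$ on $\mathbb C\setminus\Gamma_1$ (so that $z_0^k$ is the analytic extension of $g_k$ to $\mathbb C\setminus\Gamma_1$), $k=1,\dots,p$. (iii) There are real constants $c_{j,k}$, $1\le k\le j\le p$, with $c_{j,j}=1$, such that the measures in (ii) satisfy $\mu_j=\sum_{k=1}^jc_{j,k}\sigma_k$, $j=1,\dots,p$. (iv) Let $n\ge0$, $n=mp+s$ with $0\le s<p$, and put $n_j=m+1$ for $1\le j\le s$ and $n_j=m$ for $s<j\le p$. Then $$\int x^{k}Q_n(x)\,d\sigma_j(x)=0,\qquad k=0,\dots,n_j-1,\quad j=1,\dots,p,$$ and $Q_n$ has $n$ zeros, all of them simple and in the interior of $\Gamma_1$. -/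

import Mathlib

open MeasureTheory Filter Topology Polynomial

noncomputable section

namespace ConstRec

/-! ### The recurrence, the symbol and the critical points -/

/-- The monic polynomials with `x Q_n = Q_{n+1} + a_0 Q_n + ⋯ + a_p Q_{n-p}`, `Q_0 = 1`, where the
polynomials of negative index are `0`. -/
def Q (a : ℕ → ℝ) (p : ℕ) : ℕ → ℝ[X]
  | 0 => 1
  | n + 1 => X * Q a p n - ∑ k : Fin (n + 1), if (k : ℕ) ≤ p then C (a k) * Q a p (n - k) else 0
termination_by n => n
decreasing_by all_goals omega

/-- The `j`-th component (`1 ≤ j ≤ p`) of the multi-index `(m+1, …, m+1, m, …, m)` attached to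
`n = m p + k`, `0 ≤ k < p`, which has `k` components `m + 1`. -/
def multiIndex (p n j : ℕ) : ℕ := n / p + if j ≤ n % p then 1 else 0

/-- `z (a(z) - l) = 1 + (a_0 - l) z + a_1 z² + ⋯ + a_p z^{p+1}`, where
`a(z) = 1/z + a_0 + a_1 z + ⋯ + a_p z^p`; its roots are the solutions of `a(z) = l`. -/
def symbolPoly (a : ℕ → ℝ) (p : ℕ) (l : ℂ) : ℂ[X] :=
  1 - C l * X + ∑ k ∈ Finset.range (p + 1), C (a k : ℂ) * X ^ (k + 1)

/-- For every `l`, `z 0 l, …, z p l` are the `p + 1` solutions of `a(z) = l`, with multiplicity,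
listed with nondecreasing absolute values (ties are broken arbitrarily). -/
structure IsRootLabelling (a : ℕ → ℝ) (p : ℕ) (z : ℕ → ℂ → ℂ) : Prop where
  roots_eq : ∀ l, (symbolPoly a p l).roots = (Multiset.range (p + 1)).map fun i => z i l
  norm_le : ∀ l, ∀ i < p, ‖z i l‖ ≤ ‖z (i + 1) l‖

/-- A labelling exists as soon as `p ≥ 1` and `a_p ≠ 0`. -/
theorem exists_isRootLabelling (a : ℕ → ℝ) (p : ℕ) (hp : 1 ≤ p) (ha : a p ≠ 0) :
    ∃ z, IsRootLabelling a p z := by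
  have hdeg : ∀ l, (symbolPoly a p l).natDegree = p + 1 := by
    intro l
    have h1 : ∀ k, p + 1 < k → (symbolPoly a p l).coeff k = 0 := by
      intro k hk
      simp only [symbolPoly, coeff_add, coeff_sub, finsetSum_coeff, coeff_one, coeff_C_mul, coeff_X,
        coeff_X_pow]
      rw [if_neg (by omega), if_neg (by omega), Finset.sum_eq_zero]
      · simp
      · intro i hi
        rw [Finset.mem_range] at hi
        rw [if_neg (by omega), mul_zero]
    have h2 : (symbolPoly a p l).coeff (p + 1) ≠ 0 := by
      simp only [symbolPoly, coeff_add, coeff_sub, finsetSum_coeff, coeff_one, coeff_C_mul, coeff_X,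
        coeff_X_pow]
      rw [if_neg (by omega), if_neg (by omega), Finset.sum_eq_single p]
      · simpa using ha
      · intro i _ hi
        rw [if_neg (by omega), mul_zero]
      · simp
    exact le_antisymm (natDegree_le_iff_coeff_eq_zero.2 h1) (le_natDegree_of_ne_zero h2)
  have key : ∀ l : ℂ, ∃ L : List ℂ, (L : Multiset ℂ) = (symbolPoly a p l).roots ∧
      L.length = p + 1 ∧ L.Pairwise fun u v => ‖u‖ ≤ ‖v‖ := by
    intro l
    have ht : Std.Total (fun u v : ℂ => ‖u‖ ≤ ‖v‖) := ⟨fun u v => le_total _ _⟩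
    have ht2 : IsTrans ℂ (fun u v : ℂ => ‖u‖ ≤ ‖v‖) := ⟨fun u v w => le_trans⟩
    have hp := List.perm_insertionSort (fun u v : ℂ => ‖u‖ ≤ ‖v‖) (symbolPoly a p l).roots.toList
    have he : ((List.insertionSort (fun u v : ℂ => ‖u‖ ≤ ‖v‖) (symbolPoly a p l).roots.toList :
        List ℂ) : Multiset ℂ) = (symbolPoly a p l).roots := by
      rw [Multiset.coe_eq_coe.2 hp, Multiset.coe_toList]
    refine ⟨_, he, ?_, List.pairwise_insertionSort _ _⟩
    rw [← Multiset.coe_card, he, ← hdeg l]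
    exact (splits_iff_card_roots.1 (IsAlgClosed.splits _))
  choose L hL hlen hs using key
  refine ⟨fun i l => (L l).getD i 0, fun l => ?_, fun l i hi => ?_⟩
  · rw [← hL l, Multiset.range, Multiset.map_coe, ← hlen l]
    congr 1
    exact (List.ext_getElem (by simp) (by intro i h1 h2; simp [List.getElem?_eq_getElem h1]))
  · have h1 : i < (L l).length := by rw [hlen]; omega
    have h2 : i + 1 < (L l).length := by rw [hlen]; omega
    rw [List.getD_eq_getElem _ _ h1, List.getD_eq_getElem _ _ h2]
    exact List.pairwise_iff_getElem.1 (hs l) i (i+1) h1 h2 (by omega)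

/-- `r(w) = a(1/w) = w + a_0 + a_1 / w + ⋯ + a_p / w^p` on the real line. -/
def r (a : ℕ → ℝ) (p : ℕ) (w : ℝ) : ℝ := w + ∑ k ∈ Finset.range (p + 1), a k / w ^ k

/-- `q(w) = w^{p+1} r'(w) = w^{p+1} - a_1 w^{p-1} - 2 a_2 w^{p-2} - ⋯ - p a_p`. -/
def q (a : ℕ → ℝ) (p : ℕ) : ℝ[X] :=
  X ^ (p + 1) - ∑ k ∈ Finset.Icc 1 p, C ((k : ℝ) * a k) * X ^ (p - k)

/-- `x_1 < ⋯ < x_p < 0 < x_{p+1}`. -/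
def NegCase (p : ℕ) (x : ℕ → ℝ) : Prop :=
  StrictMonoOn x (Set.Icc 1 p) ∧ x p < 0 ∧ 0 < x (p + 1)

/-- `x_{p+1} < 0 < x_p < ⋯ < x_1`. -/
def PosCase (p : ℕ) (x : ℕ → ℝ) : Prop :=
  StrictAntiOn x (Set.Icc 1 p) ∧ 0 < x p ∧ x (p + 1) < 0

/-- The branch points `λ_k = r(x_k)`. -/
def branchPt (a : ℕ → ℝ) (p : ℕ) (x : ℕ → ℝ) (k : ℕ) : ℝ := r a p (x k)

/-! ### The sets `Γ_k` and the generalized Nikishin system -/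

/-- `Γ_k = {l : |z_{k-1}(l)| = |z_k(l)|}`, for `k ≥ 1`. -/
def Γ (z : ℕ → ℂ → ℂ) (k : ℕ) : Set ℂ := {l | ‖z (k - 1) l‖ = ‖z k l‖}

/-- The real points of `Γ_k`. -/
def ΓReal (z : ℕ → ℂ → ℂ) (k : ℕ) : Set ℝ := {x | (x : ℂ) ∈ Γ z k}

/-- The boundary value `f_-(x)` of `f` from the lower half-plane. -/
def lowerValue (f : ℂ → ℂ) (x : ℝ) : ℂ := limUnder (𝓝[{w : ℂ | w.im < 0}] (x : ℂ)) f

/-- The density of the generating measure `ρ_j` with respect to Lebesgue measure: on `Γ_j` it is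
`Im z_{0,-}(x) / π` for `j = 1` and `Im z_{j-1,-}(x) / (π (x - λ_j))` for `j ≥ 2`. The sequence
`b` is the sequence of branch points. The measures `ρ_j`, `j ≥ 2`, are infinite and may be negative;
like all the measures built from them they are handled through their densities. -/
def ρ (z : ℕ → ℂ → ℂ) (b : ℕ → ℝ) (j : ℕ) : ℝ → ℝ :=
  (ΓReal z j).indicator fun x =>
    if j = 1 then (lowerValue (z 0) x).im / Real.pi
    else (lowerValue (z (j - 1)) x).im / (Real.pi * (x - b j))

/-- At real points, the Cauchy transform `∫ dβ(t) / (x - t)` of the measure with density `w`. -/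
def cauchyReal (w : ℝ → ℝ) (x : ℝ) : ℝ := ∫ t, w t / (x - t)

/-- The density of `⟨β_j, β_{j+1}⟩`, i.e. of `(x - λ_{j+1}) β̂_{j+1}(x) dβ_j(x)`, in terms of the
densities `u` of `β_j` and `v` of `β_{j+1}`. -/
def prodDensity (b : ℕ → ℝ) (j : ℕ) (u v : ℝ → ℝ) (x : ℝ) : ℝ :=
  (x - b (j + 1)) * cauchyReal v x * u x

/-- The density of `⟨ρ_j, ⟨ρ_{j+1}, … ρ_{j+m}⟩⟩`, a measure on `Γ_j`. -/
def nikishinDensity (z : ℕ → ℂ → ℂ) (b : ℕ → ℝ) : ℕ → ℕ → ℝ → ℝ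
  | 0, j => ρ z b j
  | m + 1, j => prodDensity b j (ρ z b j) (nikishinDensity z b m (j + 1))

/-- `σ_k = ⟨ρ_1, ⟨ρ_2, … ρ_k⟩⟩`, for `k ≥ 1`. -/
def σ (z : ℕ → ℂ → ℂ) (b : ℕ → ℝ) (k : ℕ) : SignedMeasure ℝ :=
  volume.withDensityᵥ (nikishinDensity z b (k - 1) 1)

/-- `(σ_1, …, σ_p)` is well defined by the constructions above: the boundary values exist on the
sets `Γ_j`, the Cauchy transforms in the products converge absolutely, the measures `σ_k` are finite,
and all the measures involved have constant sign. -/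
structure IsNikishinSystem (p : ℕ) (z : ℕ → ℂ → ℂ) (b : ℕ → ℝ) : Prop where
  boundary : ∀ j ∈ Finset.Icc 1 p, ∀ x ∈ ΓReal z j,
    Tendsto (z (j - 1)) (𝓝[{w : ℂ | w.im < 0}] (x : ℂ)) (𝓝 (lowerValue (z (j - 1)) x))
  cauchy : ∀ j m, 2 ≤ j → j + m ≤ p → ∀ x ∈ ΓReal z (j - 1),
    Integrable fun t => nikishinDensity z b m j t / (x - t)
  finite : ∀ k ∈ Finset.Icc 1 p, Integrable (nikishinDensity z b (k - 1) 1)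
  sign : ∀ j m, 1 ≤ j → j + m ≤ p →
    (∀ x ∈ interior (ΓReal z j), 0 < nikishinDensity z b m j x) ∨
      (∀ x ∈ interior (ΓReal z j), nikishinDensity z b m j x < 0)

/-- The Cauchy transform `∫ dμ(x) / (l - x)` of a finite signed measure on the real line. -/
def cauchyTransform (μ : SignedMeasure ℝ) (l : ℂ) : ℂ := ∫ᵛ x, (l - (x : ℂ))⁻¹ ∂<•μ

/-! ### The Toeplitz operator and its resolvent functions -/

/-- Square-summable complex sequences. -/
abbrev Ell2 : Type := lp (fun _ : ℕ => ℂ) 2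

/-- The sequence `(0, u_0, u_1, …)`. -/
def shiftFun (u : ℕ → ℂ) : ℕ → ℂ
  | 0 => 0
  | n + 1 => u n

theorem memℓp_shiftFun (u : Ell2) : Memℓp (shiftFun u) 2 := by
  have h := (lp.memℓp u).summable (by norm_num)
  apply memℓp_gen
  rw [← summable_nat_add_iff 1]
  exact h

/-- The shift `e_n ↦ e_{n+1}` on `ℓ²`. -/
def shift : Ell2 →ₗᵢ[ℂ] Ell2 where
  toFun u := ⟨shiftFun u, memℓp_shiftFun u⟩
  map_add' u v := by
    ext n
    cases n with
    | zero => exact (add_zero (0 : ℂ)).symm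
    | succ n => rfl
  map_smul' c u := by
    ext n
    cases n <;> simp [shiftFun]
  norm_map' u := by
    have h2 : (0 : ℝ) < (2 : ENNReal).toReal := by norm_num
    have h : ∀ v : Ell2, Summable fun n => ‖v n‖ ^ (2 : ENNReal).toReal :=
      fun v => (lp.memℓp v).summable h2
    rw [lp.norm_eq_tsum_rpow h2, lp.norm_eq_tsum_rpow h2, (h _).tsum_eq_zero_add]
    simp [shiftFun]

/-- The operator on `ℓ²` whose matrix has `1` above the diagonal, `a_k` on the `k`-th diagonal from
the main one downwards for `0 ≤ k ≤ p`, and `0` elsewhere. -/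
def toeplitzOp (a : ℕ → ℝ) (p : ℕ) : Ell2 →L[ℂ] Ell2 :=
  ContinuousLinearMap.adjoint shift.toContinuousLinearMap +
    ∑ k ∈ Finset.range (p + 1), (a k : ℂ) • shift.toContinuousLinearMap ^ k

/-- The unit vector with `1` in the component of index `n` (starting from `0`). -/
def e (n : ℕ) : Ell2 := lp.single 2 n 1

theorem shift_e (n : ℕ) : shift (e n) = e (n + 1) := by
  ext m
  change shiftFun (e n) m = _
  cases m <;> simp [shiftFun, e, Pi.single_apply]

theorem shift_pow_e (n k : ℕ) : (shift.toContinuousLinearMap ^ k) (e n) = e (n + k) := by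
  induction k with
  | zero => simp
  | succ k ih => rw [pow_succ', mul_apply_eq_comp, ih]; exact shift_e _

theorem inner_e (i j : ℕ) : inner ℂ (e i) (e j) = if i = j then 1 else 0 := by
  rw [e, lp.inner_single_left]
  simp [e, Pi.single_apply]

/-- The matrix entries of `toeplitzOp`. -/
theorem inner_toeplitzOp (a : ℕ → ℝ) (p i j : ℕ) :
    inner ℂ (e i) (toeplitzOp a p (e j)) =
      if j = i + 1 then 1 else if j ≤ i ∧ i ≤ j + p then (a (i - j) : ℂ) else 0 := by
  simp only [toeplitzOp, add_apply, inner_add_right,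
    ContinuousLinearMap.adjoint_inner_right, sum_apply, inner_sum,
    smul_apply, inner_smul_right, shift_pow_e, inner_e]
  rw [show shift.toContinuousLinearMap (e i) = e (i + 1) from shift_e i, inner_e]
  rcases lt_trichotomy j i with h | h | h
  · obtain ⟨d, rfl⟩ := Nat.exists_eq_add_of_lt h
    by_cases hd : d + 1 ≤ p
    · rw [Finset.sum_eq_single (d + 1)]
      · rw [if_neg (by omega), if_pos (by omega), if_neg (by omega), if_pos (by omega),
          show j + d + 1 - j = d + 1 by omega]
        simp
      · intro k _ hk
        rw [if_neg (by omega), mul_zero]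
      · intro hk
        exact absurd (Finset.mem_range.2 (by omega)) hk
    · rw [Finset.sum_eq_zero, if_neg (by omega), if_neg (by omega), if_neg (by omega), add_zero]
      intro k hk
      rw [Finset.mem_range] at hk
      rw [if_neg (by omega), mul_zero]
  · subst h
    rw [Finset.sum_eq_single 0] <;> simp
    omega
  · rw [Finset.sum_eq_zero, add_zero, if_neg (show ¬(j ≤ i ∧ i ≤ j + p) by omega)]
    · simp only [eq_comm]
    · intro k _
      rw [if_neg (by omega), mul_zero]
/-- `g_k(l) = (R_l e_{k-1}, e_0)`, `R_l = (l I - A)⁻¹`, for `k ≥ 1`. -/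
def g (a : ℕ → ℝ) (p k : ℕ) (l : ℂ) : ℂ :=
  inner ℂ (e 0) (resolvent (toeplitzOp a p) l (e (k - 1)))

end ConstRec

end

noncomputable section

namespace ConstRec

/-! ### Coefficients -/

/-! Everything rests on one rigidity property: two points of equal modulus at which `r` takes the
same value are equal or complex conjugate (`NegCase.eq_or_eq_conj`; the other sign pattern follows
by reflecting `w` to `-w`). Write the two points as `y e^{it}` and `y e^{-it}`. Equality of the
values says that `rayPoly a p t` vanishes at `y`, so it suffices that this real polynomial of degree
`p + 1` has only real zeros. Its positive zeros are those of `Im r` on the ray of angle `t`, its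
negative ones correspond to the ray of angle `π - t`. They are produced by sign changes at the
points where the argument `phi` of `w r'(w)` equals `-iπ`: `phi` increases along a ray wherever it
is nonpositive (`NegCase.deriv_phi_pos`, a Cauchy–Schwarz inequality using that the critical points
sum to zero), and a maximum argument along the curves `phi = -iπ` determines the sign of `Im r` on
them (`NegCase.imR_sign`).

Rigidity describes the sets `Γ_k`. Off the branch points the two roots of equal modulus are nonreal
and conjugate, so the parameter is real, and `Γ_k` is open and closed in what remains of the real
line. Following the real root `1 / w` of `a(z) = r(w)` from `w = ∞` through the critical points
shows which pair of labels meets at each `λ_k`, and the curvature of `r` there decides on which side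
`Γ_k` lies. Consecutive sets `Γ_k`, `Γ_{k+1}` are disjoint, since a common point would carry a
triple root.

Off the real line all moduli are distinct, so each root is holomorphic on the upper half-plane and
extends continuously to the real line (`up`). Let `F_{j,m}` be the complete homogeneous symmetric
function of degree `m` of the first `j` roots. It is real off `Γ_j`, while on `Γ_j` conjugation only
replaces the last root `z_{j-1}` by `z_j`; a divided difference identity then gives `Im F_{j,m+1} =
Im z_{j-1} · F_{j+1,m}` (`F_im`). Cauchy's formula for the half-plane, applied to the difference
quotient of `F_{j,m+1}` at `λ_j`, represents `F_{j,m+1}` through the Cauchy transform of `ρ_j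
F_{j+1,m}` (`F_rep`). By induction the iterated products have density `ρ_j` times a combination of
the `F_{j+1,i}` with leading coefficient 1 (`nikishinDensity_eq`). Since `F_{1,m} = z_0^m`, the
densities of the `σ_j` are unitriangular combinations of those representing the powers of `z_0`, and
the system is inverted.

For the resolvent, `(l - A) u = e_{k-1}` becomes, for the generating function of `u`, an equation
whose left side vanishes at every root in the closed unit disc; this forces `g_k = z_0^k`.
Orthogonality holds because multiplication by the variable acts on the moments against the powers of
`z_0` by the transpose of the recurrence.

For the zeros, let `E_j` be the product of the first `j` roots with the complete homogeneous
function of degree `n` of the reciprocals of the others; `E_0 = Q_n`. The imaginary part of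
`E_{k+1}` lives on `Γ_{k+1}` and is a density times `E_k`. Its decay gives `n_{k+1}` orthogonality
relations for `E_k`, and each zero of `E_{k+1}` on `Γ_{k+2}` gives one more. Descending from `k = p
- 1` to `0` yields `n_1 + ⋯ + n_p = n` zeros of `Q_n` inside `Γ_1`. -/

theorem prod_X_add_C_coeff_pos {ι : Type*} (s : ι → ℝ) (T : Finset ι) (hs : ∀ i ∈ T, 0 < s i) :
    (∀ i, 0 ≤ (∏ k ∈ T, (X + C (s k))).coeff i) ∧
    (∀ i ≤ T.card, 0 < (∏ k ∈ T, (X + C (s k))).coeff i) ∧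
    (∏ k ∈ T, (X + C (s k))).coeff T.card = 1 ∧
    (∀ i, 0 ≤ (C (∑ k ∈ T, s k) * ∏ k ∈ T, (X + C (s k)) - X * ∏ k ∈ T, (X + C (s k))
      + X ^ (T.card + 1)).coeff i) ∧
    (∀ i < T.card, 0 < (C (∑ k ∈ T, s k) * ∏ k ∈ T, (X + C (s k)) - X * ∏ k ∈ T, (X + C (s k))
      + X ^ (T.card + 1)).coeff i) := by
  classical
  induction T using Finset.induction_on with
  | empty =>
    refine ⟨fun i => ?_, fun i hi => ?_, by simp, fun i => ?_, fun i hi => by simp at hi⟩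
    · simp only [Finset.prod_empty, coeff_one]; split_ifs <;> norm_num
    · simp at hi; simp [hi]
    · simp
  | insert b T hb ih =>
    obtain ⟨h0, h1, h2, h3, h4⟩ := ih fun i hi => hs i (Finset.mem_insert_of_mem hi)
    have hsb := hs b (Finset.mem_insert_self b T)
    rw [Finset.prod_insert hb, Finset.sum_insert hb, Finset.card_insert_of_notMem hb]
    set N := ∏ k ∈ T, (X + C (s k)) with hN
    set S := ∑ k ∈ T, s k
    set D := C S * N - X * N + X ^ (T.card + 1) with hD
    -- Adjoining a factor `X + s_b` turns `D` into a sum of polynomials with nonnegative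
    -- coefficients; the last summand, a positive multiple of `N`, gives strict positivity.
    have key : C (s b + S) * ((X + C (s b)) * N) - X * ((X + C (s b)) * N) + X ^ (T.card + 1 + 1)
        = (X * D + C (s b) * D) + C (s b) * (X * N - X ^ (T.card + 1)) + C (s b ^ 2) * N := by
      rw [hD, C_add, C_pow]; ring
    have hXD : ∀ i, 0 ≤ (X * D).coeff i := by
      intro i; cases i with
      | zero => simp
      | succ i => rw [coeff_X_mul]; exact h3 i
    have hXN : ∀ i, 0 ≤ (X * N).coeff i := by
      intro i; cases i with
      | zero => simp
      | succ i => rw [coeff_X_mul]; exact h0 i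
    have hXN' : ∀ i, 0 ≤ (X * N - X ^ (T.card + 1)).coeff i := by
      intro i
      rw [coeff_sub, coeff_X_pow]
      split_ifs with h
      · rw [h, coeff_X_mul, h2]; simp
      · simpa using hXN i
    rw [key]
    refine ⟨fun i => ?_, fun i hi => ?_, ?_, fun i => ?_, fun i hi => ?_⟩
    · rw [add_mul, coeff_add, coeff_C_mul]
      exact add_nonneg (hXN i) (mul_nonneg hsb.le (h0 i))
    · rw [add_mul, coeff_add, coeff_C_mul]
      rcases Nat.lt_or_ge i (T.card + 1) with h | h
      · exact add_pos_of_nonneg_of_pos (hXN i) (mul_pos hsb (h1 i (by omega)))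
      · obtain rfl : i = T.card + 1 := by omega
        rw [coeff_X_mul, h2]
        exact add_pos_of_pos_of_nonneg one_pos (mul_nonneg hsb.le (h0 _))
    · have hdeg : N.natDegree ≤ T.card := by
        rw [hN]
        refine (natDegree_prod_le _ _).trans ?_
        refine (Finset.sum_le_card_nsmul _ _ 1 fun i _ => ?_).trans (by simp)
        rw [natDegree_X_add_C]
      rw [add_mul, coeff_add, coeff_C_mul, coeff_X_mul, h2,
        coeff_eq_zero_of_natDegree_lt (by omega)]; simp
    · simp only [coeff_add, coeff_C_mul]
      have := h3 i; have := h0 i; have := hXD i; have := hXN' i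
      positivity
    · simp only [coeff_add, coeff_C_mul]
      have := h3 i; have := h1 i (by omega); have := hXD i; have := hXN' i
      positivity

theorem q_coeff_top (a : ℕ → ℝ) (p : ℕ) :
    (q a p).coeff p = 0 := by
  simp only [q, coeff_sub, coeff_X_pow, finsetSum_coeff, coeff_C_mul]
  rw [if_neg (by omega), Finset.sum_eq_zero]
  · simp
  · intro k hk
    rw [Finset.mem_Icc] at hk
    rw [if_neg (by omega), mul_zero]

theorem q_coeff (a : ℕ → ℝ) (p k : ℕ) (hk : k ∈ Finset.Icc 1 p) :
    (q a p).coeff (p - k) = -(k * a k) := by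
  rw [Finset.mem_Icc] at hk
  simp only [q, coeff_sub, coeff_X_pow, finsetSum_coeff, coeff_C_mul]
  rw [if_neg (by omega), Finset.sum_eq_single k]
  · simp
  · intro i hi hik
    rw [Finset.mem_Icc] at hi
    rw [if_neg (by omega), mul_zero]
  · intro h; exact absurd (Finset.mem_Icc.2 hk) h

/-- The polynomial `q` has no term of degree `p`. -/
theorem sum_crit_eq_zero {a x : ℕ → ℝ} {p : ℕ} (hp : 1 ≤ p)
    (hq : q a p = ∏ k ∈ Finset.Icc 1 (p + 1), (X - C (x k))) :
    ∑ k ∈ Finset.Icc 1 (p + 1), x k = 0 := by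
  have h1 := prod_X_sub_C_nextCoeff (s := Finset.Icc 1 (p + 1)) (f := x)
  have hd : (∏ k ∈ Finset.Icc 1 (p + 1), (X - C (x k))).natDegree = p + 1 := by
    rw [natDegree_prod_of_monic _ _ fun i _ => monic_X_sub_C _]; simp
  rw [nextCoeff_of_natDegree_pos (by omega), hd, Nat.add_sub_cancel, ← hq, q_coeff_top a p] at h1
  linarith

theorem NegCase.neg {p : ℕ} {x : ℕ → ℝ} (h : NegCase p x) (k : ℕ) (hk : k ∈ Finset.Icc 1 p) :
    x k < 0 := by
  rw [Finset.mem_Icc] at hk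
  refine lt_of_le_of_lt ?_ h.2.1
  exact h.1.monotoneOn ⟨hk.1, hk.2⟩ ⟨by omega, le_rfl⟩ hk.2

theorem NegCase.sum_eq {a x : ℕ → ℝ} {p : ℕ} (hp : 1 ≤ p)
    (hq : q a p = ∏ k ∈ Finset.Icc 1 (p + 1), (X - C (x k))) :
    x (p + 1) = ∑ k ∈ Finset.Icc 1 p, -x k := by
  have h := sum_crit_eq_zero hp hq
  rw [Finset.sum_Icc_succ_top (by omega)] at h
  rw [Finset.sum_neg_distrib]; linarith

/-- With `s_k = -x_k`, whose sum is `x_{p+1}`, the polynomial `X^{p+1} - q` is the one shown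
positive in `prod_X_add_C_coeff_pos`; its coefficients are the numbers `k a_k`. -/
theorem NegCase.coeff_pos {a x : ℕ → ℝ} {p : ℕ} (hp : 1 ≤ p) (h : NegCase p x)
    (hq : q a p = ∏ k ∈ Finset.Icc 1 (p + 1), (X - C (x k))) (k : ℕ) (hk : k ∈ Finset.Icc 1 p) :
    0 < a k := by
  have h1 := (prod_X_add_C_coeff_pos (fun i => -x i) (Finset.Icc 1 p)
    fun i hi => neg_pos.2 (h.neg i hi)).2.2.2.2 (p - k) (by
      rw [Finset.mem_Icc] at hk; simp; omega)
  have h2 : C (∑ k ∈ Finset.Icc 1 p, -x k) * ∏ k ∈ Finset.Icc 1 p, (X + C (-x k))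
      - X * ∏ k ∈ Finset.Icc 1 p, (X + C (-x k)) + X ^ ((Finset.Icc 1 p).card + 1)
      = X ^ (p + 1) - q a p := by
    rw [← NegCase.sum_eq hp hq, hq, Finset.prod_Icc_succ_top (by omega)]
    simp only [C_neg, ← sub_eq_add_neg, Nat.card_Icc, Nat.add_sub_cancel]
    ring
  rw [h2, coeff_sub, q_coeff a p k hk, coeff_X_pow, if_neg (by omega)] at h1
  have hk1 : (0:ℝ) < k := by rw [Finset.mem_Icc] at hk; exact_mod_cast hk.1
  have : 0 < (k:ℝ) * a k := by linarith
  exact (pos_iff_pos_of_mul_pos this).1 hk1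

/-! ### The complex symbol -/

/-- `r` on the complex plane. -/
def rC (a : ℕ → ℝ) (p : ℕ) (w : ℂ) : ℂ := w + ∑ k ∈ Finset.range (p + 1), (a k : ℂ) / w ^ k

/-- `w r'(w)`. -/
def wrDeriv (a : ℕ → ℝ) (p : ℕ) (w : ℂ) : ℂ :=
  w - ∑ k ∈ Finset.range (p + 1), (k * a k : ℂ) / w ^ k

theorem pow_mul_wrDeriv {a x : ℕ → ℝ} {p : ℕ}
    (hq : q a p = ∏ k ∈ Finset.Icc 1 (p + 1), (X - C (x k))) {w : ℂ} (hw : w ≠ 0) :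
    w ^ p * wrDeriv a p w = ∏ k ∈ Finset.Icc 1 (p + 1), (w - x k) := by
  have h := congrArg (fun P : ℝ[X] => (P.map (algebraMap ℝ ℂ)).eval w) hq
  simp only [q, Polynomial.map_sub, Polynomial.map_pow, map_X, Polynomial.map_sum,
    Polynomial.map_mul, map_C, eval_sub, eval_pow, eval_X, eval_finsetSum, eval_mul, eval_C,
    Polynomial.map_prod, eval_prod] at h
  simp only [Complex.coe_algebraMap] at h
  rw [← h, wrDeriv, mul_sub, pow_succ, Finset.mul_sum, Finset.range_eq_Ico,
    Finset.sum_eq_sum_Ico_succ_bot (by omega)]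
  simp only [Nat.cast_zero, zero_mul, zero_div, mul_zero, zero_add]
  congr 1
  refine Finset.sum_congr rfl fun k hk => ?_
  rw [Finset.mem_Icc] at hk
  obtain ⟨d, rfl⟩ := Nat.exists_eq_add_of_le (show k ≤ p by omega)
  rw [Nat.add_sub_cancel_left, pow_add]
  have := pow_ne_zero k hw
  push_cast
  field_simp

/-! ### Polar coordinates and the argument of `w r'(w)` -/

/-- The point with polar coordinates `s`, `t`. -/
def pol (s t : ℝ) : ℂ := s * Complex.exp (t * Complex.I)

theorem pol_re (s t : ℝ) : (pol s t).re = s * Real.cos t := by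
  simp [pol, Complex.exp_re]

theorem pol_im (s t : ℝ) : (pol s t).im = s * Real.sin t := by
  simp [pol, Complex.exp_im]

theorem norm_pol {s : ℝ} (hs : 0 ≤ s) (t : ℝ) : ‖pol s t‖ = s := by
  simp [pol, Complex.norm_exp, abs_of_nonneg hs]

theorem pol_im_pos {s t : ℝ} (hs : 0 < s) (ht : t ∈ Set.Ioo 0 Real.pi) : 0 < (pol s t).im := by
  rw [pol_im]; exact mul_pos hs (Real.sin_pos_of_pos_of_lt_pi ht.1 ht.2)

theorem pol_ne_zero {s : ℝ} (hs : s ≠ 0) (t : ℝ) : pol s t ≠ 0 := by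
  simp [pol, hs, Complex.exp_ne_zero]

theorem arg_pol {s t : ℝ} (hs : 0 < s) (ht : t ∈ Set.Ioo 0 Real.pi) : (pol s t).arg = t := by
  rw [pol, Complex.exp_mul_I]
  exact Complex.arg_mul_cos_add_sin_mul_I hs ⟨by linarith [ht.1, Real.pi_pos], ht.2.le⟩

theorem pol_pow (s t : ℝ) (k : ℕ) : pol s t ^ k = pol (s ^ k) (k * t) := by
  rw [pol, pol, mul_pow, ← Complex.exp_nat_mul]; push_cast; ring_nf

theorem inv_pol (s t : ℝ) : (pol s t)⁻¹ = pol s⁻¹ (-t) := by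
  rw [pol, pol, mul_inv, ← Complex.exp_neg]; push_cast; ring_nf

theorem continuous_pol : Continuous fun st : ℝ × ℝ => pol st.1 st.2 := by
  unfold pol; fun_prop

theorem hasDerivAt_rC (a : ℕ → ℝ) (p : ℕ) {w : ℂ} (hw : w ≠ 0) :
    HasDerivAt (rC a p) (wrDeriv a p w / w) w := by
  have h : HasDerivAt (rC a p)
      (1 + ∑ k ∈ Finset.range (p + 1), -((a k : ℂ) * (k * w ^ (k - 1))) / (w ^ k) ^ 2) w := by
    refine (hasDerivAt_id w).add (HasDerivAt.fun_sum fun k _ => ?_)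
    have := ((hasDerivAt_pow k w).fun_inv (pow_ne_zero k hw)).const_mul (a k : ℂ)
    simp only [div_eq_mul_inv]
    refine this.congr_deriv ?_
    rw [div_eq_mul_inv]; ring
  convert h using 1
  rw [wrDeriv, sub_div, div_self hw, sub_eq_add_neg, Finset.sum_div, ← Finset.sum_neg_distrib]
  congr 1
  refine Finset.sum_congr rfl fun k _ => ?_
  rcases k with _ | k
  · simp
  · simp only [Nat.add_sub_cancel]
    field_simp
    ring

/-- The imaginary part of `r` in polar coordinates. -/
def imR (a : ℕ → ℝ) (p : ℕ) (s t : ℝ) : ℝ := (rC a p (pol s t)).im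

theorem imR_eq (a : ℕ → ℝ) (p : ℕ) (s t : ℝ) :
    imR a p s t = s * Real.sin t - ∑ k ∈ Finset.range (p + 1), a k / s ^ k * Real.sin (k * t) := by
  rw [imR, rC, Complex.add_im, pol_im, Complex.im_sum, sub_eq_add_neg, ← Finset.sum_neg_distrib]
  congr 1
  refine Finset.sum_congr rfl fun k _ => ?_
  rw [div_eq_mul_inv, pol_pow, inv_pol, Complex.im_ofReal_mul, pol_im, Real.sin_neg]
  ring

theorem wrDeriv_pol_im (a : ℕ → ℝ) (p : ℕ) (s t : ℝ) :
    (wrDeriv a p (pol s t)).im =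
      s * Real.sin t + ∑ k ∈ Finset.range (p + 1), k * a k / s ^ k * Real.sin (k * t) := by
  rw [wrDeriv, Complex.sub_im, pol_im, Complex.im_sum, sub_eq_add_neg, ← Finset.sum_neg_distrib]
  congr 1
  refine Finset.sum_congr rfl fun k _ => ?_
  rw [div_eq_mul_inv, pol_pow, inv_pol,
    show ((k : ℂ) * (a k : ℂ)) = ((k * a k : ℝ) : ℂ) by push_cast; rfl,
    Complex.im_ofReal_mul, pol_im, Real.sin_neg]
  ring

theorem continuousAt_imR (a : ℕ → ℝ) (p : ℕ) {s : ℝ} (hs : s ≠ 0) (t : ℝ) :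
    ContinuousAt (fun st : ℝ × ℝ => imR a p st.1 st.2) (s, t) := by
  have h1 : ContinuousAt (rC a p) (pol s t) := (hasDerivAt_rC a p (pol_ne_zero hs t)).continuousAt
  have h2 : ContinuousAt (fun st : ℝ × ℝ => rC a p (pol st.1 st.2)) (s, t) :=
    ContinuousAt.comp (f := fun st : ℝ × ℝ => pol st.1 st.2) (x := (s, t)) h1
      continuous_pol.continuousAt
  exact Complex.continuous_im.continuousAt.comp h2

theorem hasDerivAt_imR_left (a : ℕ → ℝ) (p : ℕ) {s : ℝ} (hs : s ≠ 0) (t : ℝ) :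
    HasDerivAt (fun s => imR a p s t) ((wrDeriv a p (pol s t)).im / s) s := by
  have h0 : HasDerivAt (fun s : ℝ => pol s t) (Complex.exp (t * Complex.I)) s := by
    simpa [pol] using (Complex.ofRealCLM.hasDerivAt (x := s)).mul_const (Complex.exp (t * Complex.I))
  have h1 := (hasDerivAt_rC a p (pol_ne_zero hs t)).comp s h0
  have h2 := Complex.imCLM.hasFDerivAt.comp_hasDerivAt s h1
  refine h2.congr_deriv ?_
  rw [Complex.imCLM_apply]
  have hs' : (s : ℂ) ≠ 0 := by exact_mod_cast hs
  have : wrDeriv a p (pol s t) / pol s t * Complex.exp (t * Complex.I)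
      = wrDeriv a p (pol s t) / (s : ℝ) := by
    rw [div_mul_eq_mul_div, pol]
    field_simp [Complex.exp_ne_zero]
  rw [this, Complex.div_ofReal_im]

theorem hasDerivAt_imR_right (a : ℕ → ℝ) (p : ℕ) {s : ℝ} (hs : s ≠ 0) (t : ℝ) :
    HasDerivAt (fun t => imR a p s t) (wrDeriv a p (pol s t)).re t := by
  have h0 : HasDerivAt (fun t : ℝ => pol s t) (pol s t * Complex.I) t := by
    have : HasDerivAt (fun t : ℝ => (t : ℂ) * Complex.I) Complex.I t := by
      simpa using (Complex.ofRealCLM.hasDerivAt (x := t)).mul_const Complex.I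
    refine (this.cexp.const_mul (s : ℂ)).congr_deriv ?_
    rw [pol]; ring
  have h1 := (hasDerivAt_rC a p (pol_ne_zero hs t)).comp t h0
  have h2 := Complex.imCLM.hasFDerivAt.comp_hasDerivAt t h1
  refine h2.congr_deriv ?_
  rw [Complex.imCLM_apply]
  have : wrDeriv a p (pol s t) / pol s t * (pol s t * Complex.I)
      = wrDeriv a p (pol s t) * Complex.I := by
    rw [← mul_assoc, div_mul_cancel₀ _ (pol_ne_zero hs t)]
  rw [this, Complex.mul_I_im]

/-- A continuous argument of `w r'(w)` on the upper half-plane. -/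
def phi (p : ℕ) (x : ℕ → ℝ) (w : ℂ) : ℝ :=
  ∑ k ∈ Finset.Icc 1 (p + 1), (w - x k).arg - p * w.arg

/-- Since `w^p · w r'(w)` is the product of the `w - x_k`, modulus and argument can be read off
factor by factor. -/
theorem wrDeriv_polar {a x : ℕ → ℝ} {p : ℕ}
    (hq : q a p = ∏ k ∈ Finset.Icc 1 (p + 1), (X - C (x k))) {w : ℂ} (hw : 0 < w.im) :
    ∃ c : ℝ, 0 < c ∧ wrDeriv a p w = c * Complex.exp (phi p x w * Complex.I) := by
  have hw0 : w ≠ 0 := by rintro rfl; simp at hw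
  have hk : ∀ k, w - x k ≠ 0 := by
    intro k h
    have := congrArg Complex.im h
    simp at this; linarith
  have h := pow_mul_wrDeriv hq hw0
  refine ⟨(∏ k ∈ Finset.Icc 1 (p + 1), ‖w - x k‖) / ‖w‖ ^ p, ?_, ?_⟩
  · exact div_pos (Finset.prod_pos fun k _ => norm_pos_iff.2 (hk k))
      (pow_pos (norm_pos_iff.2 hw0) p)
  · have hn : (‖w‖ : ℂ) ≠ 0 := by exact_mod_cast norm_ne_zero_iff.2 hw0
    have e1 : w ^ p = (‖w‖ : ℂ) ^ p * Complex.exp (p * (w.arg * Complex.I)) := by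
      conv_lhs => rw [← Complex.norm_mul_exp_arg_mul_I w]
      rw [mul_pow, Complex.exp_nat_mul]
    have e2 : ∏ k ∈ Finset.Icc 1 (p + 1), (w - x k) =
        (∏ k ∈ Finset.Icc 1 (p + 1), (‖w - x k‖ : ℂ)) *
          Complex.exp (∑ k ∈ Finset.Icc 1 (p + 1), ((w - x k).arg * Complex.I)) := by
      rw [Complex.exp_sum, ← Finset.prod_mul_distrib]
      exact Finset.prod_congr rfl fun k _ => (Complex.norm_mul_exp_arg_mul_I _).symm
    have e3 : (phi p x w : ℂ) * Complex.I = ∑ k ∈ Finset.Icc 1 (p + 1), ((w - x k).arg * Complex.I)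
        - p * (w.arg * Complex.I) := by
      rw [phi]; push_cast; rw [← Finset.sum_mul]; ring
    rw [e3, Complex.exp_sub]
    rw [e1, e2] at h
    push_cast
    have := Complex.exp_ne_zero (p * (w.arg * Complex.I))
    rw [div_mul_div_comm, eq_div_iff (mul_ne_zero (pow_ne_zero p hn) this), ← h]
    ring

/-- Twice the signed area of the triangle `0, x, w`, computed in two ways. It converts the angle at
`w` subtended by the segment from `0` to `x` into lengths. -/
theorem norm_mul_norm_mul_sin_arg_sub (w : ℂ) (x : ℝ) :
    ‖w‖ * ‖w - x‖ * Real.sin (w.arg - (w - x).arg) = -x * w.im := by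
  have h1 := Complex.norm_mul_cos_arg w
  have h2 := Complex.norm_mul_sin_arg w
  have h3 := Complex.norm_mul_cos_arg (w - x)
  have h4 := Complex.norm_mul_sin_arg (w - x)
  simp only [Complex.sub_re, Complex.sub_im, Complex.ofReal_re, Complex.ofReal_im, sub_zero] at h3 h4
  rw [Real.sin_sub]
  linear_combination (‖w - x‖ * Real.cos (w - ↑x).arg) * h2 + w.im * h3 -
    (‖w - x‖ * Real.sin (w - ↑x).arg) * h1 - w.re * h4

theorem arg_mem_Ioo_of_im_pos {w : ℂ} (hw : 0 < w.im) : w.arg ∈ Set.Ioo 0 Real.pi := by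
  refine ⟨?_, Complex.arg_lt_pi_iff.2 (Or.inr hw.ne')⟩
  refine lt_of_le_of_ne (Complex.arg_nonneg_iff.2 hw.le) fun h => ?_
  have := Complex.arg_eq_zero_iff.1 h.symm
  linarith [this.2]

theorem abs_sin_sum_le {ι : Type*} (T : Finset ι) (b : ι → ℝ) :
    |Real.sin (∑ k ∈ T, b k)| ≤ ∑ k ∈ T, |Real.sin (b k)| := by
  classical
  induction T using Finset.induction_on with
  | empty => simp
  | insert k T hk ih =>
    rw [Finset.sum_insert hk, Finset.sum_insert hk, Real.sin_add]
    refine (abs_add_le _ _).trans (add_le_add ?_ (le_trans ?_ ih))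
    · rw [abs_mul]; exact mul_le_of_le_one_right (abs_nonneg _) (Real.abs_cos_le_one _)
    · rw [abs_mul]; exact mul_le_of_le_one_left (abs_nonneg _) (Real.abs_cos_le_one _)

/-- If some `b_k ≥ c`, then `sin b_k ≥ sin c` because `b_k < π - c`, and any second term makes the
inequality strict. Otherwise all `b_k` are at most `π / 2`; shrinking them by a common factor makes
their sum equal to `c`, and subadditivity of `|sin|` together with monotonicity finishes. -/
theorem sin_lt_sum_sin {ι : Type*} (T : Finset ι) (b : ι → ℝ) {c t : ℝ} (hT : 2 ≤ T.card)
    (hb : ∀ k ∈ T, b k ∈ Set.Ioo 0 t) (hc : 0 < c) (ht : t < Real.pi - c)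
    (hs : c < ∑ k ∈ T, b k) : Real.sin c < ∑ k ∈ T, Real.sin (b k) := by
  classical
  have hpos : ∀ k ∈ T, 0 < Real.sin (b k) := fun k hk =>
    Real.sin_pos_of_pos_of_lt_pi (hb k hk).1 (by linarith [(hb k hk).2])
  by_cases h : ∃ k ∈ T, c ≤ b k
  · obtain ⟨k, hk, hck⟩ := h
    have h1 : Real.sin c ≤ Real.sin (b k) := by
      have hbk := hb k hk
      rcases le_total (b k) (Real.pi / 2) with h2 | h2
      · exact Real.sin_le_sin_of_le_of_le_pi_div_two (by linarith) h2 hck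
      · rw [← Real.sin_pi_sub (b k)]
        exact Real.sin_le_sin_of_le_of_le_pi_div_two (by linarith [Real.pi_pos]) (by linarith)
          (by linarith [hbk.2])
    refine lt_of_le_of_lt h1 ?_
    obtain ⟨l, hl, hlk⟩ := Finset.exists_mem_ne (by omega : 1 < T.card) k
    have : ∑ i ∈ {l, k}, Real.sin (b i) ≤ ∑ i ∈ T, Real.sin (b i) :=
      Finset.sum_le_sum_of_subset_of_nonneg
        (by intro i hi; simp at hi; rcases hi with rfl | rfl <;> assumption)
        fun i hi _ => (hpos i hi).le
    rw [Finset.sum_pair hlk] at this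
    linarith [hpos l hl]
  · push Not at h
    have hS : 0 < ∑ k ∈ T, b k := hc.trans hs
    set d := c / ∑ k ∈ T, b k with hd
    have hd0 : 0 < d := div_pos hc hS
    have hd1 : d < 1 := (div_lt_one hS).2 hs
    have hne : T.Nonempty := Finset.card_pos.1 (by omega)
    have h2 : ∀ k ∈ T, |Real.sin (d * b k)| < Real.sin (b k) := by
      intro k hk
      have hbk := hb k hk
      have h3 := h k hk
      have h4 : b k ≤ Real.pi / 2 := by linarith [hbk.2]
      have h5 : 0 < d * b k := mul_pos hd0 hbk.1
      have h6 : d * b k < b k := by nlinarith [hbk.1]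
      rw [abs_of_pos (Real.sin_pos_of_pos_of_lt_pi h5 (by linarith))]
      exact Real.sin_lt_sin_of_lt_of_le_pi_div_two (by linarith) h4 h6
    have h3 : c = ∑ k ∈ T, d * b k := by
      rw [← Finset.mul_sum, hd, div_mul_cancel₀ _ hS.ne']
    calc Real.sin c ≤ |Real.sin c| := le_abs_self _
      _ = |Real.sin (∑ k ∈ T, d * b k)| := by rw [← h3]
      _ ≤ ∑ k ∈ T, |Real.sin (d * b k)| := abs_sin_sum_le _ _
      _ < _ := Finset.sum_lt_sum_of_nonempty hne h2

theorem hasDerivAt_arg_pol_sub {s t : ℝ} (hs : 0 < s) (ht : t ∈ Set.Ioo 0 Real.pi) (x : ℝ) :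
    HasDerivAt (fun s => (pol s t - x).arg) (Real.sin t * (-x / ‖pol s t - x‖ ^ 2)) s := by
  have him := pol_im_pos hs ht
  have h0 : HasDerivAt (fun s : ℝ => pol s t - x) (Complex.exp (t * Complex.I)) s := by
    simpa [pol] using ((Complex.ofRealCLM.hasDerivAt (x := s)).mul_const
      (Complex.exp (t * Complex.I))).sub_const (x : ℂ)
  have h1 := h0.clog_real (Complex.mem_slitPlane_iff.2 (Or.inr (by simpa using him.ne')))
  have h2 := Complex.imCLM.hasFDerivAt.comp_hasDerivAt s h1
  have e : (fun s => (pol s t - x).arg) =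
      Complex.imCLM ∘ fun s => Complex.log (pol s t - x) := by
    funext s; simp [Complex.log_im]
  rw [e]
  refine h2.congr_deriv ?_
  rw [Complex.imCLM_apply, Complex.div_im, ← Complex.normSq_eq_norm_sq]
  simp only [Complex.exp_ofReal_mul_I_re, Complex.exp_ofReal_mul_I_im, Complex.sub_re,
    Complex.sub_im, Complex.ofReal_re, Complex.ofReal_im, pol_re, pol_im]
  ring

theorem hasDerivAt_phi (p : ℕ) (x : ℕ → ℝ) {s t : ℝ} (hs : 0 < s) (ht : t ∈ Set.Ioo 0 Real.pi) :
    HasDerivAt (fun s => phi p x (pol s t))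
      (Real.sin t * ∑ k ∈ Finset.Icc 1 (p + 1), -x k / ‖pol s t - x k‖ ^ 2) s := by
  have h0 := (hasDerivAt_arg_pol_sub hs ht 0).const_mul (p : ℝ)
  have h1 := HasDerivAt.fun_sum (u := Finset.Icc 1 (p + 1)) fun k _ =>
    hasDerivAt_arg_pol_sub hs ht (x k)
  have h2 := h1.fun_sub h0
  simp only [Complex.ofReal_zero, sub_zero] at h2
  refine h2.congr_deriv ?_
  rw [Finset.mul_sum]; simp

theorem continuousAt_phi (p : ℕ) (x : ℕ → ℝ) {w : ℂ} (hw : 0 < w.im) :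
    ContinuousAt (phi p x) w := by
  unfold phi
  refine ContinuousAt.sub ?_ (continuousAt_const.mul (Complex.continuousAt_arg
    (Complex.mem_slitPlane_iff.2 (Or.inr hw.ne'))))
  refine tendsto_finsetSum _ fun k _ => ?_
  exact ContinuousAt.comp (f := fun w : ℂ => w - x k) (Complex.continuousAt_arg
    (Complex.mem_slitPlane_iff.2 (Or.inr (by simpa using hw.ne')))) (by fun_prop)

/-- Up to the factor `sin t`, the sum is the radial derivative of `phi`. The angles `b_k = arg w -
arg (w - x_k)`, `k ≤ p`, and `c = arg (w - x_{p+1}) - arg w` are positive, and `phi ≤ 0` reads `arg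
w + c ≤ ∑ b_k`, whence `sin c < ∑ sin b_k`. Each sine is `|x_k| Im w / (|w| |w - x_k|)`, so
Cauchy–Schwarz with the weights `-x_k`, which add up to `x_{p+1}`, gives the inequality. -/
theorem NegCase.deriv_phi_pos {a x : ℕ → ℝ} {p : ℕ} (hp : 2 ≤ p) (h : NegCase p x)
    (hq : q a p = ∏ k ∈ Finset.Icc 1 (p + 1), (X - C (x k))) {w : ℂ} (hw : 0 < w.im)
    (hphi : phi p x w ≤ 0) :
    0 < ∑ k ∈ Finset.Icc 1 (p + 1), -x k / ‖w - x k‖ ^ 2 := by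
  have hw0 : w ≠ 0 := by rintro rfl; simp at hw
  have hn : 0 < ‖w‖ := norm_pos_iff.2 hw0
  have hk : ∀ y : ℝ, 0 < ‖w - y‖ := by
    intro y
    refine norm_pos_iff.2 fun h => ?_
    have := congrArg Complex.im h
    simp at this; linarith
  have harg : ∀ y : ℝ, (w - y).arg ∈ Set.Ioo 0 Real.pi := fun y =>
    arg_mem_Ioo_of_im_pos (by simpa using hw)
  have hargw := arg_mem_Ioo_of_im_pos hw
  set S := w.im / ‖w‖ with hS
  have hSpos : 0 < S := div_pos hw hn
  have hsin : ∀ y : ℝ, Real.sin (w.arg - (w - y).arg) = -y * S / ‖w - y‖ := by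
    intro y
    have := norm_mul_norm_mul_sin_arg_sub w y
    rw [hS, eq_div_iff (hk y).ne', mul_div_assoc', eq_div_iff hn.ne']
    linarith
  rw [Finset.sum_Icc_succ_top (by omega)]
  set Y := x (p + 1) with hY
  have hYpos : 0 < Y := h.2.2
  have hb : ∀ k ∈ Finset.Icc 1 p, w.arg - (w - x k).arg ∈ Set.Ioo 0 w.arg := by
    intro k hk'
    have h1 : 0 < Real.sin (w.arg - (w - x k).arg) := by
      rw [hsin]; exact div_pos (mul_pos (neg_pos.2 (h.neg k hk')) hSpos) (hk _)
    refine ⟨?_, by linarith [(harg (x k)).1]⟩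
    by_contra hcon
    push Not at hcon
    have := Real.sin_nonpos_of_nonpos_of_neg_pi_le hcon (by linarith [(harg (x k)).2, hargw.1])
    linarith
  have hg : 0 < (w - Y).arg - w.arg := by
    have h1 : Real.sin (w.arg - (w - Y).arg) < 0 := by
      rw [hsin, div_neg_iff]; right
      exact ⟨by nlinarith, hk _⟩
    by_contra hcon
    push Not at hcon
    have := Real.sin_nonneg_of_nonneg_of_le_pi (x := w.arg - (w - Y).arg) (by linarith)
      (by linarith [(harg Y).1, hargw.2])
    linarith
  have hsum : (w - Y).arg - w.arg < ∑ k ∈ Finset.Icc 1 p, (w.arg - (w - x k).arg) := by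
    rw [phi, Finset.sum_Icc_succ_top (by omega)] at hphi
    rw [Finset.sum_sub_distrib]
    simp only [Finset.sum_const, Nat.card_Icc, Nat.add_sub_cancel, nsmul_eq_mul]
    linarith [hargw.1]
  have hlt := sin_lt_sum_sin (Finset.Icc 1 p) (fun k => w.arg - (w - x k).arg) (c := (w - Y).arg - w.arg)
    (t := w.arg) (by simpa using hp) hb hg (by linarith [(harg Y).2]) hsum
  have hgs : Real.sin ((w - Y).arg - w.arg) = Y * S / ‖w - Y‖ := by
    rw [← neg_sub, Real.sin_neg, hsin]; ring
  have hgpos : 0 < Real.sin ((w - Y).arg - w.arg) := by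
    rw [hgs]; exact div_pos (mul_pos hYpos hSpos) (hk _)
  have hCS := Finset.sq_sum_div_le_sum_sq_div (Finset.Icc 1 p)
    (fun k => Real.sin (w.arg - (w - x k).arg)) (g := fun k => -x k)
    fun k hk' => neg_pos.2 (h.neg k hk')
  rw [← NegCase.sum_eq (by omega) hq] at hCS
  have e1 : ∑ k ∈ Finset.Icc 1 p, Real.sin (w.arg - (w - x k).arg) ^ 2 / -x k
      = S ^ 2 * ∑ k ∈ Finset.Icc 1 p, -x k / ‖w - x k‖ ^ 2 := by
    rw [Finset.mul_sum]
    refine Finset.sum_congr rfl fun k hk' => ?_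
    have := (h.neg k hk').ne
    have := (hk (x k)).ne'
    rw [hsin]; field_simp
  have e2 : S ^ 2 * (Y / ‖w - Y‖ ^ 2) < S ^ 2 * ∑ k ∈ Finset.Icc 1 p, -x k / ‖w - x k‖ ^ 2 := by
    rw [← e1]
    refine lt_of_lt_of_le ?_ hCS
    have : S ^ 2 * (Y / ‖w - Y‖ ^ 2) = Real.sin ((w - Y).arg - w.arg) ^ 2 / Y := by
      rw [hgs]; have := (hk Y).ne'; field_simp
    rw [this]
    exact div_lt_div_of_pos_right (pow_lt_pow_left₀ hlt hgpos.le (by norm_num)) hYpos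
  have e3 := lt_of_mul_lt_mul_left e2 (by positivity)
  rw [neg_div]; linarith

/-! ### Zeros of the imaginary part of `r` on a ray -/

theorem neg_one_pow_mul_wrDeriv {a x : ℕ → ℝ} {p : ℕ}
    (hq : q a p = ∏ k ∈ Finset.Icc 1 (p + 1), (X - C (x k))) {w : ℂ} (hw : 0 < w.im) (i : ℕ) :
    ∃ c : ℝ, 0 < c ∧
      (-1) ^ i * (wrDeriv a p w).re = c * Real.cos (phi p x w + i * Real.pi) ∧
      (-1) ^ i * (wrDeriv a p w).im = c * Real.sin (phi p x w + i * Real.pi) := by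
  obtain ⟨c, hc, h⟩ := wrDeriv_polar hq hw
  refine ⟨c, hc, ?_, ?_⟩
  · rw [h, Complex.re_ofReal_mul, Complex.exp_ofReal_mul_I_re, Real.cos_add_nat_mul_pi]; ring
  · rw [h, Complex.im_ofReal_mul, Complex.exp_ofReal_mul_I_im, Real.sin_add_nat_mul_pi]; ring

theorem abs_sin_natCast_mul_le (k : ℕ) (t : ℝ) : |Real.sin (k * t)| ≤ k * |Real.sin t| := by
  have := abs_sin_sum_le (Finset.range k) fun _ => t
  simpa using this

/-- The inequality `|sin kt| ≤ k |sin t|` lets `s sin t` dominate uniformly in `t`. It confines the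
curves `phi = -iπ` to bounded `s`. -/
theorem exists_wrDeriv_im_pos (a : ℕ → ℝ) (p : ℕ) :
    ∃ b : ℝ, 0 < b ∧ ∀ s t, b < s → t ∈ Set.Ioo 0 Real.pi → 0 < (wrDeriv a p (pol s t)).im := by
  set B := ∑ k ∈ Finset.range (p + 1), (k : ℝ) * |a k| * k with hB
  have hB0 : 0 ≤ B := Finset.sum_nonneg fun k _ => by positivity
  refine ⟨1 + B, by positivity, fun s t hs ht => ?_⟩
  have hsin := Real.sin_pos_of_pos_of_lt_pi ht.1 ht.2
  rw [wrDeriv_pol_im]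
  have h1 : |∑ k ∈ Finset.range (p + 1), k * a k / s ^ k * Real.sin (k * t)| ≤ B * Real.sin t := by
    rw [hB, Finset.sum_mul]
    refine (Finset.abs_sum_le_sum_abs _ _).trans (Finset.sum_le_sum fun k _ => ?_)
    have h2 := abs_sin_natCast_mul_le k t
    rw [abs_of_pos hsin] at h2
    have h3 : |(k * a k / s ^ k : ℝ)| ≤ k * |a k| := by
      rw [abs_div, abs_mul, Nat.abs_cast]
      refine div_le_self (by positivity) ?_
      have hs0 : 0 < s := by linarith
      rw [abs_of_pos (by positivity)]
      exact one_le_pow₀ (by linarith)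
    rw [abs_mul, mul_assoc]
    calc _ ≤ (k * |a k|) * (k * Real.sin t) := mul_le_mul h3 h2 (abs_nonneg _) (by positivity)
      _ = _ := by ring
  have h2 := (abs_le.1 h1).1
  nlinarith

/-- Near the origin the arguments of `w - x_k`, `k ≤ p`, are small, and the rest of `phi` is at most
`π - p t`. It keeps the curves `phi = -iπ` away from the origin. -/
theorem exists_phi_lt {x : ℕ → ℝ} {p : ℕ} (h : NegCase p x) {c t₀ : ℝ} (ht₀ : 0 < t₀)
    (hc : Real.pi - p * t₀ < c) :
    ∃ b : ℝ, 0 < b ∧ ∀ s t, 0 < s → s ≤ b → t ∈ Set.Ico t₀ Real.pi → phi p x (pol s t) < c := by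
  have hcont : ContinuousAt (fun w : ℂ => ∑ k ∈ Finset.Icc 1 p, (w - x k).arg) 0 := by
    refine tendsto_finsetSum _ fun k hk => ?_
    refine ContinuousAt.comp (f := fun w : ℂ => w - x k) (Complex.continuousAt_arg ?_) (by fun_prop)
    refine Complex.mem_slitPlane_iff.2 (Or.inl ?_)
    simpa using h.neg k hk
  have h0 : ∑ k ∈ Finset.Icc 1 p, ((0 : ℂ) - x k).arg = 0 := by
    refine Finset.sum_eq_zero fun k hk => ?_
    rw [zero_sub, ← Complex.ofReal_neg]
    exact Complex.arg_ofReal_of_nonneg (neg_pos.2 (h.neg k hk)).le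
  have hev : ∀ᶠ w : ℂ in 𝓝 0, ∑ k ∈ Finset.Icc 1 p, (w - x k).arg < c - (Real.pi - p * t₀) := by
    refine hcont.eventually_lt continuousAt_const ?_
    rw [h0]; linarith
  obtain ⟨d, hd, hd'⟩ := Metric.eventually_nhds_iff.1 hev
  refine ⟨d / 2, by positivity, fun s t hs hsd ht => ?_⟩
  have htp : t ∈ Set.Ioo 0 Real.pi := ⟨by linarith [ht.1], ht.2⟩
  have h1 := hd' (y := pol s t) (by rw [dist_zero_right, norm_pol hs.le]; linarith)
  have h2 := Complex.arg_le_pi (pol s t - x (p + 1))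
  rw [phi, Finset.sum_Icc_succ_top (by omega), arg_pol hs htp]
  have h3 : (p : ℝ) * t₀ ≤ p * t := mul_le_mul_of_nonneg_left ht.1 (Nat.cast_nonneg p)
  linarith

/-- All `p + 1` arguments tend to `t`, and `(p + 1) t - p t = t`. -/
theorem tendsto_phi_atTop (p : ℕ) (x : ℕ → ℝ) {t : ℝ} (ht : t ∈ Set.Ioo 0 Real.pi) :
    Tendsto (fun s => phi p x (pol s t)) atTop (𝓝 t) := by
  have h1 : ∀ y : ℝ, Tendsto (fun s : ℝ => (pol s t - y).arg) atTop (𝓝 t) := by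
    intro y
    have h2 : Tendsto (fun s : ℝ => pol 1 t - (y / s : ℝ)) atTop (𝓝 (pol 1 t - (0 : ℝ))) := by
      refine tendsto_const_nhds.sub ?_
      exact (Complex.continuous_ofReal.tendsto _).comp (tendsto_const_nhds.div_atTop tendsto_id)
    rw [Complex.ofReal_zero, sub_zero] at h2
    have h3 := (Complex.continuousAt_arg (Complex.mem_slitPlane_iff.2
      (Or.inr (pol_im_pos one_pos ht).ne'))).tendsto.comp h2
    rw [arg_pol one_pos ht] at h3
    refine h3.congr' ?_
    filter_upwards [eventually_gt_atTop 0] with s hs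
    have hs' : (s : ℂ) ≠ 0 := by exact_mod_cast hs.ne'
    rw [Function.comp_apply, ← Complex.arg_real_mul _ hs]
    congr 1
    rw [pol, pol]; push_cast; field_simp
  have h2 := (tendsto_finsetSum (Finset.Icc 1 (p + 1)) fun k _ => h1 (x k)).sub
    ((h1 0).const_mul (p : ℝ))
  have e : ∑ _k ∈ Finset.Icc 1 (p + 1), t - p * t = t := by simp; ring
  rw [e] at h2
  refine h2.congr fun s => ?_
  simp [phi]

section

variable {a x : ℕ → ℝ} {p : ℕ}

/-- If it failed, the minimum of `phi` over `[s₁, s₂]` would be attained in the interior at a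
nonpositive value, where the radial derivative is positive. -/
theorem NegCase.phi_lt_of_lt (hp : 2 ≤ p) (h : NegCase p x)
    (hq : q a p = ∏ k ∈ Finset.Icc 1 (p + 1), (X - C (x k))) {t : ℝ}
    (ht : t ∈ Set.Ioo 0 Real.pi) {s₁ s₂ : ℝ} (hs₁ : 0 < s₁) (hs : s₁ < s₂)
    (h2 : phi p x (pol s₂ t) ≤ 0) : phi p x (pol s₁ t) < phi p x (pol s₂ t) := by
  by_contra hcon
  push Not at hcon
  have hs₂ : 0 < s₂ := hs₁.trans hs
  have hsin := Real.sin_pos_of_pos_of_lt_pi ht.1 ht.2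
  have hd : ∀ s, 0 < s → phi p x (pol s t) ≤ 0 → 0 < deriv (fun s => phi p x (pol s t)) s := by
    intro s hs hs'
    rw [(hasDerivAt_phi p x hs ht).deriv]
    exact mul_pos hsin (h.deriv_phi_pos hp hq (pol_im_pos hs ht) hs')
  have hc : ContinuousOn (fun s => phi p x (pol s t)) (Set.Icc s₁ s₂) := fun s hs' =>
    (hasDerivAt_phi p x (lt_of_lt_of_le hs₁ hs'.1) ht).continuousAt.continuousWithinAt
  obtain ⟨m, hm, hmin⟩ := isCompact_Icc.exists_isMinOn (Set.nonempty_Icc.2 hs.le) hc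
  have hsgn := eventually_nhdsWithin_sign_eq_of_deriv_pos
    (f := fun s => phi p x (pol s t) - phi p x (pol s₂ t)) (x₀ := s₂)
    (by rw [deriv_sub_const]; exact hd s₂ hs₂ h2) (sub_self _)
  have hlt : ∀ᶠ s in 𝓝[<] s₂, phi p x (pol s t) < phi p x (pol s₂ t) := by
    filter_upwards [nhdsWithin_le_nhds hsgn, self_mem_nhdsWithin] with s h3 h4
    have h4' : s < s₂ := h4
    rw [sign_neg (sub_neg.2 h4'), sign_eq_neg_one_iff] at h3
    linarith
  obtain ⟨s, hs3, hs4⟩ := (hlt.and (Ioo_mem_nhdsLT hs)).exists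
  have hm' : phi p x (pol m t) < phi p x (pol s₂ t) :=
    lt_of_le_of_lt (hmin ⟨hs4.1.le, hs4.2.le⟩) hs3
  have hm1 : m ≠ s₁ := by rintro rfl; linarith
  have hm2 : m ≠ s₂ := by rintro rfl; linarith
  have hmI : m ∈ Set.Ioo s₁ s₂ := ⟨lt_of_le_of_ne hm.1 hm1.symm, lt_of_le_of_ne hm.2 hm2⟩
  have hloc : IsLocalMin (fun s => phi p x (pol s t)) m :=
    hmin.isLocalMin (Icc_mem_nhds hmI.1 hmI.2)
  exact (hd m (hs₁.trans hmI.1) (by linarith)).ne' hloc.deriv_eq_zero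

/-- Put `f = (-1)^i Im r`. On the curve `phi = -iπ` the radial derivative of `f` vanishes, changing
sign from minus to plus as `phi` increases, so `f` is minimal in `s`; the angular derivative of `f`
is positive there. As `phi` is increasing in `s`, the curve meets every slightly larger angle `t'`,
at a radius `s'` close to `s`. Going from `(s, t)` to `(s', t)` and then to `(s', t')` increases
`f`. -/
theorem NegCase.exists_larger (hp : 2 ≤ p) (h : NegCase p x)
    (hq : q a p = ∏ k ∈ Finset.Icc 1 (p + 1), (X - C (x k))) (i : ℕ) {s t e : ℝ}
    (hs : 0 < s) (ht : t ∈ Set.Ioo 0 Real.pi) (hphi : phi p x (pol s t) = -(i * Real.pi))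
    (he : t < e) :
    ∃ s' t', 0 < s' ∧ t < t' ∧ t' < e ∧ phi p x (pol s' t') = -(i * Real.pi) ∧
      (-1) ^ i * imR a p s t < (-1) ^ i * imR a p s' t' := by
  have hpi := Real.pi_pos
  set ψ : ℝ × ℝ → ℝ := fun st => phi p x (pol st.1 st.2) + i * Real.pi with hψ
  have hψ0 : ψ (s, t) = 0 := by simp [hψ, hphi]
  have hψc : ∀ s t, 0 < s → t ∈ Set.Ioo 0 Real.pi → ContinuousAt ψ (s, t) := by
    intro s t hs ht
    refine ContinuousAt.add ?_ continuousAt_const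
    exact ContinuousAt.comp (f := fun st : ℝ × ℝ => pol st.1 st.2) (x := (s, t))
      (continuousAt_phi p x (pol_im_pos hs ht)) continuous_pol.continuousAt
  have hev : ∀ᶠ st : ℝ × ℝ in 𝓝 (s, t), |ψ st| < Real.pi / 2 := by
    refine (hψc s t hs ht).abs.eventually_lt continuousAt_const ?_
    rw [hψ0, abs_zero]; positivity
  have hev2 : ∀ᶠ st : ℝ × ℝ in 𝓝 (s, t), |ψ st| < Real.pi / 2 ∧ 0 < st.1 ∧
      st.2 ∈ Set.Ioo 0 Real.pi ∧ st.2 < e := by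
    refine hev.and ?_
    refine (continuousAt_fst.eventually (lt_mem_nhds hs)).and
      ((continuousAt_snd.eventually (Ioo_mem_nhds ht.1 ht.2)).and
        (continuousAt_snd.eventually (gt_mem_nhds he)))
  rw [nhds_prod_eq, eventually_prod_iff] at hev2
  obtain ⟨P, hP, R, hR, hPR⟩ := hev2
  have hsgn := eventually_nhdsWithin_sign_eq_of_deriv_pos
    (f := fun s => ψ (s, t)) (x₀ := s) (by
      simp only [hψ]
      rw [deriv_add_const, (hasDerivAt_phi p x hs ht).deriv]
      refine mul_pos (Real.sin_pos_of_pos_of_lt_pi ht.1 ht.2)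
        (h.deriv_phi_pos hp hq (pol_im_pos hs ht) ?_)
      rw [hphi]; exact neg_nonpos.2 (by positivity)) hψ0
  obtain ⟨d, hd, hd'⟩ := Metric.eventually_nhds_iff.1 (hP.and hsgn)
  have hbox : ∀ s' ∈ Set.Icc (s - d / 2) (s + d / 2),
      P s' ∧ SignType.sign (ψ (s', t)) = SignType.sign (s' - s) := by
    intro s' hs'
    refine hd' ?_
    rw [Real.dist_eq, abs_lt]; constructor <;> linarith [hs'.1, hs'.2]
  have hRt : R t := hR.self_of_nhds
  have hlo : ψ (s - d / 2, t) < 0 := by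
    have := (hbox (s - d / 2) ⟨le_rfl, by linarith⟩).2
    rwa [sign_neg (show s - d / 2 - s < 0 by linarith), sign_eq_neg_one_iff] at this
  have hhi : 0 < ψ (s + d / 2, t) := by
    have := (hbox (s + d / 2) ⟨by linarith, le_rfl⟩).2
    rwa [sign_pos (show 0 < s + d / 2 - s by linarith), sign_eq_one_iff] at this
  have hpos : ∀ s' ∈ Set.Icc (s - d / 2) (s + d / 2), 0 < s' := fun s' hs' =>
    (hPR (hbox s' hs').1 hRt).2.1
  have hlo' : ∀ᶠ t' in 𝓝 t, ψ (s - d / 2, t') < 0 := by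
    have := (hψc _ t (hpos (s - d / 2) ⟨le_rfl, by linarith⟩) ht).comp (f := fun t' => (s - d / 2, t'))
      (by fun_prop : ContinuousAt (fun t' : ℝ => (s - d / 2, t')) t)
    exact this.eventually_lt continuousAt_const hlo
  have hhi' : ∀ᶠ t' in 𝓝 t, 0 < ψ (s + d / 2, t') := by
    have := (hψc _ t (hpos (s + d / 2) ⟨by linarith, le_rfl⟩) ht).comp (f := fun t' => (s + d / 2, t'))
      (by fun_prop : ContinuousAt (fun t' : ℝ => (s + d / 2, t')) t)
    exact continuousAt_const.eventually_lt this hhi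
  obtain ⟨l, u, htlu, hlu⟩ := mem_nhds_iff_exists_Ioo_subset.1 (hlo'.and (hhi'.and hR))
  set t' := (t + u) / 2 with ht'
  have htt' : t < t' := by linarith [htlu.2]
  have ht'u : t' < u := by linarith [htlu.2]
  have hin : ∀ τ ∈ Set.Icc t t', τ ∈ Set.Ioo l u := fun τ hτ =>
    ⟨by linarith [htlu.1, hτ.1], by linarith [hτ.2]⟩
  obtain ⟨h1, h2, h3⟩ := hlu (hin t' ⟨htt'.le, le_rfl⟩)
  have ht'pi := (hPR (hbox s ⟨by linarith, by linarith⟩).1 h3).2.2.1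
  obtain ⟨s', hs', hs'0⟩ := intermediate_value_Icc (by linarith : s - d / 2 ≤ s + d / 2)
    (f := fun s' => ψ (s', t'))
    (fun σ hσ => ((hψc σ t' (hpos σ hσ) ht'pi).comp (f := fun s' => (s', t'))
      (by fun_prop : ContinuousAt (fun s' : ℝ => (s', t')) σ)).continuousWithinAt)
    (show (0 : ℝ) ∈ Set.Icc _ _ from ⟨h1.le, h2.le⟩)
  refine ⟨s', t', hpos s' hs', htt', (hPR (hbox s ⟨by linarith, by linarith⟩).1 h3).2.2.2, ?_, ?_⟩
  · have : ψ (s', t') = 0 := hs'0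
    simp only [hψ] at this; linarith
  -- the value at `(s', t)` lies in between
  have hmin : (-1) ^ i * imR a p s t ≤ (-1) ^ i * imR a p s' t := by
    have hder : ∀ σ ∈ Set.Icc (s - d / 2) (s + d / 2), HasDerivAt (fun s => (-1) ^ i * imR a p s t)
        ((-1) ^ i * ((wrDeriv a p (pol σ t)).im / σ)) σ := fun σ hσ =>
      (hasDerivAt_imR_left a p (hpos σ hσ).ne' t).const_mul _
    have hval : ∀ σ ∈ Set.Icc (s - d / 2) (s + d / 2), ∃ c, 0 < c ∧
        (-1) ^ i * ((wrDeriv a p (pol σ t)).im / σ) = c * Real.sin (ψ (σ, t)) := by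
      intro σ hσ
      obtain ⟨c, hc, -, h5⟩ := neg_one_pow_mul_wrDeriv hq (pol_im_pos (hpos σ hσ) ht) i
      refine ⟨c / σ, div_pos hc (hpos σ hσ), ?_⟩
      rw [← mul_div_assoc, h5]; simp only [hψ]; ring
    rcases le_total s s' with hss | hss
    · have hsub : Set.Icc s s' ⊆ Set.Icc (s - d / 2) (s + d / 2) :=
        Set.Icc_subset_Icc (by linarith) hs'.2
      refine monotoneOn_of_deriv_nonneg (convex_Icc s s')
        (fun σ hσ => (hder σ (hsub hσ)).continuousAt.continuousWithinAt)
        (fun σ hσ => (hder σ (hsub (interior_subset hσ))).differentiableAt.differentiableWithinAt)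
        (fun σ hσ => ?_) ⟨le_rfl, hss⟩ ⟨hss, le_rfl⟩ hss
      rw [interior_Icc] at hσ
      have hσ' := hsub ⟨hσ.1.le, hσ.2.le⟩
      obtain ⟨c, hc, h5⟩ := hval σ hσ'
      rw [(hder σ hσ').deriv, h5]
      have h6 := (hbox σ hσ').2
      rw [sign_pos (sub_pos.2 hσ.1), sign_eq_one_iff] at h6
      have h7 := (hPR (hbox σ hσ').1 hRt).1
      exact mul_nonneg hc.le (Real.sin_nonneg_of_nonneg_of_le_pi h6.le
        (by linarith [(abs_lt.1 h7).2]))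
    · have hsub : Set.Icc s' s ⊆ Set.Icc (s - d / 2) (s + d / 2) :=
        Set.Icc_subset_Icc hs'.1 (by linarith)
      refine antitoneOn_of_deriv_nonpos (convex_Icc s' s)
        (fun σ hσ => (hder σ (hsub hσ)).continuousAt.continuousWithinAt)
        (fun σ hσ => (hder σ (hsub (interior_subset hσ))).differentiableAt.differentiableWithinAt)
        (fun σ hσ => ?_) ⟨le_rfl, hss⟩ ⟨hss, le_rfl⟩ hss
      rw [interior_Icc] at hσ
      have hσ' := hsub ⟨hσ.1.le, hσ.2.le⟩
      obtain ⟨c, hc, h5⟩ := hval σ hσ'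
      rw [(hder σ hσ').deriv, h5]
      have h6 := (hbox σ hσ').2
      rw [sign_neg (sub_neg.2 hσ.2), sign_eq_neg_one_iff] at h6
      have h7 := (hPR (hbox σ hσ').1 hRt).1
      exact mul_nonpos_of_nonneg_of_nonpos hc.le (Real.sin_nonpos_of_nonpos_of_neg_pi_le h6.le
        (by linarith [(abs_lt.1 h7).1]))
  have hmono : (-1) ^ i * imR a p s' t < (-1) ^ i * imR a p s' t' := by
    have hs'pos := hpos s' hs'
    have hder : ∀ τ, HasDerivAt (fun t => (-1) ^ i * imR a p s' t)
        ((-1) ^ i * (wrDeriv a p (pol s' τ)).re) τ := fun τ =>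
      (hasDerivAt_imR_right a p hs'pos.ne' τ).const_mul _
    refine strictMonoOn_of_deriv_pos (convex_Icc t t')
      (fun σ hσ => (hder σ).continuousAt.continuousWithinAt) (fun τ hτ => ?_)
      ⟨le_rfl, htt'.le⟩ ⟨htt'.le, le_rfl⟩ htt'
    rw [interior_Icc] at hτ
    obtain ⟨-, -, h6⟩ := hlu (hin τ ⟨hτ.1.le, hτ.2.le⟩)
    obtain ⟨h7, -, h8, -⟩ := hPR (hbox s' hs').1 h6
    obtain ⟨c, hc, h5, -⟩ := neg_one_pow_mul_wrDeriv hq (pol_im_pos hs'pos h8) i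
    rw [(hder τ).deriv, h5]
    exact mul_pos hc (Real.cos_pos_of_mem_Ioo ⟨(abs_lt.1 h7).1, (abs_lt.1 h7).2⟩)
  exact lt_of_le_of_lt hmin hmono

/-- The condition `(i + 1) π < p t` keeps the level curve `phi = -iπ` in a compact range of radii
for all angles from `t` on. If `(-1)^i Im r` were positive at a point of it, it would attain a
maximum on the part with angle in `[t, e]`; the angle `e` near `π` is excluded because `Im r`
vanishes on the negative axis, and at any other point `exists_larger` contradicts maximality.
Strictness follows by comparing with a larger value on the curve. -/
theorem NegCase.imR_sign (hp : 2 ≤ p) (h : NegCase p x)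
    (hq : q a p = ∏ k ∈ Finset.Icc 1 (p + 1), (X - C (x k))) (i : ℕ) {s t : ℝ}
    (hs : 0 < s) (ht : t ∈ Set.Ioo 0 Real.pi) (hit : (i + 1) * Real.pi < p * t)
    (hphi : phi p x (pol s t) = -(i * Real.pi)) :
    (-1) ^ i * imR a p s t < 0 := by
  have hpi := Real.pi_pos
  -- it is enough to exclude positive values
  suffices H : ∀ s t, 0 < s → t ∈ Set.Ioo 0 Real.pi → (i + 1) * Real.pi < p * t →
      phi p x (pol s t) = -(i * Real.pi) → (-1) ^ i * imR a p s t ≤ 0 by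
    obtain ⟨s', t', h1, h2, h3, h4, h5⟩ := h.exists_larger hp hq i hs ht hphi ht.2
    refine lt_of_lt_of_le h5 (H s' t' h1 ⟨ht.1.trans h2, h3⟩ ?_ h4)
    exact hit.trans_le (mul_le_mul_of_nonneg_left h2.le (Nat.cast_nonneg p))
  intro s t hs ht hit hphi
  by_contra hcon
  push Not at hcon
  set v := (-1) ^ i * imR a p s t with hv
  obtain ⟨α, hα, hα'⟩ := exists_phi_lt h (c := -(i * Real.pi)) ht.1 (by linarith)
  obtain ⟨β, hβ, hβ'⟩ := exists_wrDeriv_im_pos a p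
  have hrange : ∀ s' t', 0 < s' → t' ∈ Set.Ico t Real.pi → phi p x (pol s' t') = -(i * Real.pi) →
      s' ∈ Set.Icc α β := by
    intro s' t' hs' ht' h1
    constructor
    · by_contra hc
      push Not at hc
      exact (hα' s' t' hs' hc.le ht').ne h1
    · by_contra hc
      push Not at hc
      have ht'' : t' ∈ Set.Ioo 0 Real.pi := ⟨ht.1.trans_le ht'.1, ht'.2⟩
      obtain ⟨c, -, -, h2⟩ := neg_one_pow_mul_wrDeriv hq (pol_im_pos hs' ht'') i
      have h3 := hβ' s' t' hc ht''
      rw [h1, neg_add_cancel, Real.sin_zero, mul_zero] at h2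
      rcases mul_eq_zero.1 h2 with h4 | h4
      · exact pow_ne_zero i (by norm_num) h4
      · exact h3.ne' h4
  -- near `t = π` the values are small
  have hsmall : ∃ e, t < e ∧ e < Real.pi ∧ ∀ s' ∈ Set.Icc α β, (-1) ^ i * imR a p s' e < v := by
    have hcont : ∀ s' ∈ Set.Icc α β, ∀ᶠ st : ℝ × ℝ in 𝓝 (Real.pi, s'),
        (-1) ^ i * imR a p st.2 st.1 < v := by
      intro s' hs'
      have h0 : imR a p s' Real.pi = 0 := by
        rw [imR_eq]; simp [Real.sin_nat_mul_pi]
      have h1 : ContinuousAt (fun st : ℝ × ℝ => (-1) ^ i * imR a p st.2 st.1) (Real.pi, s') := by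
        refine continuousAt_const.mul ?_
        exact ContinuousAt.comp (f := fun st : ℝ × ℝ => (st.2, st.1)) (x := (Real.pi, s'))
          (continuousAt_imR a p (hα.trans_le hs'.1).ne' Real.pi) (by fun_prop)
      refine h1.eventually_lt continuousAt_const ?_
      simpa [h0] using hcon
    have := isCompact_Icc.eventually_forall_of_forall_eventually
      (P := fun e s' => (-1) ^ i * imR a p s' e < v) hcont
    obtain ⟨e, he, he'⟩ := ((this.filter_mono nhdsWithin_le_nhds).and
      (Ioo_mem_nhdsLT ht.2)).exists
    exact ⟨e, he'.1, he'.2, he⟩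
  obtain ⟨e, hte, hepi, he⟩ := hsmall
  set K : Set (ℝ × ℝ) := (Set.Icc α β ×ˢ Set.Icc t e) ∩
    {st | phi p x (pol st.1 st.2) = -(i * Real.pi)} with hK
  have hpolc : ContinuousOn (fun st : ℝ × ℝ => phi p x (pol st.1 st.2))
      (Set.Icc α β ×ˢ Set.Icc t e) := by
    rintro ⟨s', t'⟩ ⟨h1, h2⟩
    refine ContinuousAt.continuousWithinAt ?_
    exact ContinuousAt.comp (f := fun st : ℝ × ℝ => pol st.1 st.2) (x := (s', t'))
      (continuousAt_phi p x (pol_im_pos (hα.trans_le h1.1)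
        ⟨ht.1.trans_le h2.1, h2.2.trans_lt hepi⟩)) continuous_pol.continuousAt
  have hKc : IsCompact K := by
    have hcl : IsClosed K := hpolc.preimage_isClosed_of_isClosed
      (isClosed_Icc.prod isClosed_Icc) isClosed_singleton
    exact (isCompact_Icc.prod isCompact_Icc).of_isClosed_subset hcl Set.inter_subset_left
  have hKne : (s, t) ∈ K :=
    ⟨⟨hrange s t hs ⟨le_rfl, ht.2⟩ hphi, ⟨le_rfl, hte.le⟩⟩, hphi⟩
  obtain ⟨⟨s₁, t₁⟩, hst₁, hmax⟩ := hKc.exists_isMaxOn ⟨_, hKne⟩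
    (f := fun st : ℝ × ℝ => (-1) ^ i * imR a p st.1 st.2) (by
      rintro ⟨s', t'⟩ ⟨⟨h1, h2⟩, -⟩
      exact (continuousAt_const.mul
        (continuousAt_imR a p (hα.trans_le h1.1).ne' t')).continuousWithinAt)
  obtain ⟨⟨h1, h2⟩, h3⟩ := hst₁
  have hv1 : v ≤ (-1) ^ i * imR a p s₁ t₁ := hmax hKne
  have ht₁e : t₁ < e := by
    refine lt_of_le_of_ne h2.2 fun h4 => ?_
    have := he s₁ h1
    rw [← show t₁ = e from h4] at this; linarith
  obtain ⟨s', t', h4, h5, h6, h7, h8⟩ := h.exists_larger hp hq i (hα.trans_le h1.1)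
    ⟨ht.1.trans_le h2.1, ht₁e.trans hepi⟩ h3 ht₁e
  have h2' : t ≤ t₁ := h2.1
  have hmem : (s', t') ∈ K :=
    ⟨⟨hrange s' t' h4 ⟨by linarith, by linarith⟩ h7, ⟨by linarith, h6.le⟩⟩, h7⟩
  exact absurd (hmax hmem) (not_le.2 h8)

end

theorem exists_zeros_of_alternating {f : ℝ → ℝ} {n : ℕ} {u : ℕ → ℝ}
    (hu : ∀ m < n, u m < u (m + 1))
    (hf : ∀ m < n, ContinuousOn f (Set.Icc (u m) (u (m + 1))))
    (hs : ∀ m < n, f (u m) * f (u (m + 1)) < 0) :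
    ∃ Z : Finset ℝ, Z.card = n ∧ ∀ y ∈ Z, u 0 < y ∧ y < u n ∧ f y = 0 := by
  have h1 : ∀ m, ∃ c, m < n → c ∈ Set.Ioo (u m) (u (m + 1)) ∧ f c = 0 := by
    intro m
    by_cases hm : m < n
    · have h2 := hs m hm
      rcases mul_neg_iff.1 h2 with h3 | h3
      · obtain ⟨c, hc, hc'⟩ := intermediate_value_Ioo' (hu m hm).le (hf m hm) ⟨h3.2, h3.1⟩
        exact ⟨c, fun _ => ⟨hc, hc'⟩⟩
      · obtain ⟨c, hc, hc'⟩ := intermediate_value_Ioo (hu m hm).le (hf m hm) ⟨h3.1, h3.2⟩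
        exact ⟨c, fun _ => ⟨hc, hc'⟩⟩
    · exact ⟨0, fun h => absurd h hm⟩
  choose c hc using h1
  have hmono : ∀ m' m, m ≤ m' → m' ≤ n → u m ≤ u m' := by
    intro m'
    induction m' with
    | zero => intro m hm _; rw [Nat.le_zero.1 hm]
    | succ k ih =>
      intro m hm hk
      rcases Nat.lt_or_ge m (k + 1) with h2 | h2
      · exact (ih m (by omega) (by omega)).trans (hu k (by omega)).le
      · rw [show m = k + 1 by omega]
  have hlt : ∀ m m', m < m' → m' < n → c m < c m' := by
    intro m m' h2 h3
    have h4 := (hc m (by omega)).1.2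
    have h5 := (hc m' h3).1.1
    have := hmono m' (m + 1) h2 h3.le
    linarith
  refine ⟨(Finset.range n).image c, ?_, fun y hy => ?_⟩
  · rw [Finset.card_image_of_injOn, Finset.card_range]
    intro m hm m' hm' he
    simp only [Finset.coe_range, Set.mem_Iio] at hm hm'
    by_contra hne
    rcases Nat.lt_or_gt_of_ne hne with h2 | h2
    · exact (hlt m m' h2 hm').ne he
    · exact (hlt m' m h2 hm).ne' he
  · obtain ⟨m, hm, rfl⟩ := Finset.mem_image.1 hy
    rw [Finset.mem_range] at hm
    obtain ⟨h2, h3⟩ := hc m hm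
    refine ⟨?_, ?_, h3⟩
    · linarith [hmono m 0 (Nat.zero_le m) hm.le, h2.1]
    · linarith [hmono n (m + 1) (by omega) le_rfl, h2.2]

/-! ### Real-rootedness of the ray polynomials. -/

variable {a x : ℕ → ℝ} {p : ℕ}

/-- The polynomial with value `s ^ p Im r(s e^{it})` at real `s`. -/
def rayPoly (a : ℕ → ℝ) (p : ℕ) (t : ℝ) : ℝ[X] :=
  C (Real.sin t) * X ^ (p + 1) -
    ∑ k ∈ Finset.range (p + 1), C (a k * Real.sin (k * t)) * X ^ (p - k)

theorem eval_rayPoly (a : ℕ → ℝ) (p : ℕ) (t : ℝ) {s : ℝ} (hs : s ≠ 0) :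
    (rayPoly a p t).eval s = s ^ p * imR a p s t := by
  rw [imR_eq]
  simp only [rayPoly, eval_sub, eval_mul, eval_C, eval_pow, eval_X, eval_finsetSum]
  rw [mul_sub, Finset.mul_sum]
  congr 1
  · ring
  · refine Finset.sum_congr rfl fun k hk => ?_
    rw [Finset.mem_range] at hk
    obtain ⟨d, rfl⟩ := Nat.exists_eq_add_of_le (show k ≤ p by omega)
    rw [Nat.add_sub_cancel_left, pow_add]
    field_simp

/-- The point `-s e^{it}` is the conjugate of `s e^{i(π - t)}`, so negative zeros at angle `t` are
positive zeros at angle `π - t`. -/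
theorem rayPoly_reflect (a : ℕ → ℝ) (p : ℕ) (t s : ℝ) :
    (rayPoly a p t).eval (-s) = (-1) ^ (p + 1) * (rayPoly a p (Real.pi - t)).eval s := by
  simp only [rayPoly, eval_sub, eval_mul, eval_C, eval_pow, eval_X, eval_finsetSum]
  rw [mul_sub, Finset.mul_sum, Real.sin_pi_sub]
  congr 1
  · rw [neg_pow]; ring
  · refine Finset.sum_congr rfl fun k hk => ?_
    rw [Finset.mem_range] at hk
    obtain ⟨d, rfl⟩ := Nat.exists_eq_add_of_le (show k ≤ p by omega)
    rw [Nat.add_sub_cancel_left, mul_sub, Real.sin_nat_mul_pi_sub, neg_pow s,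
      show k + d + 1 = d + (k + 1) by ring, pow_add, pow_succ]
    have : ((-1 : ℝ) ^ k) * (-1) ^ k = 1 := by rw [← mul_pow]; simp
    linear_combination (a k * Real.sin (k * t) * (-1) ^ d * s ^ d) * (-this)

theorem rayPoly_natDegree_le (a : ℕ → ℝ) (p : ℕ) (t : ℝ) : (rayPoly a p t).natDegree ≤ p + 1 := by
  refine (natDegree_sub_le _ _).trans (max_le (natDegree_C_mul_X_pow_le _ _) ?_)
  exact natDegree_sum_le_of_forall_le _ _ fun k _ =>
    (natDegree_C_mul_X_pow_le _ _).trans (by omega)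

theorem rayPoly_coeff_top (a : ℕ → ℝ) (p : ℕ) (t : ℝ) :
    (rayPoly a p t).coeff (p + 1) = Real.sin t := by
  simp only [rayPoly, coeff_sub, coeff_C_mul, coeff_X_pow, finsetSum_coeff]
  rw [Finset.sum_eq_zero]
  · simp
  · intro k _
    rw [if_neg (by omega), mul_zero]

theorem rayPoly_eval_zero (a : ℕ → ℝ) (p : ℕ) (t : ℝ) :
    (rayPoly a p t).eval 0 = -(a p * Real.sin (p * t)) := by
  simp only [rayPoly, eval_sub, eval_mul, eval_C, eval_pow, eval_X, eval_finsetSum]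
  rw [Finset.sum_range_succ, Finset.sum_eq_zero]
  · simp
  · intro k hk
    rw [Finset.mem_range] at hk
    rw [zero_pow (by omega), mul_zero]

theorem neg_one_pow_mul_sin_pos {y : ℝ} (N : ℕ) (h1 : N * Real.pi < y) (h2 : y < (N + 1) * Real.pi) :
    0 < (-1) ^ N * Real.sin y := by
  have h3 := Real.sin_sub_nat_mul_pi y N
  have h4 : 0 < Real.sin (y - N * Real.pi) :=
    Real.sin_pos_of_pos_of_lt_pi (by linarith) (by linarith)
  rwa [h3] at h4

/-- As `s → 0` the term `-a_p sin(pt) / s^p` dominates. If `p t = (N + 1) π` it vanishes, and the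
term with `a_{p-1}` takes over, where `sin((p-1)t) = (-1)^N sin t`. Here the positivity of `a_p` and
`a_{p-1}` enters. -/
theorem NegCase.exists_imR_sign_near_zero (hp : 2 ≤ p) (h : NegCase p x)
    (hq : q a p = ∏ k ∈ Finset.Icc 1 (p + 1), (X - C (x k))) {t : ℝ} (ht : t ∈ Set.Ioo 0 Real.pi)
    (N : ℕ) (hN : N * Real.pi < p * t) (hN' : p * t ≤ (N + 1) * Real.pi) :
    ∀ᶠ s in 𝓝[>] (0 : ℝ), (-1) ^ N * imR a p s t < 0 := by
  have hap : 0 < a p := h.coeff_pos (by omega) hq p (Finset.mem_Icc.2 ⟨by omega, le_rfl⟩)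
  have hap1 : 0 < a (p - 1) := h.coeff_pos (by omega) hq _ (Finset.mem_Icc.2 ⟨by omega, by omega⟩)
  have hsin := Real.sin_pos_of_pos_of_lt_pi ht.1 ht.2
  rcases hN'.lt_or_eq with hlt | heq
  · have h1 := neg_one_pow_mul_sin_pos N hN hlt
    have h2 : ∀ᶠ s in 𝓝 (0 : ℝ), (-1) ^ N * (rayPoly a p t).eval s < 0 := by
      refine ContinuousAt.eventually_lt (by fun_prop) continuousAt_const ?_
      rw [rayPoly_eval_zero]; nlinarith
    filter_upwards [nhdsWithin_le_nhds h2, self_mem_nhdsWithin] with s h3 h4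
    have h4' : 0 < s := h4
    rw [eval_rayPoly a p t h4'.ne'] at h3
    have := pow_pos h4' p
    by_contra hcon
    push Not at hcon
    nlinarith [mul_nonneg this.le hcon]
  · have hs0 : Real.sin (p * t) = 0 := by rw [heq]; exact_mod_cast Real.sin_nat_mul_pi (N + 1)
    have h1 : Real.sin ((p - 1 : ℕ) * t) = (-1) ^ N * Real.sin t := by
      rw [Nat.cast_sub (by omega), Nat.cast_one, sub_mul, one_mul, heq]
      have := Real.sin_nat_mul_pi_sub t (N + 1)
      push_cast at this
      rw [this, pow_succ]; ring
    set P : ℝ[X] := C (Real.sin t) * X ^ p -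
      ∑ k ∈ Finset.range p, C (a k * Real.sin (k * t)) * X ^ (p - 1 - k) with hP
    have hPe : ∀ s, (rayPoly a p t).eval s = s * P.eval s := by
      intro s
      simp only [rayPoly, hP, eval_sub, eval_mul, eval_C, eval_pow, eval_X, eval_finsetSum]
      rw [Finset.sum_range_succ, hs0, mul_sub, Finset.mul_sum]
      simp only [mul_zero, zero_mul, add_zero]
      congr 1
      · ring
      · refine Finset.sum_congr rfl fun k hk => ?_
        rw [Finset.mem_range] at hk
        rw [show p - k = p - 1 - k + 1 by omega, pow_succ]; ring
    have hP0 : P.eval 0 = -(a (p - 1) * ((-1) ^ N * Real.sin t)) := by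
      simp only [hP, eval_sub, eval_mul, eval_C, eval_pow, eval_X, eval_finsetSum]
      rw [Finset.sum_eq_single (p - 1), ← h1]
      · rw [zero_pow (by omega)]; simp
      · intro k hk hk'
        rw [Finset.mem_range] at hk
        rw [zero_pow (by omega), mul_zero]
      · intro hh; exact absurd (Finset.mem_range.2 (by omega)) hh
    have h2 : ∀ᶠ s in 𝓝 (0 : ℝ), (-1) ^ N * P.eval s < 0 := by
      refine ContinuousAt.eventually_lt (by fun_prop) continuousAt_const ?_
      have : ((-1 : ℝ) ^ N) * (-1) ^ N = 1 := by rw [← mul_pow]; simp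
      rw [hP0]
      have : (-1) ^ N * -(a (p - 1) * ((-1) ^ N * Real.sin t)) = -(a (p - 1) * Real.sin t) := by
        linear_combination (-(a (p - 1) * Real.sin t)) * this
      rw [this]; nlinarith
    filter_upwards [nhdsWithin_le_nhds h2, self_mem_nhdsWithin] with s h3 h4
    have h4' : 0 < s := h4
    have h5 := eval_rayPoly a p t h4'.ne'
    rw [hPe] at h5
    have := pow_pos h4' p
    by_contra hcon
    push Not at hcon
    have h6 : (-1) ^ N * (s * P.eval s) = s ^ p * ((-1) ^ N * imR a p s t) := by rw [h5]; ring
    nlinarith [mul_nonneg this.le hcon]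

theorem exists_imR_pos_atTop (a : ℕ → ℝ) (p : ℕ) {t : ℝ} (ht : t ∈ Set.Ioo 0 Real.pi) :
    ∀ᶠ s in atTop, 0 < imR a p s t := by
  have hsin := Real.sin_pos_of_pos_of_lt_pi ht.1 ht.2
  have h1 : Tendsto (fun s : ℝ => s * Real.sin t) atTop atTop :=
    tendsto_id.atTop_mul_const hsin
  filter_upwards [h1.eventually_gt_atTop (∑ k ∈ Finset.range (p + 1), |a k|), eventually_ge_atTop 1]
    with s h2 h3
  rw [imR_eq]
  have : ∑ k ∈ Finset.range (p + 1), a k / s ^ k * Real.sin (k * t) ≤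
      ∑ k ∈ Finset.range (p + 1), |a k| := by
    refine Finset.sum_le_sum fun k _ => (le_abs_self _).trans ?_
    rw [abs_mul, abs_div]
    refine (mul_le_of_le_one_right (by positivity) (Real.abs_sin_le_one _)).trans ?_
    refine div_le_self (abs_nonneg _) ?_
    have hs0 : 0 < s := by linarith
    rw [abs_of_pos (by positivity)]
    exact one_le_pow₀ h3
  linarith

/-- Along the ray `phi` rises from below `-(N-1)π` near the origin to `t` at infinity, so it equals
`-iπ` at some `τ_i` for each `i < N`, and `τ_i` decreases with `i`. The sign of `Im r` is `-(-1)^i`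
at `τ_i`, `-(-1)^N` near the origin and positive at infinity: `N + 2` alternating points. -/
theorem NegCase.exists_ray_zeros (hp : 2 ≤ p) (h : NegCase p x)
    (hq : q a p = ∏ k ∈ Finset.Icc 1 (p + 1), (X - C (x k))) {t : ℝ} (ht : t ∈ Set.Ioo 0 Real.pi)
    (N : ℕ) (hN : N * Real.pi < p * t) (hN' : p * t ≤ (N + 1) * Real.pi) :
    ∃ Z : Finset ℝ, Z.card = N + 1 ∧ ∀ s ∈ Z, 0 < s ∧ imR a p s t = 0 := by
  have hpi := Real.pi_pos
  -- points where the argument is `-i π`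
  have hex : ∀ i : ℕ, ∃ s, i < N → 0 < s ∧ phi p x (pol s t) = -(i * Real.pi) := by
    intro i
    by_cases hi : i < N
    · have hi' : ((i : ℝ) + 1) * Real.pi < p * t := by
        refine lt_of_le_of_lt ?_ hN
        exact mul_le_mul_of_nonneg_right (by exact_mod_cast hi) hpi.le
      obtain ⟨α, hα, hα'⟩ := exists_phi_lt h (c := -(i * Real.pi)) ht.1 (by linarith)
      have htop := (tendsto_phi_atTop p x ht).eventually (lt_mem_nhds ht.1)
      obtain ⟨β, hβ1, hβ2⟩ := (htop.and (eventually_ge_atTop α)).exists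
      obtain ⟨s, hs, hs'⟩ := intermediate_value_Icc hβ2 (f := fun s => phi p x (pol s t))
        (fun s hs => (hasDerivAt_phi p x (hα.trans_le hs.1) ht).continuousAt.continuousWithinAt)
        (show -(i * Real.pi) ∈ Set.Icc _ _ from ⟨(hα' α t hα le_rfl ⟨le_rfl, ht.2⟩).le, by
          have : 0 ≤ (i : ℝ) * Real.pi := by positivity
          linarith⟩)
      exact ⟨s, fun _ => ⟨hα.trans_le hs.1, hs'⟩⟩
    · exact ⟨0, fun hh => absurd hh hi⟩
  choose τ hτ using hex
  have hτlt : ∀ i j, i < j → j < N → τ j < τ i := by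
    intro i j hij hj
    obtain ⟨h1, h2⟩ := hτ i (by omega)
    obtain ⟨h3, h4⟩ := hτ j hj
    by_contra hcon
    push Not at hcon
    have hij' : (i : ℝ) * Real.pi < j * Real.pi :=
      mul_lt_mul_of_pos_right (by exact_mod_cast hij) hpi
    rcases hcon.lt_or_eq with h5 | h5
    · have h6 := h.phi_lt_of_lt hp hq ht h1 h5 (by rw [h4]; exact neg_nonpos.2 (by positivity))
      linarith
    · rw [h5] at h2; linarith
  have hτsign : ∀ i < N, (-1) ^ i * imR a p (τ i) t < 0 := fun i hi =>
    h.imR_sign hp hq i (hτ i hi).1 ht (lt_of_le_of_lt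
      (mul_le_mul_of_nonneg_right (by exact_mod_cast hi) hpi.le) hN) (hτ i hi).2
  -- the outer points
  have hsmall : ∃ s₀, 0 < s₀ ∧ (∀ i < N, s₀ < τ i) ∧ (-1) ^ N * imR a p s₀ t < 0 := by
    have h1 : ∀ᶠ s in 𝓝[>] (0 : ℝ), ∀ i ∈ Finset.range N, s < τ i := by
      rw [Filter.eventually_all_finset]
      intro i hi
      exact nhdsWithin_le_nhds (gt_mem_nhds (hτ i (Finset.mem_range.1 hi)).1)
    obtain ⟨s, h2, h3, h4⟩ := ((h.exists_imR_sign_near_zero hp hq ht N hN hN').and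
      (h1.and self_mem_nhdsWithin)).exists
    exact ⟨s, h4, fun i hi => h3 i (Finset.mem_range.2 hi), h2⟩
  obtain ⟨s₀, hs₀, hs₀τ, hs₀s⟩ := hsmall
  have hlarge : ∃ s₁, s₀ < s₁ ∧ (∀ i < N, τ i < s₁) ∧ 0 < imR a p s₁ t := by
    have h1 : ∀ᶠ s in atTop, ∀ i ∈ Finset.range N, τ i < s := by
      rw [Filter.eventually_all_finset]
      exact fun i _ => eventually_gt_atTop _
    obtain ⟨s, h2, h3, h4⟩ := ((exists_imR_pos_atTop a p ht).and
      (h1.and (eventually_gt_atTop s₀))).exists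
    exact ⟨s, h4, fun i hi => h3 i (Finset.mem_range.2 hi), h2⟩
  obtain ⟨s₁, hs₁, hs₁τ, hs₁s⟩ := hlarge
  -- In increasing order the points are `s₀, τ_{N-1}, …, τ_0, s₁`.
  set u : ℕ → ℝ := fun m => if m = 0 then s₀ else if m ≤ N then τ (N - m) else s₁ with hu
  have hu0 : u 0 = s₀ := by simp [hu]
  have hum : ∀ m, 1 ≤ m → m ≤ N → u m = τ (N - m) := fun m h1 h2 => by
    simp only [hu]; rw [if_neg (by omega), if_pos h2]
  have huN : u (N + 1) = s₁ := by simp [hu]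
  have hulow : ∀ m, s₀ ≤ u m := by
    intro m; simp only [hu]; split_ifs with h1 h2
    · exact le_rfl
    · exact (hs₀τ _ (by omega)).le
    · exact hs₁.le
  have hinc : ∀ m < N + 1, u m < u (m + 1) := by
    intro m hm
    rcases Nat.eq_zero_or_pos m with rfl | hm0
    · rw [hu0]
      rcases Nat.eq_zero_or_pos N with rfl | hN0
      · rwa [huN]
      · rw [hum 1 le_rfl hN0]; exact hs₀τ _ (by omega)
    · rw [hum m hm0 (by omega)]
      rcases Nat.lt_or_ge m N with h1 | h1
      · rw [hum (m + 1) (by omega) h1]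
        exact hτlt _ _ (by omega) (by omega)
      · rw [show m = N by omega, huN]; exact hs₁τ _ (by omega)
  have hsgn : ∀ m ≤ N + 1, 0 < (-1) ^ (N + 1 - m) * imR a p (u m) t := by
    intro m hm
    rcases Nat.eq_zero_or_pos m with rfl | hm0
    · rw [hu0, Nat.sub_zero, pow_succ]; linarith
    · rcases Nat.lt_or_ge m (N + 1) with h1 | h1
      · rw [hum m hm0 (by omega), show N + 1 - m = (N - m) + 1 by omega, pow_succ]
        have := hτsign (N - m) (by omega)
        linarith
      · rw [show m = N + 1 by omega, huN]; simpa using hs₁s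
  obtain ⟨Z, hZ, hZ'⟩ := exists_zeros_of_alternating (f := fun s => imR a p s t) hinc
    (fun m _ s hs => (hasDerivAt_imR_left a p
      (lt_of_lt_of_le hs₀ ((hulow m).trans hs.1)).ne' t).continuousAt.continuousWithinAt) (by
      intro m hm
      have h1 := hsgn m (by omega)
      have h2 := hsgn (m + 1) (by omega)
      rw [show N + 1 - m = (N + 1 - (m + 1)) + 1 by omega, pow_succ] at h1
      have h3 := mul_pos h1 h2
      have h4 : ((-1 : ℝ) ^ (N + 1 - (m + 1))) * (-1) ^ (N + 1 - (m + 1)) = 1 := by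
        rw [← mul_pow]; simp
      have h5 : (-1 : ℝ) ^ (N + 1 - (m + 1)) * -1 * imR a p (u m) t *
          ((-1) ^ (N + 1 - (m + 1)) * imR a p (u (m + 1)) t) =
          -(imR a p (u m) t * imR a p (u (m + 1)) t) := by
        linear_combination (-(imR a p (u m) t * imR a p (u (m + 1)) t)) * h4
      linarith)
  exact ⟨Z, hZ, fun s hs => ⟨by have := (hZ' s hs).1; rw [hu0] at this; linarith, (hZ' s hs).2.2⟩⟩

/-- The angles `t` and `π - t` give `N + 1` positive and `M + 1` negative zeros, where `N + M + 2 ≥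
p`. If this is only `p`, both upper brackets are equalities, so `sin(pt) = 0` and the origin is the
missing zero. -/
theorem NegCase.exists_rayPoly_zeros (hp : 2 ≤ p) (h : NegCase p x)
    (hq : q a p = ∏ k ∈ Finset.Icc 1 (p + 1), (X - C (x k))) {t : ℝ} (ht : t ∈ Set.Ioo 0 Real.pi) :
    ∃ Z : Finset ℝ, Z.card = p + 1 ∧ ∀ s ∈ Z, (rayPoly a p t).eval s = 0 := by
  classical
  have hpi := Real.pi_pos
  have hp0 : (0 : ℝ) < p := by exact_mod_cast (by omega : 0 < p)
  have hbracket : ∀ y : ℝ, 0 < y → ∃ N : ℕ, N * Real.pi < y ∧ y ≤ (N + 1) * Real.pi := by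
    intro y hy
    have h1 : 0 < ⌈y / Real.pi⌉₊ := Nat.ceil_pos.2 (div_pos hy hpi)
    obtain ⟨N, hN⟩ := Nat.exists_eq_add_of_le h1
    refine ⟨N, ?_, ?_⟩
    · have := Nat.lt_ceil.1 (show N < ⌈y / Real.pi⌉₊ by omega)
      rwa [lt_div_iff₀ hpi] at this
    · have := Nat.le_ceil (y / Real.pi)
      rw [hN, div_le_iff₀ hpi] at this
      push_cast at this
      rw [add_comm (N : ℝ)]; simpa using this
  obtain ⟨N, hN1, hN2⟩ := hbracket (p * t) (mul_pos hp0 ht.1)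
  obtain ⟨M, hM1, hM2⟩ := hbracket (p * (Real.pi - t)) (mul_pos hp0 (by linarith [ht.2]))
  obtain ⟨Z, hZ, hZ'⟩ := h.exists_ray_zeros hp hq ht N hN1 hN2
  obtain ⟨Y, hY, hY'⟩ := h.exists_ray_zeros hp hq (t := Real.pi - t)
    ⟨by linarith [ht.2], by linarith [ht.1]⟩ M hM1 hM2
  have hlow : p ≤ N + M + 2 := by
    have : (p : ℝ) * Real.pi ≤ ((N + M + 2 : ℕ) : ℝ) * Real.pi := by push_cast; linarith
    exact_mod_cast le_of_mul_le_mul_right this hpi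
  set Y' := Y.image fun s => -s with hYdef
  have hYc : Y'.card = M + 1 := by
    rw [hYdef, Finset.card_image_of_injective _ neg_injective, hY]
  have hdisj : Disjoint Z Y' := by
    rw [Finset.disjoint_left]
    intro s hs hs'
    obtain ⟨s', hs'', rfl⟩ := Finset.mem_image.1 hs'
    linarith [(hZ' _ hs).1, (hY' _ hs'').1]
  have hroot : ∀ s ∈ Z ∪ Y', s ≠ 0 ∧ (rayPoly a p t).eval s = 0 := by
    intro s hs
    rcases Finset.mem_union.1 hs with hs | hs
    · obtain ⟨h1, h2⟩ := hZ' s hs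
      exact ⟨h1.ne', by rw [eval_rayPoly a p t h1.ne', h2, mul_zero]⟩
    · obtain ⟨s', hs'', rfl⟩ := Finset.mem_image.1 hs
      obtain ⟨h1, h2⟩ := hY' s' hs''
      refine ⟨neg_ne_zero.2 h1.ne', ?_⟩
      rw [rayPoly_reflect, eval_rayPoly _ _ _ h1.ne', h2]; simp
  have hcard : (Z ∪ Y').card = N + M + 2 := by
    rw [Finset.card_union_of_disjoint hdisj, hZ, hYc]; ring
  have hne : rayPoly a p t ≠ 0 := by
    intro h0
    have := rayPoly_coeff_top a p t
    rw [h0, coeff_zero] at this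
    exact (Real.sin_pos_of_pos_of_lt_pi ht.1 ht.2).ne this
  by_cases hbig : p + 1 ≤ N + M + 2
  · obtain ⟨W, hW, hWc⟩ := Finset.exists_subset_card_eq (hbig.trans hcard.ge)
    exact ⟨W, hWc, fun s hs => (hroot s (hW hs)).2⟩
  · have hpe : p = N + M + 2 := by omega
    refine ⟨insert 0 (Z ∪ Y'), ?_, fun s hs => ?_⟩
    · rw [Finset.card_insert_of_notMem, hcard, hpe]
      intro h0
      exact (hroot 0 h0).1 rfl
    · rcases Finset.mem_insert.1 hs with rfl | hs
      · rw [rayPoly_eval_zero]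
        have h1 : (p : ℝ) * t = ((N + 1 : ℕ) : ℝ) * Real.pi := by
          push_cast
          refine le_antisymm hN2 ?_
          have : (p : ℝ) = N + M + 2 := by exact_mod_cast hpe
          have h3 : (p : ℝ) * Real.pi = (N + M + 2) * Real.pi := by rw [this]
          linarith
        rw [h1, Real.sin_nat_mul_pi]; simp
      · exact (hroot s hs).2

/-- Two points of the same modulus with the same value of `r` are equal or conjugate. -/
theorem NegCase.eq_or_eq_conj (hp : 2 ≤ p) (h : NegCase p x)
    (hq : q a p = ∏ k ∈ Finset.Icc 1 (p + 1), (X - C (x k))) {w w' : ℂ} (hw : w ≠ 0)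
    (hn : ‖w‖ = ‖w'‖) (hr : rC a p w = rC a p w') :
    w' = w ∨ w' = (starRingEnd ℂ) w := by
  by_cases hww : w' = w
  · exact Or.inl hww
  right
  have hpi := Real.pi_pos
  have hw' : w' ≠ 0 := by rw [← norm_pos_iff, ← hn]; exact norm_pos_iff.2 hw
  -- write `w = y e^{it}`, `w' = y e^{-it}`
  obtain ⟨t, ht, y, hy, hy'⟩ : ∃ t ∈ Set.Ioo 0 Real.pi, ∃ y : ℂ,
      w = y * Complex.exp (t * Complex.I) ∧ w' = y * Complex.exp (-(t * Complex.I)) := by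
    have h1 : ‖w / w'‖ = 1 := by rw [norm_div, hn, div_self (norm_ne_zero_iff.2 hw')]
    have h2 := Complex.norm_mul_exp_arg_mul_I (w / w')
    rw [h1, Complex.ofReal_one, one_mul] at h2
    have hsolve : ∀ t : ℝ, Complex.exp ((2 * t : ℝ) * Complex.I) = w / w' →
        w = (w * Complex.exp (-(t * Complex.I))) * Complex.exp (t * Complex.I) ∧
        w' = (w * Complex.exp (-(t * Complex.I))) * Complex.exp (-(t * Complex.I)) := by
      intro t h3
      constructor
      · rw [mul_assoc, ← Complex.exp_add]; simp
      · rw [mul_assoc, ← Complex.exp_add]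
        have h4 : Complex.exp (-(t * Complex.I) + -(t * Complex.I)) =
            (Complex.exp ((2 * t : ℝ) * Complex.I))⁻¹ := by
          rw [← Complex.exp_neg]; congr 1; push_cast; ring
        rw [h4, h3, inv_div, mul_div_cancel₀ _ hw]
    rcases lt_trichotomy (w / w').arg 0 with h3 | h3 | h3
    -- Half of the argument is determined modulo `π` only; adding `π` brings it into `(0, π)`.
    · refine ⟨(w / w').arg / 2 + Real.pi, ⟨?_, by linarith⟩, _, hsolve _ ?_⟩
      · linarith [Complex.neg_pi_lt_arg (w / w')]
      · rw [show ((2 * ((w / w').arg / 2 + Real.pi) : ℝ) : ℂ) * Complex.I =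
          (w / w').arg * Complex.I + 2 * Real.pi * Complex.I by push_cast; ring]
        rw [Complex.exp_add, Complex.exp_two_pi_mul_I, mul_one, h2]
    · exfalso
      rw [h3] at h2
      simp only [Complex.ofReal_zero, zero_mul, Complex.exp_zero] at h2
      exact hww ((div_eq_one_iff_eq hw').1 h2.symm).symm
    · refine ⟨(w / w').arg / 2, ⟨by linarith, by linarith [Complex.arg_le_pi (w / w')]⟩, _,
        hsolve _ ?_⟩
      rw [mul_div_cancel₀ _ two_ne_zero, h2]
  have hy0 : y ≠ 0 := by rintro rfl; rw [zero_mul] at hy; exact hw hy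
  -- `y` is a root of the real-rooted polynomial
  have hroot : ((rayPoly a p t).map (algebraMap ℝ ℂ)).IsRoot y := by
    have hI : (2 * Complex.I : ℂ) ≠ 0 := by simp
    have hsin : ∀ k : ℕ, Complex.exp (t * Complex.I) ^ k - Complex.exp (-(t * Complex.I)) ^ k =
        2 * Complex.I * (Real.sin (k * t) : ℝ) := by
      intro k
      rw [← Complex.exp_nat_mul, ← Complex.exp_nat_mul, Complex.ofReal_sin, Complex.sin]
      push_cast
      rw [show -((k : ℂ) * t) * Complex.I = k * -(t * Complex.I) by ring,
        show ((k : ℂ) * t) * Complex.I = k * (t * Complex.I) by ring]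
      linear_combination (Complex.exp (k * (t * Complex.I)) - Complex.exp (k * -(t * Complex.I))) *
        Complex.I_sq
    have hinv : Complex.exp (t * Complex.I) * Complex.exp (-(t * Complex.I)) = 1 := by
      rw [← Complex.exp_add]; simp
    set E := Complex.exp (t * Complex.I) with hE
    set E' := Complex.exp (-(t * Complex.I)) with hE'
    have hE0 : E ≠ 0 := Complex.exp_ne_zero _
    have hE'0 : E' ≠ 0 := Complex.exp_ne_zero _
    have hterm : ∀ k : ℕ, (a k : ℂ) / w ^ k - (a k : ℂ) / w' ^ k =
        -(2 * Complex.I) * ((a k * Real.sin (k * t) : ℝ) / y ^ k) := by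
      intro k
      have h5 : E ^ k * E' ^ k = 1 := by rw [← mul_pow, hinv, one_pow]
      have h6 := hsin k
      have : (a k : ℂ) / w ^ k - (a k : ℂ) / w' ^ k = (a k : ℂ) / y ^ k * (E' ^ k - E ^ k) := by
        rw [hy, hy', mul_pow, mul_pow]
        have h7 : E' ^ k = (E ^ k)⁻¹ := (eq_inv_of_mul_eq_one_right h5)
        rw [h7]
        have := pow_ne_zero k hE0
        have := pow_ne_zero k hy0
        field_simp
      rw [this]
      push_cast at h6 ⊢
      linear_combination (-(a k : ℂ) / y ^ k) * h6
    have hkey : y * Real.sin t - ∑ k ∈ Finset.range (p + 1),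
        (a k * Real.sin (k * t) : ℝ) / y ^ k = 0 := by
      have h5 : w - w' + ∑ k ∈ Finset.range (p + 1), ((a k : ℂ) / w ^ k - (a k : ℂ) / w' ^ k) = 0 := by
        rw [Finset.sum_sub_distrib]
        simp only [rC] at hr
        linear_combination hr
      simp only [hterm] at h5
      rw [← Finset.mul_sum, show w - w' = 2 * Complex.I * (y * Real.sin t) by
        have := hsin 1
        simp only [pow_one, Nat.cast_one, one_mul] at this
        rw [hy, hy', ← mul_sub, this]; ring] at h5
      have h6 : (2 * Complex.I) * (y * Real.sin t - ∑ k ∈ Finset.range (p + 1),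
        ((a k * Real.sin (k * t) : ℝ) : ℂ) / y ^ k) = 0 := by linear_combination h5
      exact (mul_eq_zero.1 h6).resolve_left hI
    rw [IsRoot.def]
    simp only [rayPoly, Polynomial.map_sub, Polynomial.map_pow, map_X, Polynomial.map_sum,
      Polynomial.map_mul, map_C, eval_sub, eval_pow, eval_X, eval_finsetSum, eval_mul, eval_C,
      Complex.coe_algebraMap]
    have : (Real.sin t : ℂ) * y ^ (p + 1) - ∑ k ∈ Finset.range (p + 1),
        ((a k * Real.sin (k * t) : ℝ) : ℂ) * y ^ (p - k) = y ^ p * (y * Real.sin t -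
        ∑ k ∈ Finset.range (p + 1), ((a k * Real.sin (k * t) : ℝ) : ℂ) / y ^ k) := by
      rw [mul_sub, Finset.mul_sum]
      congr 1
      · ring
      · refine Finset.sum_congr rfl fun k hk => ?_
        rw [Finset.mem_range] at hk
        obtain ⟨d, hd⟩ := Nat.exists_eq_add_of_le (show k ≤ p by omega)
        rw [hd, Nat.add_sub_cancel_left, pow_add]
        have := pow_ne_zero k hy0
        field_simp
    rw [this, hkey, mul_zero]
  obtain ⟨Z, hZ, hZ'⟩ := h.exists_rayPoly_zeros hp hq ht
  have hne : rayPoly a p t ≠ 0 := by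
    intro h0
    have := rayPoly_coeff_top a p t
    rw [h0, coeff_zero] at this
    exact (Real.sin_pos_of_pos_of_lt_pi ht.1 ht.2).ne this
  -- A nonreal `y` would be a zero number `p + 2` of a polynomial of degree at most `p + 1`.
  have hreal : ∃ s : ℝ, (s : ℂ) = y := by
    classical
    by_contra hcon
    push Not at hcon
    set P := (rayPoly a p t).map (algebraMap ℝ ℂ) with hP
    have hP0 : P ≠ 0 := (Polynomial.map_ne_zero_iff (algebraMap ℝ ℂ).injective).2 hne
    have hsub : insert y (Z.image fun s : ℝ => (s : ℂ)) ⊆ P.roots.toFinset := by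
      intro v hv
      rw [Multiset.mem_toFinset, mem_roots hP0]
      rcases Finset.mem_insert.1 hv with rfl | hv
      · exact hroot
      · obtain ⟨s, hs, rfl⟩ := Finset.mem_image.1 hv
        rw [IsRoot.def, hP, eval_map_algebraMap]
        have := aeval_algebraMap_apply ℂ s (rayPoly a p t)
        rw [Complex.coe_algebraMap] at this
        rw [this, coe_aeval_eq_eval, hZ' s hs]; simp
    have h1 := Finset.card_le_card hsub
    rw [Finset.card_insert_of_notMem (by
      intro hh
      obtain ⟨s, -, hs⟩ := Finset.mem_image.1 hh
      exact hcon s hs), Finset.card_image_of_injective _ Complex.ofReal_injective, hZ] at h1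
    have h2 := (Multiset.toFinset_card_le P.roots).trans (card_roots' P)
    have h3 : P.natDegree ≤ p + 1 := natDegree_map_le.trans (rayPoly_natDegree_le a p t)
    omega
  obtain ⟨s, rfl⟩ := hreal
  rw [hy, hy', map_mul, Complex.conj_ofReal, ← Complex.exp_conj, map_mul, Complex.conj_ofReal,
    Complex.conj_I, mul_neg]

/-! ### Labellings of the roots at a single point -/

section Labelling

variable {a : ℕ → ℝ} {p : ℕ}

theorem eval_symbolPoly (a : ℕ → ℝ) (p : ℕ) (l y : ℂ) :
    (symbolPoly a p l).eval y =
      1 - l * y + ∑ k ∈ Finset.range (p + 1), (a k : ℂ) * y ^ (k + 1) := by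
  simp [symbolPoly, eval_finsetSum]

theorem eval_symbolPoly_eq_mul (a : ℕ → ℝ) (p : ℕ) (l : ℂ) {y : ℂ} (hy : y ≠ 0) :
    (symbolPoly a p l).eval y = y * (rC a p y⁻¹ - l) := by
  rw [eval_symbolPoly, rC, mul_sub, mul_add, mul_inv_cancel₀ hy, Finset.mul_sum]
  have : ∑ k ∈ Finset.range (p + 1), y * ((a k : ℂ) / y⁻¹ ^ k) =
      ∑ k ∈ Finset.range (p + 1), (a k : ℂ) * y ^ (k + 1) := by
    refine Finset.sum_congr rfl fun k _ => ?_
    rw [inv_pow, div_inv_eq_mul, pow_succ]; ring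
  rw [this]; ring

theorem natDegree_symbolPoly (hp : 1 ≤ p) (ha : a p ≠ 0) (l : ℂ) :
    (symbolPoly a p l).natDegree = p + 1 ∧ (symbolPoly a p l).coeff (p + 1) = a p := by
  have h1 : ∀ k, p + 1 < k → (symbolPoly a p l).coeff k = 0 := by
    intro k hk
    simp only [symbolPoly, coeff_add, coeff_sub, finsetSum_coeff, coeff_one, coeff_C_mul, coeff_X,
      coeff_X_pow]
    rw [if_neg (by omega), if_neg (by omega), Finset.sum_eq_zero]
    · simp
    · intro i hi
      rw [Finset.mem_range] at hi
      rw [if_neg (by omega), mul_zero]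
  have h2 : (symbolPoly a p l).coeff (p + 1) = a p := by
    simp only [symbolPoly, coeff_add, coeff_sub, finsetSum_coeff, coeff_one, coeff_C_mul, coeff_X,
      coeff_X_pow]
    rw [if_neg (by omega), if_neg (by omega), Finset.sum_eq_single p]
    · simp
    · intro i _ hi
      rw [if_neg (by omega), mul_zero]
    · simp
  refine ⟨le_antisymm (natDegree_le_iff_coeff_eq_zero.2 h1) (le_natDegree_of_ne_zero ?_), h2⟩
  rw [h2]; exact_mod_cast ha

/-- `ζ 0, …, ζ p` are the solutions of `a(z) = l`, in the order of their absolute values. -/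
structure IsLab (a : ℕ → ℝ) (p : ℕ) (l : ℂ) (ζ : ℕ → ℂ) : Prop where
  roots_eq : (symbolPoly a p l).roots = (Multiset.range (p + 1)).map ζ
  norm_le : ∀ i < p, ‖ζ i‖ ≤ ‖ζ (i + 1)‖

theorem IsRootLabelling.isLab {z : ℕ → ℂ → ℂ} (hz : IsRootLabelling a p z) (l : ℂ) :
    IsLab a p l fun i => z i l := ⟨hz.roots_eq l, hz.norm_le l⟩

/-- The factorization, unlike the equality of multisets, passes directly to limits and to
conjugates. -/
theorem isLab_iff (hp : 1 ≤ p) (ha : a p ≠ 0) {l : ℂ} {ζ : ℕ → ℂ} :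
    IsLab a p l ζ ↔ (∀ y, (symbolPoly a p l).eval y = a p * ∏ i ∈ Finset.range (p + 1), (y - ζ i)) ∧
      ∀ i < p, ‖ζ i‖ ≤ ‖ζ (i + 1)‖ := by
  have ha' : (a p : ℂ) ≠ 0 := by exact_mod_cast ha
  obtain ⟨h1, h2⟩ := natDegree_symbolPoly hp ha l
  constructor
  · rintro ⟨h3, h4⟩
    refine ⟨fun y => ?_, h4⟩
    have h5 := (IsAlgClosed.splits (symbolPoly a p l)).eq_prod_roots
    rw [leadingCoeff, h1, h2, h3] at h5
    rw [h5, eval_mul, eval_C, Multiset.map_map, eval_multiset_prod, Multiset.map_map]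
    simp only [Function.comp_def, eval_sub, eval_X, eval_C]
    rfl
  · rintro ⟨h3, h4⟩
    refine ⟨?_, h4⟩
    have h5 : symbolPoly a p l =
        C (a p : ℂ) * (((Multiset.range (p + 1)).map ζ).map fun y => X - C y).prod := by
      refine Polynomial.funext fun y => ?_
      rw [h3, eval_mul, eval_C, Multiset.map_map, eval_multiset_prod, Multiset.map_map]
      simp only [Function.comp_def, eval_sub, eval_X, eval_C]
      rfl
    rw [h5, roots_C_mul _ ha', roots_multiset_prod_X_sub_C]

theorem IsLab.eval_eq (hp : 1 ≤ p) (ha : a p ≠ 0) {l : ℂ} {ζ : ℕ → ℂ} (h : IsLab a p l ζ) (y : ℂ) :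
    (symbolPoly a p l).eval y = a p * ∏ i ∈ Finset.range (p + 1), (y - ζ i) :=
  ((isLab_iff hp ha).1 h).1 y

theorem IsLab.eq_prod (hp : 1 ≤ p) (ha : a p ≠ 0) {l : ℂ} {ζ : ℕ → ℂ} (h : IsLab a p l ζ) :
    symbolPoly a p l = C (a p : ℂ) * ∏ i ∈ Finset.range (p + 1), (X - C (ζ i)) := by
  refine Polynomial.funext fun y => ?_
  rw [h.eval_eq hp ha, eval_mul, eval_C, eval_prod]; simp

theorem IsLab.eval_zero (hp : 1 ≤ p) (ha : a p ≠ 0) {l : ℂ} {ζ : ℕ → ℂ} (h : IsLab a p l ζ) {i : ℕ}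
    (hi : i ≤ p) : (symbolPoly a p l).eval (ζ i) = 0 := by
  rw [h.eval_eq hp ha, Finset.prod_eq_zero (Finset.mem_range.2 (Nat.lt_succ_of_le hi)) (sub_self _),
    mul_zero]

theorem IsLab.exists_index (hp : 1 ≤ p) (ha : a p ≠ 0) {l : ℂ} {ζ : ℕ → ℂ} (h : IsLab a p l ζ)
    {y : ℂ} (hy : (symbolPoly a p l).eval y = 0) : ∃ i ≤ p, ζ i = y := by
  have ha' : (a p : ℂ) ≠ 0 := by exact_mod_cast ha
  rw [h.eval_eq hp ha, mul_eq_zero, or_iff_right ha', Finset.prod_eq_zero_iff] at hy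
  obtain ⟨i, hi, h1⟩ := hy
  exact ⟨i, Nat.lt_succ_iff.1 (Finset.mem_range.1 hi), (sub_eq_zero.1 h1).symm⟩

theorem ne_zero_of_eval_symbolPoly {l y : ℂ} (hy : (symbolPoly a p l).eval y = 0) : y ≠ 0 := by
  rintro rfl
  rw [eval_symbolPoly, Finset.sum_eq_zero (fun k _ => by simp)] at hy
  simp at hy

theorem IsLab.ne_zero (hp : 1 ≤ p) (ha : a p ≠ 0) {l : ℂ} {ζ : ℕ → ℂ} (h : IsLab a p l ζ) {i : ℕ}
    (hi : i ≤ p) : ζ i ≠ 0 := ne_zero_of_eval_symbolPoly (h.eval_zero hp ha hi)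

theorem eval_symbolPoly_eq_zero_iff {l y : ℂ} (hy : y ≠ 0) :
    (symbolPoly a p l).eval y = 0 ↔ rC a p y⁻¹ = l := by
  rw [eval_symbolPoly_eq_mul a p l hy, mul_eq_zero, or_iff_right hy, sub_eq_zero]

theorem IsLab.rC_inv (hp : 1 ≤ p) (ha : a p ≠ 0) {l : ℂ} {ζ : ℕ → ℂ} (h : IsLab a p l ζ) {i : ℕ}
    (hi : i ≤ p) : rC a p (ζ i)⁻¹ = l :=
  (eval_symbolPoly_eq_zero_iff (h.ne_zero hp ha hi)).1 (h.eval_zero hp ha hi)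

theorem IsLab.norm_mono {l : ℂ} {ζ : ℕ → ℂ} (h : IsLab a p l ζ) {i j : ℕ} (hij : i ≤ j)
    (hj : j ≤ p) : ‖ζ i‖ ≤ ‖ζ j‖ := by
  induction j, hij using Nat.le_induction with
  | base => exact le_rfl
  | succ k hk ih => exact (ih (by omega)).trans (h.norm_le k (by omega))

/-- Two sorted lists with the same entries coincide: ties affect the roots but not their moduli. -/
theorem IsLab.norm_eq {l : ℂ} {ζ ζ' : ℕ → ℂ} (h : IsLab a p l ζ) (h' : IsLab a p l ζ') {i : ℕ}
    (hi : i ≤ p) : ‖ζ i‖ = ‖ζ' i‖ := by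
  have hsort : ∀ {ζ : ℕ → ℂ}, IsLab a p l ζ →
      List.Pairwise (fun u v : ℝ => u ≤ v) ((List.range (p + 1)).map fun i => ‖ζ i‖) := by
    intro ζ h
    rw [List.pairwise_iff_getElem]
    intro i j hi hj hij
    simp only [List.length_map, List.length_range] at hi hj
    simp only [List.getElem_map, List.getElem_range]
    exact h.norm_mono hij.le (by omega)
  have hperm : (((List.range (p + 1)).map fun i => ‖ζ i‖ : List ℝ) : Multiset ℝ) =
      ((List.range (p + 1)).map fun i => ‖ζ' i‖ : List ℝ) := by
    have := congrArg (Multiset.map fun y : ℂ => ‖y‖) (h.roots_eq.symm.trans h'.roots_eq)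
    rw [Multiset.map_map, Multiset.map_map] at this
    exact this
  have := List.Perm.eq_of_pairwise (fun u v _ _ => le_antisymm) (hsort h) (hsort h')
    (Multiset.coe_eq_coe.1 hperm)
  have h2 : ((List.range (p + 1)).map fun i => ‖ζ i‖)[i]? =
    ((List.range (p + 1)).map fun i => ‖ζ' i‖)[i]? := by rw [this]
  simpa [List.getElem?_map, List.getElem?_range (Nat.lt_succ_of_le hi)] using h2

/-- A gap in the moduli after index `j` makes the multiset of the first `j + 1` roots independent of
how ties are broken. -/
theorem IsLab.filter_norm_lt {l : ℂ} {ζ : ℕ → ℂ} (h : IsLab a p l ζ) {j : ℕ} (hj : j < p)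
    (hlt : ‖ζ j‖ < ‖ζ (j + 1)‖) :
    (Multiset.range (j + 1)).map ζ =
      (symbolPoly a p l).roots.filter fun y => ‖y‖ < ‖ζ (j + 1)‖ := by
  classical
  rw [h.roots_eq, Multiset.filter_map]
  congr 1
  have : (Finset.range (j + 1)).val = ((Finset.range (p + 1)).filter
      ((fun y => ‖y‖ < ‖ζ (j + 1)‖) ∘ ζ)).val := by
    congr 1
    ext i
    simp only [Finset.mem_range, Finset.mem_filter, Function.comp]
    constructor
    · intro hi
      exact ⟨by omega, lt_of_le_of_lt (h.norm_mono (by omega) (by omega)) hlt⟩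
    · rintro ⟨h1, h2⟩
      by_contra h3
      exact absurd (h.norm_mono (show j + 1 ≤ i by omega) (by omega)) (not_le.2 h2)
  rw [Finset.filter_val] at this
  rw [← Finset.range_val, this, Finset.range_val]

theorem IsLab.map_eq {l : ℂ} {ζ ζ' : ℕ → ℂ} (h : IsLab a p l ζ) (h' : IsLab a p l ζ') {j : ℕ}
    (hj : j < p) (hlt : ‖ζ j‖ < ‖ζ (j + 1)‖) :
    (Multiset.range (j + 1)).map ζ = (Multiset.range (j + 1)).map ζ' := by
  have e1 := h.norm_eq h' (show j ≤ p by omega)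
  have e2 := h.norm_eq h' (show j + 1 ≤ p by omega)
  rw [h.filter_norm_lt hj hlt, h'.filter_norm_lt hj (by rwa [← e1, ← e2]), e2]

theorem eval_symbolPoly_conj (a : ℕ → ℝ) (p : ℕ) (l y : ℂ) :
    (symbolPoly a p ((starRingEnd ℂ) l)).eval ((starRingEnd ℂ) y) =
      (starRingEnd ℂ) ((symbolPoly a p l).eval y) := by
  simp [eval_symbolPoly, map_sum]

theorem IsLab.conj (hp : 1 ≤ p) (ha : a p ≠ 0) {l : ℂ} {ζ : ℕ → ℂ} (h : IsLab a p l ζ) :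
    IsLab a p ((starRingEnd ℂ) l) fun i => (starRingEnd ℂ) (ζ i) := by
  rw [isLab_iff hp ha]
  refine ⟨fun y => ?_, fun i hi => by simpa using h.norm_le i hi⟩
  have h1 := eval_symbolPoly_conj a p l ((starRingEnd ℂ) y)
  rw [Complex.conj_conj] at h1
  rw [h1, h.eval_eq hp ha, map_mul, Complex.conj_ofReal, map_prod]
  simp

theorem IsLab.prod_norm (hp : 1 ≤ p) (ha : a p ≠ 0) {l : ℂ} {ζ : ℕ → ℂ} (h : IsLab a p l ζ) :
    |a p| * ∏ i ∈ Finset.range (p + 1), ‖ζ i‖ = 1 := by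
  have h1 := h.eval_eq hp ha 0
  rw [eval_symbolPoly, Finset.sum_eq_zero (fun k _ => by simp)] at h1
  have h2 := congrArg norm h1
  simp only [mul_zero, sub_zero, add_zero, norm_one, zero_sub, norm_mul, Complex.norm_real,
    Real.norm_eq_abs, norm_prod, norm_neg] at h2
  exact h2.symm

/-! ### Growth of the roots -/

/-- For large `y` the term `a_p y^{p+1}` can only be balanced by `l y`. -/
theorem exists_norm_pow_le (ha : a p ≠ 0) :
    ∃ K : ℝ, 0 < K ∧ ∀ l y : ℂ, (symbolPoly a p l).eval y = 0 → ‖y‖ ^ p ≤ K * (1 + ‖l‖) := by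
  have hap : 0 < |a p| := abs_pos.2 ha
  set B := ∑ k ∈ Finset.range p, |a k| with hB
  have hB0 : 0 ≤ B := Finset.sum_nonneg fun k _ => abs_nonneg _
  set m := max 1 (2 * B / |a p|) with hm
  refine ⟨m ^ p + 2 / |a p|, by positivity, fun l y hy => ?_⟩
  have hm1 : 1 ≤ m := le_max_left _ _
  by_cases hym : ‖y‖ ≤ m
  · calc ‖y‖ ^ p ≤ m ^ p := pow_le_pow_left₀ (norm_nonneg _) hym p
      _ ≤ m ^ p + 2 / |a p| := by linarith [show 0 < 2 / |a p| by positivity]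
      _ ≤ _ := le_mul_of_one_le_right (by positivity) (by linarith [norm_nonneg l])
  · push Not at hym
    have hy0 := ne_zero_of_eval_symbolPoly hy
    have hy1 : 1 < ‖y‖ := hm1.trans_lt hym
    rw [eval_symbolPoly, Finset.sum_range_succ] at hy
    have e1 : (a p : ℂ) * y ^ (p + 1) =
        l * y - 1 - ∑ k ∈ Finset.range p, (a k : ℂ) * y ^ (k + 1) := by linear_combination hy
    have e2 : |a p| * ‖y‖ ^ (p + 1) ≤ ‖l‖ * ‖y‖ + 1 + B * ‖y‖ ^ p := by
      have h1 := congrArg norm e1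
      rw [norm_mul, norm_pow, Complex.norm_real, Real.norm_eq_abs] at h1
      rw [h1]
      refine (norm_sub_le _ _).trans (add_le_add ((norm_sub_le _ _).trans ?_) ?_)
      · simp
      · rw [hB, Finset.sum_mul]
        refine norm_sum_le_of_le _ fun k hk => ?_
        rw [norm_mul, norm_pow, Complex.norm_real, Real.norm_eq_abs]
        rw [Finset.mem_range] at hk
        exact mul_le_mul_of_nonneg_left (pow_le_pow_right₀ hy1.le (by omega)) (abs_nonneg _)
    have e3 : 2 * B ≤ |a p| * ‖y‖ := by
      have h1 := (le_max_right 1 (2 * B / |a p|)).trans hym.le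
      rw [div_le_iff₀ hap] at h1; linarith
    have e4 : |a p| * ‖y‖ ^ p * ‖y‖ ≤ 2 * (1 + ‖l‖) * ‖y‖ := by
      have h1 : B * ‖y‖ ^ p ≤ |a p| * ‖y‖ / 2 * ‖y‖ ^ p :=
        mul_le_mul_of_nonneg_right (by linarith) (by positivity)
      have h2 : |a p| * ‖y‖ ^ (p + 1) = |a p| * ‖y‖ ^ p * ‖y‖ := by rw [pow_succ]; ring
      rw [h2] at e2
      nlinarith
    have e5 := le_of_mul_le_mul_right e4 (by linarith)
    calc ‖y‖ ^ p ≤ 2 / |a p| * (1 + ‖l‖) := by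
          rw [div_mul_eq_mul_div, le_div_iff₀ hap]; linarith
      _ ≤ _ := mul_le_mul_of_nonneg_right (by linarith [show 0 < m ^ p by positivity])
          (by positivity)

/-- The product of all roots has modulus `1 / |a_p|`, which bounds the smallest one; then `l ζ_0` is
a bounded polynomial expression in `ζ_0`. -/
theorem exists_norm_first_le (ha : a p ≠ 0) (hp : 1 ≤ p) :
    ∃ K : ℝ, 0 < K ∧ ∀ l ζ, IsLab a p l ζ → (1 + ‖l‖) * ‖ζ 0‖ ≤ K := by
  have hap : 0 < |a p| := abs_pos.2 ha
  set m := 1 + 1 / |a p| with hm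
  have hm0 : 0 < m := by positivity
  refine ⟨m + 1 + ∑ k ∈ Finset.range (p + 1), |a k| * m ^ (k + 1), by positivity, fun l ζ h => ?_⟩
  have h0 : ‖ζ 0‖ ≤ m := by
    by_contra hcon
    push Not at hcon
    have h1 := h.prod_norm hp ha
    have h2 : m ^ (p + 1) ≤ ∏ i ∈ Finset.range (p + 1), ‖ζ i‖ := by
      have := Finset.prod_le_prod (s := Finset.range (p + 1)) (f := fun _ => m) (g := fun i => ‖ζ i‖)
        (fun _ _ => hm0.le) fun i hi => hcon.le.trans (h.norm_mono (Nat.zero_le i) (by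
          rw [Finset.mem_range] at hi; omega))
      simpa using this
    have h3 : m ≤ m ^ (p + 1) := le_self_pow₀ (by rw [hm]; linarith [show 0 < 1 / |a p| by positivity])
      (by omega)
    have h4 : |a p| * m ≤ 1 := by rw [← h1]; exact mul_le_mul_of_nonneg_left (h3.trans h2) hap.le
    rw [hm, mul_add, mul_one_div_cancel hap.ne'] at h4
    linarith
  have h1 := h.eval_zero hp ha (Nat.zero_le p)
  rw [eval_symbolPoly] at h1
  have e1 : l * ζ 0 = 1 + ∑ k ∈ Finset.range (p + 1), (a k : ℂ) * ζ 0 ^ (k + 1) := by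
    linear_combination -h1
  have e2 : ‖l‖ * ‖ζ 0‖ ≤ 1 + ∑ k ∈ Finset.range (p + 1), |a k| * m ^ (k + 1) := by
    rw [← norm_mul, e1]
    refine (norm_add_le _ _).trans (add_le_add (by simp) (norm_sum_le_of_le _ fun k _ => ?_))
    rw [norm_mul, norm_pow, Complex.norm_real, Real.norm_eq_abs]
    exact mul_le_mul_of_nonneg_left (pow_le_pow_left₀ (norm_nonneg _) h0 _) (abs_nonneg _)
  linarith

/-- Put `L = 1 + |l|`. The product of the moduli is fixed, the first one is `O(1/L)` and the `p - 1`
others are `O(L^{1/p})`, so the remaining one is at least of order `L^{1/p}`. -/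
theorem exists_le_norm_pow (ha : a p ≠ 0) (hp : 1 ≤ p) :
    ∃ K : ℝ, 0 < K ∧ ∀ l ζ, IsLab a p l ζ → ∀ i, 1 ≤ i → i ≤ p → 1 + ‖l‖ ≤ K * ‖ζ i‖ ^ p := by
  obtain ⟨K, hK, hK'⟩ := exists_norm_pow_le ha
  obtain ⟨M, hM, hM'⟩ := exists_norm_first_le (a := a) ha hp
  have hap : 0 < |a p| := abs_pos.2 ha
  refine ⟨(|a p| * M) ^ p * K ^ (p - 1), by positivity, fun l ζ h i hi1 hi2 => ?_⟩
  set L := 1 + ‖l‖ with hL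
  have hL0 : 0 < L := by positivity
  have h1 := h.prod_norm hp ha
  rw [← Finset.mul_prod_erase (Finset.range (p + 1)) _ (Finset.mem_range.2 (Nat.succ_pos p)),
    ← Finset.mul_prod_erase ((Finset.range (p + 1)).erase 0) _ (Finset.mem_erase.2
      ⟨by omega, Finset.mem_range.2 (Nat.lt_succ_of_le hi2)⟩)] at h1
  set T := ((Finset.range (p + 1)).erase 0).erase i with hT
  have hcard : T.card = p - 1 := by
    rw [hT, Finset.card_erase_of_mem (Finset.mem_erase.2
      ⟨by omega, Finset.mem_range.2 (Nat.lt_succ_of_le hi2)⟩),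
      Finset.card_erase_of_mem (Finset.mem_range.2 (Nat.succ_pos p))]
    simp
  have h2 : (∏ j ∈ T, ‖ζ j‖) ^ p ≤ (K * L) ^ (p - 1) := by
    rw [← Finset.prod_pow, ← hcard]
    refine (Finset.prod_le_prod (fun _ _ => by positivity) fun j hj => ?_).trans
      (by rw [Finset.prod_const])
    have hj' : j ≤ p := by
      rw [hT] at hj
      have := (Finset.mem_erase.1 (Finset.mem_erase.1 hj).2).2
      rw [Finset.mem_range] at this; omega
    exact hK' l (ζ j) (h.eval_zero hp ha hj')
  have h3 : L ^ p ≤ (|a p| * M) ^ p * (‖ζ i‖ ^ p * (K * L) ^ (p - 1)) := by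
    have h4 : L = |a p| * (L * ‖ζ 0‖) * (‖ζ i‖ * ∏ j ∈ T, ‖ζ j‖) := by
      linear_combination (-L) * h1
    calc L ^ p = (|a p| * (L * ‖ζ 0‖)) ^ p * (‖ζ i‖ ^ p * (∏ j ∈ T, ‖ζ j‖) ^ p) := by
          rw [← mul_pow, ← mul_pow, ← h4]
      _ ≤ _ := by
          refine mul_le_mul (pow_le_pow_left₀ (by positivity)
            (mul_le_mul_of_nonneg_left (hM' l ζ h) hap.le) p)
            (mul_le_mul_of_nonneg_left h2 (by positivity)) (by positivity) (by positivity)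
  have h5 : L ^ p = L * L ^ (p - 1) := by rw [← pow_succ', Nat.sub_add_cancel hp]
  rw [h5, mul_pow K L] at h3
  have h6 : 0 < L ^ (p - 1) := by positivity
  refine le_of_mul_le_mul_right ?_ h6
  linear_combination h3

/-! ### Continuity of the roots -/

/-- The roots stay bounded near `l`, so along an ultrafilter all of them converge, and the
factorization and the ordering survive. The limits form some labelling at `l`, possibly another one
than `z`. -/
theorem exists_isLab_of_ultrafilter (hp : 1 ≤ p) (ha : a p ≠ 0) {z : ℕ → ℂ → ℂ}
    (hz : IsRootLabelling a p z) {l : ℂ} (U : Ultrafilter ℂ) (hU : (U : Filter ℂ) ≤ 𝓝 l) :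
    ∃ ζ, IsLab a p l ζ ∧ ∀ i ≤ p, Tendsto (z i) U (𝓝 (ζ i)) := by
  obtain ⟨K, hK, hK'⟩ := exists_norm_pow_le ha
  have hbd : ∀ᶠ l' in (U : Filter ℂ), ‖l'‖ < ‖l‖ + 1 :=
    hU (continuous_norm.continuousAt.eventually (gt_mem_nhds (by linarith)))
  have hex : ∀ i, ∃ ζ, i ≤ p → Tendsto (z i) U (𝓝 ζ) := by
    intro i
    by_cases hi : i ≤ p
    · have h1 : ((U.map (z i) : Ultrafilter ℂ) : Filter ℂ) ≤
          𝓟 (Metric.closedBall 0 (1 + K * (1 + (‖l‖ + 1)))) := by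
        rw [le_principal_iff]
        change ∀ᶠ l' in (U : Filter ℂ), z i l' ∈ _
        filter_upwards [hbd] with l' hl'
        rw [mem_closedBall_zero_iff]
        have h2 := hK' l' (z i l') ((hz.isLab l').eval_zero hp ha hi)
        have h3 : K * (1 + ‖l'‖) ≤ K * (1 + (‖l‖ + 1)) :=
          mul_le_mul_of_nonneg_left (by linarith) hK.le
        by_contra hcon
        push Not at hcon
        have h4 : 0 ≤ K * (1 + (‖l‖ + 1)) := by positivity
        have h5 : ‖z i l'‖ ≤ ‖z i l'‖ ^ p := le_self_pow₀ (by linarith) (by omega)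
        linarith
      obtain ⟨ζ, -, hζ⟩ := (isCompact_closedBall 0 _).ultrafilter_le_nhds _ h1
      exact ⟨ζ, fun _ => hζ⟩
    · exact ⟨0, fun h => absurd h hi⟩
  choose ζ hζ using hex
  refine ⟨ζ, ?_, hζ⟩
  rw [isLab_iff hp ha]
  constructor
  · intro y
    have h1 : Tendsto (fun l' => (symbolPoly a p l').eval y) U (𝓝 ((symbolPoly a p l).eval y)) := by
      simp only [eval_symbolPoly]
      have h0 : Tendsto (fun l' : ℂ => l') U (𝓝 l) := hU
      exact (tendsto_const_nhds.sub (h0.mul_const y)).add_const _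
    have h2 : Tendsto (fun l' => (a p : ℂ) * ∏ i ∈ Finset.range (p + 1), (y - z i l')) U
        (𝓝 (a p * ∏ i ∈ Finset.range (p + 1), (y - ζ i))) := by
      refine (tendsto_finsetProd _ fun i hi => ?_).const_mul _
      exact (hζ i (by rw [Finset.mem_range] at hi; omega)).const_sub y
    refine tendsto_nhds_unique (h1.congr fun l' => ?_) h2
    exact (hz.isLab l').eval_eq hp ha y
  · intro i hi
    exact le_of_tendsto_of_tendsto' (hζ i hi.le).norm (hζ (i + 1) hi).norm
      fun l' => hz.norm_le l' i hi

/-- The limiting labelling may differ from `z`, but its moduli do not. -/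
theorem continuous_norm_root (hp : 1 ≤ p) (ha : a p ≠ 0) {z : ℕ → ℂ → ℂ}
    (hz : IsRootLabelling a p z) {i : ℕ} (hi : i ≤ p) : Continuous fun l => ‖z i l‖ := by
  rw [continuous_iff_ultrafilter]
  intro l U hU
  obtain ⟨ζ, hζ, hlim⟩ := exists_isLab_of_ultrafilter hp ha hz U hU
  rw [(hz.isLab l).norm_eq hζ hi]
  exact (hlim i hi).norm

/-- If the root of index `i` is the only one of its modulus, then it depends continuously on `l`. -/
theorem continuousAt_root (hp : 1 ≤ p) (ha : a p ≠ 0) {z : ℕ → ℂ → ℂ}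
    (hz : IsRootLabelling a p z) {i : ℕ} (hi : i ≤ p) {l : ℂ}
    (h : ∀ y, (symbolPoly a p l).eval y = 0 → ‖y‖ = ‖z i l‖ → y = z i l) :
    ContinuousAt (z i) l := by
  rw [ContinuousAt, tendsto_iff_ultrafilter]
  intro U hU
  obtain ⟨ζ, hζ, hlim⟩ := exists_isLab_of_ultrafilter hp ha hz U hU
  rw [← h (ζ i) (hζ.eval_zero hp ha hi) ((hζ.norm_eq (hz.isLab l) hi))]
  exact hlim i hi

end Labelling

/-! ### The two sign patterns of the critical points, treated together -/

/-- The hypotheses on the critical points, with `s = -1` if `p` of them are negative and `s = 1` if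
`p` of them are positive, together with the fact that two points of the same modulus at which the
symbol takes the same value are equal or conjugate. -/
structure CritSetup (a : ℕ → ℝ) (p : ℕ) (x : ℕ → ℝ) (s : ℝ) : Prop where
  two_le : 2 ≤ p
  q_eq : q a p = ∏ k ∈ Finset.Icc 1 (p + 1), (X - C (x k))
  sign : s = 1 ∨ s = -1
  anti : StrictAntiOn (fun k => s * x k) (Set.Icc 1 p)
  pos : 0 < s * x p
  neg : s * x (p + 1) < 0
  coincide : ∀ w w' : ℂ, w ≠ 0 → ‖w‖ = ‖w'‖ → rC a p w = rC a p w' →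
    w' = w ∨ w' = (starRingEnd ℂ) w

theorem NegCase.critSetup {a x : ℕ → ℝ} {p : ℕ} (hp : 2 ≤ p) (h : NegCase p x)
    (hq : q a p = ∏ k ∈ Finset.Icc 1 (p + 1), (X - C (x k))) : CritSetup a p x (-1) where
  two_le := hp
  q_eq := hq
  sign := Or.inr rfl
  anti := fun i hi j hj hij => by simpa using h.1 hi hj hij
  pos := by linarith [h.2.1]
  neg := by linarith [h.2.2]
  coincide := fun _ _ hw hn hr => h.eq_or_eq_conj hp hq hw hn hr

/-- The substitution `w ↦ -w`, `a_k ↦ (-1)^{k+1} a_k` exchanges the two sign patterns of the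
critical points. -/
theorem rC_reflect (a : ℕ → ℝ) (p : ℕ) (w : ℂ) :
    rC (fun k => (-1) ^ (k + 1) * a k) p (-w) = -rC a p w := by
  simp only [rC, neg_add, ← Finset.sum_neg_distrib]
  congr 1
  refine Finset.sum_congr rfl fun k _ => ?_
  push_cast
  rw [neg_pow w k]
  rcases neg_one_pow_eq_or ℂ k with h | h <;> rw [pow_succ, h] <;> ring

theorem q_reflect {a x : ℕ → ℝ} {p : ℕ}
    (hq : q a p = ∏ k ∈ Finset.Icc 1 (p + 1), (X - C (x k))) :
    q (fun k => (-1) ^ (k + 1) * a k) p = ∏ k ∈ Finset.Icc 1 (p + 1), (X - C (-x k)) := by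
  refine Polynomial.funext fun w => ?_
  have h := congrArg (fun P : ℝ[X] => (-1) ^ (p + 1) * P.eval (-w)) hq
  simp only [q, eval_sub, eval_pow, eval_X, eval_finsetSum, eval_mul, eval_C, eval_prod] at h ⊢
  have h1 : ∏ k ∈ Finset.Icc 1 (p + 1), (w - -x k) =
      (-1) ^ (p + 1) * ∏ k ∈ Finset.Icc 1 (p + 1), (-w - x k) := by
    have : ((-1 : ℝ)) ^ (p + 1) = ∏ k ∈ Finset.Icc 1 (p + 1), (-1 : ℝ) := by simp
    rw [this, ← Finset.prod_mul_distrib]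
    exact Finset.prod_congr rfl fun k _ => by ring
  rw [h1, ← h, mul_sub, ← mul_pow, Finset.mul_sum]
  congr 1
  · congr 1; ring
  · refine Finset.sum_congr rfl fun k hk => ?_
    rw [Finset.mem_Icc] at hk
    obtain ⟨d, rfl⟩ := Nat.exists_eq_add_of_le hk.2
    rw [Nat.add_sub_cancel_left, neg_pow w d, show k + d + 1 = (k + 1) + d by ring, pow_add _ (k+1)]
    rcases neg_one_pow_eq_or ℝ d with h | h <;> rw [h] <;> ring

theorem PosCase.critSetup {a x : ℕ → ℝ} {p : ℕ} (hp : 2 ≤ p) (h : PosCase p x)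
    (hq : q a p = ∏ k ∈ Finset.Icc 1 (p + 1), (X - C (x k))) : CritSetup a p x 1 where
  two_le := hp
  q_eq := hq
  sign := Or.inl rfl
  anti := fun i hi j hj hij => by simpa using h.1 hi hj hij
  pos := by linarith [h.2.1]
  neg := by linarith [h.2.2]
  coincide := fun w w' hw hn hr => by
    have h1 : NegCase p fun k => -x k :=
      ⟨fun i hi j hj hij => neg_lt_neg (h.1 hi hj hij), by linarith [h.2.1], by linarith [h.2.2]⟩
    have h2 := h1.eq_or_eq_conj hp (q_reflect hq) (w := -w) (w' := -w') (neg_ne_zero.2 hw)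
      (by simpa using hn) (by rw [rC_reflect, rC_reflect, hr])
    simpa using h2

/-- The right side is `q` with its coefficients reversed. A multiple root of the symbol polynomial
is a zero of the left side, hence the reciprocal of a critical point. -/
theorem symbolPoly_sub_X_mul_derivative {a x : ℕ → ℝ} {p : ℕ}
    (hq : q a p = ∏ k ∈ Finset.Icc 1 (p + 1), (X - C (x k))) (l : ℂ) :
    symbolPoly a p l - X * derivative (symbolPoly a p l) =
      ∏ k ∈ Finset.Icc 1 (p + 1), (1 - C (x k : ℂ) * X) := by
  have h1 : ∀ y, (symbolPoly a p l - X * derivative (symbolPoly a p l)).eval y =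
      1 - ∑ k ∈ Finset.range (p + 1), (k * a k : ℂ) * y ^ (k + 1) := by
    intro y
    simp only [symbolPoly, derivative_add, derivative_sub, derivative_one, derivative_mul,
      derivative_C, derivative_X, derivative_sum, derivative_X_pow, eval_sub, eval_add, eval_mul,
      eval_one, eval_C, eval_X, eval_finsetSum, eval_pow, eval_zero]
    have : ∑ k ∈ Finset.range (p + 1), (a k : ℂ) * y ^ (k + 1) -
        y * ∑ k ∈ Finset.range (p + 1),
          (0 * y ^ (k + 1) + (a k : ℂ) * (((k + 1 : ℕ) : ℂ) * y ^ (k + 1 - 1))) =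
        -∑ k ∈ Finset.range (p + 1), (k * a k : ℂ) * y ^ (k + 1) := by
      rw [Finset.mul_sum, ← Finset.sum_sub_distrib, ← Finset.sum_neg_distrib]
      refine Finset.sum_congr rfl fun k _ => ?_
      rw [Nat.add_sub_cancel, pow_succ]; push_cast; ring
    linear_combination this
  refine Polynomial.funext fun y => ?_
  rw [h1, eval_prod]
  simp only [eval_sub, eval_one, eval_mul, eval_C, eval_X]
  by_cases hy : y = 0
  · subst hy; simp
  have h2 := pow_mul_wrDeriv hq (inv_ne_zero hy)
  have h3 : ∏ k ∈ Finset.Icc 1 (p + 1), (1 - (x k : ℂ) * y) =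
      y ^ (p + 1) * ∏ k ∈ Finset.Icc 1 (p + 1), (y⁻¹ - x k) := by
    have : y ^ (p + 1) = ∏ k ∈ Finset.Icc 1 (p + 1), y := by simp
    rw [this, ← Finset.prod_mul_distrib]
    refine Finset.prod_congr rfl fun k _ => ?_
    rw [mul_sub, mul_inv_cancel₀ hy]; ring
  rw [h3, ← h2, wrDeriv, inv_pow, ← mul_assoc, pow_succ,
    show y ^ p * y * (y ^ p)⁻¹ = y by field_simp, mul_sub, mul_inv_cancel₀ hy, Finset.mul_sum]
  congr 1
  refine Finset.sum_congr rfl fun k _ => ?_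
  rw [inv_pow, div_inv_eq_mul, pow_succ]; ring

namespace CritSetup

variable {a x : ℕ → ℝ} {p : ℕ} {s : ℝ}

theorem one_le (S : CritSetup a p x s) : 1 ≤ p := le_trans one_le_two S.two_le

theorem sign_mul_self (S : CritSetup a p x s) : s * s = 1 := by
  rcases S.sign with h | h <;> rw [h] <;> norm_num

theorem mul_pos (S : CritSetup a p x s) {k : ℕ} (h1 : 1 ≤ k) (h2 : k ≤ p) : 0 < s * x k :=
  S.pos.trans_le (S.anti.antitoneOn ⟨h1, h2⟩ ⟨h1.trans h2, le_rfl⟩ h2)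

theorem x_ne_zero (S : CritSetup a p x s) {k : ℕ} (hk : k ∈ Finset.Icc 1 (p + 1)) : x k ≠ 0 := by
  rw [Finset.mem_Icc] at hk
  intro h
  rcases Nat.lt_succ_iff_lt_or_eq.1 (Nat.lt_succ_of_le hk.2) with h1 | h1
  · have := S.mul_pos hk.1 (Nat.lt_succ_iff.1 h1); rw [h, mul_zero] at this; exact lt_irrefl _ this
  · have := S.neg; rw [← h1, h, mul_zero] at this; exact lt_irrefl _ this

theorem x_inj (S : CritSetup a p x s) {i j : ℕ} (hi : i ∈ Finset.Icc 1 (p + 1))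
    (hj : j ∈ Finset.Icc 1 (p + 1)) (h : x i = x j) : i = j := by
  rw [Finset.mem_Icc] at hi hj
  have hn := S.neg
  rcases Nat.lt_succ_iff_lt_or_eq.1 (Nat.lt_succ_of_le hi.2) with h1 | h1 <;>
  rcases Nat.lt_succ_iff_lt_or_eq.1 (Nat.lt_succ_of_le hj.2) with h2 | h2
  · exact S.anti.injOn ⟨hi.1, Nat.lt_succ_iff.1 h1⟩ ⟨hj.1, Nat.lt_succ_iff.1 h2⟩ (by simp [h])
  · have := S.mul_pos hi.1 (Nat.lt_succ_iff.1 h1); rw [h, h2] at this; linarith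
  · have := S.mul_pos hj.1 (Nat.lt_succ_iff.1 h2); rw [← h, h1] at this; linarith
  · omega

theorem a_ne_zero (S : CritSetup a p x s) : a p ≠ 0 := by
  intro h
  have h1 := q_coeff a p p (Finset.mem_Icc.2 ⟨S.one_le, le_rfl⟩)
  rw [h, S.q_eq, Nat.sub_self, coeff_zero_eq_eval_zero, eval_prod] at h1
  have h2 := Finset.prod_eq_zero_iff.1 (h1.trans (by simp))
  obtain ⟨k, hk, h3⟩ := h2
  exact S.x_ne_zero hk (by simpa using h3)

/-- A repeated root is the reciprocal of a critical point. -/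
theorem exists_crit_of_eq (S : CritSetup a p x s) {l : ℂ} {ζ : ℕ → ℂ} (h : IsLab a p l ζ) {i j : ℕ}
    (hi : i ≤ p) (hj : j ≤ p) (hij : i ≠ j) (he : ζ i = ζ j) :
    ∃ k ∈ Finset.Icc 1 (p + 1), ζ i = ((x k : ℝ) : ℂ)⁻¹ := by
  have h1 := congrArg (eval (ζ i)) (symbolPoly_sub_X_mul_derivative S.q_eq l)
  have hd : (derivative (symbolPoly a p l)).eval (ζ i) = 0 := by
    rw [h.eq_prod S.one_le S.a_ne_zero,
      ← Finset.mul_prod_erase _ _ (Finset.mem_range.2 (Nat.lt_succ_of_le hi)),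
      ← Finset.mul_prod_erase _ _ (Finset.mem_erase.2 ⟨hij.symm, Finset.mem_range.2
        (Nat.lt_succ_of_le hj)⟩)]
    simp [derivative_mul, he]
  rw [eval_sub, eval_mul, hd, mul_zero, h.eval_zero S.one_le S.a_ne_zero hi, sub_zero, eval_prod] at h1
  obtain ⟨k, hk, h2⟩ := Finset.prod_eq_zero_iff.1 h1.symm
  refine ⟨k, hk, ?_⟩
  simp only [eval_sub, eval_one, eval_mul, eval_C, eval_X] at h2
  exact eq_inv_of_mul_eq_one_right (by linear_combination -h2)

/-- No root is repeated three times. -/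
theorem not_three (S : CritSetup a p x s) {l : ℂ} {ζ : ℕ → ℂ} (h : IsLab a p l ζ) {i j m : ℕ}
    (hi : i ≤ p) (hj : j ≤ p) (hm : m ≤ p) (hij : i ≠ j) (him : i ≠ m) (hjm : j ≠ m)
    (he : ζ i = ζ j) : ζ i ≠ ζ m := by
  intro he'
  obtain ⟨k, hk, hu⟩ := S.exists_crit_of_eq h hi hj hij he
  have hx : ((x k : ℝ) : ℂ) ≠ 0 := by exact_mod_cast S.x_ne_zero hk
  have h1 := symbolPoly_sub_X_mul_derivative S.q_eq l
  rw [h.eq_prod S.one_le S.a_ne_zero,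
      ← Finset.mul_prod_erase _ _ (Finset.mem_range.2 (Nat.lt_succ_of_le hi)),
      ← Finset.mul_prod_erase _ _ (Finset.mem_erase.2 ⟨hij.symm, Finset.mem_range.2
        (Nat.lt_succ_of_le hj)⟩), ← Finset.mul_prod_erase _ _ (Finset.mem_erase.2 ⟨hjm.symm,
        Finset.mem_erase.2 ⟨him.symm, Finset.mem_range.2 (Nat.lt_succ_of_le hm)⟩⟩),
      ← he, ← he', ← Finset.mul_prod_erase _ _ hk] at h1
  set G := ∏ i ∈ (((Finset.range (p + 1)).erase i).erase j).erase m, (X - C (ζ i)) with hG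
  set u := ζ i with hu'
  have h2 : (1 - C (x k : ℂ) * X : ℂ[X]) = (X - C u) * C (-(x k : ℂ)) := by
    have : C u * C (x k : ℂ) = 1 := by rw [← C_mul, hu, inv_mul_cancel₀ hx, C_1]
    rw [C_neg]; linear_combination -this
  rw [h2, derivative_mul, derivative_mul, derivative_mul, derivative_mul] at h1
  simp only [derivative_C, derivative_sub, derivative_X, zero_mul, zero_add, sub_zero, one_mul] at h1
  have hX : (X - C u) ≠ 0 := X_sub_C_ne_zero u
  -- After cancelling `X - u`, a triple root still makes the left side vanish at `u`, whereas the
  -- zeros of the right side are simple.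
  have h3 : (X - C u) * (C (a p : ℂ) * (X - C u) * G - X * (C (a p : ℂ) * (3 * G +
      (X - C u) * derivative G))) =
      C (-(x k : ℂ)) * ∏ i ∈ (Finset.Icc 1 (p + 1)).erase k, (1 - C (x i : ℂ) * X) := by
    refine mul_left_cancel₀ hX ?_
    linear_combination h1
  have h4 := congrArg (eval u) h3
  simp only [eval_mul, eval_sub, eval_X, eval_C, sub_self, zero_mul, eval_prod, eval_one] at h4
  rcases mul_eq_zero.1 h4.symm with h5 | h5
  · exact hx (neg_eq_zero.1 h5)
  · obtain ⟨j, hj, h6⟩ := Finset.prod_eq_zero_iff.1 h5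
    rw [Finset.mem_erase] at hj
    refine hj.1 (S.x_inj hj.2 hk ?_)
    rw [hu, sub_eq_zero, eq_comm, mul_inv_eq_one₀ hx] at h6
    exact_mod_cast h6

/-- The reciprocal of a critical point is a repeated root as soon as it is a root. -/
theorem exists_eq_of_crit (S : CritSetup a p x s) {l : ℂ} {ζ : ℕ → ℂ} (h : IsLab a p l ζ) {k i : ℕ}
    (hk : k ∈ Finset.Icc 1 (p + 1)) (hi : i ≤ p) (hu : ζ i = ((x k : ℝ) : ℂ)⁻¹) :
    ∃ j ≤ p, j ≠ i ∧ ζ j = ζ i := by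
  have hx : ((x k : ℝ) : ℂ) ≠ 0 := by exact_mod_cast S.x_ne_zero hk
  have ha : (a p : ℂ) ≠ 0 := by exact_mod_cast S.a_ne_zero
  have h0 := h.ne_zero S.one_le S.a_ne_zero hi
  have h1 := congrArg (eval (ζ i)) (symbolPoly_sub_X_mul_derivative S.q_eq l)
  rw [eval_sub, h.eval_zero S.one_le S.a_ne_zero hi, eval_prod, Finset.prod_eq_zero hk
    (by simp [hu, hx]), eval_mul, eval_X, zero_sub, neg_eq_zero, mul_eq_zero, or_iff_right h0,
    h.eq_prod S.one_le S.a_ne_zero,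
      ← Finset.mul_prod_erase _ _ (Finset.mem_range.2 (Nat.lt_succ_of_le hi))] at h1
  simp only [derivative_mul, derivative_C, derivative_sub, derivative_X, eval_add, eval_mul,
    eval_sub, eval_X, eval_C, sub_self, zero_mul, sub_zero, zero_add, one_mul, add_zero,
    eval_prod, mul_eq_zero, ha, false_or] at h1
  obtain ⟨j, hj, h2⟩ := Finset.prod_eq_zero_iff.1 h1
  rw [Finset.mem_erase, Finset.mem_range] at hj
  exact ⟨j, by omega, hj.1, (sub_eq_zero.1 h2).symm⟩

/-- Roots of the same modulus are equal or conjugate. -/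
theorem eq_or_conj (S : CritSetup a p x s) {l y y' : ℂ} (hy : (symbolPoly a p l).eval y = 0)
    (hy' : (symbolPoly a p l).eval y' = 0) (hn : ‖y‖ = ‖y'‖) :
    y' = y ∨ y' = (starRingEnd ℂ) y := by
  have h0 := ne_zero_of_eval_symbolPoly hy
  have h0' := ne_zero_of_eval_symbolPoly hy'
  have h1 := (eval_symbolPoly_eq_zero_iff h0).1 hy
  have h1' := (eval_symbolPoly_eq_zero_iff h0').1 hy'
  rcases S.coincide y⁻¹ y'⁻¹ (inv_ne_zero h0) (by simp [hn]) (h1.trans h1'.symm) with h | h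
  · left; exact inv_injective h
  · right; rw [map_inv₀] at h; exact inv_injective h

end CritSetup

/-! ### Local behaviour of `r` at a critical point. -/

theorem rC_ofReal (a : ℕ → ℝ) (p : ℕ) (w : ℝ) : rC a p w = (r a p w : ℝ) := by
  simp [rC, r]

theorem hasDerivAt_r {a x : ℕ → ℝ} {p : ℕ}
    (hq : q a p = ∏ k ∈ Finset.Icc 1 (p + 1), (X - C (x k))) {w : ℝ} (hw : w ≠ 0) :
    HasDerivAt (r a p) (∏ k ∈ Finset.Icc 1 (p + 1), (1 - x k / w)) w := by
  have hw' : (w : ℂ) ≠ 0 := by exact_mod_cast hw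
  have h1 := (hasDerivAt_rC a p hw').real_of_complex
  have h2 : wrDeriv a p w / w = ((∏ k ∈ Finset.Icc 1 (p + 1), (1 - x k / w) : ℝ) : ℂ) := by
    have h3 := pow_mul_wrDeriv hq hw'
    have h4 : ((∏ k ∈ Finset.Icc 1 (p + 1), (1 - x k / w) : ℝ) : ℂ) * (w : ℂ) ^ (p + 1) =
        ∏ k ∈ Finset.Icc 1 (p + 1), ((w : ℂ) - x k) := by
      have : (w : ℂ) ^ (p + 1) = ∏ k ∈ Finset.Icc 1 (p + 1), (w : ℂ) := by simp
      rw [this, Complex.ofReal_prod, ← Finset.prod_mul_distrib]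
      refine Finset.prod_congr rfl fun k _ => ?_
      push_cast
      field_simp
    rw [← h3] at h4
    have hwp := pow_ne_zero p hw'
    rw [div_eq_iff hw']
    refine mul_left_cancel₀ hwp ?_
    rw [← h4, pow_succ]; ring
  rw [h2, Complex.ofReal_re] at h1
  refine h1.congr_of_eventuallyEq (Eventually.of_forall fun v => ?_)
  change r a p v = (rC a p v).re
  rw [rC_ofReal, Complex.ofReal_re]

/-- The second derivative of `r` at the critical point `x m`. -/
def curv (p : ℕ) (x : ℕ → ℝ) (m : ℕ) : ℝ :=
  (∏ k ∈ (Finset.Icc 1 (p + 1)).erase m, (1 - x k / x m)) / x m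

namespace CritSetup

variable {a x : ℕ → ℝ} {p : ℕ} {s : ℝ}

theorem curv_ne_zero (S : CritSetup a p x s) {m : ℕ} (hm : m ∈ Finset.Icc 1 (p + 1)) :
    curv p x m ≠ 0 := by
  refine div_ne_zero (Finset.prod_ne_zero_iff.2 fun k hk h => ?_) (S.x_ne_zero hm)
  rw [Finset.mem_erase] at hk
  refine hk.1 (S.x_inj hk.2 hm ?_)
  rw [sub_eq_zero, eq_comm, div_eq_one_iff_eq (S.x_ne_zero hm)] at h
  exact h

theorem exists_sign_curv (S : CritSetup a p x s) {m : ℕ} (hm : m ∈ Finset.Icc 1 (p + 1)) :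
    ∃ e : ℝ, (e = 1 ∨ e = -1) ∧ 0 < e * curv p x m := by
  rcases lt_or_gt_of_ne (S.curv_ne_zero hm) with h | h
  · exact ⟨-1, Or.inr rfl, by linarith⟩
  · exact ⟨1, Or.inl rfl, by linarith⟩

/-- Since `s x_1` exceeds all other `s x_k`, every factor `1 - x_k / x_1` is positive. The sign
decides on which side of `λ_1` the set `Γ_1` lies. -/
theorem curv_first (S : CritSetup a p x s) : 0 < s * curv p x 1 := by
  have h1 : 0 < s * x 1 := S.mul_pos le_rfl S.one_le
  have h2 : 0 < ∏ k ∈ (Finset.Icc 1 (p + 1)).erase 1, (1 - x k / x 1) := by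
    refine Finset.prod_pos fun k hk => ?_
    rw [Finset.mem_erase, Finset.mem_Icc] at hk
    have h3 : x k / x 1 = (s * x k) / (s * x 1) := by
      rw [mul_div_mul_left]; rintro rfl; simp at h1
    rw [h3, sub_pos, div_lt_one h1]
    rcases Nat.lt_succ_iff_lt_or_eq.1 (Nat.lt_succ_of_le hk.2.2) with h4 | h4
    · exact S.anti ⟨le_rfl, S.one_le⟩ ⟨hk.2.1, by omega⟩ (by omega)
    · rw [h4]; linarith [S.neg]
  have h3 : s * curv p x 1 = (∏ k ∈ (Finset.Icc 1 (p + 1)).erase 1, (1 - x k / x 1)) *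
      (s * x 1) / (x 1) ^ 2 := by
    have := S.x_ne_zero (k := 1) (by simp)
    rw [curv]; field_simp
  rw [h3]
  have := S.x_ne_zero (k := 1) (by simp)
  positivity

/-- The point `x_{p+1}` is the only critical point of its sign, so all quotients `x_k / x_{p+1}` are
negative. -/
theorem curv_last (S : CritSetup a p x s) : 0 < -s * curv p x (p + 1) := by
  have h1 : s * x (p + 1) < 0 := S.neg
  have h2 : 0 < ∏ k ∈ (Finset.Icc 1 (p + 1)).erase (p + 1), (1 - x k / x (p + 1)) := by
    refine Finset.prod_pos fun k hk => ?_
    rw [Finset.mem_erase, Finset.mem_Icc] at hk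
    have h3 : x k / x (p + 1) = (s * x k) / (s * x (p + 1)) := by
      rw [mul_div_mul_left]; rintro rfl; simp at h1
    have h4 := div_neg_of_pos_of_neg (S.mul_pos hk.2.1 (by omega)) h1
    rw [h3]; linarith
  have h0 := S.x_ne_zero (k := p + 1) (by simp)
  have h3 : -s * curv p x (p + 1) = (∏ k ∈ (Finset.Icc 1 (p + 1)).erase (p + 1),
      (1 - x k / x (p + 1))) * (-(s * x (p + 1))) / (x (p + 1)) ^ 2 := by
    rw [curv]; field_simp
  rw [h3]
  have : 0 < -(s * x (p + 1)) := by linarith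
  positivity

/-- The derivative of `r` is `(w - x_m) h(w)` with `h` continuous near `x_m` and `h(x_m)` equal to
`curv`. -/
theorem exists_monotone_near_crit (S : CritSetup a p x s) {m : ℕ} (hm : m ∈ Finset.Icc 1 (p + 1))
    {e : ℝ} (he : 0 < e * curv p x m) :
    ∃ δ > 0, StrictAntiOn (fun w => e * r a p w) (Set.Icc (x m - δ) (x m)) ∧
      StrictMonoOn (fun w => e * r a p w) (Set.Icc (x m) (x m + δ)) := by
  have h0 := S.x_ne_zero hm
  have hcont : ContinuousAt (fun w => e *
      ((∏ k ∈ (Finset.Icc 1 (p + 1)).erase m, (1 - x k / w)) / w)) (x m) := by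
    refine continuousAt_const.mul (ContinuousAt.div ?_ continuousAt_id h0)
    exact tendsto_finsetProd _ fun k _ => (continuousAt_const.sub
      (continuousAt_const.div continuousAt_id h0)).tendsto
  have h1 : ∀ᶠ w in 𝓝 (x m), 0 < e *
      ((∏ k ∈ (Finset.Icc 1 (p + 1)).erase m, (1 - x k / w)) / w) ∧ w ≠ 0 :=
    (hcont.eventually (lt_mem_nhds he)).and (eventually_ne_nhds h0)
  obtain ⟨δ, hδ, h2⟩ := Metric.eventually_nhds_iff.1 h1
  have h3 : ∀ w, |w - x m| ≤ δ / 2 → w ≠ 0 ∧ ∃ h, 0 < h ∧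
      HasDerivAt (fun w => e * r a p w) ((w - x m) * h) w := by
    intro w hw
    obtain ⟨h4, h5⟩ := h2 (y := w) (by rw [Real.dist_eq]; linarith)
    refine ⟨h5, _, h4, ?_⟩
    refine ((hasDerivAt_r S.q_eq h5).const_mul e).congr_deriv ?_
    rw [← Finset.mul_prod_erase _ _ hm]
    field_simp
  refine ⟨δ / 2, by positivity, ?_, ?_⟩
  · refine strictAntiOn_of_deriv_neg (convex_Icc _ _) (fun w hw => ?_) fun w hw => ?_
    · obtain ⟨-, h, -, hd⟩ := h3 w (by rw [abs_le]; constructor <;> linarith [hw.1, hw.2])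
      exact hd.continuousAt.continuousWithinAt
    · rw [interior_Icc] at hw
      obtain ⟨-, h, hh, hd⟩ := h3 w (by rw [abs_le]; constructor <;> linarith [hw.1, hw.2])
      rw [hd.deriv]
      exact mul_neg_of_neg_of_pos (by linarith [hw.2]) hh
  · refine strictMonoOn_of_deriv_pos (convex_Icc _ _) (fun w hw => ?_) fun w hw => ?_
    · obtain ⟨-, h, -, hd⟩ := h3 w (by rw [abs_le]; constructor <;> linarith [hw.1, hw.2])
      exact hd.continuousAt.continuousWithinAt
    · rw [interior_Icc] at hw
      obtain ⟨-, h, hh, hd⟩ := h3 w (by rw [abs_le]; constructor <;> linarith [hw.1, hw.2])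
      rw [hd.deriv]
      exact _root_.mul_pos (by linarith [hw.1]) hh

/-- Near a critical point, `r` lies strictly on one side of its critical value. -/
theorem eventually_above (S : CritSetup a p x s) {m : ℕ} (hm : m ∈ Finset.Icc 1 (p + 1))
    {e : ℝ} (he : 0 < e * curv p x m) :
    ∀ᶠ w in 𝓝 (x m), w ≠ x m → 0 < e * (r a p w - branchPt a p x m) := by
  obtain ⟨δ, hδ, h1, h2⟩ := S.exists_monotone_near_crit hm he
  filter_upwards [Metric.ball_mem_nhds (x m) hδ] with w hw hne
  rw [Metric.mem_ball, Real.dist_eq, abs_lt] at hw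
  rw [mul_sub, sub_pos]
  rcases lt_or_gt_of_ne hne with h | h
  · exact h1 ⟨by linarith, h.le⟩ ⟨by linarith, le_rfl⟩ h
  · exact h2 ⟨le_rfl, by linarith⟩ ⟨h.le, by linarith⟩ h

/-- Near a critical value, values on the right side are taken on both sides of the critical point. -/
theorem exists_two_preimages (S : CritSetup a p x s) {m : ℕ} (hm : m ∈ Finset.Icc 1 (p + 1))
    {e : ℝ} (he : 0 < e * curv p x m) {η : ℝ} (hη : 0 < η) :
    ∀ᶠ v in 𝓝 (branchPt a p x m), 0 < e * (v - branchPt a p x m) →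
      ∃ w₁ ∈ Set.Ioo (x m - η) (x m), ∃ w₂ ∈ Set.Ioo (x m) (x m + η),
        r a p w₁ = v ∧ r a p w₂ = v := by
  obtain ⟨δ, hδ, h1, h2⟩ := S.exists_monotone_near_crit hm he
  have he0 : e ≠ 0 := by rintro rfl; simp at he
  have h0 := S.x_ne_zero hm
  set κ := min (min δ (η / 2)) (|x m| / 2) with hκ
  have hκ0 : 0 < κ := lt_min (lt_min hδ (by linarith)) (by have := abs_pos.2 h0; linarith)
  have hκδ : κ ≤ δ := (min_le_left _ _).trans (min_le_left _ _)
  have hκη : κ ≤ η / 2 := (min_le_left _ _).trans (min_le_right _ _)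
  have hκx : κ < |x m| := lt_of_le_of_lt (min_le_right _ _) (by have := abs_pos.2 h0; linarith)
  have hcont : ContinuousOn (fun w => e * r a p w) (Set.Icc (x m - κ) (x m + κ)) := by
    intro w hw
    have hw0 : w ≠ 0 := by
      rintro rfl
      rw [lt_abs] at hκx
      rcases hκx with h | h <;> linarith [hw.1, hw.2]
    exact ((hasDerivAt_r S.q_eq hw0).continuousAt.const_mul e).continuousWithinAt
  have h3 : e * r a p (x m) < e * r a p (x m - κ) :=
    h1 ⟨by linarith, by linarith⟩ ⟨by linarith, le_rfl⟩ (by linarith)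
  have h4 : e * r a p (x m) < e * r a p (x m + κ) :=
    h2 ⟨le_rfl, by linarith⟩ ⟨by linarith, by linarith⟩ (by linarith)
  have hc : Tendsto (fun v => e * v) (𝓝 (branchPt a p x m)) (𝓝 (e * r a p (x m))) :=
    (continuous_const.mul continuous_id).tendsto _
  filter_upwards [hc.eventually (gt_mem_nhds h3), hc.eventually (gt_mem_nhds h4)] with v hv1 hv2 hv
  have hv3 : e * r a p (x m) < e * v := by rw [mul_sub] at hv; unfold branchPt at hv; linarith
  obtain ⟨w₁, hw₁, e₁⟩ := intermediate_value_Ioo' (show x m - κ ≤ x m by linarith)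
    (hcont.mono (Set.Icc_subset_Icc_right (by linarith))) ⟨hv3, hv1⟩
  obtain ⟨w₂, hw₂, e₂⟩ := intermediate_value_Ioo (show x m ≤ x m + κ by linarith)
    (hcont.mono (Set.Icc_subset_Icc_left (by linarith))) ⟨hv3, hv2⟩
  exact ⟨w₁, ⟨by linarith [hw₁.1], hw₁.2⟩, w₂, ⟨hw₂.1, by linarith [hw₂.2]⟩,
    mul_left_cancel₀ he0 e₁, mul_left_cancel₀ he0 e₂⟩

variable {z : ℕ → ℂ → ℂ}

theorem eval_inv_r {w : ℝ} (hw : w ≠ 0) :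
    (symbolPoly a p (r a p w : ℝ)).eval ((w : ℂ)⁻¹) = 0 := by
  rw [eval_symbolPoly_eq_zero_iff (inv_ne_zero (by exact_mod_cast hw)), inv_inv, rC_ofReal]

theorem eventually_norm_ne (S : CritSetup a p x s) (hz : IsRootLabelling a p z) {i : ℕ} (hi : i ≤ p)
    {α : Type*} {F : Filter α} {f : α → ℂ} {ρ : α → ℝ} {l : ℂ} {ρ₀ : ℝ} (hf : Tendsto f F (𝓝 l))
    (hρ : Tendsto ρ F (𝓝 ρ₀)) (h : ‖z i l‖ ≠ ρ₀) : ∀ᶠ v in F, ‖z i (f v)‖ ≠ ρ v := by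
  have h1 := ((continuous_norm_root S.one_le S.a_ne_zero hz hi).tendsto l).comp hf
  have h2 := (h1.sub hρ).eventually (isOpen_ne.mem_nhds (sub_ne_zero.2 h))
  filter_upwards [h2] with v hv
  exact fun h3 => hv (by simp [h3])

/-- By continuity of the moduli, a nearby root of modulus `ρ v` can only carry a label whose root at
`l` has modulus `ρ₀`. -/
theorem eventually_forall_norm_ne (S : CritSetup a p x s) (hz : IsRootLabelling a p z)
    {α : Type*} {F : Filter α} {f : α → ℂ} {ρ : α → ℝ} {l : ℂ} {ρ₀ : ℝ} (hf : Tendsto f F (𝓝 l))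
    (hρ : Tendsto ρ F (𝓝 ρ₀)) :
    ∀ᶠ v in F, ∀ i ≤ p, ‖z i (f v)‖ = ρ v → ‖z i l‖ = ρ₀ := by
  have h1 : ∀ i ∈ Finset.range (p + 1), ∀ᶠ v in F, ‖z i (f v)‖ = ρ v → ‖z i l‖ = ρ₀ := by
    intro i hi
    by_cases h : ‖z i l‖ = ρ₀
    · exact Eventually.of_forall fun _ _ => h
    · filter_upwards [S.eventually_norm_ne hz (by rw [Finset.mem_range] at hi; omega) hf hρ h] with
        v hv h'
      exact absurd h' hv
  filter_upwards [(Filter.eventually_all_finset _).2 h1] with v hv i hi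
  exact hv i (Finset.mem_range.2 (by omega))

/-- At the branch point `r (x m)` the root `1 / x m` has two consecutive labels. -/
theorem exists_double_index (S : CritSetup a p x s) (hz : IsRootLabelling a p z) {m : ℕ}
    (hm : m ∈ Finset.Icc 1 (p + 1)) :
    ∃ k < p, z k (branchPt a p x m) = ((x m : ℝ) : ℂ)⁻¹ ∧
      z (k + 1) (branchPt a p x m) = ((x m : ℝ) : ℂ)⁻¹ ∧
      ∀ i ≤ p, ‖z i (branchPt a p x m)‖ = ‖((x m : ℝ) : ℂ)⁻¹‖ → i = k ∨ i = k + 1 := by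
  have hL := hz.isLab (branchPt a p x m)
  have hroot : (symbolPoly a p (branchPt a p x m)).eval (((x m : ℝ) : ℂ)⁻¹) = 0 :=
    eval_inv_r (S.x_ne_zero hm)
  obtain ⟨i, hi, hiu⟩ := hL.exists_index S.one_le S.a_ne_zero hroot
  obtain ⟨j, hj, hji, hju⟩ := S.exists_eq_of_crit hL hm hi hiu
  have hreal : ∀ n ≤ p, ‖z n (branchPt a p x m)‖ = ‖((x m : ℝ) : ℂ)⁻¹‖ →
      z n (branchPt a p x m) = ((x m : ℝ) : ℂ)⁻¹ := by
    intro n hn h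
    rcases S.eq_or_conj hroot (hL.eval_zero S.one_le S.a_ne_zero hn) h.symm with h1 | h1
    · exact h1
    · simpa using h1
  have h3 : ∀ n ≤ p, z n (branchPt a p x m) = ((x m : ℝ) : ℂ)⁻¹ → n = i ∨ n = j := by
    intro n hn h
    by_contra hcon
    push Not at hcon
    exact S.not_three hL hi hj hn hji.symm hcon.1.symm hcon.2.symm hju.symm (hiu.trans h.symm)
  have key : ∀ i j, i ≤ p → j ≤ p → i < j → z i (branchPt a p x m) = ((x m : ℝ) : ℂ)⁻¹ →
      z j (branchPt a p x m) = ((x m : ℝ) : ℂ)⁻¹ →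
      (∀ n ≤ p, z n (branchPt a p x m) = ((x m : ℝ) : ℂ)⁻¹ → n = i ∨ n = j) →
      ∃ k < p, z k (branchPt a p x m) = ((x m : ℝ) : ℂ)⁻¹ ∧
      z (k + 1) (branchPt a p x m) = ((x m : ℝ) : ℂ)⁻¹ ∧
      ∀ i ≤ p, ‖z i (branchPt a p x m)‖ = ‖((x m : ℝ) : ℂ)⁻¹‖ → i = k ∨ i = k + 1 := by
    intro i j hi hj hij hi' hj' h3
    have h4 : j = i + 1 := by
      have h5 : ‖z (i + 1) (branchPt a p x m)‖ = ‖((x m : ℝ) : ℂ)⁻¹‖ :=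
        le_antisymm (by rw [← hj']; exact hL.norm_mono hij hj)
          (by rw [← hi']; exact hL.norm_mono (Nat.le_succ i) (by omega))
      rcases h3 (i + 1) (by omega) (hreal (i + 1) (by omega) h5) with h6 | h6 <;> omega
    subst h4
    exact ⟨i, by omega, hi', hj', fun n hn h => h3 n hn (hreal n hn h)⟩
  rcases lt_or_gt_of_ne hji with h | h
  · exact key j i hj hi h (hju.trans hiu) hiu fun n hn h => (h3 n hn h).symm
  · exact key i j hi hj h hiu (hju.trans hiu) h3

/-- Close to a critical point, the reciprocals of the points on its two sides have consecutive
labels. -/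
theorem eventually_index_near_crit (S : CritSetup a p x s) (hz : IsRootLabelling a p z) {m k : ℕ}
    (hm : m ∈ Finset.Icc 1 (p + 1))
    (hk : ∀ i ≤ p, ‖z i (branchPt a p x m)‖ = ‖((x m : ℝ) : ℂ)⁻¹‖ → i = k ∨ i = k + 1)
    (hkp : k < p) :
    ∀ᶠ w in 𝓝 (x m), (|x m| < |w| → z k (r a p w : ℝ) = ((w : ℝ) : ℂ)⁻¹) ∧
      (|w| < |x m| → z (k + 1) (r a p w : ℝ) = ((w : ℝ) : ℂ)⁻¹) := by
  have h0 := S.x_ne_zero hm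
  have h0' : ((x m : ℝ) : ℂ) ≠ 0 := by exact_mod_cast h0
  have hr : Tendsto (r a p) (𝓝 (x m)) (𝓝 (branchPt a p x m)) :=
    (hasDerivAt_r S.q_eq h0).continuousAt
  have hr' : Tendsto (fun w => ((r a p w : ℝ) : ℂ)) (𝓝 (x m)) (𝓝 (branchPt a p x m : ℝ)) :=
    (Complex.continuous_ofReal.tendsto _).comp hr
  have hn : Tendsto (fun w : ℝ => ‖((w : ℝ) : ℂ)⁻¹‖) (𝓝 (x m)) (𝓝 ‖((x m : ℝ) : ℂ)⁻¹‖) :=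
    ((Complex.continuous_ofReal.tendsto _).inv₀ h0').norm
  have h1 := S.eventually_forall_norm_ne hz hr' hn
  have hsame : ∀ᶠ w in 𝓝 (x m), 0 < w * x m := by
    have : Tendsto (fun w => w * x m) (𝓝 (x m)) (𝓝 (x m * x m)) :=
      (continuous_id.mul continuous_const).tendsto _
    exact this.eventually (lt_mem_nhds (mul_self_pos.2 h0))
  obtain ⟨η, hη, h2⟩ := Metric.eventually_nhds_iff.1 (h1.and hsame)
  obtain ⟨e, -, he⟩ := S.exists_sign_curv hm
  have h3 := S.exists_two_preimages hm he hη
  have hidx : ∀ w, dist w (x m) < η → ∃ i, (i = k ∨ i = k + 1) ∧ z i (r a p w : ℝ) = ((w : ℝ) : ℂ)⁻¹ := by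
    intro w hw
    obtain ⟨h4, h5⟩ := h2 hw
    have hw0 : w ≠ 0 := by rintro rfl; simp at h5
    obtain ⟨i, hi, hiw⟩ := (hz.isLab (r a p w : ℝ)).exists_index S.one_le S.a_ne_zero
      (eval_inv_r hw0)
    exact ⟨i, hk i hi (h4 i hi (by rw [hiw])), hiw⟩
  -- Of two points with the same value of `r`, the one of larger modulus has the smaller reciprocal
  -- and therefore the smaller of the two available labels.
  have hpair : ∀ w w', dist w (x m) < η → dist w' (x m) < η → r a p w = r a p w' →
      |w'| < |w| → z k (r a p w : ℝ) = ((w : ℝ) : ℂ)⁻¹ ∧ z (k + 1) (r a p w : ℝ) = ((w' : ℝ) : ℂ)⁻¹ := by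
    intro w w' hw hw' hrw hlt
    obtain ⟨i, hi, hi'⟩ := hidx w hw
    obtain ⟨j, hj, hj'⟩ := hidx w' hw'
    rw [← hrw] at hj'
    have hw'0 : w' ≠ 0 := by rintro rfl; simpa using (h2 hw').2
    have hlt' : ‖z i (r a p w : ℝ)‖ < ‖z j (r a p w : ℝ)‖ := by
      rw [hi', hj']
      simp only [norm_inv, Complex.norm_real, Real.norm_eq_abs]
      exact inv_strictAnti₀ (abs_pos.2 hw'0) hlt
    have hmono := (hz.isLab (r a p w : ℝ)).norm_mono (Nat.le_succ k) (by omega)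
    rcases hi with rfl | rfl <;> rcases hj with rfl | rfl
    · exact absurd hlt' (lt_irrefl _)
    · exact ⟨hi', hj'⟩
    · exact absurd hlt' (not_lt.2 hmono)
    · exact absurd hlt' (lt_irrefl _)
  filter_upwards [Metric.ball_mem_nhds (x m) hη, S.eventually_above hm he, hr.eventually h3] with
    w hwη habove hpre
  rw [Metric.mem_ball] at hwη
  by_cases hwm : w = x m
  · subst hwm; simp
  obtain ⟨w₁, hw₁, w₂, hw₂, e₁, e₂⟩ := hpre (habove hwm)
  have hd₁ : dist w₁ (x m) < η := by
    rw [Real.dist_eq, abs_lt]; constructor <;> linarith [hw₁.1, hw₁.2]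
  have hd₂ : dist w₂ (x m) < η := by
    rw [Real.dist_eq, abs_lt]; constructor <;> linarith [hw₂.1, hw₂.2]
  -- a partner of `w` on the other side
  obtain ⟨w', hd', e', hs'⟩ : ∃ w', dist w' (x m) < η ∧ r a p w' = r a p w ∧
      (w - x m) * (w' - x m) < 0 := by
    rcases lt_or_gt_of_ne hwm with h | h
    · exact ⟨w₂, hd₂, e₂, mul_neg_of_neg_of_pos (by linarith) (by linarith [hw₂.1])⟩
    · exact ⟨w₁, hd₁, e₁, mul_neg_of_pos_of_neg (by linarith) (by linarith [hw₁.2])⟩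
  have hsw := (h2 hwη).2
  have hsw' := (h2 hd').2
  constructor
  · intro hlt
    refine (hpair w w' hwη hd' e'.symm ?_).1
    rcases lt_or_gt_of_ne h0 with hx | hx
    · have a1 : w < 0 := neg_of_mul_pos_left hsw hx.le
      have a2 : w' < 0 := neg_of_mul_pos_left hsw' hx.le
      rw [abs_of_neg hx, abs_of_neg a1] at hlt
      rw [abs_of_neg a1, abs_of_neg a2]
      have := pos_of_mul_neg_right hs' (by linarith)
      linarith
    · have a1 : 0 < w := pos_of_mul_pos_left hsw hx.le
      have a2 : 0 < w' := pos_of_mul_pos_left hsw' hx.le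
      rw [abs_of_pos hx, abs_of_pos a1] at hlt
      rw [abs_of_pos a1, abs_of_pos a2]
      have := neg_of_mul_neg_right hs' (by linarith)
      linarith
  · intro hlt
    rw [← e']
    refine (hpair w' w hd' hwη e' ?_).2
    rcases lt_or_gt_of_ne h0 with hx | hx
    · have a1 : w < 0 := neg_of_mul_pos_left hsw hx.le
      have a2 : w' < 0 := neg_of_mul_pos_left hsw' hx.le
      rw [abs_of_neg hx, abs_of_neg a1] at hlt
      rw [abs_of_neg a1, abs_of_neg a2]
      have := neg_of_mul_neg_right hs' (by linarith)
      linarith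
    · have a1 : 0 < w := pos_of_mul_pos_left hsw hx.le
      have a2 : 0 < w' := pos_of_mul_pos_left hsw' hx.le
      rw [abs_of_pos hx, abs_of_pos a1] at hlt
      rw [abs_of_pos a1, abs_of_pos a2]
      have := pos_of_mul_neg_right hs' (by linarith)
      linarith

end CritSetup

/-! ### Labels of the real roots. -/

namespace CritSetup

variable {a x : ℕ → ℝ} {p : ℕ} {s : ℝ} {z : ℕ → ℂ → ℂ}

theorem index_unique (S : CritSetup a p x s) (hz : IsRootLabelling a p z) {w : ℝ}
    (hw : ∀ k ∈ Finset.Icc 1 (p + 1), w ≠ x k) {v : ℂ} {i j : ℕ} (hi : i ≤ p) (hj : j ≤ p)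
    (h1 : z i v = ((w : ℝ) : ℂ)⁻¹) (h2 : z j v = ((w : ℝ) : ℂ)⁻¹) : i = j := by
  by_contra hij
  obtain ⟨k, hk, h3⟩ := S.exists_crit_of_eq (hz.isLab v) hi hj hij (h1.trans h2.symm)
  change z i v = _ at h3
  rw [h1, inv_inj] at h3
  exact hw k hk (by exact_mod_cast h3)

/-- The label of the root `1 / w` at `r w` is locally constant off the critical points. -/
theorem eventually_index_eq (S : CritSetup a p x s) (hz : IsRootLabelling a p z) {w : ℝ}
    (hw0 : w ≠ 0) (hw : ∀ k ∈ Finset.Icc 1 (p + 1), w ≠ x k) {i : ℕ} (hi : i ≤ p)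
    (h : z i (r a p w : ℝ) = ((w : ℝ) : ℂ)⁻¹) :
    ∀ᶠ w' in 𝓝 w, z i (r a p w' : ℝ) = ((w' : ℝ) : ℂ)⁻¹ := by
  have hw0' : (w : ℂ) ≠ 0 := by exact_mod_cast hw0
  have hr' : Tendsto (fun w => ((r a p w : ℝ) : ℂ)) (𝓝 w) (𝓝 (r a p w : ℝ)) :=
    (Complex.continuous_ofReal.tendsto _).comp (hasDerivAt_r S.q_eq hw0).continuousAt
  have hn : Tendsto (fun w : ℝ => ‖((w : ℝ) : ℂ)⁻¹‖) (𝓝 w) (𝓝 ‖((w : ℝ) : ℂ)⁻¹‖) :=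
    ((Complex.continuous_ofReal.tendsto _).inv₀ hw0').norm
  filter_upwards [S.eventually_forall_norm_ne hz hr' hn, eventually_ne_nhds hw0] with w' h1 hw'
  obtain ⟨j, hj, h2⟩ := (hz.isLab (r a p w' : ℝ)).exists_index S.one_le S.a_ne_zero (eval_inv_r hw')
  have h3 := h1 j hj (by rw [h2])
  have hL := hz.isLab (r a p w : ℝ)
  have h4 : z j (r a p w : ℝ) = ((w : ℝ) : ℂ)⁻¹ := by
    rcases S.eq_or_conj (eval_inv_r hw0) (hL.eval_zero S.one_le S.a_ne_zero hj) h3.symm with h5 | h5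
    · exact h5
    · simpa using h5
  rw [S.index_unique hz hw hi hj h h4]; exact h2

theorem index_eq_of_isPreconnected (S : CritSetup a p x s) (hz : IsRootLabelling a p z) {T : Set ℝ}
    (hT : IsPreconnected T) (hT0 : ∀ w ∈ T, w ≠ 0)
    (hTx : ∀ w ∈ T, ∀ k ∈ Finset.Icc 1 (p + 1), w ≠ x k) {w w' : ℝ} (hw : w ∈ T) (hw' : w' ∈ T)
    {i : ℕ} (hi : i ≤ p) (h : z i (r a p w : ℝ) = ((w : ℝ) : ℂ)⁻¹) :
    z i (r a p w' : ℝ) = ((w' : ℝ) : ℂ)⁻¹ := by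
  have key := hT.induction₂ (fun w w' => ∀ j ≤ p, z j (r a p w : ℝ) = ((w : ℝ) : ℂ)⁻¹ ↔
    z j (r a p w' : ℝ) = ((w' : ℝ) : ℂ)⁻¹) (fun w hw => ?_) (fun u v w _ _ _ h1 h2 j hj =>
      (h1 j hj).trans (h2 j hj)) (fun u v _ _ h1 j hj => (h1 j hj).symm) hw hw'
  · exact (key i hi).1 h
  · obtain ⟨j, hj, h2⟩ := (hz.isLab (r a p w : ℝ)).exists_index S.one_le S.a_ne_zero
      (eval_inv_r (hT0 w hw))
    filter_upwards [nhdsWithin_le_nhds (S.eventually_index_eq hz (hT0 w hw) (hTx w hw) hj h2),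
      self_mem_nhdsWithin] with w' hw' hw'T i hi
    constructor
    · intro h3; rw [S.index_unique hz (hTx w hw) hi hj h3 h2]; exact hw'
    · intro h3; rw [S.index_unique hz (hTx w' hw'T) hi hj h3 hw']; exact h2

/-- All roots other than the first are bounded away from zero, so the small root `1 / w` can only be
the first one. -/
theorem exists_index_zero_of_large (S : CritSetup a p x s) (hz : IsRootLabelling a p z) :
    ∃ B > 0, ∀ w : ℝ, B < |w| → z 0 (r a p w : ℝ) = ((w : ℝ) : ℂ)⁻¹ := by
  obtain ⟨K, hK, h⟩ := exists_le_norm_pow (a := a) S.a_ne_zero S.one_le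
  refine ⟨1 + K, by positivity, fun w hw => ?_⟩
  have hw0 : w ≠ 0 := by rintro rfl; rw [abs_zero] at hw; linarith
  obtain ⟨i, hi, h2⟩ := (hz.isLab (r a p w : ℝ)).exists_index S.one_le S.a_ne_zero (eval_inv_r hw0)
  rcases Nat.eq_zero_or_pos i with rfl | hi0
  · exact h2
  exfalso
  have h3 := h _ _ (hz.isLab (r a p w : ℝ)) i hi0 hi
  rw [h2, norm_inv, Complex.norm_real, Complex.norm_real, Real.norm_eq_abs, Real.norm_eq_abs,
    inv_pow] at h3
  have h4 : |w| ≤ |w| ^ p := le_self_pow₀ (by linarith) (by have := S.one_le; omega)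
  have h5 : K * (|w| ^ p)⁻¹ < 1 := by
    rw [mul_inv_lt_iff₀ (by positivity)]; linarith
  linarith [abs_nonneg (r a p w)]

theorem ne_crit_of_between (S : CritSetup a p x s) {j : ℕ} (hj : j < p) {w : ℝ}
    (h1 : s * x (j + 1) < s * w) (h2 : 1 ≤ j → s * w < s * x j) :
    w ≠ 0 ∧ ∀ k ∈ Finset.Icc 1 (p + 1), w ≠ x k := by
  have h3 := S.mul_pos (k := j + 1) (by omega) (by omega)
  refine ⟨by rintro rfl; simp at h1; linarith, fun k hk => ?_⟩
  rw [Finset.mem_Icc] at hk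
  rintro rfl
  rcases Nat.lt_succ_iff_lt_or_eq.1 (Nat.lt_succ_of_le hk.2) with h4 | h4
  · rcases le_or_gt k j with h5 | h5
    · have := S.anti.antitoneOn ⟨hk.1, by omega⟩ ⟨by omega, by omega⟩ h5
      have := h2 (by omega)
      linarith
    · have := S.anti.antitoneOn ⟨by omega, by omega⟩ ⟨by omega, by omega⟩ (show j + 1 ≤ k by omega)
      linarith
  · rw [h4] at h1
    linarith [S.neg]

theorem tendsto_dilate (c : ℝ) : Tendsto (fun t : ℝ => c * t) (𝓝[>] 1) (𝓝 c) ∧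
    Tendsto (fun t : ℝ => c * t) (𝓝[<] 1) (𝓝 c) := by
  have h : Tendsto (fun t : ℝ => c * t) (𝓝 1) (𝓝 c) := by
    have : Continuous fun t : ℝ => c * t := by fun_prop
    simpa using this.tendsto 1
  exact ⟨h.mono_left nhdsWithin_le_nhds, h.mono_left nhdsWithin_le_nhds⟩

/-- The upper bound is imposed only if `j ≥ 1`; with `j = 0` the same set is a half-line, which
covers the unbounded intervals too. -/
theorem isPreconnected_between (c : ℝ) (j : ℕ) (u v : ℝ) :
    IsPreconnected {w : ℝ | u < c * w ∧ (1 ≤ j → c * w < v)} := by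
  refine (convex_iff_ordConnected.2 ⟨?_⟩ : Convex ℝ _).isPreconnected
  rintro y ⟨hy1, hy2⟩ y' ⟨hy1', hy2'⟩ t ⟨ht, ht'⟩
  rcases le_total 0 c with hc | hc
  · exact ⟨hy1.trans_le (mul_le_mul_of_nonneg_left ht hc),
      fun h => (mul_le_mul_of_nonneg_left ht' hc).trans_lt (hy2' h)⟩
  · exact ⟨hy1'.trans_le (mul_le_mul_of_nonpos_left ht' hc),
      fun h => (mul_le_mul_of_nonpos_left ht hc).trans_lt (hy2 h)⟩

/-- The label of the root `1 / w` at `r w`, for `w` between consecutive critical points. -/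
theorem index_between (S : CritSetup a p x s) (hz : IsRootLabelling a p z) {j : ℕ} (hj : j < p) :
    (∀ w, s * x (j + 1) < s * w → (1 ≤ j → s * w < s * x j) →
      z j (r a p w : ℝ) = ((w : ℝ) : ℂ)⁻¹) ∧
    z j (branchPt a p x (j + 1)) = ((x (j + 1) : ℝ) : ℂ)⁻¹ ∧
    z (j + 1) (branchPt a p x (j + 1)) = ((x (j + 1) : ℝ) : ℂ)⁻¹ := by
  have habs : |s| = 1 := by rcases S.sign with h | h <;> rw [h] <;> simp
  have habs' : ∀ w, |w| = |s * w| := fun w => by rw [abs_mul, habs, one_mul]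
  -- Slightly farther from the origin than `x_{j+1}` the label is `j`, and near a critical point the
  -- outer side carries the lower label of the pair, so the pair is `j, j + 1`.
  have hcrit : ∀ {j : ℕ}, j < p → (∀ w, s * x (j + 1) < s * w → (1 ≤ j → s * w < s * x j) →
      z j (r a p w : ℝ) = ((w : ℝ) : ℂ)⁻¹) → z j (branchPt a p x (j + 1)) = ((x (j + 1) : ℝ) : ℂ)⁻¹ ∧
    z (j + 1) (branchPt a p x (j + 1)) = ((x (j + 1) : ℝ) : ℂ)⁻¹ := by
    intro j hj h
    have hm : j + 1 ∈ Finset.Icc 1 (p + 1) := Finset.mem_Icc.2 ⟨by omega, by omega⟩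
    have hpos := S.mul_pos (k := j + 1) (by omega) (by omega)
    obtain ⟨k, hk, h1, h2, h3⟩ := S.exists_double_index hz hm
    have h4 := S.eventually_index_near_crit hz hm h3 hk
    have h5 : ∀ᶠ w in 𝓝 (x (j + 1)), 1 ≤ j → s * w < s * x j := by
      by_cases hj1 : 1 ≤ j
      · have : Tendsto (fun w => s * w) (𝓝 (x (j + 1))) (𝓝 (s * x (j + 1))) :=
          (continuous_const.mul continuous_id).tendsto _
        filter_upwards [this.eventually (gt_mem_nhds (S.anti ⟨hj1, by omega⟩ ⟨by omega, by omega⟩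
          (Nat.lt_succ_self j)))] with w hw _ using hw
      · exact Eventually.of_forall fun _ h => absurd h hj1
    obtain ⟨t, ⟨h6, h7⟩, ht⟩ := (((tendsto_dilate (x (j + 1))).1.eventually (h4.and h5)).and
      self_mem_nhdsWithin).exists
    have h8 : s * x (j + 1) < s * (x (j + 1) * t) := by rw [← mul_assoc]; nlinarith
    have h9 := h _ h8 h7
    have h10 := h6.1 (by
      rw [habs' (x (j + 1)), habs' (_ * t), abs_of_pos hpos, abs_of_pos (by linarith)]; exact h8)
    have := S.index_unique hz (S.ne_crit_of_between hj h8 h7).2 hj.le hk.le h9 h10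
    subst this
    exact ⟨h1, h2⟩
  induction j with
  | zero =>
    have h : ∀ w, s * x 1 < s * w → (1 ≤ 0 → s * w < s * x 0) →
        z 0 (r a p w : ℝ) = ((w : ℝ) : ℂ)⁻¹ := by
      intro w hw hw'
      obtain ⟨B, hB, h1⟩ := S.exists_index_zero_of_large hz
      have hpos := S.mul_pos (k := 1) le_rfl (by omega)
      have h2 : s * x 1 < s * (s * (B + 1 + s * x 1)) := by
        rw [← mul_assoc, S.sign_mul_self]; linarith
      refine S.index_eq_of_isPreconnected hz (isPreconnected_between s 0 (s * x 1) (s * x 0))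
        (fun v hv => (S.ne_crit_of_between hj hv.1 hv.2).1)
        (fun v hv => (S.ne_crit_of_between hj hv.1 hv.2).2)
        (w := s * (B + 1 + s * x 1)) ⟨h2, by simp⟩ ⟨hw, hw'⟩ (Nat.zero_le p) (h1 _ ?_)
      rw [abs_mul, habs, one_mul, abs_of_pos (by linarith)]; linarith
    exact ⟨h, hcrit hj h⟩
  | succ j ih =>
    have h : ∀ w, s * x (j + 1 + 1) < s * w → (1 ≤ j + 1 → s * w < s * x (j + 1)) →
        z (j + 1) (r a p w : ℝ) = ((w : ℝ) : ℂ)⁻¹ := by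
      intro w hw hw'
      obtain ⟨-, h1, h2⟩ := ih (by omega)
      have hm : j + 1 ∈ Finset.Icc 1 (p + 1) := Finset.mem_Icc.2 ⟨by omega, by omega⟩
      have hpos := S.mul_pos (k := j + 1) (by omega) (by omega)
      obtain ⟨k, hk, h1', h2', h3⟩ := S.exists_double_index hz hm
      have hkj : k = j := by
        have e1 := h3 j (by omega) (by rw [h1])
        have e2 := h3 (j + 1) (by omega) (by rw [h2])
        omega
      subst hkj
      have h4 := S.eventually_index_near_crit hz hm h3 hk
      have h5 : ∀ᶠ w in 𝓝 (x (k + 1)), s * x (k + 1 + 1) < s * w := by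
        have : Tendsto (fun w => s * w) (𝓝 (x (k + 1))) (𝓝 (s * x (k + 1))) :=
          (continuous_const.mul continuous_id).tendsto _
        exact this.eventually (lt_mem_nhds (S.anti ⟨by omega, by omega⟩ ⟨by omega, by omega⟩
          (Nat.lt_succ_self (k + 1))))
      -- Crossing `x_{k+1}` towards the origin, the root `1 / w` passes from the label `k` to `k +
      -- 1`.
      obtain ⟨t, ⟨h6, h7⟩, ht⟩ := (((tendsto_dilate (x (k + 1))).2.eventually (h4.and h5)).and
        self_mem_nhdsWithin).exists
      have h8 : s * (x (k + 1) * t) < s * x (k + 1) := by rw [← mul_assoc]; nlinarith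
      have hpos2 := S.mul_pos (k := k + 1 + 1) (by omega) (by omega)
      have h10 := h6.2 (by
        rw [habs' (x (k + 1)), habs' (_ * t), abs_of_pos hpos, abs_of_pos (by linarith)]; exact h8)
      exact S.index_eq_of_isPreconnected hz
        (isPreconnected_between s (k + 1) (s * x (k + 1 + 1)) (s * x (k + 1)))
        (fun v hv => (S.ne_crit_of_between hj hv.1 hv.2).1)
        (fun v hv => (S.ne_crit_of_between hj hv.1 hv.2).2) ⟨h7, fun _ => h8⟩ ⟨hw, hw'⟩ hj.le h10
    exact ⟨h, hcrit hj h⟩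

theorem double_index (S : CritSetup a p x s) (hz : IsRootLabelling a p z) {j : ℕ} (h1 : 1 ≤ j)
    (h2 : j ≤ p) : z (j - 1) (branchPt a p x j) = ((x j : ℝ) : ℂ)⁻¹ ∧
      z j (branchPt a p x j) = ((x j : ℝ) : ℂ)⁻¹ := by
  obtain ⟨j, rfl⟩ := Nat.exists_eq_add_of_le' h1
  exact (S.index_between hz (j := j) (by omega)).2

/-- On the other half-axis there is no critical point beyond `x_{p+1}`, so the label is `0` from
infinity up to it. This makes `λ_{p+1}` the second end point of `Γ_1`. -/
theorem double_index_last (S : CritSetup a p x s) (hz : IsRootLabelling a p z) :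
    z 0 (branchPt a p x (p + 1)) = ((x (p + 1) : ℝ) : ℂ)⁻¹ ∧
      z 1 (branchPt a p x (p + 1)) = ((x (p + 1) : ℝ) : ℂ)⁻¹ := by
  have habs : |s| = 1 := by rcases S.sign with h | h <;> rw [h] <;> simp
  have habs' : ∀ w, |w| = |s * w| := fun w => by rw [abs_mul, habs, one_mul]
  have hm : p + 1 ∈ Finset.Icc 1 (p + 1) := Finset.mem_Icc.2 ⟨by omega, by omega⟩
  have hne : ∀ w, -(s * x (p + 1)) < -s * w → w ≠ 0 ∧ ∀ k ∈ Finset.Icc 1 (p + 1), w ≠ x k := by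
    intro w hw
    have hneg := S.neg
    refine ⟨by rintro rfl; simp at hw; linarith, fun k hk => ?_⟩
    rw [Finset.mem_Icc] at hk
    rintro rfl
    rcases Nat.lt_succ_iff_lt_or_eq.1 (Nat.lt_succ_of_le hk.2) with h4 | h4
    · linarith [S.mul_pos hk.1 (by omega)]
    · rw [h4] at hw; linarith
  have hneg := S.neg
  obtain ⟨k, hk, h1, h2, h3⟩ := S.exists_double_index hz hm
  have h4 := S.eventually_index_near_crit hz hm h3 hk
  obtain ⟨t, h6, ht⟩ := (((tendsto_dilate (x (p + 1))).1.eventually h4).and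
    self_mem_nhdsWithin).exists
  have h8 : -(s * x (p + 1)) < -s * (x (p + 1) * t) := by rw [← mul_assoc]; nlinarith
  have h10 := h6.1 (by
    rw [habs' (x (p + 1)), habs' (_ * t), abs_of_neg hneg, abs_of_neg (by linarith)]; linarith)
  obtain ⟨B, hB, h11⟩ := S.exists_index_zero_of_large hz
  have h12 : -(s * x (p + 1)) < -s * (-s * (B + 1 - s * x (p + 1))) := by
    have := S.sign_mul_self
    rw [← mul_assoc, neg_mul_neg, this]; linarith
  have h13 := S.index_eq_of_isPreconnected hz (isPreconnected_between (-s) 0 (-(s * x (p + 1))) 0)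
    (fun v hv => (hne v hv.1).1) (fun v hv => (hne v hv.1).2)
    (w := -s * (B + 1 - s * x (p + 1))) ⟨h12, by simp⟩ ⟨h8, by simp⟩ (Nat.zero_le p) (h11 _ (by
      rw [abs_mul, abs_neg, habs, one_mul, abs_of_pos (by linarith)]; linarith))
  have := S.index_unique hz (hne _ h8).2 (Nat.zero_le p) hk.le h13 h10
  subst this
  exact ⟨h1, h2⟩

/-! ### The sets `Γ_k` -/

/-- A double root is the reciprocal of a critical point, and the pair of labels at each critical
point is known. -/
theorem eq_of_double (S : CritSetup a p x s) (hz : IsRootLabelling a p z) {l : ℂ} {k : ℕ} (hk : k < p)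
    (h : z k l = z (k + 1) l) :
    l = branchPt a p x (k + 1) ∨ (k = 0 ∧ l = branchPt a p x (p + 1)) := by
  have hL := hz.isLab l
  obtain ⟨m, hm, h1⟩ := S.exists_crit_of_eq hL hk.le hk (Nat.succ_ne_self k).symm h
  have h2 : l = branchPt a p x m := by
    have h3 := hL.rC_inv S.one_le S.a_ne_zero hk.le
    rw [h1, inv_inv, rC_ofReal] at h3
    exact h3.symm
  subst h2
  obtain ⟨n, hn, h3, h4, h5⟩ := S.exists_double_index hz hm
  have e1 := h5 k hk.le (by rw [← h1])
  have e2 := h5 (k + 1) hk (by rw [← h1]; exact congrArg _ h.symm)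
  rw [Finset.mem_Icc] at hm
  rcases Nat.lt_succ_iff_lt_or_eq.1 (Nat.lt_succ_of_le hm.2) with h6 | h6
  · obtain ⟨d1, d2⟩ := S.double_index hz hm.1 (Nat.lt_succ_iff.1 h6)
    have e3 := h5 (m - 1) (by omega) (by rw [d1])
    have e4 := h5 m (by omega) (by rw [d2])
    left; congr 2; omega
  · right
    subst h6
    obtain ⟨d1, d2⟩ := S.double_index_last hz
    have e3 := h5 0 (by omega) (by rw [d1])
    exact ⟨by omega, rfl⟩

/-- On `Γ_{k+1}`, off the branch points, the two roots in question are nonreal and conjugate. -/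
theorem conj_of_mem_Γ (S : CritSetup a p x s) (hz : IsRootLabelling a p z) {l : ℂ} {k : ℕ} (hk : k < p)
    (h : l ∈ Γ z (k + 1)) (h1 : l ≠ branchPt a p x (k + 1))
    (h2 : k = 0 → l ≠ branchPt a p x (p + 1)) :
    l.im = 0 ∧ (z k l).im ≠ 0 ∧ z (k + 1) l = (starRingEnd ℂ) (z k l) := by
  have hL := hz.isLab l
  have h3 : ‖z k l‖ = ‖z (k + 1) l‖ := h
  have hne : z k l ≠ z (k + 1) l := fun h4 => by
    rcases S.eq_of_double hz hk h4 with h5 | ⟨h5, h6⟩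
    · exact h1 h5
    · exact h2 h5 h6
  rcases S.eq_or_conj (hL.eval_zero S.one_le S.a_ne_zero hk.le) (hL.eval_zero S.one_le S.a_ne_zero hk)
    h3 with h4 | h4
  · exact absurd h4.symm hne
  refine ⟨?_, fun h5 => hne ?_, h4⟩
  · have e1 := hL.rC_inv S.one_le S.a_ne_zero hk.le
    have e2 := (hL.conj S.one_le S.a_ne_zero).rC_inv S.one_le S.a_ne_zero hk.le
    have e3 := hL.rC_inv S.one_le S.a_ne_zero (show k + 1 ≤ p from hk)
    rw [h4] at e3
    exact Complex.conj_eq_iff_im.1 (e2.symm.trans e3)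
  · rw [h4, Complex.conj_eq_iff_im.2 h5]

theorem Γ_subset_real (S : CritSetup a p x s) (hz : IsRootLabelling a p z) {l : ℂ} {k : ℕ} (hk : k < p)
    (h : l ∈ Γ z (k + 1)) : l.im = 0 := by
  by_cases h1 : l = branchPt a p x (k + 1)
  · rw [h1]; exact Complex.ofReal_im _
  by_cases h2 : l = branchPt a p x (p + 1)
  · rw [h2]; exact Complex.ofReal_im _
  exact (S.conj_of_mem_Γ hz hk h h1 fun _ => h2).1

/-- At a real parameter the conjugate of a nonreal root is another root of the same modulus; only
the label `k + 1` is left for it. -/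
theorem mem_Γ_of_nonreal (S : CritSetup a p x s) (hz : IsRootLabelling a p z) {v : ℝ} {k : ℕ}
    (hk : k < p) (h : (z k v).im ≠ 0)
    (hs : ∀ i ≤ p, ‖z i v‖ = ‖z k v‖ → i = k ∨ i = k + 1) : (v : ℂ) ∈ Γ z (k + 1) := by
  have hL := hz.isLab (v : ℂ)
  have h1 : (symbolPoly a p v).eval ((starRingEnd ℂ) (z k v)) = 0 := by
    have := eval_symbolPoly_conj a p v (z k v)
    rw [Complex.conj_ofReal] at this
    rw [this, hL.eval_zero S.one_le S.a_ne_zero hk.le, map_zero]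
  obtain ⟨i, hi, h2⟩ := hL.exists_index S.one_le S.a_ne_zero h1
  have h3 : ‖z i v‖ = ‖z k v‖ := by rw [h2]; simp
  rcases hs i hi h3 with rfl | rfl
  · exact absurd (Complex.conj_eq_iff_im.1 h2.symm) h
  · exact h3.symm

/-- Nearby, the root stays nonreal, and no third root can share its modulus: in the limit it would
coincide with `z_k` or its conjugate, and multiple roots are real. -/
theorem eventually_mem_Γ (S : CritSetup a p x s) (hz : IsRootLabelling a p z) {v : ℝ} {k : ℕ}
    (hk : k < p) (h : (v : ℂ) ∈ Γ z (k + 1)) (h1 : v ≠ branchPt a p x (k + 1))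
    (h2 : k = 0 → v ≠ branchPt a p x (p + 1)) : ∀ᶠ v' : ℝ in 𝓝 v, (v' : ℂ) ∈ Γ z (k + 1) := by
  have hL := hz.isLab (v : ℂ)
  obtain ⟨-, h3, h4⟩ := S.conj_of_mem_Γ hz hk h (by exact_mod_cast h1)
    (fun h => by exact_mod_cast h2 h)
  have him : ∀ᶠ l in 𝓝 (v : ℂ), (z k l).im ≠ 0 := by
    change {l | (z k l).im ≠ 0} ∈ 𝓝 (v : ℂ)
    rw [mem_iff_ultrafilter]
    intro U hU
    obtain ⟨ζ, hζ, hlim⟩ := exists_isLab_of_ultrafilter S.one_le S.a_ne_zero hz U hU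
    have h5 : (ζ k).im ≠ 0 := by
      rcases S.eq_or_conj (hL.eval_zero S.one_le S.a_ne_zero hk.le)
        (hζ.eval_zero S.one_le S.a_ne_zero hk.le) (hL.norm_eq hζ hk.le) with h5 | h5
      · rw [h5]; exact h3
      · rw [h5]; simpa using h3
    exact ((Complex.continuous_im.tendsto _).comp (hlim k hk.le)).eventually
      (isOpen_ne.mem_nhds h5)
  have hf : Tendsto (fun v' : ℝ => (v' : ℂ)) (𝓝 v) (𝓝 (v : ℂ)) := Complex.continuous_ofReal.tendsto v
  filter_upwards [hf.eventually him, S.eventually_forall_norm_ne hz hf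
    (((continuous_norm_root S.one_le S.a_ne_zero hz hk.le).tendsto (v : ℂ)).comp hf)] with v' h5 h6
  refine S.mem_Γ_of_nonreal hz hk h5 fun i hi h7 => ?_
  have h8 := h6 i hi h7
  by_contra hcon
  push Not at hcon
  have h9 : ∃ j ≤ p, j ≠ i ∧ z j v = z i v := by
    rcases S.eq_or_conj (hL.eval_zero S.one_le S.a_ne_zero hk.le)
        (hL.eval_zero S.one_le S.a_ne_zero hi) h8.symm with h9 | h9
    · exact ⟨k, hk.le, hcon.1.symm, h9.symm⟩
    · exact ⟨k + 1, hk, hcon.2.symm, h4.trans h9.symm⟩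
  obtain ⟨j, hj, hji, h10⟩ := h9
  obtain ⟨m, -, h11⟩ := S.exists_crit_of_eq hL hi hj hji.symm h10.symm
  change z i v = _ at h11
  have h12 : (z i v).im = 0 := by rw [h11, ← Complex.ofReal_inv]; exact Complex.ofReal_im _
  rcases S.eq_or_conj (hL.eval_zero S.one_le S.a_ne_zero hk.le)
        (hL.eval_zero S.one_le S.a_ne_zero hi) h8.symm with h9 | h9
  · rw [h9] at h12; exact h3 h12
  · rw [h9] at h12; exact h3 (by simpa using h12)

theorem isClosed_Γ (S : CritSetup a p x s) (hz : IsRootLabelling a p z) {k : ℕ} (hk : k < p) :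
    IsClosed (Γ z (k + 1)) :=
  isClosed_eq (continuous_norm_root S.one_le S.a_ne_zero hz hk.le)
    (continuous_norm_root S.one_le S.a_ne_zero hz hk)

/-- Off the branch points `Γ_{k+1}` is both open and closed in the real line. -/
theorem mem_Γ_iff_of_isPreconnected (S : CritSetup a p x s) (hz : IsRootLabelling a p z) {k : ℕ}
    (hk : k < p) {T : Set ℝ} (hT : IsPreconnected T) (h1 : ∀ v ∈ T, v ≠ branchPt a p x (k + 1))
    (h2 : k = 0 → ∀ v ∈ T, v ≠ branchPt a p x (p + 1)) {v v' : ℝ} (hv : v ∈ T) (hv' : v' ∈ T) :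
    (v : ℂ) ∈ Γ z (k + 1) ↔ (v' : ℂ) ∈ Γ z (k + 1) := by
  refine hT.induction₂ (fun v v' => (v : ℂ) ∈ Γ z (k + 1) ↔ (v' : ℂ) ∈ Γ z (k + 1))
    (fun v hv => ?_) (fun u v w _ _ _ h1 h2 => h1.trans h2) (fun u v _ _ h1 => h1.symm) hv hv'
  refine nhdsWithin_le_nhds ?_
  by_cases h : (v : ℂ) ∈ Γ z (k + 1)
  · filter_upwards [S.eventually_mem_Γ hz hk h (h1 v hv) fun h => h2 h v hv] with v' hv'
    exact iff_of_true h hv'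
  · have hf : Tendsto (fun v' : ℝ => (v' : ℂ)) (𝓝 v) (𝓝 (v : ℂ)) :=
      Complex.continuous_ofReal.tendsto v
    filter_upwards [hf.eventually ((S.isClosed_Γ hz hk).isOpen_compl.mem_nhds h)] with v' hv'
    exact iff_of_false h hv'

/-- Near a branch point, `Γ_{k+1}` consists of the points on one side. -/
theorem eventually_mem_Γ_iff_near_branchPt (S : CritSetup a p x s) (hz : IsRootLabelling a p z)
    {m k : ℕ} (hm : m ∈ Finset.Icc 1 (p + 1)) (hk : k < p)
    (hd : z k (branchPt a p x m) = ((x m : ℝ) : ℂ)⁻¹ ∧ z (k + 1) (branchPt a p x m) = ((x m : ℝ) : ℂ)⁻¹)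
    {e : ℝ} (he : 0 < e * curv p x m) :
    ∀ᶠ v : ℝ in 𝓝 (branchPt a p x m), (0 < e * (v - branchPt a p x m) → (v : ℂ) ∉ Γ z (k + 1)) ∧
      (e * (v - branchPt a p x m) < 0 → (v : ℂ) ∈ Γ z (k + 1)) := by
  have hL := hz.isLab (branchPt a p x m)
  have h0 := S.x_ne_zero hm
  have h0' : ((x m : ℝ) : ℂ) ≠ 0 := by exact_mod_cast h0
  have hroot : (symbolPoly a p (branchPt a p x m)).eval (((x m : ℝ) : ℂ)⁻¹) = 0 :=
    eval_inv_r (S.x_ne_zero hm)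
  obtain ⟨n, hn, h1, h2, h3⟩ := S.exists_double_index hz hm
  have hnk : n = k := by
    have e1 := h3 k hk.le (by rw [hd.1])
    have e2 := h3 (k + 1) hk (by rw [hd.2])
    omega
  subst hnk
  have hf : Tendsto (fun v' : ℝ => (v' : ℂ)) (𝓝 (branchPt a p x m)) (𝓝 (branchPt a p x m : ℝ)) :=
    Complex.continuous_ofReal.tendsto _
  have hzc : Tendsto (fun v : ℝ => z n v) (𝓝 (branchPt a p x m)) (𝓝 (((x m : ℝ) : ℂ)⁻¹)) := by
    have : ContinuousAt (z n) (branchPt a p x m : ℝ) := by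
      refine continuousAt_root S.one_le S.a_ne_zero hz hk.le fun y hy hny => ?_
      rw [h1] at hny ⊢
      rcases S.eq_or_conj hroot hy hny.symm with h | h
      · exact h
      · simpa using h
    rw [ContinuousAt, h1] at this
    exact this.comp hf
  have hwc : Tendsto (fun v : ℝ => ((z n v)⁻¹).re) (𝓝 (branchPt a p x m)) (𝓝 (x m)) := by
    have := (Complex.continuous_re.tendsto _).comp (hzc.inv₀ (inv_ne_zero h0'))
    rwa [inv_inv] at this
  have hidx := S.eventually_index_near_crit hz hm h3 hk
  obtain ⟨η, hη, hidx⟩ := Metric.eventually_nhds_iff.1 hidx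
  have hsmall : 0 < min η |x m| := lt_min hη (abs_pos.2 h0)
  filter_upwards [hwc.eventually (S.eventually_above hm he), S.exists_two_preimages hm he hsmall,
    S.eventually_forall_norm_ne hz hf hzc.norm] with v h4 h5 h6
  constructor
  -- On this side `r` has two real preimages near `x_m`, of different moduli, and their reciprocals
  -- occupy both labels.
  · intro hv hmem
    obtain ⟨w₁, hw₁, w₂, hw₂, e₁, e₂⟩ := h5 hv
    have hmin1 := min_le_left η |x m|
    have hmin2 := min_le_right η |x m|
    have d₁ := hidx (y := w₁) (by rw [Real.dist_eq, abs_lt]; constructor <;> linarith [hw₁.1, hw₁.2])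
    have d₂ := hidx (y := w₂) (by rw [Real.dist_eq, abs_lt]; constructor <;> linarith [hw₂.1, hw₂.2])
    have hmem' : ‖z n v‖ = ‖z (n + 1) v‖ := hmem
    rw [e₁] at d₁
    rw [e₂] at d₂
    have habs : |w₁| ≠ |w₂| ∧ ((|x m| < |w₁| ∧ |w₂| < |x m|) ∨ (|x m| < |w₂| ∧ |w₁| < |x m|)) := by
      rcases lt_or_gt_of_ne h0 with hx | hx
      · have hmin2' := hmin2.trans_eq (abs_of_neg hx)
        have b1 : w₁ < 0 := by linarith [hw₁.2]
        have b2 : w₂ < 0 := by linarith [hw₂.2]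
        rw [abs_of_neg hx, abs_of_neg b1, abs_of_neg b2]
        exact ⟨by linarith [hw₁.2, hw₂.1], Or.inl ⟨by linarith [hw₁.2], by linarith [hw₂.1]⟩⟩
      · have hmin2' := hmin2.trans_eq (abs_of_pos hx)
        have b1 : 0 < w₁ := by linarith [hw₁.1]
        have b2 : 0 < w₂ := by linarith [hw₂.1]
        rw [abs_of_pos hx, abs_of_pos b1, abs_of_pos b2]
        exact ⟨by linarith [hw₁.2, hw₂.1], Or.inr ⟨by linarith [hw₂.1], by linarith [hw₁.2]⟩⟩
    rcases habs.2 with ⟨c1, c2⟩ | ⟨c1, c2⟩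
    · rw [d₁.1 c1, d₂.2 c2] at hmem'
      simp only [norm_inv, Complex.norm_real, Real.norm_eq_abs, inv_inj] at hmem'
      exact habs.1 hmem'
    · rw [d₂.1 c1, d₁.2 c2] at hmem'
      simp only [norm_inv, Complex.norm_real, Real.norm_eq_abs, inv_inj] at hmem'
      exact habs.1 hmem'.symm
  -- On the other side `r` does not take the value `v` at real points near `x_m`, so the root near
  -- `1 / x_m` is nonreal.
  · intro hv
    refine S.mem_Γ_of_nonreal hz hk (fun him => ?_) fun i hi h7 => h3 i hi (h6 i hi h7)
    have e1 : (z n v)⁻¹ = (((z n v)⁻¹).re : ℝ) := by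
      apply Complex.ext <;> simp [Complex.inv_im, him]
    have e2 := (hz.isLab (v : ℂ)).rC_inv S.one_le S.a_ne_zero hk.le
    rw [e1, rC_ofReal] at e2
    have e3 : r a p ((z n v)⁻¹).re = v := by exact_mod_cast e2
    rw [e3] at h4
    by_cases hw : ((z n v)⁻¹).re = x m
    · have : v = branchPt a p x m := by rw [← e3, hw]; rfl
      rw [this, sub_self, mul_zero] at hv
      exact lt_irrefl _ hv
    · linarith [h4 hw]

end CritSetup

namespace CritSetup

variable {a x : ℕ → ℝ} {p : ℕ} {s : ℝ} {z : ℕ → ℂ → ℂ}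

theorem exists_side {P : ℝ → Prop} {b : ℝ} (h : ∀ᶠ v in 𝓝 b, P v) {e : ℝ} (he : e ≠ 0) {δ : ℝ}
    (hδ : 0 < δ) : ∃ v, P v ∧ 0 < e * (v - b) ∧ e * (v - b) < δ := by
  have h1 : Tendsto (fun t : ℝ => b + e * t) (𝓝[>] 0) (𝓝 b) := by
    have : Continuous fun t : ℝ => b + e * t := by fun_prop
    have h2 := this.tendsto 0
    rw [mul_zero, add_zero] at h2
    exact h2.mono_left nhdsWithin_le_nhds
  have h2 : Tendsto (fun t : ℝ => e * (b + e * t - b)) (𝓝[>] 0) (𝓝 0) := by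
    have : Continuous fun t : ℝ => e * (b + e * t - b) := by fun_prop
    have h2 := this.tendsto 0
    simp only [mul_zero, add_zero, sub_self] at h2
    exact h2.mono_left nhdsWithin_le_nhds
  obtain ⟨t, ⟨h3, h4⟩, ht⟩ := (((h1.eventually h).and (h2.eventually (gt_mem_nhds hδ))).and
    self_mem_nhdsWithin).exists
  refine ⟨_, h3, ?_, h4⟩
  have ht' : 0 < t := ht
  have : e * (b + e * t - b) = e ^ 2 * t := by ring
  rw [this]
  positivity

theorem branchPt_mem_Γ (S : CritSetup a p x s) (hz : IsRootLabelling a p z) {k : ℕ} (h1 : 1 ≤ k)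
    (h2 : k ≤ p) : (branchPt a p x k : ℂ) ∈ Γ z k := by
  obtain ⟨d1, d2⟩ := S.double_index hz h1 h2
  rw [Γ, Set.mem_ofPred_eq, d1, d2]

theorem ofReal_mem_image {T : Set ℝ} {v : ℝ} : (v : ℂ) ∈ (fun t : ℝ => (t : ℂ)) '' T ↔ v ∈ T := by
  constructor
  · rintro ⟨t, ht, h⟩
    rwa [← Complex.ofReal_injective h]
  · exact fun h => ⟨v, h, rfl⟩

theorem Γ_eq_image (S : CritSetup a p x s) (hz : IsRootLabelling a p z) {k : ℕ} (h1 : 1 ≤ k)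
    (h2 : k ≤ p) {T : Set ℝ} (h : ∀ v : ℝ, (v : ℂ) ∈ Γ z k ↔ v ∈ T) :
    Γ z k = (fun t : ℝ => (t : ℂ)) '' T := by
  obtain ⟨k, rfl⟩ := Nat.exists_eq_add_of_le' h1
  ext l
  constructor
  · intro hl
    have h3 := S.Γ_subset_real hz (by omega) hl
    have h4 : l = (l.re : ℂ) := by apply Complex.ext <;> simp [h3]
    rw [h4] at hl ⊢
    exact ofReal_mem_image.2 ((h _).1 hl)
  · rintro ⟨t, ht, rfl⟩
    exact (h t).2 ht

/-- For `2 ≤ k ≤ p` the set `Γ_k` is a half-line. -/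
theorem mem_Γ_iff (S : CritSetup a p x s) (hz : IsRootLabelling a p z) {k : ℕ} (h1 : 2 ≤ k)
    (h2 : k ≤ p) {e : ℝ} (he : 0 < e * curv p x k) (v : ℝ) :
    (v : ℂ) ∈ Γ z k ↔ e * (v - branchPt a p x k) ≤ 0 := by
  have he0 : e ≠ 0 := by rintro rfl; simp at he
  obtain ⟨j, rfl⟩ := Nat.exists_eq_add_of_le' (show 1 ≤ k by omega)
  have hd := S.double_index hz (show 1 ≤ j + 1 by omega) h2
  have hm : j + 1 ∈ Finset.Icc 1 (p + 1) := Finset.mem_Icc.2 ⟨by omega, by omega⟩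
  have hnear := S.eventually_mem_Γ_iff_near_branchPt hz hm (show j < p by omega) hd he
  have hside : ∀ c : ℝ, c ≠ 0 → ∀ v v' : ℝ, 0 < c * (v - branchPt a p x (j + 1)) →
      0 < c * (v' - branchPt a p x (j + 1)) → ((v : ℂ) ∈ Γ z (j + 1) ↔ (v' : ℂ) ∈ Γ z (j + 1)) := by
    intro c hc v v' hv hv'
    refine S.mem_Γ_iff_of_isPreconnected hz (by omega)
      (isPreconnected_between c 0 (c * branchPt a p x (j + 1)) 0)
      (fun u hu h => ?_) (fun h => by omega) ⟨by linarith, by simp⟩ ⟨by linarith, by simp⟩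
    rw [h] at hu; exact lt_irrefl _ hu.1
  rcases lt_trichotomy (e * (v - branchPt a p x (j + 1))) 0 with h | h | h
  · obtain ⟨v', h3, h4, -⟩ := exists_side hnear (neg_ne_zero.2 he0) one_pos
    exact iff_of_true ((hside (-e) (neg_ne_zero.2 he0) v v' (by linarith) h4).2
      (h3.2 (by linarith))) h.le
  · have : v = branchPt a p x (j + 1) := by
      rcases mul_eq_zero.1 h with h3 | h3
      · exact absurd h3 he0
      · linarith
    exact iff_of_true (by rw [this]; exact S.branchPt_mem_Γ hz (by omega) h2) h.le
  · obtain ⟨v', h3, h4, -⟩ := exists_side hnear he0 one_pos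
    exact iff_of_false (fun h5 => h3.1 h4 ((hside e he0 v v' h h4).1 h5)) (not_le.2 h)

/-- For large `l` the first root is small while the second one is bounded below. -/
theorem exists_bound_Γ_one (S : CritSetup a p x s) (hz : IsRootLabelling a p z) :
    ∃ B, ∀ l ∈ Γ z 1, ‖l‖ < B := by
  obtain ⟨K, hK, h1⟩ := exists_norm_first_le (a := a) S.a_ne_zero S.one_le
  obtain ⟨M, hM, h2⟩ := exists_le_norm_pow (a := a) S.a_ne_zero S.one_le
  refine ⟨K + M, fun l hl => ?_⟩
  by_contra hcon
  push Not at hcon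
  have h3 := h1 l _ (hz.isLab l)
  have h4 := h2 l _ (hz.isLab l) 1 le_rfl S.one_le
  have h5 : ‖z 0 l‖ = ‖z 1 l‖ := hl
  simp only [← h5] at h4
  have h6 : ‖z 0 l‖ ≤ 1 := by
    by_contra h7
    push Not at h7
    have : (1 + ‖l‖) * 1 ≤ (1 + ‖l‖) * ‖z 0 l‖ :=
      mul_le_mul_of_nonneg_left h7.le (by linarith [norm_nonneg l])
    linarith
  have h7 : ‖z 0 l‖ ^ p ≤ 1 := pow_le_one₀ (norm_nonneg _) h6
  have : M * ‖z 0 l‖ ^ p ≤ M * 1 := mul_le_mul_of_nonneg_left h7 hM.le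
  linarith

/-- `Γ_1` is the interval between the branch points `λ_1` and `λ_{p+1}`. -/
theorem mem_Γ_one_iff (S : CritSetup a p x s) (hz : IsRootLabelling a p z) :
    s * branchPt a p x (p + 1) < s * branchPt a p x 1 ∧ ∀ v : ℝ, (v : ℂ) ∈ Γ z 1 ↔
      s * branchPt a p x (p + 1) ≤ s * v ∧ s * v ≤ s * branchPt a p x 1 := by
  have hs0 : s ≠ 0 := by rcases S.sign with h | h <;> rw [h] <;> norm_num
  have habs : |s| = 1 := by rcases S.sign with h | h <;> rw [h] <;> simp
  set b := branchPt a p x 1 with hb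
  set b' := branchPt a p x (p + 1) with hb'
  have hp := S.one_le
  have hm : 1 ∈ Finset.Icc 1 (p + 1) := Finset.mem_Icc.2 ⟨by omega, by omega⟩
  have hm' : p + 1 ∈ Finset.Icc 1 (p + 1) := Finset.mem_Icc.2 ⟨by omega, by omega⟩
  have hnear := S.eventually_mem_Γ_iff_near_branchPt hz hm (show 0 < p by omega)
    (S.double_index hz le_rfl hp) S.curv_first
  have hnear' := S.eventually_mem_Γ_iff_near_branchPt hz hm' (show 0 < p by omega)
    (S.double_index_last hz) S.curv_last
  simp only [← hb, ← hb', zero_add] at hnear hnear'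
  have hconn : ∀ c : ℝ, ∀ n : ℕ, ∀ u w : ℝ, (∀ v, u < c * v → (1 ≤ n → c * v < w) → v ≠ b ∧ v ≠ b') →
      ∀ v v' : ℝ, u < c * v → (1 ≤ n → c * v < w) → u < c * v' → (1 ≤ n → c * v' < w) →
      ((v : ℂ) ∈ Γ z 1 ↔ (v' : ℂ) ∈ Γ z 1) := by
    intro c n u w h v v' h1 h2 h3 h4
    exact S.mem_Γ_iff_of_isPreconnected hz (k := 0) (by omega) (isPreconnected_between c n u w)
      (fun t ht => (h t ht.1 ht.2).1) (fun _ t ht => (h t ht.1 ht.2).2) ⟨h1, h2⟩ ⟨h3, h4⟩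
  obtain ⟨B, hB⟩ := S.exists_bound_Γ_one hz
  have hfar : ∀ v : ℝ, B ≤ |v| → (v : ℂ) ∉ Γ z 1 := by
    intro v hv h
    have := hB v h
    rw [Complex.norm_real, Real.norm_eq_abs] at this
    linarith
  have hss := S.sign_mul_self
  -- A half-line free of branch points lies wholly in `Γ_1` or in its complement, and `Γ_1` is
  -- bounded.
  have hout : ∀ c : ℝ, (c = s ∨ c = -s) → ∀ u : ℝ, (∀ v, u < c * v → v ≠ b ∧ v ≠ b') → ∀ v : ℝ,
      u < c * v → (v : ℂ) ∉ Γ z 1 := by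
    intro c hc u h v hv hmem
    have hcc : c * c = 1 := by rcases hc with rfl | rfl <;> linarith
    have hca : |c| = 1 := by rcases hc with rfl | rfl <;> simp [habs]
    have h1 : u < c * (c * (|u| + |B| + 1)) := by
      rw [← mul_assoc, hcc, one_mul]; linarith [le_abs_self u, abs_nonneg B]
    have h2 := (hconn c 0 u 0 (fun v h1 _ => h v h1) v (c * (|u| + |B| + 1)) hv (by simp) h1
      (by simp)).1 hmem
    refine hfar _ ?_ h2
    rw [abs_mul, hca, one_mul, abs_of_pos (by positivity)]
    linarith [le_abs_self B, abs_nonneg u]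
  -- In the reverse order the half-line on the `Γ_1` side of `λ_1` would contain no branch point and
  -- hence miss `Γ_1`, although `Γ_1` contains points next to `λ_1` there.
  have hlt : s * b' < s * b := by
    by_contra hcon
    push Not at hcon
    -- the points beyond `b'` are in no special position
    obtain ⟨v, h1, h2, -⟩ := exists_side hnear (neg_ne_zero.2 hs0) one_pos
    refine hout (-s) (Or.inr rfl) (-s * b) (fun v hv => ⟨?_, ?_⟩) v (by linarith) (h1.2 (by linarith))
    · rintro rfl; exact lt_irrefl _ hv
    · rintro rfl; linarith
  refine ⟨hlt, fun v => ?_⟩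
  rcases lt_trichotomy (s * v) (s * b') with h | h | h
  · refine iff_of_false (hout (-s) (Or.inr rfl) (-s * b') (fun v hv => ⟨?_, ?_⟩) v (by linarith))
      fun h' => by linarith [h'.1]
    · rintro h; rw [h] at hv; linarith
    · rintro h; rw [h] at hv; linarith
  · have : v = b' := mul_left_cancel₀ hs0 h
    rw [this]
    refine iff_of_true ?_ ⟨le_rfl, hlt.le⟩
    obtain ⟨d1, d2⟩ := S.double_index_last hz
    rw [Γ, Set.mem_ofPred_eq, Nat.sub_self, d1, d2]
  rcases lt_trichotomy (s * v) (s * b) with h' | h' | h'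
  · refine iff_of_true ?_ ⟨h.le, h'.le⟩
    obtain ⟨v', h1, h2, h3⟩ := exists_side hnear (neg_ne_zero.2 hs0) (sub_pos.2 hlt)
    refine (hconn s 1 (s * b') (s * b) (fun v h1 h2 => ⟨?_, ?_⟩) v v' h (fun _ => h') (by linarith)
      (fun _ => by linarith)).2 (h1.2 (by linarith))
    · intro h; rw [h] at h2; exact lt_irrefl _ (h2 le_rfl)
    · intro h; rw [h] at h1; exact lt_irrefl _ h1
  · have : v = b := mul_left_cancel₀ hs0 h'
    rw [this]
    exact iff_of_true (S.branchPt_mem_Γ hz le_rfl hp) ⟨hlt.le, le_rfl⟩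
  · refine iff_of_false (hout s (Or.inl rfl) (s * b) (fun v hv => ⟨?_, ?_⟩) v h')
      fun h' => by linarith [h'.2]
    · intro h; rw [h] at hv; exact lt_irrefl _ hv
    · intro h; rw [h] at hv; linarith

/-- The local extrema of `r` at the critical points and the half-lines `Γ_k`. -/
theorem localExtr_and_Γ (S : CritSetup a p x s) (hz : IsRootLabelling a p z) {k : ℕ} (h1 : 2 ≤ k)
    (h2 : k ≤ p) :
    (IsLocalMax (r a p) (x k) ∨ IsLocalMin (r a p) (x k)) ∧
      (IsLocalMax (r a p) (x k) →
        Γ z k = (fun t : ℝ => (t : ℂ)) '' Set.Ici (branchPt a p x k)) ∧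
      (IsLocalMin (r a p) (x k) →
        Γ z k = (fun t : ℝ => (t : ℂ)) '' Set.Iic (branchPt a p x k)) := by
  have hm : k ∈ Finset.Icc 1 (p + 1) := Finset.mem_Icc.2 ⟨by omega, by omega⟩
  obtain ⟨e, he, hc⟩ := S.exists_sign_curv hm
  have h3 := S.eventually_above hm hc
  have hΓ := S.mem_Γ_iff hz h1 h2 hc
  have hex : ∀ {P : ℝ → Prop}, (∀ᶠ w in 𝓝 (x k), P w) → ∃ w, P w ∧ w ≠ x k := fun h => by
    obtain ⟨w, h4, h5⟩ := ((h.filter_mono (nhdsWithin_le_nhds (s := {x k}ᶜ))).and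
      self_mem_nhdsWithin).exists
    exact ⟨w, h4, h5⟩
  rcases he with rfl | rfl
  · refine ⟨Or.inr ?_, fun hmax => ?_, fun _ => S.Γ_eq_image hz (by omega) h2 fun v => ?_⟩
    · filter_upwards [h3] with w hw
      by_cases hwx : w = x k
      · rw [hwx]
      · have := hw hwx; rw [branchPt] at this; linarith
    · exfalso
      obtain ⟨w, ⟨h4, h5⟩, h6⟩ := hex (h3.and hmax)
      have := h4 h6
      rw [branchPt] at this
      linarith
    · rw [hΓ, Set.mem_Iic]; constructor <;> intro h <;> linarith
  · refine ⟨Or.inl ?_, fun _ => S.Γ_eq_image hz (by omega) h2 fun v => ?_, fun hmin => ?_⟩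
    · filter_upwards [h3] with w hw
      by_cases hwx : w = x k
      · rw [hwx]
      · have := hw hwx; rw [branchPt] at this; linarith
    · rw [hΓ, Set.mem_Ici]; constructor <;> intro h <;> linarith
    · exfalso
      obtain ⟨w, ⟨h4, h5⟩, h6⟩ := hex (h3.and hmin)
      have := h4 h6
      rw [branchPt] at this
      linarith

end CritSetup

/-! ### Boundary values of the roots -/

/-- The open upper half-plane. -/
def upperHP : Set ℂ := {l | 0 < l.im}

theorem isOpen_upperHP : IsOpen upperHP := isOpen_lt continuous_const Complex.continuous_im

theorem convex_upperHP : Convex ℝ upperHP := convex_halfSpace_im_gt 0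

/-- The sign of the imaginary part of the root of index `i` on the upper half-plane. -/
def imSign (z : ℕ → ℂ → ℂ) (i : ℕ) : ℝ := if 0 < (z i Complex.I).im then 1 else -1

/-- The root of index `i` on the upper half-plane, extended to the real line by continuity and to the
lower half-plane by reflection. -/
def up (z : ℕ → ℂ → ℂ) (i : ℕ) (l : ℂ) : ℂ := ⟨(z i l).re, imSign z i * |(z i l).im|⟩

theorem abs_imSign (z : ℕ → ℂ → ℂ) (i : ℕ) : |imSign z i| = 1 := by
  rw [imSign]; split_ifs <;> simp

theorem imSign_mul_self (z : ℕ → ℂ → ℂ) (i : ℕ) : imSign z i * imSign z i = 1 := by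
  rw [imSign]; split_ifs <;> simp

theorem up_eq_or (z : ℕ → ℂ → ℂ) (i : ℕ) (l : ℂ) :
    up z i l = z i l ∨ up z i l = (starRingEnd ℂ) (z i l) := by
  have h : imSign z i * |(z i l).im| = (z i l).im ∨ imSign z i * |(z i l).im| = -(z i l).im := by
    rw [imSign]
    split_ifs <;> rcases abs_choice (z i l).im with h | h <;> rw [h] <;> simp
  rcases h with h | h
  · left; exact Complex.ext rfl h
  · right; exact Complex.ext (by simp [up]) (by simpa [up] using h)

theorem norm_up (z : ℕ → ℂ → ℂ) (i : ℕ) (l : ℂ) : ‖up z i l‖ = ‖z i l‖ := by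
  rcases up_eq_or z i l with h | h <;> rw [h]
  simp

namespace CritSetup

variable {a x : ℕ → ℝ} {p : ℕ} {s : ℝ} {z : ℕ → ℂ → ℂ}

theorem im_root_ne_zero (S : CritSetup a p x s) (hz : IsRootLabelling a p z) {i : ℕ} (hi : i ≤ p)
    {l : ℂ} (hl : l.im ≠ 0) : (z i l).im ≠ 0 := by
  intro h
  have h1 := (hz.isLab l).rC_inv S.one_le S.a_ne_zero hi
  have h2 := ((hz.isLab l).conj S.one_le S.a_ne_zero).rC_inv S.one_le S.a_ne_zero hi
  rw [Complex.conj_eq_iff_im.2 h, h1] at h2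
  exact hl (Complex.conj_eq_iff_im.1 h2.symm)

/-- The alternative is a conjugate root; as `r` commutes with conjugation, the parameter would then
be real. -/
theorem eq_of_norm_eq_of_im_ne_zero (S : CritSetup a p x s) (hz : IsRootLabelling a p z) {i : ℕ}
    (hi : i ≤ p) {l : ℂ} (hl : l.im ≠ 0) {y : ℂ} (hy : (symbolPoly a p l).eval y = 0)
    (hn : ‖y‖ = ‖z i l‖) : y = z i l := by
  have hL := hz.isLab l
  rcases S.eq_or_conj (hL.eval_zero S.one_le S.a_ne_zero hi) hy hn.symm with h | h
  · exact h
  · exfalso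
    have h1 := eval_symbolPoly_conj a p ((starRingEnd ℂ) l) (z i l)
    rw [Complex.conj_conj, ← h, hy] at h1
    have h2 := (map_eq_zero (starRingEnd ℂ)).1 h1.symm
    have h0 := hL.ne_zero S.one_le S.a_ne_zero hi
    have e1 := (eval_symbolPoly_eq_zero_iff h0).1 h2
    have e2 := hL.rC_inv S.one_le S.a_ne_zero hi
    exact hl (Complex.conj_eq_iff_im.1 (e1.symm.trans e2))

theorem continuousAt_root_of_im_ne_zero (S : CritSetup a p x s) (hz : IsRootLabelling a p z) {i : ℕ}
    (hi : i ≤ p) {l : ℂ} (hl : l.im ≠ 0) : ContinuousAt (z i) l :=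
  continuousAt_root S.one_le S.a_ne_zero hz hi fun _ hy hn =>
    S.eq_of_norm_eq_of_im_ne_zero hz hi hl hy hn

theorem root_conj (S : CritSetup a p x s) (hz : IsRootLabelling a p z) {i : ℕ}
    (hi : i ≤ p) {l : ℂ} (hl : l.im ≠ 0) : z i ((starRingEnd ℂ) l) = (starRingEnd ℂ) (z i l) := by
  have hL := (hz.isLab l).conj S.one_le S.a_ne_zero
  exact (S.eq_of_norm_eq_of_im_ne_zero hz hi (by simpa using hl)
    (hL.eval_zero S.one_le S.a_ne_zero hi) (hL.norm_eq (hz.isLab _) hi)).symm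

theorem imSign_mul_im_pos (S : CritSetup a p x s) (hz : IsRootLabelling a p z) {i : ℕ} (hi : i ≤ p)
    {l : ℂ} (hl : 0 < l.im) : 0 < imSign z i * (z i l).im := by
  have hcont : ContinuousOn (fun l => (z i l).im) upperHP := fun l hl =>
    (Complex.continuous_im.continuousAt.comp
      (S.continuousAt_root_of_im_ne_zero hz hi (ne_of_gt hl))).continuousWithinAt
  have hne : ∀ l ∈ upperHP, (z i l).im ≠ 0 := fun l hl => S.im_root_ne_zero hz hi (ne_of_gt hl)
  have hI : Complex.I ∈ upperHP := by simp [upperHP]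
  rw [imSign]
  split_ifs with h
  · rw [one_mul]
    by_contra hcon
    push Not at hcon
    obtain ⟨y, hy, h1⟩ := convex_upperHP.isPreconnected.intermediate_value hl hI hcont
      ⟨hcon, h.le⟩
    exact hne y hy h1
  · push Not at h
    by_contra hcon
    push Not at hcon
    obtain ⟨y, hy, h1⟩ := convex_upperHP.isPreconnected.intermediate_value hI hl hcont
      ⟨h, show 0 ≤ (z i l).im by linarith⟩
    exact hne y hy h1

theorem up_eq (S : CritSetup a p x s) (hz : IsRootLabelling a p z) {i : ℕ} (hi : i ≤ p) {l : ℂ}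
    (hl : 0 < l.im) : up z i l = z i l := by
  refine Complex.ext rfl ?_
  have h := S.imSign_mul_im_pos hz hi hl
  change imSign z i * |(z i l).im| = (z i l).im
  have h1 : |(z i l).im| = imSign z i * (z i l).im := by
    rw [← abs_of_pos h, abs_mul, abs_imSign, one_mul]
  rw [h1, ← mul_assoc, imSign_mul_self, one_mul]

theorem up_conj (S : CritSetup a p x s) (hz : IsRootLabelling a p z) {i : ℕ} (hi : i ≤ p) {l : ℂ}
    (hl : l.im < 0) : z i l = (starRingEnd ℂ) (up z i ((starRingEnd ℂ) l)) := by
  rw [S.up_eq hz hi (by simpa using hl), ← S.root_conj hz hi (by simpa using hl.ne),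
    Complex.conj_conj]

/-- At a real point the limit of a root can differ from the labelled root only by conjugation, which
neither the real part nor the absolute value of the imaginary part sees; the constant sign `imSign`
selects the branch. -/
theorem continuous_up (S : CritSetup a p x s) (hz : IsRootLabelling a p z) {i : ℕ} (hi : i ≤ p) :
    Continuous (up z i) := by
  rw [continuous_iff_ultrafilter]
  intro l U hU
  obtain ⟨ζ, hζ, hlim⟩ := exists_isLab_of_ultrafilter S.one_le S.a_ne_zero hz U hU
  have hL := hz.isLab l
  have hre : Tendsto (fun l => (z i l).re) U (𝓝 (z i l).re) := by
    have := (Complex.continuous_re.tendsto _).comp (hlim i hi)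
    rcases S.eq_or_conj (hL.eval_zero S.one_le S.a_ne_zero hi)
      (hζ.eval_zero S.one_le S.a_ne_zero hi) (hL.norm_eq hζ hi) with h | h <;> rw [h] at this
    · exact this
    · simpa [Function.comp_def] using this
  have him : Tendsto (fun l => |(z i l).im|) U (𝓝 |(z i l).im|) := by
    have := ((Complex.continuous_im.tendsto _).comp (hlim i hi)).abs
    rcases S.eq_or_conj (hL.eval_zero S.one_le S.a_ne_zero hi)
      (hζ.eval_zero S.one_le S.a_ne_zero hi) (hL.norm_eq hζ hi) with h | h <;> rw [h] at this
    · exact this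
    · simpa using this
  have h1 := ((Complex.continuous_ofReal.tendsto _).comp hre).add
    (((Complex.continuous_ofReal.tendsto _).comp (him.const_mul (imSign z i))).mul_const Complex.I)
  have h2 : ∀ l, up z i l = ((z i l).re : ℂ) + ((imSign z i * |(z i l).im| : ℝ) : ℂ) * Complex.I :=
    fun l => by apply Complex.ext <;> simp [up]
  rw [h2]
  exact h1.congr fun l => (h2 l).symm

instance neBot_lower (v : ℝ) : (𝓝[{w : ℂ | w.im < 0}] (v : ℂ)).NeBot := by
  rw [← mem_closure_iff_nhdsWithin_neBot, Complex.closure_setOfPred_im_lt]; simp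

theorem neBot_upper (v : ℝ) : (𝓝[upperHP] (v : ℂ)).NeBot := by
  rw [← mem_closure_iff_nhdsWithin_neBot, upperHP, Complex.closure_setOfPred_lt_im]; simp

theorem tendsto_lower (S : CritSetup a p x s) (hz : IsRootLabelling a p z) {i : ℕ} (hi : i ≤ p)
    (v : ℝ) : Tendsto (z i) (𝓝[{w : ℂ | w.im < 0}] (v : ℂ)) (𝓝 ((starRingEnd ℂ) (up z i v))) := by
  have h1 : Continuous fun l => (starRingEnd ℂ) (up z i ((starRingEnd ℂ) l)) :=
    Complex.continuous_conj.comp ((S.continuous_up hz hi).comp Complex.continuous_conj)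
  have h2 := (h1.tendsto (v : ℂ)).mono_left (nhdsWithin_le_nhds (s := {w : ℂ | w.im < 0}))
  rw [Complex.conj_ofReal] at h2
  refine h2.congr' ?_
  filter_upwards [self_mem_nhdsWithin] with l hl
  exact (S.up_conj hz hi hl).symm

theorem lowerValue_eq (S : CritSetup a p x s) (hz : IsRootLabelling a p z) {i : ℕ} (hi : i ≤ p)
    (v : ℝ) : lowerValue (z i) v = (starRingEnd ℂ) (up z i v) :=
  (S.tendsto_lower hz hi v).limUnder_eq

/-- On the real line the values of `up` are limits from the upper half-plane, and limits of
labellings are labellings. -/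
theorem isLab_up (S : CritSetup a p x s) (hz : IsRootLabelling a p z) {l : ℂ} (hl : 0 ≤ l.im) :
    IsLab a p l fun i => up z i l := by
  rcases hl.lt_or_eq with hl | hl
  · have h1 := hz.isLab l
    rw [isLab_iff S.one_le S.a_ne_zero] at h1 ⊢
    refine ⟨fun y => ?_, fun i hi => by rw [norm_up, norm_up]; exact h1.2 i hi⟩
    rw [h1.1]
    congr 1
    refine Finset.prod_congr rfl fun i hi => ?_
    rw [Finset.mem_range] at hi
    rw [S.up_eq hz (by omega) hl]
  · obtain ⟨v, rfl⟩ : ∃ v : ℝ, l = v := ⟨l.re, by apply Complex.ext <;> simp [← hl]⟩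
    have := neBot_upper v
    obtain ⟨ζ, hζ, hlim⟩ := exists_isLab_of_ultrafilter S.one_le S.a_ne_zero hz
      (Ultrafilter.of (𝓝[upperHP] (v : ℂ)))
      ((Ultrafilter.of_le _).trans nhdsWithin_le_nhds)
    have h1 : ∀ i ≤ p, up z i v = ζ i := by
      intro i hi
      refine tendsto_nhds_unique (((S.continuous_up hz hi).tendsto (v : ℂ)).mono_left
        ((Ultrafilter.of_le _).trans nhdsWithin_le_nhds)) ((hlim i hi).congr' ?_)
      have h2 : ∀ᶠ l in 𝓝[upperHP] (v : ℂ), z i l = up z i l := by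
        filter_upwards [self_mem_nhdsWithin] with l hl using (S.up_eq hz hi hl).symm
      exact Ultrafilter.of_le _ h2
    rw [isLab_iff S.one_le S.a_ne_zero] at hζ ⊢
    refine ⟨fun y => ?_, fun i hi => by rw [norm_up, norm_up]; exact hz.norm_le _ i hi⟩
    rw [hζ.1]
    congr 1
    refine Finset.prod_congr rfl fun i hi => ?_
    rw [Finset.mem_range] at hi
    rw [h1 i (by omega)]

/-- The function `r` is a left inverse of `l ↦ 1 / z_i(l)`, and `r'` does not vanish at nonreal
points because all critical points are real. -/
theorem differentiableOn_up (S : CritSetup a p x s) (hz : IsRootLabelling a p z) {i : ℕ}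
    (hi : i ≤ p) : DifferentiableOn ℂ (up z i) upperHP := by
  intro l hl
  refine DifferentiableAt.differentiableWithinAt ?_
  have hl0 : l.im ≠ 0 := ne_of_gt hl
  have h0 : ∀ l, z i l ≠ 0 := fun l => (hz.isLab l).ne_zero S.one_le S.a_ne_zero hi
  have hw : (z i l)⁻¹ ≠ 0 := inv_ne_zero (h0 l)
  have hd : wrDeriv a p (z i l)⁻¹ / (z i l)⁻¹ ≠ 0 := by
    refine div_ne_zero (fun h => ?_) hw
    have h1 := pow_mul_wrDeriv S.q_eq hw
    rw [h, mul_zero] at h1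
    obtain ⟨k, -, h2⟩ := Finset.prod_eq_zero_iff.1 h1.symm
    refine S.im_root_ne_zero hz hi hl0 ?_
    rw [sub_eq_zero, inv_eq_iff_eq_inv] at h2
    rw [h2, ← Complex.ofReal_inv]; exact Complex.ofReal_im _
  have h1 : HasDerivAt (fun l => (z i l)⁻¹) (wrDeriv a p (z i l)⁻¹ / (z i l)⁻¹)⁻¹ l :=
    HasDerivAt.of_local_left_inverse ((S.continuousAt_root_of_im_ne_zero hz hi hl0).inv₀ (h0 l))
      (hasDerivAt_rC a p hw) hd
      (Eventually.of_forall fun l => (hz.isLab l).rC_inv S.one_le S.a_ne_zero hi)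
  have h2 : DifferentiableAt ℂ (fun l => ((z i l)⁻¹)⁻¹) l := h1.differentiableAt.inv hw
  refine h2.congr_of_eventuallyEq ?_
  filter_upwards [isOpen_upperHP.mem_nhds hl] with l' hl'
  rw [inv_inv, S.up_eq hz hi hl']

/-- On `Γ_{k+1}` the boundary values of the two roots in question are conjugate. -/
theorem up_succ_of_mem_Γ (S : CritSetup a p x s) (hz : IsRootLabelling a p z) {v : ℝ} {k : ℕ}
    (hk : k < p) (h : (v : ℂ) ∈ Γ z (k + 1)) : up z (k + 1) v = (starRingEnd ℂ) (up z k v) := by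
  have hL := S.isLab_up hz (l := v) (by simp)
  have h1 : ‖up z k v‖ = ‖up z (k + 1) v‖ := by rw [norm_up, norm_up]; exact h
  rcases S.eq_or_conj (hL.eval_zero S.one_le S.a_ne_zero hk.le) (hL.eval_zero S.one_le S.a_ne_zero hk)
    h1 with h2 | h2
  · obtain ⟨m, -, h3⟩ := S.exists_crit_of_eq hL hk.le hk (Nat.succ_ne_self k).symm h2.symm
    change up z k v = _ at h3
    rw [h2, h3, ← Complex.ofReal_inv, Complex.conj_ofReal]
  · exact h2

/-- At a common point two successive conjugations give `z_k = z_{k+2}`. This double root is real, so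
it also equals `z_{k+1}` and would be triple. -/
theorem Γ_disjoint (S : CritSetup a p x s) (hz : IsRootLabelling a p z) {l : ℂ} {k : ℕ}
    (hk : k + 1 < p) (h : l ∈ Γ z (k + 1)) : l ∉ Γ z (k + 2) := by
  intro h'
  have hv := S.Γ_subset_real hz (by omega) h
  obtain ⟨v, rfl⟩ : ∃ v : ℝ, l = v := ⟨l.re, by apply Complex.ext <;> simp [hv]⟩
  have hL := S.isLab_up hz (l := v) (by simp)
  have h1 := S.up_succ_of_mem_Γ hz (by omega) h
  have h2 := S.up_succ_of_mem_Γ hz (by omega) h'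
  rw [h1, Complex.conj_conj] at h2
  obtain ⟨m, -, h3⟩ := S.exists_crit_of_eq hL (show k ≤ p by omega) (show k + 2 ≤ p by omega)
    (by omega) h2.symm
  change up z k v = _ at h3
  have h4 : up z (k + 1) v = up z k v := by
    rw [h1, h3, ← Complex.ofReal_inv, Complex.conj_ofReal]
  exact S.not_three hL (show k ≤ p by omega) (show k + 1 ≤ p by omega) (show k + 2 ≤ p by omega)
    (by omega) (by omega) (by omega) h4.symm h2.symm

theorem imSign_mul_im_up_pos (S : CritSetup a p x s) (hz : IsRootLabelling a p z) {v : ℝ} {k : ℕ}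
    (hk : k < p) (h : (v : ℂ) ∈ Γ z (k + 1)) (h1 : v ≠ branchPt a p x (k + 1))
    (h2 : k = 0 → v ≠ branchPt a p x (p + 1)) : 0 < imSign z k * (up z k v).im := by
  obtain ⟨-, h3, -⟩ := S.conj_of_mem_Γ hz hk h (by exact_mod_cast h1) fun h => by
    exact_mod_cast h2 h
  change 0 < imSign z k * (imSign z k * |(z k v).im|)
  rw [← mul_assoc, imSign_mul_self, one_mul]
  exact abs_pos.2 h3

end CritSetup

/-! ### Cauchy's theorem and formula for the upper half-plane -/

theorem ofReal_add_mul_I_mem {t y : ℝ} (hy : 0 < y) : (t + y * Complex.I : ℂ) ∈ upperHP := by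
  simp [upperHP, hy]

theorem integrable_horizontal {Φ : ℂ → ℂ} {g : ℝ → ℝ} {b : ℝ} (hd : DifferentiableOn ℂ Φ upperHP)
    (hg : Integrable g) (hbd : ∀ l ∈ upperHP, l.re ≠ b → ‖Φ l‖ ≤ g l.re) {y : ℝ} (hy : 0 < y) :
    Integrable fun t : ℝ => Φ (t + y * Complex.I) := by
  refine hg.mono' ?_ ?_
  · refine Continuous.aestronglyMeasurable ?_
    exact hd.continuousOn.comp_continuous (by fun_prop) fun t => ofReal_add_mul_I_mem hy
  · filter_upwards [Measure.ae_ne volume b] with t ht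
    simpa using hbd _ (ofReal_add_mul_I_mem (t := t) hy) (by simpa using ht)

/-- Cauchy's theorem on the rectangle `[-R, R] × [y₁, y₂]`; the vertical sides vanish in the limit
because `g` tends to zero. Leaving out the line `re = b` allows a majorant that is singular at `b`.
-/
theorem integral_horizontal_eq {Φ : ℂ → ℂ} {g : ℝ → ℝ} {b : ℝ} (hd : DifferentiableOn ℂ Φ upperHP)
    (hg : Integrable g) (hbd : ∀ l ∈ upperHP, l.re ≠ b → ‖Φ l‖ ≤ g l.re)
    (hT : Tendsto g atTop (𝓝 0)) (hB : Tendsto g atBot (𝓝 0)) {y₁ y₂ : ℝ} (hy₁ : 0 < y₁)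
    (hy : y₁ ≤ y₂) :
    ∫ t : ℝ, Φ (t + y₁ * Complex.I) = ∫ t : ℝ, Φ (t + y₂ * Complex.I) := by
  have hy₂ := hy₁.trans_le hy
  have hlim : ∀ y : ℝ, 0 < y → Tendsto (fun R : ℝ => ∫ t in (-R)..R, Φ (t + y * Complex.I)) atTop
      (𝓝 (∫ t : ℝ, Φ (t + y * Complex.I))) := fun y hy =>
    intervalIntegral_tendsto_integral (integrable_horizontal hd hg hbd hy) tendsto_neg_atTop_atBot
      tendsto_id
  have hrect : ∀ R : ℝ, (∫ t in (-R)..R, Φ (t + y₁ * Complex.I)) -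
      (∫ t in (-R)..R, Φ (t + y₂ * Complex.I)) =
      -(Complex.I • ∫ y in y₁..y₂, Φ (R + y * Complex.I)) +
        Complex.I • ∫ y in y₁..y₂, Φ ((-R : ℝ) + y * Complex.I) := by
    intro R
    have := Complex.integral_boundary_rect_eq_zero_of_differentiableOn Φ
      (⟨-R, y₁⟩ : ℂ) (⟨R, y₂⟩ : ℂ) (hd.mono fun l hl => ?_)
    · simp only at this
      linear_combination this
    · rw [Complex.mem_reProdIm, Set.uIcc_of_le hy] at hl
      exact hy₁.trans_le hl.2.1
  have hside : ∀ R : ℝ, R ≠ b → ‖∫ y in y₁..y₂, Φ (R + y * Complex.I)‖ ≤ g R * |y₂ - y₁| := by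
    intro R hR
    refine intervalIntegral.norm_integral_le_of_norm_le_const fun y hy' => ?_
    rw [Set.uIoc_of_le hy] at hy'
    simpa using hbd _ (ofReal_add_mul_I_mem (t := R) (hy₁.trans hy'.1)) (by simpa using hR)
  have h1 : Tendsto (fun R : ℝ => ∫ y in y₁..y₂, Φ (R + y * Complex.I)) atTop (𝓝 0) := by
    refine squeeze_zero_norm' ?_ (by simpa using hT.mul_const |y₂ - y₁|)
    filter_upwards [eventually_ne_atTop b] with R hR using hside R hR
  have h2 : Tendsto (fun R : ℝ => ∫ y in y₁..y₂, Φ ((-R : ℝ) + y * Complex.I)) atTop (𝓝 0) := by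
    have : Tendsto (fun R : ℝ => ∫ y in y₁..y₂, Φ (R + y * Complex.I)) atBot (𝓝 0) := by
      refine squeeze_zero_norm' ?_ (by simpa using hB.mul_const |y₂ - y₁|)
      filter_upwards [eventually_ne_atBot b] with R hR using hside R hR
    exact this.comp tendsto_neg_atTop_atBot
  have h3 := (hlim y₁ hy₁).sub (hlim y₂ hy₂)
  have h4 := (h1.const_smul Complex.I).neg.add (h2.const_smul Complex.I)
  rw [smul_zero, neg_zero, add_zero] at h4
  have := tendsto_nhds_unique h3 (h4.congr fun R => (hrect R).symm)
  exact sub_eq_zero.1 this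

/-- Cauchy's theorem for the upper half-plane. -/
theorem integral_boundary_eq_zero {Φ : ℂ → ℂ} {φ : ℝ → ℂ} {g : ℝ → ℝ} {b : ℝ}
    (hd : DifferentiableOn ℂ Φ upperHP)
    (hg : Integrable g) (hbd : ∀ l ∈ upperHP, l.re ≠ b → ‖Φ l‖ ≤ g l.re)
    (hT : Tendsto g atTop (𝓝 0)) (hB : Tendsto g atBot (𝓝 0))
    (htop : ∀ t : ℝ, t ≠ b → Tendsto (fun y : ℝ => Φ (t + y * Complex.I)) atTop (𝓝 0))
    (hφ : ∀ t : ℝ, t ≠ b → Tendsto (fun y : ℝ => Φ (t + y * Complex.I)) (𝓝[>] 0) (𝓝 (φ t))) :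
    ∫ t, φ t = 0 := by
  have hmeas : ∀ y : ℝ, 0 < y → AEStronglyMeasurable (fun t : ℝ => Φ (t + y * Complex.I)) volume :=
    fun y hy => (integrable_horizontal hd hg hbd hy).aestronglyMeasurable
  have hbound : ∀ y : ℝ, 0 < y → ∀ᵐ t : ℝ, ‖Φ (t + y * Complex.I)‖ ≤ g t := by
    intro y hy
    filter_upwards [Measure.ae_ne volume b] with t ht
    simpa using hbd _ (ofReal_add_mul_I_mem (t := t) hy) (by simpa using ht)
  -- Moving the line to infinity shows that all horizontal integrals vanish; moving it down to the
  -- boundary transfers this to `φ`. Both limits are dominated by `g`.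
  have h1 : Tendsto (fun y : ℝ => ∫ t : ℝ, Φ (t + y * Complex.I)) atTop (𝓝 (∫ t : ℝ, (0 : ℂ))) := by
    refine tendsto_integral_filter_of_dominated_convergence g ?_ ?_ hg ?_
    · filter_upwards [eventually_gt_atTop 0] with y hy using hmeas y hy
    · filter_upwards [eventually_gt_atTop 0] with y hy using hbound y hy
    · filter_upwards [Measure.ae_ne volume b] with t ht using htop t ht
  rw [integral_zero] at h1
  have h2 : ∀ y : ℝ, 0 < y → ∫ t : ℝ, Φ (t + y * Complex.I) = 0 := by
    intro y hy
    refine tendsto_nhds_unique (tendsto_const_nhds.congr' ?_) h1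
    filter_upwards [eventually_ge_atTop y] with y' hy'
    exact integral_horizontal_eq hd hg hbd hT hB hy hy'
  have h3 : Tendsto (fun y : ℝ => ∫ t : ℝ, Φ (t + y * Complex.I)) (𝓝[>] 0) (𝓝 (∫ t : ℝ, φ t)) := by
    refine tendsto_integral_filter_of_dominated_convergence g ?_ ?_ hg ?_
    · filter_upwards [self_mem_nhdsWithin] with y hy using hmeas y hy
    · filter_upwards [self_mem_nhdsWithin] with y hy using hbound y hy
    · filter_upwards [Measure.ae_ne volume b] with t ht using hφ t ht
  refine tendsto_nhds_unique h3 (tendsto_const_nhds.congr' ?_)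
  filter_upwards [self_mem_nhdsWithin] with y hy using (h2 y hy).symm

/-- The majorant `|t|^{-1/2} + |t|^{-θ}`. -/
def majorant (θ t : ℝ) : ℝ := |t| ^ (-(1 / 2 : ℝ)) + |t| ^ (-θ)

theorem majorant_nonneg (θ t : ℝ) : 0 ≤ majorant θ t := by unfold majorant; positivity

theorem majorant_anti {θ : ℝ} (hθ : 0 ≤ θ) {t t' : ℝ} (ht : t ≠ 0) (h : |t| ≤ |t'|) :
    majorant θ t' ≤ majorant θ t := by
  have h0 := abs_pos.2 ht
  exact add_le_add (Real.rpow_le_rpow_of_nonpos h0 h (by norm_num))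
    (Real.rpow_le_rpow_of_nonpos h0 h (by linarith))

theorem tendsto_majorant {θ : ℝ} (hθ : 0 < θ) {α : Type*} {F : Filter α} {f : α → ℝ}
    (hf : Tendsto (fun t => |f t|) F atTop) : Tendsto (fun t => majorant θ (f t)) F (𝓝 0) := by
  have := ((tendsto_rpow_neg_atTop (show (0 : ℝ) < 1 / 2 by norm_num)).comp hf).add
    ((tendsto_rpow_neg_atTop hθ).comp hf)
  simpa [majorant] using this

theorem integrable_rpow_div {θ : ℝ} (h0 : 0 < θ) (h1 : θ < 1) :
    Integrable fun t : ℝ => |t| ^ (-θ) / (1 + |t|) := by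
  have hloc : IntegrableOn (fun t : ℝ => |t| ^ (-θ) / (1 + |t|)) (Set.Ioi 0) := by
    rw [← Set.Ioc_union_Ioi_eq_Ioi (zero_le_one' ℝ)]
    refine IntegrableOn.union ?_ ?_
    · have h2 : IntegrableOn (fun t : ℝ => t ^ (-θ)) (Set.Ioc 0 1) := by
        have := intervalIntegral.intervalIntegrable_rpow' (a := 0) (b := 1) (r := -θ) (by linarith)
        rwa [intervalIntegrable_iff_integrableOn_Ioc_of_le zero_le_one] at this
      refine Integrable.mono' h2 ?_ ?_
      · exact Measurable.aestronglyMeasurable (by fun_prop)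
      · filter_upwards [ae_restrict_mem measurableSet_Ioc] with t ht
        rw [Real.norm_of_nonneg (by positivity), abs_of_pos ht.1]
        exact div_le_self (Real.rpow_nonneg ht.1.le _) (by linarith [ht.1])
    · refine Integrable.mono' (integrableOn_Ioi_rpow_of_lt (a := -θ - 1) (by linarith) one_pos) ?_ ?_
      · exact Measurable.aestronglyMeasurable (by fun_prop)
      · filter_upwards [ae_restrict_mem measurableSet_Ioi] with t ht
        have ht' : (0 : ℝ) < t := one_pos.trans ht
        rw [Real.norm_of_nonneg (by positivity), abs_of_pos ht', Real.rpow_sub ht', Real.rpow_one]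
        exact div_le_div_of_nonneg_left (Real.rpow_nonneg ht'.le _) ht' (by linarith)
  have hIic : IntegrableOn (fun t : ℝ => |t| ^ (-θ) / (1 + |t|)) (Set.Iic 0) := by
    rw [← Measure.map_neg_eq_self (volume : Measure ℝ)]
    let m : MeasurableEmbedding fun x : ℝ => -x := (Homeomorph.neg ℝ).measurableEmbedding
    rw [m.integrableOn_map_iff]
    simp_rw [Function.comp_def, abs_neg, Set.neg_preimage, Set.neg_Iic, neg_zero]
    exact Iff.mpr integrableOn_Ici_iff_integrableOn_Ioi hloc
  have := hIic.union hloc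
  rwa [Set.Iic_union_Ioi, integrableOn_univ] at this

theorem integrable_majorant_div {θ : ℝ} (h0 : 0 < θ) (h1 : θ < 1) (b : ℝ) :
    Integrable fun t : ℝ => majorant θ (t - b) / (1 + |t - b|) := by
  have h2 := (integrable_rpow_div (θ := 1 / 2) (by norm_num) (by norm_num)).add
    (integrable_rpow_div h0 h1)
  refine (h2.comp_sub_right b).congr (Eventually.of_forall fun t => ?_)
  simp only [majorant, Pi.add_apply, add_div]

theorem tendsto_majorant_div {θ : ℝ} (h0 : 0 < θ) (b : ℝ) {F : Filter ℝ}
    (hF : Tendsto (fun t => |t - b|) F atTop) :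
    Tendsto (fun t : ℝ => majorant θ (t - b) / (1 + |t - b|)) F (𝓝 0) := by
  have h1 := tendsto_majorant h0 hF
  refine squeeze_zero (fun t => div_nonneg (majorant_nonneg _ _) (by positivity)) (fun t => ?_) h1
  exact div_le_self (majorant_nonneg _ _) (by linarith [abs_nonneg (t - b)])

/-- The integrand is `2πi` times the Poisson kernel of the upper half-plane at `c`. -/
theorem integral_inv_mul_conj {c : ℂ} (hc : 0 < c.im) :
    ∫ t : ℝ, ((c - (starRingEnd ℂ) c) / ((t - (starRingEnd ℂ) c) * (t - c)) : ℂ) =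
      2 * Real.pi * Complex.I := by
  have h1 : ∀ t : ℝ, ((c - (starRingEnd ℂ) c) / ((t - (starRingEnd ℂ) c) * (t - c)) : ℂ) =
      2 * Complex.I * ((c.im⁻¹ * (1 + (c.im⁻¹ * (t - c.re)) ^ 2)⁻¹ : ℝ) : ℂ) := by
    intro t
    have e1 : (c - (starRingEnd ℂ) c : ℂ) = 2 * c.im * Complex.I := by
      apply Complex.ext <;> simp; ring
    have e2 : ((t - (starRingEnd ℂ) c) * (t - c) : ℂ) = (((t - c.re) ^ 2 + c.im ^ 2 : ℝ) : ℂ) := by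
      have e3 : (starRingEnd ℂ) c = c.re - c.im * Complex.I := by apply Complex.ext <;> simp
      have e4 : c = c.re + c.im * Complex.I := (Complex.re_add_im c).symm
      rw [e3]
      nth_rw 3 [e4]
      push_cast
      linear_combination (-(c.im : ℂ) ^ 2) * Complex.I_sq
    rw [e1, e2]
    have h2 : c.im⁻¹ * (1 + (c.im⁻¹ * (t - c.re)) ^ 2)⁻¹ = c.im / ((t - c.re) ^ 2 + c.im ^ 2) := by
      have : (t - c.re) ^ 2 + c.im ^ 2 ≠ 0 := by positivity
      field_simp
      ring
    rw [h2]
    push_cast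
    ring
  simp only [h1]
  rw [integral_const_mul, integral_complex_ofReal, integral_const_mul,
    integral_sub_right_eq_self (fun t : ℝ => (1 + (c.im⁻¹ * t) ^ 2)⁻¹) c.re,
    Measure.integral_comp_mul_left (fun t : ℝ => (1 + t ^ 2)⁻¹) c.im⁻¹, integral_univ_inv_one_add_sq,
    inv_inv, abs_of_pos hc, smul_eq_mul, inv_mul_cancel_left₀ hc.ne']
  ring

section CauchyFormula

variable {G : ℂ → ℂ} {φ : ℝ → ℂ} {C b θ : ℝ}

theorem norm_boundary_le
    (hbd : ∀ l ∈ upperHP, ‖G l‖ ≤ C * majorant θ ‖l - b‖)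
    (hφ : ∀ t : ℝ, t ≠ b → Tendsto (fun y : ℝ => G (t + y * Complex.I)) (𝓝[>] 0) (𝓝 (φ t))) {t : ℝ}
    (ht : t ≠ b) : ‖φ t‖ ≤ C * majorant θ (t - b) := by
  have h1 : ContinuousAt (fun y : ℝ => C * majorant θ ‖(t + y * Complex.I : ℂ) - b‖) 0 := by
    have h0 : |‖(t + (0 : ℝ) * Complex.I : ℂ) - b‖| ≠ 0 := by
      rw [abs_norm, norm_ne_zero_iff]
      simpa [sub_eq_zero] using ht
    unfold majorant
    refine continuousAt_const.mul (ContinuousAt.add ?_ ?_)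
    · exact ContinuousAt.rpow_const (by fun_prop) (Or.inl h0)
    · exact ContinuousAt.rpow_const (by fun_prop) (Or.inl h0)
  have h2 : majorant θ ‖(t + (0 : ℝ) * Complex.I : ℂ) - b‖ = majorant θ (t - b) := by
    rw [Complex.ofReal_zero, zero_mul, add_zero, ← Complex.ofReal_sub, Complex.norm_real,
      Real.norm_eq_abs, majorant, abs_abs, majorant]
  have h3 := h1.tendsto.mono_left (nhdsWithin_le_nhds (s := Set.Ioi 0))
  rw [h2] at h3
  refine le_of_tendsto_of_tendsto (hφ t ht).norm h3 ?_
  filter_upwards [self_mem_nhdsWithin] with y hy using hbd _ (ofReal_add_mul_I_mem hy)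

theorem aestronglyMeasurable_boundary (hd : ContinuousOn G upperHP)
    (hφ : ∀ t : ℝ, t ≠ b → Tendsto (fun y : ℝ => G (t + y * Complex.I)) (𝓝[>] 0) (𝓝 (φ t))) :
    AEStronglyMeasurable φ volume := by
  have hu : Tendsto (fun n : ℕ => 1 / ((n : ℝ) + 1)) atTop (𝓝[>] 0) :=
    tendsto_nhdsWithin_iff.2 ⟨tendsto_one_div_add_atTop_nhds_zero_nat,
      Eventually.of_forall fun n => Set.mem_Ioi.2 (by positivity)⟩
  refine aestronglyMeasurable_of_tendsto_ae atTop
    (f := fun (n : ℕ) (t : ℝ) => G (t + (1 / ((n : ℝ) + 1) : ℝ) * Complex.I)) (fun n => ?_) ?_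
  · refine Continuous.aestronglyMeasurable ?_
    exact hd.comp_continuous (by fun_prop) fun t => ofReal_add_mul_I_mem (by positivity)
  · filter_upwards [Measure.ae_ne volume b] with t ht
    exact (hφ t ht).comp hu

theorem one_add_abs_le {c l : ℂ} {m : ℝ} (hm : 0 < m) (hl : m ≤ ‖l - c‖) :
    1 + |l.re - b| ≤ ((1 + |c.re - b|) / m + 1) * ‖l - c‖ := by
  have h1 : |l.re - c.re| ≤ ‖l - c‖ := by simpa using Complex.abs_re_le_norm (l - c)
  have h3 : |l.re - b| ≤ |l.re - c.re| + |c.re - b| := abs_sub_le _ _ _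
  have h4 : (1 + |c.re - b|) / m * m ≤ (1 + |c.re - b|) / m * ‖l - c‖ :=
    mul_le_mul_of_nonneg_left hl (by positivity)
  rw [div_mul_cancel₀ _ hm.ne'] at h4
  linarith

theorem norm_div_le_majorant {c l u : ℂ} {m M : ℝ} (hm : 0 < m) (hl : m ≤ ‖l - c‖) (hu : ‖u‖ ≤ M) :
    ‖u / (l - c)‖ ≤ ((1 + |c.re - b|) / m + 1) * (M / (1 + |l.re - b|)) := by
  have hpos : 0 < ‖l - c‖ := hm.trans_le hl
  have h0 : 0 ≤ M := (norm_nonneg _).trans hu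
  rw [norm_div, div_le_iff₀ hpos]
  calc ‖u‖ ≤ M := hu
    _ = M / (1 + |l.re - b|) * (1 + |l.re - b|) := by rw [div_mul_cancel₀]; positivity
    _ ≤ M / (1 + |l.re - b|) * (((1 + |c.re - b|) / m + 1) * ‖l - c‖) :=
        mul_le_mul_of_nonneg_left (one_add_abs_le hm hl) (by positivity)
    _ = _ := by ring

theorem tendsto_abs_sub_atTop (b : ℝ) : Tendsto (fun t : ℝ => |t - b|) atTop atTop :=
  tendsto_abs_atTop_atTop.comp (tendsto_atTop_add_const_right _ (-b) tendsto_id)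

theorem tendsto_abs_sub_atBot (b : ℝ) : Tendsto (fun t : ℝ => |t - b|) atBot atTop :=
  tendsto_abs_atBot_atTop.comp (tendsto_atBot_add_const_right _ (-b) tendsto_id)

theorem tendsto_norm_vertical (t : ℝ) (c : ℂ) :
    Tendsto (fun y : ℝ => ‖(t + y * Complex.I : ℂ) - c‖) atTop atTop := by
  refine tendsto_atTop_mono (fun y => ?_) (tendsto_atTop_add_const_right _ (-c.im) tendsto_id)
  have := Complex.im_le_norm ((t + y * Complex.I : ℂ) - c)
  simpa using this

theorem norm_ge_of_im {c l : ℂ} (hl : 0 ≤ l.im) :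
    c.im ≤ ‖l - (starRingEnd ℂ) c‖ := by
  have := Complex.im_le_norm (l - (starRingEnd ℂ) c)
  simp only [Complex.sub_im, Complex.conj_im, sub_neg_eq_add] at this
  linarith

theorem integrable_div_sub (hθ : 0 < θ) (hθ1 : θ < 1) (hmeas : AEStronglyMeasurable φ volume)
    (hbd : ∀ t : ℝ, t ≠ b → ‖φ t‖ ≤ C * majorant θ (t - b)) {c : ℂ} (hc : c.im ≠ 0) :
    Integrable fun t : ℝ => φ t / (t - c) := by
  refine Integrable.mono' ((integrable_majorant_div hθ hθ1 b).const_mul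
    (((1 + |c.re - b|) / |c.im| + 1) * C)) ?_ ?_
  · have h1 : Continuous fun t : ℝ => ((t : ℂ) - c)⁻¹ := by
      refine Continuous.inv₀ (by fun_prop) fun t h => hc ?_
      simpa using congrArg Complex.im h
    simp only [div_eq_mul_inv]
    exact hmeas.mul h1.aestronglyMeasurable
  · filter_upwards [Measure.ae_ne volume b] with t ht
    have h1 : |c.im| ≤ ‖(t : ℂ) - c‖ := by simpa using Complex.abs_im_le_norm ((t : ℂ) - c)
    refine (norm_div_le_majorant (b := b) (abs_pos.2 hc) h1 (hbd t ht)).trans (le_of_eq ?_)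
    rw [Complex.ofReal_re]; ring

/-- Cauchy's formula for the upper half-plane, in terms of the imaginary part of the boundary
values. -/
theorem cauchy_formula (hθ : 0 < θ) (hθ1 : θ < 1) (hd : DifferentiableOn ℂ G upperHP)
    (hbd : ∀ l ∈ upperHP, ‖G l‖ ≤ C * majorant θ ‖l - b‖)
    (hφ : ∀ t : ℝ, t ≠ b → Tendsto (fun y : ℝ => G (t + y * Complex.I)) (𝓝[>] 0) (𝓝 (φ t)))
    {c : ℂ} (hc : c ∈ upperHP) :
    G c = (Real.pi : ℂ)⁻¹ * ∫ t : ℝ, ((φ t).im : ℂ) / (t - c) := by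
  have hc' : 0 < c.im := hc
  have hC : 0 ≤ C := by
    have h1 := (norm_nonneg _).trans (hbd c hc)
    have h2 : 0 < majorant θ ‖c - b‖ := by
      have : 0 < ‖c - b‖ := norm_pos_iff.2 fun h => hc'.ne' (by simpa using congrArg Complex.im h)
      unfold majorant; positivity
    exact nonneg_of_mul_nonneg_left h1 h2
  have hbd' : ∀ l ∈ upperHP, l.re ≠ b → ‖G l‖ ≤ C * majorant θ (l.re - b) := by
    intro l hl hlb
    refine (hbd l hl).trans (mul_le_mul_of_nonneg_left (majorant_anti hθ.le (sub_ne_zero.2 hlb) ?_) hC)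
    rw [abs_norm]
    simpa using Complex.abs_re_le_norm (l - b)
  have hmeas := aestronglyMeasurable_boundary hd.continuousOn hφ
  have hφb : ∀ t : ℝ, t ≠ b → ‖φ t‖ ≤ C * majorant θ (t - b) := fun t ht =>
    norm_boundary_le hbd hφ ht
  set c' := (starRingEnd ℂ) c with hc'def
  have hne' : ∀ l ∈ upperHP, l - c' ≠ 0 := fun l hl h => by
    have := norm_ge_of_im (c := c) (le_of_lt hl)
    rw [← hc'def, h, norm_zero] at this
    linarith
  have htopG : ∀ t : ℝ, Tendsto (fun y : ℝ => G (t + y * Complex.I)) atTop (𝓝 0) := by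
    intro t
    have h1 := (tendsto_majorant (f := fun y : ℝ => ‖(t + y * Complex.I : ℂ) - b‖) hθ
      (by simpa using tendsto_norm_vertical t b)).const_mul C
    rw [mul_zero] at h1
    refine squeeze_zero_norm' ?_ h1
    filter_upwards [eventually_gt_atTop 0] with y hy using hbd _ (ofReal_add_mul_I_mem hy)
  have htopinv : ∀ (t : ℝ) (d : ℂ), Tendsto (fun y : ℝ => ((t + y * Complex.I : ℂ) - d)⁻¹) atTop
      (𝓝 0) := fun t d => by
    refine squeeze_zero_norm (fun y => le_of_eq (norm_inv _)) ?_
    exact tendsto_inv_atTop_zero.comp (tendsto_norm_vertical t d)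
  have hbdry : ∀ (t : ℝ) (d : ℂ), (t : ℂ) - d ≠ 0 → Tendsto
      (fun y : ℝ => ((t + y * Complex.I : ℂ) - d)⁻¹) (𝓝[>] 0) (𝓝 ((t : ℂ) - d)⁻¹) := by
    intro t d h
    refine Tendsto.inv₀ ?_ h
    have : Continuous fun y : ℝ => (t + y * Complex.I : ℂ) - d := by fun_prop
    have h2 := this.tendsto 0
    simp only [Complex.ofReal_zero, zero_mul, add_zero] at h2
    exact h2.mono_left nhdsWithin_le_nhds
  have hreal : ∀ t : ℝ, (t : ℂ) - c' ≠ 0 ∧ (t : ℂ) - c ≠ 0 := by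
    intro t
    constructor <;> intro h <;> have := congrArg Complex.im h <;> simp [c'] at this <;>
      exact hc'.ne' this
  have hwT := tendsto_majorant_div hθ b (tendsto_abs_sub_atTop b)
  have hwB := tendsto_majorant_div hθ b (tendsto_abs_sub_atBot b)
  have hwI := integrable_majorant_div hθ hθ1 b
  -- the formula with the reflected pole
  have hA : ∫ t : ℝ, φ t / (t - c') = 0 := by
    refine integral_boundary_eq_zero (Φ := fun l => G l / (l - c')) (b := b)
      (g := fun t => ((1 + |c'.re - b|) / c.im + 1) * C * (majorant θ (t - b) / (1 + |t - b|)))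
      (hd.div (by fun_prop) hne') (hwI.const_mul _) (fun l hl hlb => ?_)
      (by simpa using hwT.const_mul _) (by simpa using hwB.const_mul _) (fun t _ => ?_) fun t ht => ?_
    · refine (norm_div_le_majorant (b := b) hc' (norm_ge_of_im (le_of_lt hl))
        (hbd' l hl hlb)).trans (le_of_eq (by ring))
    · simpa [div_eq_mul_inv] using (htopG t).mul (htopinv t c')
    · simpa [div_eq_mul_inv] using (hφ t ht).mul (hbdry t c' (hreal t).1)
  -- the formula with the pole `c` removed
  set N : ℂ → ℂ := fun l => G l - G c * ((c - c') / (l - c')) with hN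
  have hNd : DifferentiableOn ℂ N upperHP :=
    hd.sub ((differentiableOn_const _).mul ((differentiableOn_const _).div (by fun_prop) hne'))
  -- The subtracted term equals `G c` at `c`, decays at infinity, and has its only pole at `c'`,
  -- below the real line.
  have hNc : N c = 0 := by simp [hN, div_self (hne' c hc)]
  have hslope : ∀ l, l ≠ c → dslope N c l = N l / (l - c) := fun l hl => by
    rw [dslope_of_ne _ hl, slope_def_field, hNc, sub_zero]
  have hball : Metric.closedBall c (c.im / 2) ⊆ upperHP := by
    intro l hl
    rw [Metric.mem_closedBall, dist_eq_norm] at hl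
    have h1 := (abs_le.1 (Complex.abs_im_le_norm (l - c))).1
    rw [Complex.sub_im] at h1
    change 0 < l.im
    linarith
  have hΦd : DifferentiableOn ℂ (dslope N c) upperHP :=
    (Complex.differentiableOn_dslope (isOpen_upperHP.mem_nhds hc)).2 hNd
  obtain ⟨M, hM⟩ := (isCompact_closedBall c (c.im / 2)).exists_bound_of_continuousOn
    (hΦd.continuousOn.mono hball)
  have hM0 : 0 ≤ M := (norm_nonneg _).trans (hM c (Metric.mem_closedBall_self (by positivity)))
  set w₂ : ℝ → ℝ := fun t => (1 + (t - b) ^ 2)⁻¹ with hw₂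
  have hw₂I : Integrable w₂ := integrable_inv_one_add_sq.comp_sub_right b
  have hw₂lim : ∀ F : Filter ℝ, Tendsto (fun t => |t - b|) F atTop → Tendsto w₂ F (𝓝 0) := by
    intro F hF
    refine tendsto_inv_atTop_zero.comp (tendsto_atTop_mono (fun t => ?_) hF)
    nlinarith [sq_abs (t - b), sq_nonneg (|t - b| - 1), abs_nonneg (t - b)]
  set K₁ := (1 + |c'.re - b|) / c.im + 1 with hK₁
  set K₂ := (1 + |c.re - b|) / (c.im / 2) + 1 with hK₂
  have hK₁0 : 0 ≤ K₁ := by positivity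
  have hK₂0 : 0 ≤ K₂ := by positivity
  set D := K₂ * (K₁ * (‖G c‖ * ‖c - c'‖)) + M * (1 + (|c.re - b| + c.im) ^ 2) with hD
  have hD1 : K₂ * (K₁ * (‖G c‖ * ‖c - c'‖)) ≤ D := by rw [hD]; linarith [show 0 ≤ M * (1 + (|c.re - b| + c.im) ^ 2) by positivity]
  have hB : ∫ t : ℝ, (φ t / (t - c) - G c * ((c - c') / ((t - c') * (t - c)))) = 0 := by
    refine integral_boundary_eq_zero (Φ := dslope N c) (b := b)
      (g := fun t => K₂ * C * (majorant θ (t - b) / (1 + |t - b|)) + D * w₂ t)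
      hΦd ((hwI.const_mul _).add (hw₂I.const_mul _)) (fun l hl hlb => ?_)
      (by simpa using (hwT.const_mul _).add ((hw₂lim _ (tendsto_abs_sub_atTop b)).const_mul D))
      (by simpa using (hwB.const_mul _).add ((hw₂lim _ (tendsto_abs_sub_atBot b)).const_mul D))
      (fun t _ => ?_) fun t ht => ?_
    -- Close to `c` the difference quotient is bounded by compactness; elsewhere it is estimated
    -- through the size of `N`, the two factors `1 / (1 + |t - b|)` producing `w₂`.
    · by_cases hlc : ‖l - c‖ ≤ c.im / 2
      · refine (hM l (by rwa [Metric.mem_closedBall, dist_eq_norm])).trans ?_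
        have h1 : |l.re - b| ≤ |c.re - b| + c.im := by
          have h2 : |l.re - c.re| ≤ ‖l - c‖ := by simpa using Complex.abs_re_le_norm (l - c)
          have h3 : |l.re - b| ≤ |l.re - c.re| + |c.re - b| := abs_sub_le _ _ _
          linarith
        have h2 : 1 + (l.re - b) ^ 2 ≤ 1 + (|c.re - b| + c.im) ^ 2 := by
          rw [← sq_abs (l.re - b)]
          gcongr
        have h3 : M ≤ M * (1 + (|c.re - b| + c.im) ^ 2) * w₂ l.re := by
          rw [hw₂, ← div_eq_mul_inv, le_div_iff₀ (by positivity)]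
          exact mul_le_mul_of_nonneg_left h2 hM0
        have h4 : M * (1 + (|c.re - b| + c.im) ^ 2) * w₂ l.re ≤ D * w₂ l.re := by
          refine mul_le_mul_of_nonneg_right ?_ (by positivity)
          rw [hD]; linarith [show 0 ≤ K₂ * (K₁ * (‖G c‖ * ‖c - c'‖)) by positivity]
        have h5 : 0 ≤ K₂ * C * (majorant θ (l.re - b) / (1 + |l.re - b|)) :=
          mul_nonneg (mul_nonneg hK₂0 hC) (div_nonneg (majorant_nonneg _ _) (by positivity))
        linarith
      · push Not at hlc
        have hl1 : l ≠ c := by rintro rfl; simp at hlc; linarith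
        rw [hslope l hl1]
        have h1 : ‖N l‖ ≤ C * majorant θ (l.re - b) + ‖G c‖ * (K₁ * (‖c - c'‖ / (1 + |l.re - b|))) := by
          refine (norm_sub_le _ _).trans (add_le_add (hbd' l hl hlb) ?_)
          rw [norm_mul]
          exact mul_le_mul_of_nonneg_left (norm_div_le_majorant (b := b) hc'
            (norm_ge_of_im (le_of_lt hl)) le_rfl) (norm_nonneg _)
        refine (norm_div_le_majorant (b := b) (half_pos hc') hlc.le h1).trans ?_
        have h2 : (1 + |l.re - b|)⁻¹ * (1 + |l.re - b|)⁻¹ ≤ w₂ l.re := by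
          rw [hw₂, ← mul_inv]
          refine inv_anti₀ (by positivity) ?_
          nlinarith [sq_abs (l.re - b), abs_nonneg (l.re - b)]
        have h3 : K₂ * (K₁ * (‖G c‖ * ‖c - c'‖)) * ((1 + |l.re - b|)⁻¹ * (1 + |l.re - b|)⁻¹) ≤
            D * w₂ l.re := mul_le_mul hD1 h2 (by positivity) (by positivity)
        refine le_trans (le_of_eq ?_) (add_le_add_right h3
          (K₂ * C * (majorant θ (l.re - b) / (1 + |l.re - b|))))
        rw [← hK₂]; ring
    · have h1 : Tendsto (fun y : ℝ => N (t + y * Complex.I) / ((t + y * Complex.I : ℂ) - c)) atTop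
          (𝓝 0) := by
        have h2 := ((htopG t).sub (((htopinv t c').const_mul (c - c')).const_mul (G c))).mul
          (htopinv t c)
        simpa [div_eq_mul_inv, hN] using h2
      refine h1.congr' ?_
      filter_upwards [eventually_gt_atTop c.im] with y hy
      exact (hslope _ fun h => by have := congrArg Complex.im h; simp at this; linarith).symm
    · have h2 := ((hφ t ht).sub (((hbdry t c' (hreal t).1).const_mul (c - c')).const_mul (G c))).mul
          (hbdry t c (hreal t).2)
      have h3 : (φ t - G c * ((c - c') * ((t : ℂ) - c')⁻¹)) * ((t : ℂ) - c)⁻¹ =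
          φ t / (t - c) - G c * ((c - c') / ((t - c') * (t - c))) := by
        rw [div_eq_mul_inv, div_eq_mul_inv, mul_inv]; ring
      rw [h3] at h2
      refine h2.congr' ?_
      filter_upwards [Ioo_mem_nhdsGT hc'] with y hy
      rw [hslope _ fun h => by have := congrArg Complex.im h; simp at this; linarith [hy.2]]
      simp [hN, div_eq_mul_inv]
  have hI1 : Integrable fun t : ℝ => φ t / (t - c) := integrable_div_sub hθ hθ1 hmeas hφb hc'.ne'
  have hI2 : Integrable fun t : ℝ => φ t / (t - c') :=
    integrable_div_sub hθ hθ1 hmeas hφb (by simpa [c'] using hc'.ne')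
  have hpi := integral_inv_mul_conj hc'
  rw [← hc'def] at hpi
  have hI3 : Integrable fun t : ℝ => (c - c') / ((t - c') * (t - c)) := by
    by_contra hcon
    rw [integral_undef hcon] at hpi
    simp [Real.pi_ne_zero] at hpi
  rw [integral_sub hI1 (hI3.const_mul _), integral_const_mul, hpi] at hB
  -- Conjugating the identity at the reflected pole shows that the conjugate of `φ` contributes
  -- nothing at `c`, so `φ` may be replaced by `2i Im φ`.
  have hA' : ∫ t : ℝ, (starRingEnd ℂ) (φ t) / (t - c) = 0 := by
    have h1 := congrArg (starRingEnd ℂ) hA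
    rw [← integral_conj, map_zero] at h1
    rw [← h1]
    refine integral_congr_ae (Eventually.of_forall fun t => ?_)
    simp [c']
  have hI4 : Integrable fun t : ℝ => (starRingEnd ℂ) (φ t) / (t - c) := by
    refine integrable_div_sub hθ hθ1 (C := C) (b := b) ?_ (fun t ht => by simpa using hφb t ht) hc'.ne'
    exact Complex.continuous_conj.comp_aestronglyMeasurable hmeas
  have hI : ∫ t : ℝ, ((φ t).im : ℂ) / (t - c) =
      (2 * Complex.I)⁻¹ * ((∫ t : ℝ, φ t / (t - c)) - ∫ t : ℝ, (starRingEnd ℂ) (φ t) / (t - c)) := by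
    rw [← integral_sub hI1 hI4, ← integral_const_mul]
    refine integral_congr_ae (Eventually.of_forall fun t => ?_)
    have h1 : φ t - (starRingEnd ℂ) (φ t) = 2 * Complex.I * (φ t).im := by
      apply Complex.ext <;> simp; ring
    change ((φ t).im : ℂ) / (t - c) = (2 * Complex.I)⁻¹ * (φ t / (t - c) - (starRingEnd ℂ) (φ t) / (t - c))
    rw [← sub_div, h1, mul_div_assoc, inv_mul_cancel_left₀ (by simp)]
  rw [hI, hA', sub_zero, sub_eq_zero.1 hB]
  have : (Real.pi : ℂ) ≠ 0 := by exact_mod_cast Real.pi_ne_zero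
  field_simp

/-- The formula at a real point near which the boundary values are real. -/
theorem cauchy_formula_real (hθ : 0 < θ) (hθ1 : θ < 1) (hd : DifferentiableOn ℂ G upperHP)
    (hbd : ∀ l ∈ upperHP, ‖G l‖ ≤ C * majorant θ ‖l - b‖)
    (hφ : ∀ t : ℝ, t ≠ b → Tendsto (fun y : ℝ => G (t + y * Complex.I)) (𝓝[>] 0) (𝓝 (φ t)))
    {v δ : ℝ} (hδ : 0 < δ) (hv : ∀ t, |t - v| < δ → (φ t).im = 0) {γ : ℂ}
    (hγ : Tendsto (fun y : ℝ => G (v + y * Complex.I)) (𝓝[>] 0) (𝓝 γ)) :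
    Integrable (fun t => (φ t).im / (t - v)) ∧
      γ = (Real.pi : ℂ)⁻¹ * ((∫ t : ℝ, (φ t).im / (t - v) : ℝ) : ℂ) := by
  have hmeas := aestronglyMeasurable_boundary hd.continuousOn hφ
  have hmeas' : AEStronglyMeasurable (fun t => ((φ t).im : ℂ)) volume :=
    (Complex.continuous_ofReal.comp Complex.continuous_im).comp_aestronglyMeasurable hmeas
  set g := fun t => ((1 + |v - b|) / δ + 1) * C * (majorant θ (t - b) / (1 + |t - b|)) with hg
  have hgI : Integrable g := (integrable_majorant_div hθ hθ1 b).const_mul _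
  have hC : 0 ≤ C := by
    have h1 := (norm_nonneg _).trans (hbd Complex.I (by simp [upperHP]))
    have h2 : 0 < majorant θ ‖Complex.I - b‖ := by
      have : 0 < ‖Complex.I - b‖ := norm_pos_iff.2 fun h => by
        simpa using congrArg Complex.im h
      unfold majorant; positivity
    exact nonneg_of_mul_nonneg_left h1 h2
  -- Where `Im φ` does not vanish, `t` is at distance at least `δ` from `v`, so the bound is uniform
  -- in `y`.
  have hbound : ∀ y : ℝ, ∀ t : ℝ, t ≠ b → ‖((φ t).im : ℂ) / (t - (v + y * Complex.I))‖ ≤ g t := by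
    intro y t ht
    by_cases h : |t - v| < δ
    · rw [hv t h, Complex.ofReal_zero, zero_div, norm_zero]
      exact mul_nonneg (mul_nonneg (by positivity) hC) (div_nonneg (majorant_nonneg _ _) (by positivity))
    · push Not at h
      have h1 : δ ≤ ‖(t : ℂ) - (v + y * Complex.I)‖ := h.trans (by
        simpa using Complex.abs_re_le_norm ((t : ℂ) - (v + y * Complex.I)))
      have h2 : ‖((φ t).im : ℂ)‖ ≤ C * majorant θ (t - b) := by
        rw [Complex.norm_real, Real.norm_eq_abs]
        exact (Complex.abs_im_le_norm _).trans (norm_boundary_le hbd hφ ht)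
      refine (norm_div_le_majorant (b := b) hδ h1 h2).trans (le_of_eq ?_)
      simp [hg]; ring
  have hI : Integrable fun t : ℝ => (φ t).im / (t - v) := by
    refine hgI.mono' ?_ ?_
    · exact ((Complex.continuous_im.comp_aestronglyMeasurable hmeas).aemeasurable.div
        (by fun_prop)).aestronglyMeasurable
    · filter_upwards [Measure.ae_ne volume b] with t ht
      have := hbound 0 t ht
      simpa [← Complex.ofReal_sub, ← Complex.ofReal_div] using this
  refine ⟨hI, tendsto_nhds_unique hγ ?_⟩
  have h1 : Tendsto (fun y : ℝ => ∫ t : ℝ, ((φ t).im : ℂ) / (t - (v + y * Complex.I))) (𝓝[>] 0)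
      (𝓝 (∫ t : ℝ, ((φ t).im : ℂ) / (t - v))) := by
    refine tendsto_integral_filter_of_dominated_convergence g ?_ ?_ hgI ?_
    · refine Eventually.of_forall fun y => ?_
      exact (hmeas'.aemeasurable.div (by fun_prop)).aestronglyMeasurable
    · refine Eventually.of_forall fun y => ?_
      filter_upwards [Measure.ae_ne volume b] with t ht using hbound y t ht
    · filter_upwards [Measure.ae_ne volume v] with t ht
      have h2 : Continuous fun y : ℝ => (t : ℂ) - (v + y * Complex.I) := by fun_prop
      have h3 := (h2.tendsto 0).mono_left (nhdsWithin_le_nhds (s := Set.Ioi 0))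
      simp only [Complex.ofReal_zero, zero_mul, add_zero] at h3
      exact tendsto_const_nhds.div h3 (by
        rw [sub_ne_zero]; exact_mod_cast ht)
  have h2 : ∫ t : ℝ, ((φ t).im : ℂ) / (t - v) = ((∫ t : ℝ, (φ t).im / (t - v) : ℝ) : ℂ) := by
    rw [← integral_complex_ofReal]
    simp
  rw [h2] at h1
  refine (h1.const_mul (Real.pi : ℂ)⁻¹).congr' ?_
  filter_upwards [self_mem_nhdsWithin] with y hy
  exact (cauchy_formula hθ hθ1 hd hbd hφ (ofReal_add_mul_I_mem hy)).symm

end CauchyFormula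

/-! ### Complete homogeneous symmetric functions -/

/-- The complete homogeneous symmetric function of degree `m` of `ζ 0, …, ζ (j - 1)`. -/
def hs (ζ : ℕ → ℂ) : ℕ → ℕ → ℂ
  | _, 0 => 1
  | 0, _ + 1 => 0
  | j + 1, m + 1 => hs ζ j (m + 1) + ζ j * hs ζ (j + 1) m

theorem hs_zero_right (ζ : ℕ → ℂ) (j : ℕ) : hs ζ j 0 = 1 := by cases j <;> simp [hs]

theorem hs_zero_left (ζ : ℕ → ℂ) (m : ℕ) : hs ζ 0 (m + 1) = 0 := by simp [hs]

theorem hs_succ (ζ : ℕ → ℂ) (j m : ℕ) :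
    hs ζ (j + 1) (m + 1) = hs ζ j (m + 1) + ζ j * hs ζ (j + 1) m := by rw [hs]

theorem hs_one (ζ : ℕ → ℂ) (m : ℕ) : hs ζ 1 m = ζ 0 ^ m := by
  induction m with
  | zero => rw [hs_zero_right, pow_zero]
  | succ m ih => rw [hs_succ, hs_zero_left, ih, zero_add, pow_succ']

/-- Induction along the recursion of `hs`. -/
theorem hs_induction {P : ℕ → ℕ → Prop} (h0 : ∀ j, P j 0) (h1 : ∀ m, P 0 (m + 1))
    (h2 : ∀ j m, P j (m + 1) → P (j + 1) m → P (j + 1) (m + 1)) (j m : ℕ) : P j m := by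
  induction j generalizing m with
  | zero => cases m with
    | zero => exact h0 0
    | succ m => exact h1 m
  | succ j ih => induction m with
    | zero => exact h0 _
    | succ m ih' => exact h2 j m (ih _) ih'

theorem hs_congr {ζ ζ' : ℕ → ℂ} (j m : ℕ) (h : ∀ i < j, ζ i = ζ' i) : hs ζ j m = hs ζ' j m := by
  induction j, m using hs_induction with
  | h0 j => rw [hs_zero_right, hs_zero_right]
  | h1 m => rw [hs_zero_left, hs_zero_left]
  | h2 j m h1 h2 =>
    rw [hs_succ, hs_succ, h1 fun i hi => h i (by omega), h2 h, h j (by omega)]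

theorem hs_conj (ζ : ℕ → ℂ) (j m : ℕ) :
    (starRingEnd ℂ) (hs ζ j m) = hs (fun i => (starRingEnd ℂ) (ζ i)) j m := by
  induction j, m using hs_induction with
  | h0 j => simp [hs_zero_right]
  | h1 m => simp [hs_zero_left]
  | h2 j m h1 h2 => rw [hs_succ, hs_succ, map_add, map_mul, h1, h2]

theorem norm_hs_le (ζ : ℕ → ℂ) (j m : ℕ) {B : ℝ} (hB : 0 ≤ B) (h : ∀ i < j, ‖ζ i‖ ≤ B) :
    ‖hs ζ j m‖ ≤ 2 ^ (j + m) * B ^ m := by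
  induction j, m using hs_induction with
  | h0 j => rw [hs_zero_right, norm_one, pow_zero, mul_one]; exact one_le_pow₀ (by norm_num)
  | h1 m => rw [hs_zero_left, norm_zero]; positivity
  | h2 j m h1 h2 =>
    rw [hs_succ]
    calc _ ≤ ‖hs ζ j (m + 1)‖ + ‖ζ j‖ * ‖hs ζ (j + 1) m‖ := (norm_add_le _ _).trans (by rw [norm_mul])
      _ ≤ 2 ^ (j + (m + 1)) * B ^ (m + 1) + B * (2 ^ (j + 1 + m) * B ^ m) :=
          add_le_add (h1 fun i hi => h i (by omega))
            (mul_le_mul (h j (by omega)) (h2 h) (norm_nonneg _) hB)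
      _ = _ := by ring

theorem prod_mul_mk_hs (ζ : ℕ → ℂ) (j : ℕ) :
    (∏ i ∈ Finset.range j, (1 - PowerSeries.C (ζ i) * PowerSeries.X)) * PowerSeries.mk (hs ζ j) = 1 := by
  induction j with
  | zero =>
    ext m
    cases m <;> simp [hs_zero_left, hs_zero_right, PowerSeries.coeff_one]
  | succ j ih =>
    have h : (1 - PowerSeries.C (ζ j) * PowerSeries.X) * PowerSeries.mk (hs ζ (j + 1)) =
        PowerSeries.mk (hs ζ j) := by
      ext m
      rw [sub_mul, one_mul, mul_assoc, map_sub, PowerSeries.coeff_C_mul]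
      cases m with
      | zero => simp [hs_zero_right]
      | succ m => rw [PowerSeries.coeff_succ_X_mul]; simp [hs_succ]
    rw [Finset.prod_range_succ, mul_assoc, h, ih]

/-- Symmetry is hidden by the recursion; the generating function, the inverse of the product of the
`1 - ζ_i X`, depends on the multiset of variables only. -/
theorem hs_congr_map {ζ ζ' : ℕ → ℂ} {j : ℕ}
    (h : (Multiset.range j).map ζ = (Multiset.range j).map ζ') (m : ℕ) : hs ζ j m = hs ζ' j m := by
  have h1 := congrArg (fun M => (Multiset.map
    (fun u => (1 - PowerSeries.C u * PowerSeries.X : PowerSeries ℂ)) M).prod) h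
  simp only [Multiset.map_map] at h1
  have h2 : (∏ i ∈ Finset.range j, (1 - PowerSeries.C (ζ i) * PowerSeries.X : PowerSeries ℂ)) =
    ∏ i ∈ Finset.range j, (1 - PowerSeries.C (ζ' i) * PowerSeries.X) := h1
  have h3 := prod_mul_mk_hs ζ j
  have h4 := prod_mul_mk_hs ζ' j
  rw [h2] at h3
  have h5 : PowerSeries.mk (hs ζ j) = PowerSeries.mk (hs ζ' j) := by
    rw [← one_mul (PowerSeries.mk (hs ζ j)), ← h4, mul_comm _ (PowerSeries.mk (hs ζ' j)), mul_assoc,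
      h3, mul_one]
  simpa using congrArg (PowerSeries.coeff m) h5

/-- A divided difference identity: exchanging the last variable lowers the degree by one and admits
both variables. It computes the jumps of the symmetric functions of the roots. -/
theorem hs_sub {ζ ζ' : ℕ → ℂ} (j m : ℕ) (h : ∀ i < j, ζ i = ζ' i) (h' : ζ' j = ζ (j + 1)) :
    hs ζ (j + 1) (m + 1) - hs ζ' (j + 1) (m + 1) = (ζ j - ζ (j + 1)) * hs ζ (j + 2) m := by
  induction m with
  | zero => rw [hs_succ, hs_succ, hs_congr j 1 h, h']; simp only [hs_zero_right]; ring
  | succ m ih =>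
    rw [hs_succ, hs_succ ζ', hs_congr j (m + 1 + 1) h, h', hs_succ ζ (j + 1)]
    linear_combination (ζ (j + 1)) * ih

/-! ### Symmetric functions of the first roots and their jumps. -/

/-- The complete homogeneous symmetric function of degree `m` of the first `j` roots. -/
def F (z : ℕ → ℂ → ℂ) (j m : ℕ) (l : ℂ) : ℂ := hs (fun i => up z i l) j m

/-- `Im z_{j-1,-} / π` on `Γ_j`, extended by `0`. -/
def dens (z : ℕ → ℂ → ℂ) (j : ℕ) : ℝ → ℝ :=
  (ΓReal z j).indicator fun v => -(up z (j - 1) v).im / Real.pi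

namespace CritSetup

variable {a x : ℕ → ℝ} {p : ℕ} {s : ℝ} {z : ℕ → ℂ → ℂ}

theorem continuous_F (S : CritSetup a p x s) (hz : IsRootLabelling a p z) {j : ℕ} (hj : j ≤ p + 1)
    (m : ℕ) : Continuous (F z j m) := by
  unfold F
  induction j, m using hs_induction with
  | h0 j => simp only [hs_zero_right]; exact continuous_const
  | h1 m => simp only [hs_zero_left]; exact continuous_const
  | h2 j m h1 h2 =>
    simp only [hs_succ]
    exact (h1 (by omega)).add ((S.continuous_up hz (by omega)).mul (h2 hj))

theorem differentiableOn_F (S : CritSetup a p x s) (hz : IsRootLabelling a p z) {j : ℕ}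
    (hj : j ≤ p + 1) (m : ℕ) : DifferentiableOn ℂ (F z j m) upperHP := by
  unfold F
  induction j, m using hs_induction with
  | h0 j => simp only [hs_zero_right]; exact differentiableOn_const _
  | h1 m => simp only [hs_zero_left]; exact differentiableOn_const _
  | h2 j m h1 h2 =>
    simp only [hs_succ]
    exact (h1 (by omega)).add ((S.differentiableOn_up hz (by omega)).mul (h2 hj))

/-- At a real point off `Γ_j` the first `j` roots are permuted by conjugation. -/
theorem map_conj_up (S : CritSetup a p x s) (hz : IsRootLabelling a p z) {v : ℝ} {j : ℕ}
    (hj : j ≤ p + 1) (h : 1 ≤ j → j ≤ p → (v : ℂ) ∉ Γ z j) :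
    (Multiset.range j).map (fun i => up z i v) =
      (Multiset.range j).map fun i => (starRingEnd ℂ) (up z i v) := by
  have hL := S.isLab_up hz (l := v) (by simp)
  have hL' := hL.conj S.one_le S.a_ne_zero
  rw [Complex.conj_ofReal] at hL'
  rcases Nat.eq_zero_or_pos j with rfl | hj0
  · simp
  rcases Nat.lt_or_ge p j with hjp | hjp
  · obtain rfl : j = p + 1 := by omega
    exact hL.roots_eq.symm.trans hL'.roots_eq
  obtain ⟨k, rfl⟩ := Nat.exists_eq_add_of_le' hj0
  refine hL.map_eq hL' (by omega) ?_
  have h1 := hL.norm_le k (by omega)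
  refine lt_of_le_of_ne h1 fun h2 => h hj0 hjp ?_
  change ‖z k v‖ = ‖z (k + 1) v‖
  rw [← norm_up z k, ← norm_up z (k + 1)]; exact h2

/-- Off `Γ_j` the first `j` roots form a conjugation-invariant family, on which a symmetric function
with real coefficients is real. -/
theorem F_im_eq_zero (S : CritSetup a p x s) (hz : IsRootLabelling a p z) {v : ℝ} {j : ℕ}
    (hj : j ≤ p + 1) (h : 1 ≤ j → j ≤ p → (v : ℂ) ∉ Γ z j) (m : ℕ) : (F z j m v).im = 0 := by
  rw [← Complex.conj_eq_iff_im, F, hs_conj]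
  exact (hs_congr_map (S.map_conj_up hz hj h) m).symm

theorem notMem_Γ_succ (S : CritSetup a p x s) (hz : IsRootLabelling a p z) {v : ℂ} {k : ℕ}
    (h : v ∈ Γ z (k + 1)) : 1 ≤ k + 2 → k + 2 ≤ p → v ∉ Γ z (k + 2) :=
  fun _ h1 => S.Γ_disjoint hz (by omega) h

theorem notMem_Γ_pred (S : CritSetup a p x s) (hz : IsRootLabelling a p z) {v : ℂ} {k : ℕ}
    (hk : k < p) (h : v ∈ Γ z (k + 1)) : 1 ≤ k → k ≤ p → v ∉ Γ z k := by
  intro h1 _ h2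
  obtain ⟨k, rfl⟩ := Nat.exists_eq_add_of_le' h1
  exact S.Γ_disjoint hz (by omega) h2 h

/-- On `Γ_{k+1}` conjugation permutes the first `k` roots and sends `z_k` to `z_{k+1}`, so it only
changes the last variable and `hs_sub` applies. -/
theorem F_sub_conj (S : CritSetup a p x s) (hz : IsRootLabelling a p z) {v : ℝ} {k : ℕ} (hk : k < p)
    (h : (v : ℂ) ∈ Γ z (k + 1)) (m : ℕ) :
    F z (k + 1) (m + 1) v - (starRingEnd ℂ) (F z (k + 1) (m + 1) v) =
      (up z k v - (starRingEnd ℂ) (up z k v)) * F z (k + 2) m v := by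
  have h1 := S.map_conj_up hz (j := k) (by omega) (S.notMem_Γ_pred hz hk h)
  have h2 := S.up_succ_of_mem_Γ hz hk h
  set ζ' : ℕ → ℂ := fun i => if i < k then up z i v else (starRingEnd ℂ) (up z i v) with hζ'
  have h3 : hs (fun i => (starRingEnd ℂ) (up z i v)) (k + 1) (m + 1) = hs ζ' (k + 1) (m + 1) := by
    refine hs_congr_map ?_ _
    rw [Multiset.range_succ, Multiset.map_cons, Multiset.map_cons, ← h1]
    congr 1
    · simp [hζ']
    · exact Multiset.map_congr rfl fun i hi => by
        rw [Multiset.mem_range] at hi; simp [hζ', hi]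
  rw [F, hs_conj, h3, hs_sub k m (fun i hi => by simp [hζ', hi]) (by simp [hζ', h2]), h2, F]

/-- The jump relation behind the Nikishin structure. On `Γ_{k+1}` the function `F z (k + 2) m` is
real because `Γ_{k+2}` is disjoint from it. -/
theorem F_im (S : CritSetup a p x s) (hz : IsRootLabelling a p z) {k : ℕ} (hk : k < p) (m : ℕ)
    (v : ℝ) : (F z (k + 1) (m + 1) v).im = -Real.pi * (dens z (k + 1) v * (F z (k + 2) m v).re) := by
  by_cases h : (v : ℂ) ∈ Γ z (k + 1)
  · have h1 := congrArg Complex.im (S.F_sub_conj hz hk h m)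
    have h2 := S.F_im_eq_zero hz (show k + 2 ≤ p + 1 by omega) (S.notMem_Γ_succ hz h) m
    have h3 : dens z (k + 1) v = -(up z k v).im / Real.pi :=
      Set.indicator_of_mem (show v ∈ ΓReal z (k + 1) from h) _
    simp only [Complex.sub_im, Complex.conj_im, Complex.mul_im, Complex.sub_re, Complex.conj_re,
      sub_self, h2, zero_add, mul_zero] at h1
    rw [h3]
    field_simp
    linarith
  · have h3 : dens z (k + 1) v = 0 :=
      Set.indicator_of_notMem (show v ∉ ΓReal z (k + 1) from h) _
    rw [h3, zero_mul, mul_zero]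
    exact S.F_im_eq_zero hz (by omega) (fun _ _ => h) _

/-- Evaluating the symbol polynomial for `v` at the root for `l` gives `(l - v) z_i(l)`, equal to
`a_p` times the product of the differences `z_i(l) - z_k(v)`. At most two of these differences tend
to zero, as no root is triple. -/
theorem up_isBigO (S : CritSetup a p x s) (hz : IsRootLabelling a p z) {i : ℕ} (hi : i ≤ p) (v : ℝ) :
    (fun l => up z i l - up z i v) =O[𝓝[upperHP] (v : ℂ)] fun l => ‖l - v‖ ^ (1 / 2 : ℝ) := by
  classical
  have hL := S.isLab_up hz (l := v) (by simp)
  set T := (Finset.range (p + 1)).filter fun k => up z k v = up z i v with hT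
  set T' := (Finset.range (p + 1)).filter fun k => ¬up z k v = up z i v with hT'
  have hiT : i ∈ T := Finset.mem_filter.2 ⟨Finset.mem_range.2 (by omega), rfl⟩
  have hcard : T.card ≤ 2 := by
    by_contra hcon
    push Not at hcon
    obtain ⟨i₁, i₂, i₃, h1, h2, h3, h12, h13, h23⟩ := Finset.two_lt_card_iff.1 hcon
    simp only [hT, Finset.mem_filter, Finset.mem_range] at h1 h2 h3
    exact S.not_three hL (by omega) (by omega) (by omega) h12 h13 h23 (h1.2.trans h2.2.symm)
      (h1.2.trans h3.2.symm)
  have hup : Tendsto (up z i) (𝓝[upperHP] (v : ℂ)) (𝓝 (up z i v)) :=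
    ((S.continuous_up hz hi).tendsto _).mono_left nhdsWithin_le_nhds
  have hP : Tendsto (fun l => ‖∏ k ∈ T', (up z i l - up z k v)‖) (𝓝[upperHP] (v : ℂ))
      (𝓝 ‖∏ k ∈ T', (up z i v - up z k v)‖) :=
    (tendsto_finsetProd _ fun k _ => hup.sub_const _).norm
  set c := ‖∏ k ∈ T', (up z i v - up z k v)‖ with hc
  have hc0 : 0 < c := by
    rw [hc, norm_pos_iff, Finset.prod_ne_zero_iff]
    intro k hk h
    exact (Finset.mem_filter.1 hk).2 (sub_eq_zero.1 h).symm
  have hap : 0 < |a p| := abs_pos.2 S.a_ne_zero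
  set B := ‖up z i v‖ + 1 with hB
  have hB0 : 0 < B := by positivity
  refine Asymptotics.IsBigO.of_bound (Real.sqrt (B / (|a p| * (c / 2)))) ?_
  have hsmall : ∀ᶠ l in 𝓝[upperHP] (v : ℂ), ‖up z i l - up z i v‖ < 1 := by
    have := (hup.sub_const (up z i v)).norm
    rw [sub_self, norm_zero] at this
    exact this.eventually (gt_mem_nhds one_pos)
  filter_upwards [self_mem_nhdsWithin, hsmall, hP.eventually (lt_mem_nhds (half_lt_self hc0)),
    hup.norm.eventually (gt_mem_nhds (show ‖up z i v‖ < B by linarith))] with l hl h1 h2 h3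
  have h4 := (S.isLab_up hz (le_of_lt hl)).eval_zero S.one_le S.a_ne_zero hi
  have h5 := hL.eval_eq S.one_le S.a_ne_zero (up z i l)
  have h6 : (symbolPoly a p v).eval (up z i l) = (l - v) * up z i l := by
    rw [eval_symbolPoly] at h4 ⊢
    linear_combination h4
  rw [h6, ← Finset.prod_filter_mul_prod_filter_not _ fun k => up z k v = up z i v, ← hT, ← hT',
    Finset.prod_congr rfl fun k hk => by rw [(Finset.mem_filter.1 hk).2], Finset.prod_const] at h5
  have h7 := congrArg norm h5
  rw [norm_mul, norm_mul, norm_mul, norm_pow, Complex.norm_real, Real.norm_eq_abs] at h7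
  set δ := ‖up z i l - up z i v‖ with hδ
  have h8 : δ ^ 2 ≤ δ ^ T.card := pow_le_pow_of_le_one (norm_nonneg _) h1.le hcard
  have h9 : |a p| * (δ ^ 2 * (c / 2)) ≤ ‖l - v‖ * B := by
    calc _ ≤ |a p| * (δ ^ T.card * ‖∏ k ∈ T', (up z i l - up z k v)‖) := by gcongr
      _ = ‖l - v‖ * ‖up z i l‖ := h7.symm
      _ ≤ _ := by gcongr
  have h10 : δ ^ 2 ≤ B / (|a p| * (c / 2)) * ‖l - v‖ := by
    rw [div_mul_eq_mul_div, le_div_iff₀ (by positivity)]; linarith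
  rw [Real.norm_of_nonneg (by positivity), ← Real.sqrt_eq_rpow, ← Real.sqrt_mul (by positivity)]
  exact Real.le_sqrt_of_sq_le h10

theorem F_isBigO (S : CritSetup a p x s) (hz : IsRootLabelling a p z) {j : ℕ} (hj : j ≤ p + 1)
    (m : ℕ) (v : ℝ) :
    (fun l => F z j m l - F z j m v) =O[𝓝[upperHP] (v : ℂ)] fun l => ‖l - v‖ ^ (1 / 2 : ℝ) := by
  unfold F
  induction j, m using hs_induction with
  | h0 j => simp only [hs_zero_right, sub_self]; exact Asymptotics.isBigO_zero _ _
  | h1 m => simp only [hs_zero_left, sub_self]; exact Asymptotics.isBigO_zero _ _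
  | h2 j m h1 h2 =>
    have h3 : (fun l => up z j l) =O[𝓝[upperHP] (v : ℂ)] fun _ => (1 : ℝ) :=
      (((S.continuous_up hz (show j ≤ p by omega)).tendsto (v : ℂ)).mono_left
        nhdsWithin_le_nhds).isBigO_one ℝ
    have h4 := h3.mul (h2 hj)
    have h5 := (S.up_isBigO hz (show j ≤ p by omega) v).mul
      (Asymptotics.isBigO_const_one ℝ (hs (fun i => up z i v) (j + 1) m) (𝓝[upperHP] (v : ℂ)))
    simp only [mul_one, one_mul] at h4 h5
    refine ((h1 (by omega)).add (h4.add h5)).congr (fun l => ?_) fun _ => rfl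
    rw [hs_succ, hs_succ]; ring

theorem exists_norm_up_le (S : CritSetup a p x s) (hz : IsRootLabelling a p z) :
    ∃ K > 0, ∀ l, ∀ i ≤ p, ‖up z i l‖ ≤ K * (1 + ‖l‖) ^ (1 / p : ℝ) := by
  obtain ⟨K, hK, h⟩ := exists_norm_pow_le (a := a) (p := p) S.a_ne_zero
  refine ⟨K ^ (1 / p : ℝ), by positivity, fun l i hi => ?_⟩
  have h1 := h l (z i l) ((hz.isLab l).eval_zero S.one_le S.a_ne_zero hi)
  have hp0 : (p : ℝ) ≠ 0 := by have := S.one_le; positivity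
  rw [norm_up, ← Real.mul_rpow hK.le (by positivity)]
  calc ‖z i l‖ = (‖z i l‖ ^ p) ^ (1 / p : ℝ) := by
        rw [← Real.rpow_natCast, ← Real.rpow_mul (norm_nonneg _), mul_one_div_cancel hp0,
          Real.rpow_one]
    _ ≤ _ := Real.rpow_le_rpow (by positivity) h1 (by positivity)

end CritSetup

/-- The majorant of a difference quotient at a boundary point. -/
theorem exists_norm_div_le_majorant {h : ℂ → ℂ} {b θ C : ℝ} (hθ1 : θ < 1)
    (h1 : (fun l => h l - h b) =O[𝓝[upperHP] (b : ℂ)] fun l => ‖l - b‖ ^ (1 / 2 : ℝ))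
    (h2 : ∀ l ∈ upperHP, ‖h l‖ ≤ C * (1 + ‖l‖) ^ (1 - θ)) :
    ∃ C', ∀ l ∈ upperHP, ‖(h l - h b) / (l - b)‖ ≤ C' * majorant θ ‖l - b‖ := by
  obtain ⟨C₁, hC₁, h3⟩ := h1.exists_pos
  obtain ⟨δ, hδ, h4⟩ := Metric.eventually_nhds_iff.1
    (eventually_nhdsWithin_iff.1 (Asymptotics.isBigOWith_iff.1 h3))
  have hC : 0 ≤ C := by
    have h5 := (norm_nonneg _).trans (h2 Complex.I (by simp [upperHP]))
    exact nonneg_of_mul_nonneg_left h5 (by positivity)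
  set A := (1 + |b|) / δ + 1 with hA
  have hA0 : 0 < A := by positivity
  set C₂ := C * A ^ (1 - θ) + ‖h b‖ * (δ ^ (1 - θ))⁻¹ with hC₂
  have hC₂0 : 0 ≤ C₂ := by positivity
  refine ⟨C₁ + C₂, fun l hl => ?_⟩
  have hr : 0 < ‖l - b‖ := norm_pos_iff.2 fun h => by
    have := congrArg Complex.im h
    simp at this
    exact (ne_of_gt hl) this
  set ρ := ‖l - b‖ with hρ
  rw [norm_div, div_le_iff₀ hr, majorant, abs_of_pos hr]
  have e1 : ρ ^ (-(1 / 2) : ℝ) * ρ = ρ ^ (1 / 2 : ℝ) := by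
    rw [← Real.rpow_add_one hr.ne']; norm_num
  have e2 : ρ ^ (-θ) * ρ = ρ ^ (1 - θ) := by
    rw [← Real.rpow_add_one hr.ne']; congr 1; ring
  have e3 : (C₁ + C₂) * (ρ ^ (-(1 / 2) : ℝ) + ρ ^ (-θ)) * ρ =
      (C₁ + C₂) * (ρ ^ (1 / 2 : ℝ) + ρ ^ (1 - θ)) := by rw [← e1, ← e2]; ring
  rw [e3]
  have p1 : 0 ≤ ρ ^ (1 / 2 : ℝ) := by positivity
  have p2 : 0 ≤ ρ ^ (1 - θ) := by positivity
  by_cases hlδ : ρ < δ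
  · have h5 := h4 (y := l) (by rwa [dist_eq_norm]) hl
    rw [Real.norm_of_nonneg p1] at h5
    nlinarith [mul_nonneg hC₁.le p2, mul_nonneg hC₂0 p1, mul_nonneg hC₂0 p2]
  · push Not at hlδ
    have h5 : 1 + ‖l‖ ≤ A * ρ := by
      have h6 : ‖l‖ ≤ ρ + |b| := by
        have := norm_add_le (l - b) (b : ℂ)
        rwa [sub_add_cancel, Complex.norm_real, Real.norm_eq_abs] at this
      have h7 : (1 + |b|) / δ * δ ≤ (1 + |b|) / δ * ρ := mul_le_mul_of_nonneg_left hlδ (by positivity)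
      rw [div_mul_cancel₀ _ hδ.ne'] at h7
      rw [hA]; linarith
    have h6 : (1 + ‖l‖) ^ (1 - θ) ≤ A ^ (1 - θ) * ρ ^ (1 - θ) := by
      rw [← Real.mul_rpow hA0.le hr.le]
      exact Real.rpow_le_rpow (by positivity) h5 (by linarith)
    have h7 : 1 ≤ (δ ^ (1 - θ))⁻¹ * ρ ^ (1 - θ) := by
      rw [inv_mul_eq_div, one_le_div (by positivity)]
      exact Real.rpow_le_rpow hδ.le hlδ (by linarith)
    calc ‖h l - h b‖ ≤ ‖h l‖ + ‖h b‖ := norm_sub_le _ _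
      _ ≤ C * (A ^ (1 - θ) * ρ ^ (1 - θ)) + ‖h b‖ * ((δ ^ (1 - θ))⁻¹ * ρ ^ (1 - θ)) :=
          add_le_add ((h2 l hl).trans (mul_le_mul_of_nonneg_left h6 hC))
            (le_mul_of_one_le_right (norm_nonneg _) h7)
      _ = C₂ * ρ ^ (1 - θ) := by rw [hC₂]; ring
      _ ≤ _ := by nlinarith [mul_nonneg hC₁.le p2, mul_nonneg hC₁.le p1, mul_nonneg hC₂0 p1]

namespace CritSetup

variable {a x : ℕ → ℝ} {p : ℕ} {s : ℝ} {z : ℕ → ℂ → ℂ}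

/-! ### Integral representations of the symmetric functions -/

/-- The roots are `O((1 + |l|)^{1/p})`, so a degree `m ≤ p - 1` leaves an exponent of at most `1 -
1/p`; difference quotients then decay like `|l|^{-1/p}`. -/
theorem exists_norm_F_le (S : CritSetup a p x s) (hz : IsRootLabelling a p z) {j m : ℕ}
    (hj : j ≤ p + 1) (hm : m + 1 ≤ p) :
    ∃ C, ∀ l ∈ upperHP, ‖F z j m l‖ ≤ C * (1 + ‖l‖) ^ (1 - 1 / p : ℝ) := by
  obtain ⟨K, hK, h⟩ := S.exists_norm_up_le hz
  refine ⟨2 ^ (j + m) * K ^ m, fun l _ => ?_⟩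
  have hp0 : (0 : ℝ) < p := by have := S.one_le; positivity
  refine (norm_hs_le (fun i => up z i l) j m (B := K * (1 + ‖l‖) ^ (1 / p : ℝ)) (by positivity)
    fun i hi => h l i (by omega)).trans ?_
  rw [mul_pow, ← Real.rpow_mul_natCast (by positivity), mul_assoc]
  refine mul_le_mul_of_nonneg_left (mul_le_mul_of_nonneg_left ?_ (by positivity)) (by positivity)
  refine Real.rpow_le_rpow_of_exponent_le (by linarith [norm_nonneg l]) ?_
  have : (m : ℝ) + 1 ≤ p := by exact_mod_cast hm
  rw [one_div_mul_eq_div, le_sub_iff_add_le, ← add_div, div_le_one hp0]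
  exact this

theorem one_div_mem (S : CritSetup a p x s) : (0 : ℝ) < 1 / p ∧ (1 / p : ℝ) < 1 := by
  have h2 : (2 : ℝ) ≤ p := by exact_mod_cast S.two_le
  exact ⟨by positivity, by rw [div_lt_one] <;> linarith⟩

theorem ρ_one (S : CritSetup a p x s) (hz : IsRootLabelling a p z) (b : ℕ → ℝ) :
    ρ z b 1 = dens z 1 := by
  refine congrArg _ (funext fun v => ?_)
  rw [if_pos rfl, S.lowerValue_eq hz (Nat.zero_le p), Complex.conj_im]

theorem ρ_eq (S : CritSetup a p x s) (hz : IsRootLabelling a p z) (b : ℕ → ℝ) {j : ℕ} (hj : 2 ≤ j)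
    (hjp : j ≤ p) (v : ℝ) : ρ z b j v = dens z j v / (v - b j) := by
  rw [ρ, dens]
  by_cases h : v ∈ ΓReal z j
  · rw [Set.indicator_of_mem h, Set.indicator_of_mem h, if_neg (by omega),
      S.lowerValue_eq hz (by omega), Complex.conj_im, div_div]
  · rw [Set.indicator_of_notMem h, Set.indicator_of_notMem h, zero_div]

theorem isClosed_ΓReal (S : CritSetup a p x s) (hz : IsRootLabelling a p z) {k : ℕ} (hk : k < p) :
    IsClosed (ΓReal z (k + 1)) := (S.isClosed_Γ hz hk).preimage Complex.continuous_ofReal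

theorem exists_ball_compl (S : CritSetup a p x s) (hz : IsRootLabelling a p z) {k : ℕ} (hk : k < p)
    {v : ℝ} (hv : (v : ℂ) ∉ Γ z (k + 1)) : ∃ δ > 0, ∀ t, |t - v| < δ → t ∉ ΓReal z (k + 1) :=
  Metric.isOpen_iff.1 (S.isClosed_ΓReal hz hk).isOpen_compl v hv

theorem tendsto_vertical {f : ℂ → ℂ} (hf : Continuous f) (t : ℝ) :
    Tendsto (fun y : ℝ => f (t + y * Complex.I)) (𝓝[>] 0) (𝓝 (f t)) := by
  have h1 : Continuous fun y : ℝ => f (t + y * Complex.I) := by fun_prop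
  have h2 := (h1.tendsto 0).mono_left (nhdsWithin_le_nhds (s := Set.Ioi 0))
  simpa using h2

/-- The values of the symmetric functions off `Γ_j` in terms of the Cauchy transform of a density on
`Γ_j`. -/
theorem F_rep (S : CritSetup a p x s) (hz : IsRootLabelling a p z) {k m : ℕ} (hk1 : 1 ≤ k) (hk : k < p)
    (hm : m + 2 ≤ p) {v : ℝ} (hv : (v : ℂ) ∉ Γ z (k + 1)) :
    Integrable (fun t => ρ z (branchPt a p x) (k + 1) t * (F z (k + 2) m t).re / (v - t)) ∧
      (v - branchPt a p x (k + 1)) *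
        ∫ t, ρ z (branchPt a p x) (k + 1) t * (F z (k + 2) m t).re / (v - t) =
      (F z (k + 1) (m + 1) v).re - (F z (k + 1) (m + 1) (branchPt a p x (k + 1))).re := by
  set b := branchPt a p x (k + 1) with hb
  have hbΓ : (b : ℂ) ∈ Γ z (k + 1) := S.branchPt_mem_Γ hz (by omega) (by omega)
  have hvb : v ≠ b := by rintro rfl; exact hv hbΓ
  set f := F z (k + 1) (m + 1) with hf
  -- The double root at the branch point is real, so the density vanishes there.
  have hfb : (f b).im = 0 := by
    have h1 : up z k b = ((x (k + 1) : ℝ) : ℂ)⁻¹ := by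
      have h2 := (S.double_index hz (show 1 ≤ k + 1 by omega) (by omega)).1
      rw [Nat.add_sub_cancel] at h2
      rcases up_eq_or z k b with h3 | h3 <;> rw [h3, h2]
      simp
    rw [hf, S.F_im hz hk, dens, Set.indicator_of_mem (show b ∈ ΓReal z (k + 1) from hbΓ),
      Nat.add_sub_cancel, h1, ← Complex.ofReal_inv, Complex.ofReal_im]
    simp
  obtain ⟨hθ, hθ1⟩ := S.one_div_mem
  obtain ⟨C, hC⟩ := S.exists_norm_F_le hz (show k + 1 ≤ p + 1 by omega) (show m + 1 + 1 ≤ p by omega)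
  obtain ⟨C', hC'⟩ := exists_norm_div_le_majorant hθ1 (S.F_isBigO hz (show k + 1 ≤ p + 1 by omega)
    (m + 1) b) hC
  obtain ⟨δ, hδ, hball⟩ := S.exists_ball_compl hz hk hv
  set φ : ℝ → ℂ := fun t => (f t - f b) / (t - b) with hφ
  have hfc : Continuous f := S.continuous_F hz (by omega) _
  have hlim : ∀ t : ℝ, t ≠ b → Tendsto (fun y : ℝ => (f (t + y * Complex.I) - f b) /
      ((t + y * Complex.I : ℂ) - b)) (𝓝[>] 0) (𝓝 (φ t)) := by
    intro t ht
    refine Tendsto.div ((tendsto_vertical hfc t).sub_const _)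
      (tendsto_vertical (f := fun l => l - b) (by fun_prop) t) ?_
    rw [sub_ne_zero]; exact_mod_cast ht
  -- Dividing by `t - λ_{k+1}` turns `dens` into `ρ`; this is the origin of the denominator in the
  -- generating measures.
  have him : ∀ t : ℝ, (φ t).im = -Real.pi * (ρ z (branchPt a p x) (k + 1) t * (F z (k + 2) m t).re) := by
    intro t
    rw [hφ]
    simp only
    rw [← Complex.ofReal_sub, Complex.div_ofReal_im, Complex.sub_im, hfb, sub_zero, hf,
      S.F_im hz hk, S.ρ_eq hz _ (by omega) (by omega)]
    ring
  have key := cauchy_formula_real (G := fun l => (f l - f b) / (l - b)) (φ := φ) (b := b) hθ hθ1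
    (((S.differentiableOn_F hz (by omega) _).sub_const _).div (by fun_prop) fun l hl h => by
      have := congrArg Complex.im h
      simp at this
      exact (ne_of_gt hl) this) hC' hlim hδ (fun t ht => by
        rw [him, S.ρ_eq hz _ (by omega) (by omega), dens, Set.indicator_of_notMem (hball t ht)]
        simp) (hlim v hvb)
  have heq : ∀ t, (φ t).im / (t - v) =
      Real.pi * (ρ z (branchPt a p x) (k + 1) t * (F z (k + 2) m t).re / (v - t)) := by
    intro t
    rw [him, ← neg_sub v t, div_neg]; ring
  simp only [heq] at key
  have hpi := Real.pi_ne_zero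
  refine ⟨?_, ?_⟩
  · have := key.1.const_mul Real.pi⁻¹
    simpa only [inv_mul_cancel_left₀ hpi] using this
  · have h1 := key.2
    rw [integral_const_mul, Complex.ofReal_mul, inv_mul_cancel_left₀ (by exact_mod_cast hpi), hφ] at h1
    simp only at h1
    have h2 : (v : ℂ) - b ≠ 0 := by rw [sub_ne_zero]; exact_mod_cast hvb
    rw [div_eq_iff h2, ← Complex.ofReal_sub, ← Complex.ofReal_mul] at h1
    have h3 := congrArg Complex.re h1
    rw [Complex.sub_re, Complex.ofReal_re] at h3
    linarith

/-! ### The generalized Nikishin system -/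

/-- By `F_rep`, the factor `t - λ_{k+2}` times the Cauchy transform of `ρ_{k+2} F_{k+3,i}` is
`F_{k+2,i+1}(t)` minus its value at `λ_{k+2}`. Degrees rise by one, the leading coefficient is kept,
and the constants are collected in front of `F_{k+2,0} = 1`. -/
theorem nikishinDensity_eq (S : CritSetup a p x s) (hz : IsRootLabelling a p z) (m : ℕ) :
    ∀ k, k + 1 + m ≤ p → ∃ c : ℕ → ℝ, c m = 1 ∧
      ∀ t, nikishinDensity z (branchPt a p x) m (k + 1) t = ρ z (branchPt a p x) (k + 1) t *
        ∑ i ∈ Finset.range (m + 1), c i * (F z (k + 2) i t).re := by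
  induction m with
  | zero =>
    intro k hk
    exact ⟨fun _ => 1, rfl, fun t => by simp [nikishinDensity, F, hs_zero_right]⟩
  | succ m ih =>
    intro k hk
    obtain ⟨c, hc, h⟩ := ih (k + 1) (by omega)
    set b := branchPt a p x (k + 2) with hb
    refine ⟨fun
      | 0 => -∑ i ∈ Finset.range (m + 1), c i * (F z (k + 2) (i + 1) b).re
      | i + 1 => c i, hc, fun t => ?_⟩
    by_cases ht : (t : ℂ) ∈ Γ z (k + 1)
    · have hrep := fun i (hi : i ∈ Finset.range (m + 1)) => S.F_rep hz (k := k + 1) (m := i) (by omega)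
        (by omega) (by rw [Finset.mem_range] at hi; omega) (S.Γ_disjoint hz (by omega) ht)
      have h1 : cauchyReal (nikishinDensity z (branchPt a p x) m (k + 1 + 1)) t =
          ∑ i ∈ Finset.range (m + 1), c i * ∫ u, ρ z (branchPt a p x) (k + 1 + 1) u *
            (F z (k + 1 + 2) i u).re / (t - u) := by
        rw [cauchyReal]
        simp only [h, ← integral_const_mul]
        rw [← integral_finsetSum _ fun i hi => (hrep i hi).1.const_mul (c i)]
        refine integral_congr_ae (Eventually.of_forall fun u => ?_)
        simp only [Finset.mul_sum, Finset.sum_div]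
        exact Finset.sum_congr rfl fun i _ => by ring
      have h2 : ∑ i ∈ Finset.range (m + 1), (t - branchPt a p x (k + 1 + 1)) * (c i *
          ∫ u, ρ z (branchPt a p x) (k + 1 + 1) u * (F z (k + 1 + 2) i u).re / (t - u)) =
          ∑ i ∈ Finset.range (m + 1), c i * ((F z (k + 2) (i + 1) t).re -
            (F z (k + 2) (i + 1) b).re) := by
        refine Finset.sum_congr rfl fun i hi => ?_
        rw [← (hrep i hi).2]; ring
      rw [nikishinDensity, prodDensity, h1, Finset.mul_sum, h2, Finset.sum_range_succ' _ (m + 1)]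
      simp only [mul_sub, Finset.sum_sub_distrib, F, hs_zero_right, Complex.one_re]
      ring
    · have h1 : ρ z (branchPt a p x) (k + 1) t = 0 :=
        Set.indicator_of_notMem (show t ∉ ΓReal z (k + 1) from ht) _
      rw [nikishinDensity, prodDensity, h1, mul_zero, zero_mul]

theorem integrable_nikishinDensity_div (S : CritSetup a p x s) (hz : IsRootLabelling a p z)
    {k m : ℕ} (hk : k + 2 + m ≤ p) {v : ℝ} (hv : (v : ℂ) ∈ Γ z (k + 1)) :
    Integrable fun t => nikishinDensity z (branchPt a p x) m (k + 2) t / (v - t) := by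
  obtain ⟨c, -, h⟩ := S.nikishinDensity_eq hz m (k + 1) (by omega)
  have h1 := integrable_finsetSum (Finset.range (m + 1)) fun i hi =>
    (S.F_rep hz (k := k + 1) (m := i) (by omega) (by omega) (by rw [Finset.mem_range] at hi; omega)
      (S.Γ_disjoint hz (by omega) hv)).1.const_mul (c i)
  refine h1.congr (Eventually.of_forall fun t => ?_)
  simp only [h, Finset.mul_sum, Finset.sum_div]
  exact Finset.sum_congr rfl fun i _ => by ring

theorem isCompact_ΓReal_one (S : CritSetup a p x s) (hz : IsRootLabelling a p z) :
    IsCompact (ΓReal z 1) := by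
  obtain ⟨B, hB⟩ := S.exists_bound_Γ_one hz
  refine Metric.isCompact_of_isClosed_isBounded (S.isClosed_ΓReal hz S.one_le)
    ((Metric.isBounded_Icc (-B) B).subset fun v hv => ?_)
  have h := hB v hv
  rw [Complex.norm_real, Real.norm_eq_abs, abs_lt] at h
  exact ⟨h.1.le, h.2.le⟩

theorem integrable_dens_one_mul (S : CritSetup a p x s) (hz : IsRootLabelling a p z) {E : Type*}
    [NormedAddCommGroup E] [NormedSpace ℝ E] {f : ℝ → E} (hf : ContinuousOn f (ΓReal z 1)) :
    Integrable fun t => dens z 1 t • f t := by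
  have h1 : (fun t => dens z 1 t • f t) =
      (ΓReal z 1).indicator fun t => (-(up z 0 t).im / Real.pi) • f t := by
    funext t
    rw [dens, Set.indicator_smul_apply_left]
  have hc := S.isCompact_ΓReal_one hz
  rw [h1, integrable_indicator_iff hc.isClosed.measurableSet]
  refine ContinuousOn.integrableOn_compact hc (ContinuousOn.smul (Continuous.continuousOn ?_) hf)
  have := (S.continuous_up hz (Nat.zero_le p)).comp Complex.continuous_ofReal
  exact (Complex.continuous_im.comp this).neg.div_const _

theorem continuous_F_re (S : CritSetup a p x s) (hz : IsRootLabelling a p z) {j : ℕ}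
    (hj : j ≤ p + 1) (m : ℕ) : Continuous fun t : ℝ => (F z j m t).re :=
  Complex.continuous_re.comp ((S.continuous_F hz hj m).comp Complex.continuous_ofReal)

theorem integrable_nikishinDensity (S : CritSetup a p x s) (hz : IsRootLabelling a p z) {m : ℕ}
    (hm : m + 1 ≤ p) : Integrable (nikishinDensity z (branchPt a p x) m 1) := by
  obtain ⟨c, -, h⟩ := S.nikishinDensity_eq hz m 0 (by omega)
  simp only [zero_add, S.ρ_one hz] at h
  refine (S.integrable_dens_one_mul hz (f := fun t : ℝ => ∑ i ∈ Finset.range (m + 1),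
    c i * (F z 2 i t).re) (Continuous.continuousOn ?_)).congr
      (Eventually.of_forall fun t => (h t).symm)
  exact continuous_finsetSum _ fun i _ => continuous_const.mul
    (S.continuous_F_re hz (by have := S.one_le; omega) i)

theorem mem_interior_iff (S : CritSetup a p x s) (hz : IsRootLabelling a p z) {k : ℕ} (h1 : 2 ≤ k)
    (h2 : k ≤ p) {e : ℝ} (he : 0 < e * curv p x k) (v : ℝ) :
    v ∈ interior (ΓReal z k) ↔ e * (v - branchPt a p x k) < 0 := by
  have he0 : e ≠ 0 := by rintro rfl; simp at he
  have hΓ := S.mem_Γ_iff hz h1 h2 he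
  constructor
  · intro hv
    refine lt_of_le_of_ne ((hΓ v).1 (show v ∈ ΓReal z k from interior_subset hv)) fun h => ?_
    have hvb : v = branchPt a p x k := by
      rcases mul_eq_zero.1 h with h3 | h3
      · exact absurd h3 he0
      · linarith
    obtain ⟨u, h3, h4, -⟩ := exists_side (P := fun u => u ∈ ΓReal z k)
      (mem_interior_iff_mem_nhds.1 hv) he0 one_pos
    have := (hΓ u).1 h3
    rw [← hvb] at this
    linarith
  · intro hv
    refine mem_interior.2 ⟨{u | e * (u - branchPt a p x k) < 0}, fun u hu => (hΓ u).2 (le_of_lt hu), ?_,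
      hv⟩
    exact isOpen_lt (by fun_prop) continuous_const

theorem mem_interior_one_iff (S : CritSetup a p x s) (hz : IsRootLabelling a p z) (v : ℝ) :
    v ∈ interior (ΓReal z 1) ↔
      s * branchPt a p x (p + 1) < s * v ∧ s * v < s * branchPt a p x 1 := by
  have hs0 : s ≠ 0 := by rcases S.sign with h | h <;> rw [h] <;> norm_num
  obtain ⟨hlt, hΓ⟩ := S.mem_Γ_one_iff hz
  constructor
  · intro hv
    obtain ⟨h1, h2⟩ := (hΓ v).1 (show v ∈ ΓReal z 1 from interior_subset hv)
    refine ⟨lt_of_le_of_ne h1 fun h => ?_, lt_of_le_of_ne h2 fun h => ?_⟩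
    · obtain ⟨u, h3, h4, -⟩ := exists_side (P := fun u => u ∈ ΓReal z 1)
        (mem_interior_iff_mem_nhds.1 hv) (neg_ne_zero.2 hs0) one_pos
      have := ((hΓ u).1 h3).1
      linarith
    · obtain ⟨u, h3, h4, -⟩ := exists_side (P := fun u => u ∈ ΓReal z 1)
        (mem_interior_iff_mem_nhds.1 hv) hs0 one_pos
      have := ((hΓ u).1 h3).2
      linarith
  · intro hv
    refine mem_interior.2 ⟨{u | s * branchPt a p x (p + 1) < s * u ∧ s * u < s * branchPt a p x 1},
      fun u hu => (hΓ u).2 ⟨le_of_lt hu.1, le_of_lt hu.2⟩, ?_, hv⟩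
    have h1 : IsOpen {u : ℝ | s * branchPt a p x (p + 1) < s * u} :=
      isOpen_lt continuous_const (continuous_const.mul continuous_id)
    have h2 : IsOpen {u : ℝ | s * u < s * branchPt a p x 1} :=
      isOpen_lt (continuous_const.mul continuous_id) continuous_const
    exact h1.inter h2

theorem ne_of_mem_interior (S : CritSetup a p x s) (hz : IsRootLabelling a p z) {k : ℕ} (hk : k < p)
    {v : ℝ} (hv : v ∈ interior (ΓReal z (k + 1))) :
    v ≠ branchPt a p x (k + 1) ∧ (k = 0 → v ≠ branchPt a p x (p + 1)) := by
  rcases Nat.eq_zero_or_pos k with rfl | hk0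
  · have h := (S.mem_interior_one_iff hz v).1 hv
    exact ⟨fun h1 => by rw [h1] at h; exact lt_irrefl _ h.2,
      fun _ h1 => by rw [h1] at h; exact lt_irrefl _ h.1⟩
  · obtain ⟨e, -, he⟩ := S.exists_sign_curv (m := k + 1) (Finset.mem_Icc.2 ⟨by omega, by omega⟩)
    have h := (S.mem_interior_iff hz (by omega) (by omega) he v).1 hv
    exact ⟨fun h1 => by rw [h1] at h; simp at h, fun h => by omega⟩

theorem imSign_mul_dens_neg (S : CritSetup a p x s) (hz : IsRootLabelling a p z) {k : ℕ} (hk : k < p)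
    {v : ℝ} (hv : v ∈ interior (ΓReal z (k + 1))) : imSign z k * dens z (k + 1) v < 0 := by
  obtain ⟨h1, h2⟩ := S.ne_of_mem_interior hz hk hv
  have h3 := S.imSign_mul_im_up_pos hz hk (show v ∈ ΓReal z (k + 1) from interior_subset hv) h1 h2
  rw [dens, Set.indicator_of_mem (interior_subset hv), Nat.add_sub_cancel, mul_div_assoc', mul_neg]
  exact div_neg_of_neg_of_pos (by linarith) Real.pi_pos

/-- A nonreal boundary value is impossible at a branch point, and away from the branch points every
point of `Γ_{k+1}` is interior. -/
theorem dens_eq_zero (S : CritSetup a p x s) (hz : IsRootLabelling a p z) {k : ℕ} (hk : k < p)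
    {v : ℝ} (hv : v ∉ interior (ΓReal z (k + 1))) : dens z (k + 1) v = 0 := by
  by_cases h : v ∈ ΓReal z (k + 1)
  · rw [dens, Set.indicator_of_mem h, Nat.add_sub_cancel]
    suffices (up z k v).im = 0 by rw [this]; simp
    by_contra him
    refine hv (mem_interior_iff_mem_nhds.2 (S.eventually_mem_Γ hz hk h (fun h1 => him ?_)
      fun h0 h1 => him ?_))
    · have h2 := (S.double_index hz (show 1 ≤ k + 1 by omega) (by omega)).1
      rw [Nat.add_sub_cancel, ← h1] at h2
      rcases up_eq_or z k v with h3 | h3 <;> rw [h3, h2, ← Complex.ofReal_inv] <;> simp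
    · have h2 := (S.double_index_last hz).1
      rw [← h1, ← h0] at h2
      rcases up_eq_or z k v with h3 | h3 <;> rw [h3, h2, ← Complex.ofReal_inv] <;> simp
  · rw [dens, Set.indicator_of_notMem h]

/-- The imaginary part of a root has constant sign on the upper half-plane, inherited by its nonzero
boundary values; for `k ≥ 1`, `t - λ_{k+1}` has constant sign inside the half-line. -/
theorem exists_sign_ρ (S : CritSetup a p x s) (hz : IsRootLabelling a p z) {k : ℕ} (hk : k < p) :
    ∃ ε : ℝ, (ε = 1 ∨ ε = -1) ∧
      ∀ v ∈ interior (ΓReal z (k + 1)), 0 < ε * ρ z (branchPt a p x) (k + 1) v := by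
  have hσ : imSign z k = 1 ∨ imSign z k = -1 := by
    rw [imSign]; split_ifs
    · exact Or.inl rfl
    · exact Or.inr rfl
  rcases Nat.eq_zero_or_pos k with rfl | hk0
  · refine ⟨-imSign z 0, by rcases hσ with h | h <;> rw [h] <;> norm_num, fun v hv => ?_⟩
    rw [zero_add, S.ρ_one hz]
    have := S.imSign_mul_dens_neg hz hk hv
    linarith
  · obtain ⟨e, he', he⟩ := S.exists_sign_curv (m := k + 1) (Finset.mem_Icc.2 ⟨by omega, by omega⟩)
    refine ⟨imSign z k * e, ?_, fun v hv => ?_⟩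
    · rcases hσ with h | h <;> rcases he' with h' | h' <;> rw [h, h'] <;> norm_num
    · have h := (S.mem_interior_iff hz (by omega) (by omega) he v).1 hv
      have h2 := S.imSign_mul_dens_neg hz hk hv
      have hee : e * e = 1 := by rcases he' with h' | h' <;> rw [h'] <;> norm_num
      rw [S.ρ_eq hz _ (by omega) (by omega)]
      have h3 : imSign z k * e * (dens z (k + 1) v / (v - branchPt a p x (k + 1))) =
          (imSign z k * dens z (k + 1) v) / (e * (v - branchPt a p x (k + 1))) := by
        have h4 : v - branchPt a p x (k + 1) ≠ 0 := by
          intro h4; rw [h4, mul_zero] at h; exact lt_irrefl _ h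
        have h5 : e ≠ 0 := by rintro rfl; simp at hee
        field_simp
        linear_combination (imSign z k * dens z (k + 1) v) * hee
      rw [h3]
      exact div_pos_of_neg_of_neg h2 h

theorem nikishinDensity_eq_zero (S : CritSetup a p x s) (hz : IsRootLabelling a p z) {k m : ℕ}
    (hk : k < p) {v : ℝ} (hv : v ∉ interior (ΓReal z (k + 1))) :
    nikishinDensity z (branchPt a p x) m (k + 1) v = 0 := by
  have h : ρ z (branchPt a p x) (k + 1) v = 0 := by
    rcases Nat.eq_zero_or_pos k with rfl | hk0
    · rw [zero_add, S.ρ_one hz]; exact S.dens_eq_zero hz hk hv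
    · rw [S.ρ_eq hz _ (by omega) (by omega), S.dens_eq_zero hz hk hv, zero_div]
  cases m with
  | zero => exact h
  | succ m => rw [nikishinDensity, prodDensity, h, mul_zero]

/-- A Cauchy transform of a density of constant sign on `Γ_{k+2}` has constant sign on `Γ_{k+1}`. -/
theorem exists_sign_integral (S : CritSetup a p x s) (hz : IsRootLabelling a p z) {k : ℕ}
    (hk : k + 1 < p) {w : ℝ → ℝ} {ε : ℝ}
    (hw : ∀ t ∈ interior (ΓReal z (k + 2)), 0 < ε * w t)
    (hw0 : ∀ t ∉ interior (ΓReal z (k + 2)), w t = 0)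
    (hI : ∀ v ∈ ΓReal z (k + 1), Integrable fun t => w t / (v - t)) :
    ∃ e : ℝ, (e = 1 ∨ e = -1) ∧ ∀ v ∈ ΓReal z (k + 1),
      0 < e * (v - branchPt a p x (k + 2)) ∧ 0 < e * ε * ∫ t, w t / (v - t) := by
  obtain ⟨e, he', he⟩ := S.exists_sign_curv (m := k + 2) (Finset.mem_Icc.2 ⟨by omega, by omega⟩)
  refine ⟨e, he', fun v hv => ?_⟩
  have hΓ := S.mem_Γ_iff hz (show 2 ≤ k + 2 by omega) (by omega) he
  have h1 : 0 < e * (v - branchPt a p x (k + 2)) := by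
    by_contra hcon
    exact S.Γ_disjoint hz (by omega) hv ((hΓ v).2 (not_lt.1 hcon))
  refine ⟨h1, ?_⟩
  have hpos : ∀ t ∈ interior (ΓReal z (k + 2)), 0 < e * ε * (w t / (v - t)) := by
    intro t ht
    have h2 := (hΓ t).1 (show t ∈ ΓReal z (k + 2) from interior_subset ht)
    have h3 : 0 < e * (v - t) := by linarith
    have h4 : e * ε * (w t / (v - t)) = (ε * w t) / (e * (v - t)) := by
      have hee : e * e = 1 := by rcases he' with h' | h' <;> rw [h'] <;> norm_num
      have h4 : v - t ≠ 0 := by intro h4; rw [h4, mul_zero] at h3; exact lt_irrefl _ h3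
      have h5 : e ≠ 0 := by rintro rfl; simp at hee
      field_simp
      linear_combination (ε * w t) * hee
    rw [h4]
    exact div_pos (hw t ht) h3
  rw [← integral_const_mul, integral_pos_iff_support_of_nonneg]
  · refine lt_of_lt_of_le ?_ (measure_mono (fun t ht => (hpos t ht).ne' :
      interior (ΓReal z (k + 2)) ⊆ _))
    refine isOpen_interior.measure_pos _ ⟨branchPt a p x (k + 2) - e, ?_⟩
    rw [S.mem_interior_iff hz (by omega) (by omega) he]
    rcases he' with h' | h' <;> rw [h'] <;> norm_num
  · intro t
    by_cases ht : t ∈ interior (ΓReal z (k + 2))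
    · exact (hpos t ht).le
    · simp [hw0 t ht]
  · exact (hI v hv).const_mul _

/-- The set `Γ_{k+1}` lies on one side of the half-line `Γ_{k+2}`. The sign `e` of that side enters
through `t - λ_{k+2}` and again through the Cauchy transform, so it cancels. -/
theorem exists_sign_nikishinDensity (S : CritSetup a p x s) (hz : IsRootLabelling a p z) (m : ℕ) :
    ∀ k, k + 1 + m ≤ p → ∃ ε : ℝ, (ε = 1 ∨ ε = -1) ∧ ∀ v ∈ interior (ΓReal z (k + 1)),
      0 < ε * nikishinDensity z (branchPt a p x) m (k + 1) v := by
  induction m with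
  | zero => exact fun k hk => S.exists_sign_ρ hz (by omega)
  | succ m ih =>
    intro k hk
    obtain ⟨ε₁, hε₁, h1⟩ := S.exists_sign_ρ hz (k := k) (by omega)
    obtain ⟨ε₂, hε₂, h2⟩ := ih (k + 1) (by omega)
    obtain ⟨e, he, h3⟩ := S.exists_sign_integral hz (by omega) h2
      (fun t ht => S.nikishinDensity_eq_zero hz (by omega) ht)
      fun v hv => S.integrable_nikishinDensity_div hz (by omega) hv
    refine ⟨ε₁ * ε₂, ?_, fun v hv => ?_⟩
    · rcases hε₁ with h | h <;> rcases hε₂ with h' | h' <;> rw [h, h'] <;> norm_num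
    · obtain ⟨h4, h5⟩ := h3 v (interior_subset hv)
      have hee : e * e = 1 := by rcases he with h' | h' <;> rw [h'] <;> norm_num
      have h6 := _root_.mul_pos (_root_.mul_pos h4 h5) (h1 v hv)
      rw [nikishinDensity, prodDensity, cauchyReal]
      calc _ < _ := h6
        _ = (e * e) * (ε₁ * ε₂ * ((v - branchPt a p x (k + 2)) *
          (∫ t, nikishinDensity z (branchPt a p x) m (k + 2) t / (v - t)) *
            ρ z (branchPt a p x) (k + 1) v)) := by ring
        _ = _ := by rw [hee, one_mul]

theorem isNikishinSystem (S : CritSetup a p x s) (hz : IsRootLabelling a p z) :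
    IsNikishinSystem p z (branchPt a p x) where
  boundary j hj v _ := by
    rw [Finset.mem_Icc] at hj
    rw [S.lowerValue_eq hz (by omega)]
    exact S.tendsto_lower hz (by omega) v
  cauchy j m hj hjm v hv := by
    obtain ⟨k, rfl⟩ := Nat.exists_eq_add_of_le' hj
    exact S.integrable_nikishinDensity_div hz hjm hv
  finite k hk := by
    rw [Finset.mem_Icc] at hk
    exact S.integrable_nikishinDensity hz (by omega)
  sign j m hj hjm := by
    obtain ⟨k, rfl⟩ := Nat.exists_eq_add_of_le' hj
    obtain ⟨ε, hε, h⟩ := S.exists_sign_nikishinDensity hz m k hjm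
    rcases hε with rfl | rfl
    · left; intro v hv; have := h v hv; linarith
    · right; intro v hv; have := h v hv; linarith

end CritSetup

/-! ### Integration against measures with densities -/

theorem integral_withDensityᵥ {E : Type*} [NormedAddCommGroup E] [NormedSpace ℝ E] [CompleteSpace E]
    {f : ℝ → ℝ} {g : ℝ → E} (hf : Integrable f) (hg : AEStronglyMeasurable g volume)
    (hfg : Integrable fun t => f t • g t) :
    ∫ᵛ t, g t ∂<•(volume.withDensityᵥ f) = ∫ t, f t • g t := by
  -- Used for `h = f` and `h = -f`, whose positive parts give the signed measure as a difference of
  -- two finite measures.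
  have key : ∀ h : ℝ → ℝ, Integrable h → (∀ t, |h t| ≤ |f t|) →
      Integrable (fun t => max (h t) 0 • g t) ∧
      Integrable g (volume.withDensity fun t => ENNReal.ofReal (h t)) ∧
      ∫ t, g t ∂(volume.withDensity fun t => ENNReal.ofReal (h t)) = ∫ t, max (h t) 0 • g t := by
    intro h hh hle
    have h1 : Integrable (fun t => max (h t) 0 • g t) := by
      refine hfg.mono ((hh.aestronglyMeasurable.sup aestronglyMeasurable_const).smul hg)
        (Eventually.of_forall fun t => ?_)
      rw [norm_smul, norm_smul, Real.norm_eq_abs, Real.norm_eq_abs]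
      refine mul_le_mul_of_nonneg_right ((?_ : _ ≤ |h t|).trans (hle t)) (norm_nonneg _)
      rw [abs_of_nonneg (le_max_right _ _)]
      exact max_le (le_abs_self _) (abs_nonneg _)
    have hm : AEMeasurable (fun t => ENNReal.ofReal (h t)) volume := hh.aemeasurable.ennreal_ofReal
    have hlt : ∀ᵐ t ∂(volume : Measure ℝ), ENNReal.ofReal (h t) < ⊤ := by simp
    refine ⟨h1, ?_, ?_⟩
    · rw [integrable_withDensity_iff_integrable_smul₀' hm hlt]
      simpa only [ENNReal.toReal_ofReal'] using h1
    · rw [integral_withDensity_eq_integral_toReal_smul₀ hm hlt]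
      simp only [ENNReal.toReal_ofReal']
  obtain ⟨h1, h2, h3⟩ := key f hf fun t => le_rfl
  obtain ⟨h4, h5, h6⟩ := key (fun t => -f t) hf.neg fun t => (abs_neg _).le
  have hfin := isFiniteMeasure_withDensity_ofReal hf.2
  have hfin' := isFiniteMeasure_withDensity_ofReal hf.neg.2
  rw [withDensityᵥ_eq_withDensity_pos_part_sub_withDensity_neg_part hf,
    VectorMeasure.integral_sub_vectorMeasure (by simpa [VectorMeasure.Integrable] using h2)
      (by simpa [VectorMeasure.Integrable] using h5), VectorMeasure.integral_toSignedMeasure,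
    VectorMeasure.integral_toSignedMeasure, h3, h6, ← integral_sub h1 h4]
  refine integral_congr_ae (Eventually.of_forall fun t => ?_)
  simp only [← sub_smul]
  rcases le_total 0 (f t) with h | h
  · rw [max_eq_left h, max_eq_right (by linarith), sub_zero]
  · rw [max_eq_right h, max_eq_left (by linarith)]; simp

theorem totalVariation_withDensityᵥ_eq_zero {f : ℝ → ℝ} (hf : Integrable f) {T : Set ℝ}
    (hT : MeasurableSet T) (h : ∀ t ∈ T, f t = 0) :
    SignedMeasure.totalVariation (volume.withDensityᵥ f) T = 0 := by
  rw [SignedMeasure.totalVariation_eq_variation, Measure.variation_withDensityᵥ hf,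
    withDensity_apply _ hT, setLIntegral_congr_fun hT (g := fun _ => 0) fun t ht => by simp [h t ht]]
  simp

theorem withDensityᵥ_finsetSum {ι : Type*} (T : Finset ι) (c : ι → ℝ) {f : ι → ℝ → ℝ}
    (hf : ∀ i ∈ T, Integrable (f i)) :
    (volume.withDensityᵥ fun t => ∑ i ∈ T, c i * f i t) =
      ∑ i ∈ T, c i • (volume : Measure ℝ).withDensityᵥ (f i) := by
  classical
  induction T using Finset.induction_on with
  | empty => exact withDensityᵥ_zero
  | insert i T hi ih =>
    simp only [Finset.sum_insert hi]
    rw [withDensityᵥ_add' ((hf i (by simp)).const_mul _) (integrable_finsetSum _ fun j hj =>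
      (hf j (by simp [hj])).const_mul _), ih fun j hj => hf j (by simp [hj])]
    congr 1
    exact withDensityᵥ_smul' (f i) (c i)

/-- Inversion of unitriangular systems. -/
theorem exists_triangular_inverse {M : Type*} [AddCommGroup M] [Module ℝ M] {N J : ℕ → M} {n : ℕ}
    (h : ∀ m < n, ∃ c : ℕ → ℝ, c m = 1 ∧ N m = ∑ i ∈ Finset.range (m + 1), c i • J i) :
    ∀ m < n, ∃ c : ℕ → ℝ, c m = 1 ∧ J m = ∑ i ∈ Finset.range (m + 1), c i • N i := by
  have key : ∀ m < n, J m - N m ∈ Submodule.span ℝ (N '' (Finset.range m : Set ℕ)) := by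
    intro m
    induction m using Nat.strong_induction_on with
    | _ m ih =>
      intro hm
      obtain ⟨c, hc, hN⟩ := h m hm
      have h1 : J m - N m = -∑ i ∈ Finset.range m, c i • J i := by
        rw [hN, Finset.sum_range_succ, hc, one_smul]; abel
      rw [h1]
      refine neg_mem (sum_mem fun i hi => Submodule.smul_mem _ _ ?_)
      rw [Finset.mem_range] at hi
      rw [← sub_add_cancel (J i) (N i)]
      refine add_mem (Submodule.span_mono (Set.image_mono ?_) (ih i hi (hi.trans hm)))
        (Submodule.subset_span ⟨i, by simpa using hi, rfl⟩)
      intro k hk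
      simp only [Finset.coe_range, Set.mem_Iio] at hk ⊢
      exact hk.trans hi
  intro m hm
  obtain ⟨c, hc⟩ := (Submodule.mem_span_image_finset_iff_exists_fun ℝ).1 (key m hm)
  refine ⟨fun i => if h : i ∈ Finset.range m then c ⟨i, h⟩ else 1, dif_neg (by simp), ?_⟩
  beta_reduce
  rw [Finset.sum_range_succ, dif_neg (by simp), one_smul, ← sub_eq_iff_eq_add, ← hc,
    ← Finset.sum_coe_sort (Finset.range m)]
  exact Finset.sum_congr rfl fun i _ => by rw [dif_pos i.2]

/-! ### The measures representing the powers of the first root -/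

/-- The density `Im z_{0,-}^k / π` of `μ_k`. -/
def J (z : ℕ → ℂ → ℂ) (k : ℕ) (t : ℝ) : ℝ := -(up z 0 t ^ k).im / Real.pi

theorem norm_le_majorant {G : ℂ → ℂ} {C θ : ℝ} (hθ : 0 < θ)
    (h : ∀ l ∈ upperHP, ‖G l‖ ≤ C * (1 + ‖l‖) ^ (-θ)) {l : ℂ} (hl : l ∈ upperHP) :
    ‖G l‖ ≤ C * majorant θ ‖l - (0 : ℝ)‖ := by
  have hl0 : 0 < ‖l‖ := norm_pos_iff.2 fun h0 => by
    have : 0 < l.im := hl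
    simp [h0] at this
  have hC : 0 ≤ C := nonneg_of_mul_nonneg_left ((norm_nonneg _).trans (h l hl))
    (Real.rpow_pos_of_pos (by positivity) _)
  refine (h l hl).trans (mul_le_mul_of_nonneg_left ?_ hC)
  rw [Complex.ofReal_zero, sub_zero, majorant, abs_norm]
  have h1 := Real.rpow_le_rpow_of_nonpos hl0 (show ‖l‖ ≤ 1 + ‖l‖ by linarith)
    (show -θ ≤ 0 by linarith)
  have h2 : 0 ≤ ‖l‖ ^ (-(1 / 2 : ℝ)) := by positivity
  linarith

namespace CritSetup

variable {a x : ℕ → ℝ} {p : ℕ} {s : ℝ} {z : ℕ → ℂ → ℂ}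

/-- This is the jump relation `F_im` for `k = 0`, since `F z 1 (m + 1)` is the power `m + 1` of the
first root. -/
theorem J_succ (S : CritSetup a p x s) (hz : IsRootLabelling a p z) (m : ℕ) (t : ℝ) :
    J z (m + 1) t = dens z 1 t * (F z 2 m t).re := by
  have h := S.F_im hz S.one_le m t
  rw [zero_add, F, hs_one] at h
  rw [J, h]
  field_simp [Real.pi_ne_zero]

theorem integrable_J_smul (S : CritSetup a p x s) (hz : IsRootLabelling a p z) {E : Type*}
    [NormedAddCommGroup E] [NormedSpace ℝ E] {f : ℝ → E} (hf : ContinuousOn f (ΓReal z 1)) {k : ℕ}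
    (hk : 1 ≤ k) : Integrable fun t => J z k t • f t := by
  obtain ⟨k, rfl⟩ := Nat.exists_eq_add_of_le' hk
  simp only [S.J_succ hz, mul_smul]
  exact S.integrable_dens_one_mul hz
    ((S.continuous_F_re hz (by have := S.one_le; omega) k).continuousOn.smul hf)

theorem integrable_J (S : CritSetup a p x s) (hz : IsRootLabelling a p z) {k : ℕ}
    (hk : 1 ≤ k) : Integrable (J z k) := by
  simpa using S.integrable_J_smul hz (f := fun _ => (1 : ℝ)) continuousOn_const hk

theorem J_eq_zero (S : CritSetup a p x s) (hz : IsRootLabelling a p z) {k : ℕ}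
    (hk : 1 ≤ k) {t : ℝ} (ht : t ∉ ΓReal z 1) : J z k t = 0 := by
  obtain ⟨k, rfl⟩ := Nat.exists_eq_add_of_le' hk
  rw [S.J_succ hz, dens, Set.indicator_of_notMem ht, zero_mul]

theorem exists_norm_up_zero_pow_le (S : CritSetup a p x s) (hz : IsRootLabelling a p z) {k : ℕ}
    {η : ℝ} (hη : η ≤ k) : ∃ C, ∀ l, ‖up z 0 l ^ k‖ ≤ C * (1 + ‖l‖) ^ (-η) := by
  obtain ⟨K, hK, h⟩ := exists_norm_first_le (a := a) (p := p) S.a_ne_zero S.one_le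
  refine ⟨K ^ k, fun l => ?_⟩
  have h1 := h l _ (hz.isLab l)
  have hl : 1 ≤ 1 + ‖l‖ := by linarith [norm_nonneg l]
  have h2 : ‖z 0 l‖ ≤ K * (1 + ‖l‖)⁻¹ := by
    rw [← div_eq_mul_inv, le_div_iff₀ (by linarith)]; linarith
  rw [norm_pow, norm_up]
  refine (pow_le_pow_left₀ (norm_nonneg _) h2 k).trans ?_
  rw [mul_pow]
  refine mul_le_mul_of_nonneg_left ?_ (by positivity)
  rw [← Real.rpow_neg_one, ← Real.rpow_mul_natCast (by positivity)]
  exact Real.rpow_le_rpow_of_exponent_le hl (by linarith)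

theorem root_eq_up (S : CritSetup a p x s) (hz : IsRootLabelling a p z) {v : ℝ}
    (hv : (v : ℂ) ∉ Γ z 1) : z 0 v = up z 0 v := by
  have h := S.F_im_eq_zero hz (j := 1) (by omega) (fun _ _ => hv) 1
  rw [F, hs_one, pow_one, ← Complex.conj_eq_iff_im] at h
  rcases up_eq_or z 0 v with h1 | h1
  · exact h1.symm
  · rw [← h, h1, Complex.conj_conj]

/-- The powers of the first root are Cauchy transforms of measures on `Γ_1`. -/
theorem root_pow_eq_integral (S : CritSetup a p x s) (hz : IsRootLabelling a p z) {k : ℕ}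
    (hk : 1 ≤ k) {l : ℂ} (hl : l ∉ Γ z 1) :
    z 0 l ^ k = ∫ t : ℝ, J z k t • (l - t)⁻¹ := by
  obtain ⟨hθ, hθ1⟩ := S.one_div_mem
  obtain ⟨C, hC⟩ := S.exists_norm_up_zero_pow_le hz (k := k) (η := 1 / p)
    (hθ1.le.trans (by exact_mod_cast hk))
  have hd : DifferentiableOn ℂ (fun l => up z 0 l ^ k) upperHP :=
    (S.differentiableOn_up hz (Nat.zero_le p)).pow k
  have hbd := fun l => norm_le_majorant hθ (fun l _ => hC l) (l := l)
  have hcont : Continuous fun l => up z 0 l ^ k := (S.continuous_up hz (Nat.zero_le p)).pow k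
  have hlim := fun t (_ : t ≠ 0) => tendsto_vertical hcont t
  have hJ : ∀ (t : ℝ) (c : ℂ), J z k t • (c - t)⁻¹ =
      (Real.pi : ℂ)⁻¹ * (((up z 0 t ^ k).im : ℂ) / (t - c)) := by
    intro t c
    rw [J, ← neg_sub c t, div_neg, Complex.real_smul, Complex.ofReal_div, Complex.ofReal_neg]
    ring
  have hup : ∀ l ∈ upperHP, z 0 l ^ k = ∫ t : ℝ, J z k t • (l - t)⁻¹ := by
    intro l hl
    simp only [hJ, integral_const_mul]
    rw [← S.up_eq hz (Nat.zero_le p) hl]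
    exact cauchy_formula hθ hθ1 hd hbd hlim hl
  -- The lower half-plane is reached by conjugation. At a real point off `Γ_1` the boundary values
  -- are real in a neighbourhood and the boundary version of Cauchy's formula applies.
  rcases lt_trichotomy l.im 0 with h | h | h
  · have h1 := hup ((starRingEnd ℂ) l) (by simpa [upperHP] using h)
    rw [S.root_conj hz (Nat.zero_le p) h.ne, ← map_pow] at h1
    have h2 := congrArg (starRingEnd ℂ) h1
    rw [Complex.conj_conj, ← integral_conj] at h2
    rw [h2]
    refine integral_congr_ae (Eventually.of_forall fun t => ?_)
    simp
  · obtain ⟨v, rfl⟩ : ∃ v : ℝ, l = v := ⟨l.re, by apply Complex.ext <;> simp [h]⟩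
    obtain ⟨δ, hδ, hball⟩ := S.exists_ball_compl hz S.one_le hl
    have h1 := (cauchy_formula_real hθ hθ1 hd hbd hlim hδ (fun t ht => by
      have h2 := S.J_eq_zero hz hk (hball t ht)
      rw [J, div_eq_zero_iff] at h2
      rcases h2 with h2 | h2
      · linarith
      · exact absurd h2 Real.pi_ne_zero) (tendsto_vertical hcont v)).2
    rw [S.root_eq_up hz hl, h1]
    simp only [hJ, integral_const_mul]
    rw [← integral_complex_ofReal]
    congr 2
    funext t
    push_cast
    rfl
  · exact hup l h

theorem cauchyTransform_withDensityᵥ_J (S : CritSetup a p x s) (hz : IsRootLabelling a p z) {k : ℕ}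
    (hk : 1 ≤ k) {l : ℂ} (hl : l ∉ Γ z 1) :
    z 0 l ^ k = cauchyTransform (volume.withDensityᵥ (J z k)) l := by
  have hf : ContinuousOn (fun t : ℝ => (l - t)⁻¹) (ΓReal z 1) := by
    refine ContinuousOn.inv₀ (by fun_prop) fun t ht h => hl ?_
    rw [sub_eq_zero.1 h]; exact ht
  rw [S.root_pow_eq_integral hz hk hl, cauchyTransform, integral_withDensityᵥ (S.integrable_J hz hk)
    (by fun_prop) (S.integrable_J_smul hz hf hk)]

/-- For `k = 0` the products `ρ_1 F_{2,i}` in `nikishinDensity_eq` are the densities of the measures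
representing the powers of `z_0`. -/
theorem nikishinDensity_one_eq (S : CritSetup a p x s) (hz : IsRootLabelling a p z) {m : ℕ}
    (hm : m < p) : ∃ c : ℕ → ℝ, c m = 1 ∧ nikishinDensity z (branchPt a p x) m 1 =
      ∑ i ∈ Finset.range (m + 1), c i • J z (i + 1) := by
  obtain ⟨c, hc, h⟩ := S.nikishinDensity_eq hz m 0 (by omega)
  refine ⟨c, hc, funext fun t => ?_⟩
  rw [h t, zero_add, S.ρ_one hz, Finset.sum_apply, Finset.mul_sum]
  refine Finset.sum_congr rfl fun i _ => ?_
  rw [Pi.smul_apply, S.J_succ hz, smul_eq_mul]; ring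

theorem exists_measure_eq_sum (S : CritSetup a p x s) (hz : IsRootLabelling a p z) {j : ℕ}
    (hj : j ∈ Finset.Icc 1 p) : ∃ c : ℕ → ℝ, c j = 1 ∧
      volume.withDensityᵥ (J z j) = ∑ k ∈ Finset.Icc 1 j, c k • σ z (branchPt a p x) k := by
  rw [Finset.mem_Icc] at hj
  obtain ⟨m, rfl⟩ := Nat.exists_eq_add_of_le' hj.1
  obtain ⟨c, hc, h⟩ := exists_triangular_inverse (N := fun m => nikishinDensity z (branchPt a p x) m 1)
    (J := fun m => J z (m + 1)) (fun m hm => S.nikishinDensity_one_eq hz hm) m (by omega)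
  refine ⟨fun k => c (k - 1), hc, ?_⟩
  have h1 : J z (m + 1) = fun t => ∑ i ∈ Finset.range (m + 1), c i *
      nikishinDensity z (branchPt a p x) i 1 t := by
    rw [h]; funext t; simp
  rw [h1, withDensityᵥ_finsetSum _ _ fun i hi => S.integrable_nikishinDensity hz (by
    rw [Finset.mem_range] at hi; omega), ← Finset.Ico_add_one_right_eq_Icc, Finset.range_eq_Ico,
    ← Finset.sum_Ico_add' _ 0 (m + 1) 1]
  rfl

end CritSetup

variable {a : ℕ → ℝ} {p : ℕ}

/-! ### The polynomials `Q_n` as symmetric functions of the reciprocal roots -/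

/-- The value of `Q_n` at a complex point. -/
def QC (a : ℕ → ℝ) (p n : ℕ) (l : ℂ) : ℂ := ((Q a p n).map (algebraMap ℝ ℂ)).eval l

theorem sum_ite_comm {R : Type*} [AddCommMonoid R] (f : ℕ → R) (n p : ℕ) :
    ∑ k ∈ Finset.range (n + 1), (if k ≤ p then f k else 0) =
      ∑ k ∈ Finset.range (p + 1), if k ≤ n then f k else 0 := by
  rw [← Finset.sum_filter, ← Finset.sum_filter]
  refine Finset.sum_congr (Finset.ext fun k => ?_) fun _ _ => rfl
  simp only [Finset.mem_filter, Finset.mem_range]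
  omega

theorem Q_zero (a : ℕ → ℝ) (p : ℕ) : Q a p 0 = 1 := by rw [Q]

theorem Q_succ (a : ℕ → ℝ) (p n : ℕ) : Q a p (n + 1) = X * Q a p n -
    ∑ k ∈ Finset.range (p + 1), if k ≤ n then C (a k) * Q a p (n - k) else 0 := by
  rw [Q, ← sum_ite_comm, Finset.sum_range]

theorem QC_zero (a : ℕ → ℝ) (p : ℕ) (l : ℂ) : QC a p 0 l = 1 := by simp [QC, Q_zero]

theorem QC_succ (a : ℕ → ℝ) (p n : ℕ) (l : ℂ) : QC a p (n + 1) l = l * QC a p n l -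
    ∑ k ∈ Finset.range (p + 1), if k ≤ n then (a k : ℂ) * QC a p (n - k) l else 0 := by
  rw [QC, Q_succ, Polynomial.map_sub, eval_sub, Polynomial.map_mul, eval_mul, Polynomial.map_X, eval_X,
    Polynomial.map_sum, eval_finsetSum]
  congr 1
  refine Finset.sum_congr rfl fun k _ => ?_
  split_ifs
  · simp [QC]
  · simp

/-- Coefficient by coefficient this is the recurrence, including the convention for negative
indices. -/
theorem symbolPoly_mul_mk_QC (a : ℕ → ℝ) (p : ℕ) (l : ℂ) :
    (symbolPoly a p l : PowerSeries ℂ) * PowerSeries.mk (fun n => QC a p n l) = 1 := by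
  have h : (symbolPoly a p l : PowerSeries ℂ) = 1 - PowerSeries.C l * PowerSeries.X +
      ∑ k ∈ Finset.range (p + 1), PowerSeries.C (a k : ℂ) * PowerSeries.X ^ (k + 1) := by
    rw [symbolPoly, Polynomial.coe_add, Polynomial.coe_sub, Polynomial.coe_one, Polynomial.coe_mul,
      Polynomial.coe_C, Polynomial.coe_X, ← Polynomial.coeToPowerSeries.ringHom_apply, map_sum]
    simp
  rw [h, add_mul, sub_mul, one_mul, mul_assoc, Finset.sum_mul]
  ext n
  rw [map_add, map_sub, map_sum, PowerSeries.coeff_C_mul]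
  simp only [mul_assoc, PowerSeries.coeff_C_mul, PowerSeries.coeff_X_pow_mul']
  cases n with
  | zero => simp [QC_zero]
  | succ n =>
    rw [PowerSeries.coeff_succ_X_mul, PowerSeries.coeff_one, if_neg (by omega)]
    simp only [PowerSeries.coeff_mk, QC_succ, Nat.add_le_add_iff_right, Nat.add_sub_add_right, mul_ite,
      mul_zero]
    ring

theorem IsLab.eq_prod_inv (hp : 1 ≤ p) (ha : a p ≠ 0) {l : ℂ} {ζ : ℕ → ℂ} (h : IsLab a p l ζ) :
    symbolPoly a p l = ∏ i ∈ Finset.range (p + 1), (1 - C (ζ i)⁻¹ * X) := by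
  refine Polynomial.funext fun y => ?_
  have h0 := h.eval_eq hp ha 0
  rw [eval_symbolPoly, Finset.sum_eq_zero (fun k _ => by simp)] at h0
  have h1 : ∀ i ∈ Finset.range (p + 1), y - ζ i = (0 - ζ i) * (1 - (ζ i)⁻¹ * y) := by
    intro i hi
    have := h.ne_zero hp ha (Nat.lt_succ_iff.1 (Finset.mem_range.1 hi))
    field_simp
    ring
  rw [h.eval_eq hp ha, Finset.prod_congr rfl h1, Finset.prod_mul_distrib, ← mul_assoc, ← h0, eval_prod]
  simp

theorem IsLab.coe_eq_prod (hp : 1 ≤ p) (ha : a p ≠ 0) {l : ℂ} {ζ : ℕ → ℂ} (h : IsLab a p l ζ) :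
    (symbolPoly a p l : PowerSeries ℂ) = ∏ i ∈ Finset.range (p + 1),
      (1 - PowerSeries.C (ζ i)⁻¹ * PowerSeries.X) := by
  rw [h.eq_prod_inv hp ha, ← Polynomial.coeToPowerSeries.ringHom_apply, map_prod]
  exact Finset.prod_congr rfl fun i _ => by simp

theorem QC_eq_hs (hp : 1 ≤ p) (ha : a p ≠ 0) {l : ℂ} {ζ : ℕ → ℂ} (h : IsLab a p l ζ) (n : ℕ) :
    QC a p n l = hs (fun i => (ζ i)⁻¹) (p + 1) n := by
  have h1 := symbolPoly_mul_mk_QC a p l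
  have h2 := prod_mul_mk_hs (fun i => (ζ i)⁻¹) (p + 1)
  rw [h.coe_eq_prod hp ha] at h1
  have h4 : PowerSeries.mk (fun n => QC a p n l) =
      PowerSeries.mk (hs (fun i => (ζ i)⁻¹) (p + 1)) := by
    rw [← one_mul (PowerSeries.mk fun n => QC a p n l), ← h2, mul_right_comm, h1, one_mul]
  simpa using congrArg (PowerSeries.coeff n) h4

/-- Here the geometric rate may be any `ρ > β`, without the factor `2^m` of `norm_hs_le`; square
summability needs a rate below one. -/
theorem norm_hs_le_pow (ζ : ℕ → ℂ) {β ρ : ℝ} (hβ : 0 ≤ β) (hρ : β < ρ) (j m : ℕ)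
    (h : ∀ i < j, ‖ζ i‖ ≤ β) : ‖hs ζ j m‖ ≤ (ρ / (ρ - β)) ^ j * ρ ^ m := by
  have hρ0 : 0 < ρ := hβ.trans_lt hρ
  have h1 : 1 ≤ ρ / (ρ - β) := by rw [le_div_iff₀ (by linarith)]; linarith
  induction j, m using hs_induction with
  | h0 j => rw [hs_zero_right, norm_one, pow_zero, mul_one]; exact one_le_pow₀ h1
  | h1 m => rw [hs_zero_left, norm_zero]; positivity
  | h2 j m h2 h3 =>
    have h2 := h2 fun i hi => h i (by omega)
    have h3 := h3 h
    rw [hs_succ]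
    calc _ ≤ ‖hs ζ j (m + 1)‖ + ‖ζ j‖ * ‖hs ζ (j + 1) m‖ := by
          rw [← norm_mul]; exact norm_add_le _ _
      _ ≤ (ρ / (ρ - β)) ^ j * ρ ^ (m + 1) + β * ((ρ / (ρ - β)) ^ (j + 1) * ρ ^ m) :=
        add_le_add h2 (mul_le_mul (h j (by omega)) h3 (norm_nonneg _) hβ)
      _ = _ := by
        have : ρ - β ≠ 0 := by linarith
        rw [pow_succ (ρ / (ρ - β)) j, pow_succ]
        field_simp
        ring

/-! ### The Toeplitz operator -/

/-- The shift as a bounded operator. -/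
abbrev shiftL : Ell2 →L[ℂ] Ell2 := shift.toContinuousLinearMap

theorem inner_e_left (n : ℕ) (u : Ell2) : inner ℂ (e n) u = u n := by
  rw [e, lp.inner_single_left]; simp

theorem shiftL_pow_apply (k : ℕ) (u : Ell2) (n : ℕ) :
    (shiftL ^ k) u n = if k ≤ n then u (n - k) else 0 := by
  induction k generalizing n with
  | zero => simp
  | succ k ih =>
    rw [pow_succ', mul_apply_eq_comp]
    change shiftFun ((shiftL ^ k) u) n = _
    cases n with
    | zero => simp [shiftFun]
    | succ n =>
      change (shiftL ^ k) u n = _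
      rw [ih]
      simp

theorem adjoint_shiftL_apply (u : Ell2) (n : ℕ) :
    ContinuousLinearMap.adjoint shiftL u n = u (n + 1) := by
  rw [← inner_e_left, ContinuousLinearMap.adjoint_inner_right, ← inner_e_left]
  exact congrArg (fun v => inner ℂ v u) (shift_e n)

theorem toeplitzOp_apply (a : ℕ → ℝ) (p : ℕ) (u : Ell2) (n : ℕ) :
    toeplitzOp a p u n = u (n + 1) +
      ∑ k ∈ Finset.range (p + 1), if k ≤ n then (a k : ℂ) * u (n - k) else 0 := by
  rw [← inner_e_left, toeplitzOp]
  simp only [add_apply, sum_apply, smul_apply, inner_add_right, inner_sum, inner_smul_right,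
    inner_e_left]
  rw [adjoint_shiftL_apply]
  congr 1
  refine Finset.sum_congr rfl fun k _ => ?_
  rw [shiftL_pow_apply, mul_ite, mul_zero]

theorem memℓp_geom {y : ℂ} (hy : ‖y‖ < 1) : Memℓp (fun n => y ^ n) 2 := by
  apply memℓp_gen
  have h : (2 : ENNReal).toReal = (2 : ℕ) := by norm_num
  simp only [h, Real.rpow_natCast, norm_pow, ← pow_mul]
  simp only [mul_comm _ 2, pow_mul]
  exact summable_geometric_of_lt_one (by positivity) (by rw [sq]; nlinarith [norm_nonneg y])

/-- The sequence `(1, y, y², …)`. -/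
def geom (y : ℂ) (hy : ‖y‖ < 1) : Ell2 := ⟨fun n => y ^ n, memℓp_geom hy⟩

theorem norm_geom_sq {y : ℂ} (hy : ‖y‖ < 1) : ‖geom y hy‖ ^ 2 = (1 - ‖y‖ ^ 2)⁻¹ := by
  have h2 : (2 : ENNReal).toReal = (2 : ℕ) := by norm_num
  have h := lp.norm_rpow_eq_tsum (p := 2) (by norm_num) (geom y hy)
  simp only [h2, Real.rpow_natCast] at h
  rw [h, ← tsum_geometric_of_lt_one (by positivity) (by nlinarith [norm_nonneg y] : ‖y‖ ^ 2 < 1)]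
  refine tsum_congr fun n => ?_
  change ‖y ^ n‖ ^ 2 = _
  rw [norm_pow, ← pow_mul, ← pow_mul, mul_comm]

/-- The function `∑ u_n y^n` on the unit disc. -/
def genFun (u : Ell2) (y : ℂ) : ℂ := ∑' n, u n * y ^ n

theorem genFun_eq_inner (u : Ell2) {y : ℂ} (hy : ‖(starRingEnd ℂ) y‖ < 1) :
    genFun u y = inner ℂ (geom ((starRingEnd ℂ) y) hy) u := by
  rw [lp.inner_eq_tsum]
  refine tsum_congr fun n => ?_
  simp [geom]

/-- Cauchy–Schwarz against a geometric sequence: the growth towards the unit circle is at most of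
order `(1 - |y|)^{-1/2}`, too slow for a pole. -/
theorem norm_genFun_sq_le (u : Ell2) {y : ℂ} (hy : ‖y‖ < 1) :
    (1 - ‖y‖) * ‖genFun u y‖ ^ 2 ≤ ‖u‖ ^ 2 := by
  have hy' : ‖(starRingEnd ℂ) y‖ < 1 := by simpa using hy
  have h1 := norm_inner_le_norm (𝕜 := ℂ) (geom _ hy') u
  rw [← genFun_eq_inner] at h1
  have h2 := pow_le_pow_left₀ (norm_nonneg _) h1 2
  rw [mul_pow, norm_geom_sq, RCLike.norm_conj] at h2
  have h3 : 0 < 1 - ‖y‖ ^ 2 := by nlinarith [norm_nonneg y]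
  rw [inv_mul_eq_div, le_div_iff₀ h3] at h2
  have h4 : 1 - ‖y‖ ≤ 1 - ‖y‖ ^ 2 := by nlinarith [norm_nonneg y]
  nlinarith [sq_nonneg ‖genFun u y‖]

/-- The action of `l - A` in terms of generating functions. -/
theorem genFun_sub_toeplitzOp (a : ℕ → ℝ) (p : ℕ) (l : ℂ) (u : Ell2) {y : ℂ} (hy : ‖y‖ < 1) :
    (symbolPoly a p l).eval y * genFun u y = u 0 - y * genFun (l • u - toeplitzOp a p u) y := by
  have hy' : ‖(starRingEnd ℂ) y‖ < 1 := by simpa using hy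
  set v := geom _ hy' with hv
  -- Geometric sequences are eigenvectors of the adjoint of the shift.
  have hS : ∀ k (w : Ell2), inner ℂ v ((shiftL ^ k) w) = y ^ k * inner ℂ v w := by
    have h1 : ContinuousLinearMap.adjoint shiftL v = (starRingEnd ℂ) y • v := by
      ext n
      rw [adjoint_shiftL_apply]
      change (starRingEnd ℂ) y ^ (n + 1) = (starRingEnd ℂ) y * (starRingEnd ℂ) y ^ n
      rw [pow_succ']
    intro k
    induction k with
    | zero => simp
    | succ k ih =>
      intro w
      rw [pow_succ, mul_apply_eq_comp, ih, ← ContinuousLinearMap.adjoint_inner_left, h1,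
        inner_smul_left, Complex.conj_conj, pow_succ, mul_assoc]
  have hS' : y * inner ℂ v (ContinuousLinearMap.adjoint shiftL u) = inner ℂ v u - u 0 := by
    rw [ContinuousLinearMap.adjoint_inner_right, ← inner_e_left 0, ← inner_sub_left]
    have h1 : v - e 0 = (starRingEnd ℂ) y • shiftL v := by
      ext n
      cases n with
      | zero =>
        change (starRingEnd ℂ) y ^ 0 - e 0 0 = (starRingEnd ℂ) y * 0
        simp [e]
      | succ n =>
        change (starRingEnd ℂ) y ^ (n + 1) - e 0 (n + 1) = (starRingEnd ℂ) y * (starRingEnd ℂ) y ^ n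
        simp [e, pow_succ']
    rw [h1, inner_smul_left, Complex.conj_conj]
  rw [genFun_eq_inner _ hy', genFun_eq_inner _ hy', ← hv, toeplitzOp, inner_sub_right,
    inner_smul_right, eval_symbolPoly]
  simp only [add_apply, sum_apply, smul_apply, inner_add_right, inner_sum, inner_smul_right]
  rw [mul_sub, mul_add, hS', Finset.mul_sum, add_mul, Finset.sum_mul]
  have h2 : ∑ k ∈ Finset.range (p + 1), y * ((a k : ℂ) * inner ℂ v ((shiftL ^ k) u)) =
      ∑ k ∈ Finset.range (p + 1), (a k : ℂ) * y ^ (k + 1) * inner ℂ v u :=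
    Finset.sum_congr rfl fun k _ => by rw [hS]; ring
  rw [h2]
  ring

variable {a : ℕ → ℝ} {p : ℕ}

/-! ### The resolvent functions -/

/-- Radial growth slower than `1 / (1 - t)`; it is what admits roots on the unit circle itself,
where the generating function need not be defined. -/
theorem tendsto_genFun (u : Ell2) {y : ℂ} (hy : ‖y‖ ≤ 1) :
    Tendsto (fun t : ℝ => ((1 - t : ℝ) : ℂ) * genFun u (t * y)) (𝓝[<] 1) (𝓝 0) := by
  have h1 : Tendsto (fun t : ℝ => √(1 - t) * ‖u‖) (𝓝[<] 1) (𝓝 0) := by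
    have h2 : Continuous fun t : ℝ => √(1 - t) * ‖u‖ := by fun_prop
    have h3 := (h2.tendsto 1).mono_left (nhdsWithin_le_nhds (s := Set.Iio 1))
    simpa using h3
  refine squeeze_zero_norm' ?_ h1
  filter_upwards [self_mem_nhdsWithin, mem_nhdsWithin_of_mem_nhds (lt_mem_nhds zero_lt_one)]
    with t ht1 ht0
  have ht1' : t < 1 := ht1
  have h4 : ‖(t : ℂ) * y‖ ≤ t := by
    rw [norm_mul, Complex.norm_real, Real.norm_of_nonneg ht0.le]
    nlinarith
  have h5 := norm_genFun_sq_le u (h4.trans_lt ht1')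
  rw [norm_mul, Complex.norm_real, Real.norm_of_nonneg (by linarith)]
  refine abs_le_of_sq_le_sq' ?_ (by positivity) |>.2
  rw [mul_pow, mul_pow, Real.sq_sqrt (by linarith), sq, mul_assoc]
  refine mul_le_mul_of_nonneg_left (le_trans ?_ h5) (by linarith)
  exact mul_le_mul_of_nonneg_right (by linarith) (sq_nonneg _)

theorem genFun_e (n : ℕ) (y : ℂ) : genFun (e n) y = y ^ n := by
  rw [genFun, tsum_eq_single n]
  · simp [e]
  · intro m hm
    simp [e, hm]

theorem resolvent_apply_e {l : ℂ} (hl : l ∈ resolventSet ℂ (toeplitzOp a p)) (v : Ell2) :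
    l • resolvent (toeplitzOp a p) l v - toeplitzOp a p (resolvent (toeplitzOp a p) l v) = v := by
  have h := congrArg (fun T : Ell2 →L[ℂ] Ell2 => T v) (Ring.mul_inverse_cancel _ hl)
  simpa [resolvent, Algebra.algebraMap_eq_smul_one] using h

theorem eval_mul_genFun_resolvent {l : ℂ} (hl : l ∈ resolventSet ℂ (toeplitzOp a p)) {k : ℕ}
    (hk : 1 ≤ k) {y : ℂ} (hy : ‖y‖ < 1) :
    (symbolPoly a p l).eval y * genFun (resolvent (toeplitzOp a p) l (e (k - 1))) y =
      g a p k l - y ^ k := by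
  rw [genFun_sub_toeplitzOp a p l _ hy, resolvent_apply_e hl, genFun_e, g, inner_e_left, ← pow_succ',
    Nat.sub_add_cancel hk]

theorem norm_ofReal_mul_lt {t : ℝ} (h0 : 0 < t) (h1 : t < 1) {y : ℂ} (hy : ‖y‖ ≤ 1) :
    ‖(t : ℂ) * y‖ < 1 := by
  rw [norm_mul, Complex.norm_real, Real.norm_of_nonneg h0.le]
  nlinarith [norm_nonneg y]

theorem tendsto_eval_radial (R : ℂ[X]) (y : ℂ) :
    Tendsto (fun t : ℝ => R.eval ((t : ℂ) * y)) (𝓝[<] 1) (𝓝 (R.eval y)) := by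
  have h : Continuous fun t : ℝ => R.eval ((t : ℂ) * y) := by fun_prop
  simpa using (h.tendsto 1).mono_left (nhdsWithin_le_nhds (s := Set.Iio 1))

/-- A root in the closed unit disc determines the resolvent functions. -/
theorem g_eq_pow {l : ℂ} (hl : l ∈ resolventSet ℂ (toeplitzOp a p)) {k : ℕ} (hk : 1 ≤ k) {y : ℂ}
    (hy : ‖y‖ ≤ 1) (hr : (symbolPoly a p l).eval y = 0) : g a p k l = y ^ k := by
  obtain ⟨R, hR⟩ := dvd_iff_isRoot.2 hr
  set u := resolvent (toeplitzOp a p) l (e (k - 1)) with hu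
  have h1 : Tendsto (fun t : ℝ => -(y * R.eval ((t : ℂ) * y)) *
      (((1 - t : ℝ) : ℂ) * genFun u (t * y))) (𝓝[<] 1) (𝓝 (-(y * R.eval y) * 0)) :=
    ((tendsto_eval_radial R y).const_mul y).neg.mul (tendsto_genFun u hy)
  have h2 := (tendsto_eval_radial (X ^ k) y).const_sub (g a p k l)
  simp only [eval_pow, eval_X] at h2
  -- The factor `X - y` of the symbol polynomial contributes `(t - 1) y` at `t y`, which supplies
  -- the damping `1 - t`.
  have h3 : (fun t : ℝ => -(y * R.eval ((t : ℂ) * y)) * (((1 - t : ℝ) : ℂ) * genFun u (t * y)))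
      =ᶠ[𝓝[<] 1] fun t : ℝ => g a p k l - ((t : ℂ) * y) ^ k := by
    filter_upwards [self_mem_nhdsWithin, mem_nhdsWithin_of_mem_nhds (lt_mem_nhds zero_lt_one)]
      with t ht1 ht0
    rw [← eval_mul_genFun_resolvent hl hk (norm_ofReal_mul_lt ht0 ht1 hy), hR]
    simp only [eval_mul, eval_sub, eval_X, eval_C, Complex.ofReal_sub, Complex.ofReal_one]
    ring
  have h4 := tendsto_nhds_unique (h1.congr' h3) h2
  rw [mul_zero] at h4
  exact sub_eq_zero.1 h4.symm

/-- A double root contributes `(1 - t)² y²` on the left while the right side is `(1 - t) y`.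
Cancelling one factor, the left side tends to zero and the right side is the constant `y`. -/
theorem not_double_root {l : ℂ} (hl : l ∈ resolventSet ℂ (toeplitzOp a p)) {y : ℂ} (hy : ‖y‖ ≤ 1)
    (hy0 : y ≠ 0) (R : ℂ[X]) (hR : symbolPoly a p l = (X - C y) ^ 2 * R) : False := by
  have hg := g_eq_pow hl le_rfl hy (by rw [hR]; simp)
  set u := resolvent (toeplitzOp a p) l (e (1 - 1)) with hu
  have h1 : Tendsto (fun t : ℝ => (y ^ 2 * R.eval ((t : ℂ) * y)) *
      (((1 - t : ℝ) : ℂ) * genFun u (t * y))) (𝓝[<] 1) (𝓝 ((y ^ 2 * R.eval y) * 0)) :=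
    ((tendsto_eval_radial R y).const_mul _).mul (tendsto_genFun u hy)
  have h3 : (fun t : ℝ => (y ^ 2 * R.eval ((t : ℂ) * y)) * (((1 - t : ℝ) : ℂ) * genFun u (t * y)))
      =ᶠ[𝓝[<] 1] fun _ : ℝ => y := by
    filter_upwards [self_mem_nhdsWithin, mem_nhdsWithin_of_mem_nhds (lt_mem_nhds zero_lt_one)]
      with t ht1 ht0
    have h4 := eval_mul_genFun_resolvent hl le_rfl (norm_ofReal_mul_lt ht0 ht1 hy)
    rw [hg, hR] at h4
    simp only [eval_mul, eval_sub, eval_X, eval_C, eval_pow] at h4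
    have h5 : (1 - t : ℂ) ≠ 0 := by
      rw [sub_ne_zero]; exact_mod_cast (ne_of_lt ht1).symm
    refine mul_left_cancel₀ h5 ?_
    push_cast
    linear_combination h4
  have h4 := tendsto_nhds_unique (h1.congr' h3) tendsto_const_nhds
  rw [mul_zero] at h4
  exact hy0 h4.symm

/-- If all roots were outside the closed unit disc, the numbers `Q_n(l)`, symmetric functions of
their reciprocals, would decay geometrically and form an eigenvector of `A` in `ℓ²` for the
eigenvalue `l`. -/
theorem norm_first_le_one (hp : 1 ≤ p) (ha : a p ≠ 0) {l : ℂ}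
    (hl : l ∈ resolventSet ℂ (toeplitzOp a p)) {ζ : ℕ → ℂ} (h : IsLab a p l ζ) : ‖ζ 0‖ ≤ 1 := by
  by_contra! hcon
  set β := ‖ζ 0‖⁻¹ with hβ
  have hβ0 : 0 ≤ β := by positivity
  have hβ1 : β < 1 := inv_lt_one_of_one_lt₀ hcon
  set t := (β + 1) / 2 with ht
  have hbd : ∀ n, ‖QC a p n l‖ ≤ (t / (t - β)) ^ (p + 1) * t ^ n := fun n => by
    rw [QC_eq_hs hp ha h]
    refine norm_hs_le_pow _ hβ0 (by linarith) _ _ fun i hi => ?_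
    rw [norm_inv, hβ]
    exact inv_anti₀ (by linarith) (h.norm_mono (Nat.zero_le _) (by omega))
  have hmem : Memℓp (fun n => QC a p n l) 2 := by
    apply memℓp_gen
    have h2 : (2 : ENNReal).toReal = (2 : ℕ) := by norm_num
    simp only [h2, Real.rpow_natCast]
    refine Summable.of_nonneg_of_le (fun n => by positivity)
      (fun n => pow_le_pow_left₀ (norm_nonneg _) (hbd n) 2) ?_
    simp only [mul_pow, ← pow_mul, mul_comm _ 2]
    simp only [pow_mul]
    exact (summable_geometric_of_lt_one (by positivity) (by nlinarith)).mul_left _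
  set u : Ell2 := ⟨fun n => QC a p n l, hmem⟩ with hu
  have h1 : l • u - toeplitzOp a p u = 0 := by
    ext n
    change l * QC a p n l - toeplitzOp a p u n = 0
    rw [toeplitzOp_apply]
    change l * QC a p n l - (QC a p (n + 1) l +
      ∑ k ∈ Finset.range (p + 1), if k ≤ n then (a k : ℂ) * QC a p (n - k) l else 0) = 0
    rw [QC_succ]
    ring
  have h2 := congrArg (fun T : Ell2 →L[ℂ] Ell2 => T u) (Ring.inverse_mul_cancel _ hl)
  have h3 : (algebraMap ℂ (Ell2 →L[ℂ] Ell2) l - toeplitzOp a p) u = 0 := by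
    rw [← h1, Algebra.algebraMap_eq_smul_one]; rfl
  simp only [mul_apply_eq_comp, h3, map_zero] at h2
  have h4 : (0 : ℂ) = QC a p 0 l := congrArg (fun w : Ell2 => w 0) h2
  rw [QC_zero] at h4
  exact zero_ne_one h4

/-- On `Γ_1` both first roots lie in the closed unit disc and both equal `g_1(l)`, so they form a
double root, which is excluded. -/
theorem notMem_Γ_and_g_eq (hp : 1 ≤ p) (ha : a p ≠ 0) {z : ℕ → ℂ → ℂ} (hz : IsRootLabelling a p z)
    {l : ℂ} (hl : l ∈ resolventSet ℂ (toeplitzOp a p)) :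
    l ∉ Γ z 1 ∧ ∀ k, 1 ≤ k → g a p k l = z 0 l ^ k := by
  have hL := hz.isLab l
  have h0 := norm_first_le_one hp ha hl hL
  refine ⟨fun h => ?_, fun k hk => g_eq_pow hl hk h0 (hL.eval_zero hp ha (Nat.zero_le p))⟩
  have h1 : ‖z 1 l‖ ≤ 1 := le_of_eq_of_le (show ‖z 1 l‖ = ‖z 0 l‖ from h.symm) h0
  have h2 := g_eq_pow hl le_rfl h0 (hL.eval_zero hp ha (Nat.zero_le p))
  have h3 := g_eq_pow hl le_rfl h1 (hL.eval_zero hp ha hp)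
  rw [pow_one] at h2 h3
  obtain ⟨n, rfl⟩ := Nat.exists_eq_add_of_le' hp
  refine not_double_root hl h0 (hL.ne_zero hp ha (Nat.zero_le _))
    (C (a (n + 1) : ℂ) * ∏ i ∈ Finset.range n, (X - C (z (i + 1 + 1) l))) ?_
  rw [hL.eq_prod hp ha, Finset.prod_range_succ', Finset.prod_range_succ']
  simp only [zero_add, ← h3, ← h2]
  ring

/-! ### Orthogonality -/

theorem norm_ofReal_le_of_upperHP {G : ℂ → ℂ} {C η : ℝ} (hc : Continuous G)
    (hb : ∀ l ∈ upperHP, ‖G l‖ ≤ C * (1 + ‖l‖) ^ (-η)) (t : ℝ) : ‖G t‖ ≤ C * (1 + |t|) ^ (-η) := by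
  have h1 : Continuous fun l : ℂ => C * (1 + ‖l‖) ^ (-η) :=
    continuous_const.mul (Continuous.rpow_const (by fun_prop) fun l => Or.inl (by positivity))
  have h2 : (t : ℂ) ∈ closure upperHP := by
    rw [upperHP, Complex.closure_setOfPred_lt_im]; simp
  have h3 := closure_minimal (s := upperHP) (t := {l | ‖G l‖ ≤ C * (1 + ‖l‖) ^ (-η)}) hb
    (isClosed_le hc.norm h1) h2
  simpa using h3

/-- Cauchy's theorem for the upper half-plane and rapidly decreasing functions. -/
theorem integral_eq_zero_of_decay {G : ℂ → ℂ} {C η : ℝ} (hη : 1 < η)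
    (hd : DifferentiableOn ℂ G upperHP) (hc : Continuous G)
    (hb : ∀ l ∈ upperHP, ‖G l‖ ≤ C * (1 + ‖l‖) ^ (-η)) :
    Integrable (fun t : ℝ => G t) ∧ ∫ t : ℝ, G t = 0 := by
  have hC : 0 ≤ C := nonneg_of_mul_nonneg_left ((norm_nonneg _).trans (hb Complex.I (by simp [upperHP])))
    (Real.rpow_pos_of_pos (by positivity) _)
  have hg : Integrable fun t : ℝ => C * (1 + |t|) ^ (-η) :=
    (integrable_one_add_norm (μ := volume) (E := ℝ) (by simpa using hη)).const_mul C
  have hlim : ∀ {α : Type} {f : Filter α} {u : α → ℝ}, Tendsto u f atTop →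
      Tendsto (fun i => C * (1 + u i) ^ (-η)) f (𝓝 0) := by
    intro α f u hu
    simpa using ((tendsto_rpow_neg_atTop (show 0 < η by linarith)).comp
      (tendsto_atTop_add_const_left _ 1 hu)).const_mul C
  refine ⟨hg.mono' (hc.comp Complex.continuous_ofReal).aestronglyMeasurable
    (Eventually.of_forall (norm_ofReal_le_of_upperHP hc hb)), ?_⟩
  refine integral_boundary_eq_zero (b := 0) hd hg (fun l hl _ => (hb l hl).trans ?_)
    (hlim tendsto_abs_atTop_atTop) (hlim tendsto_abs_atBot_atTop) (fun t _ => ?_)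
    fun t _ => CritSetup.tendsto_vertical hc t
  · refine mul_le_mul_of_nonneg_left (Real.rpow_le_rpow_of_nonpos (by positivity) ?_ (by linarith)) hC
    linarith [Complex.abs_re_le_norm l]
  · refine squeeze_zero_norm' ?_ (hlim tendsto_id)
    filter_upwards [eventually_gt_atTop 0] with y hy
    refine (hb _ (ofReal_add_mul_I_mem hy)).trans ?_
    refine mul_le_mul_of_nonneg_left (Real.rpow_le_rpow_of_nonpos (by simp; linarith) ?_ (by linarith)) hC
    have := Complex.abs_im_le_norm ((t : ℂ) + y * Complex.I)
    simp only [Complex.add_im, Complex.ofReal_im, Complex.mul_im, Complex.ofReal_re, Complex.I_im,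
      Complex.I_re, mul_one, mul_zero, add_zero, zero_add] at this
    simp only [id]
    linarith [le_abs_self y]

/-- The integral of a polynomial against the density of `μ_j`. -/
def moment (z : ℕ → ℂ → ℂ) (P : ℝ[X]) (j : ℕ) : ℝ := ∫ t, J z j t * P.eval t

theorem J_zero (z : ℕ → ℂ → ℂ) (t : ℝ) : J z 0 t = 0 := by simp [J]

theorem moment_zero (z : ℕ → ℂ → ℂ) (P : ℝ[X]) : moment z P 0 = 0 := by simp [moment, J_zero]

namespace CritSetup

variable {a x : ℕ → ℝ} {p : ℕ} {s : ℝ} {z : ℕ → ℂ → ℂ}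

/-- Imaginary parts of the equation `a(z_0) = t` multiplied by `z_0^{j+1}`. -/
theorem mul_J (S : CritSetup a p x s) (hz : IsRootLabelling a p z) (j : ℕ) (t : ℝ) :
    t * J z (j + 1) t = J z j t + ∑ k ∈ Finset.range (p + 1), a k * J z (j + 1 + k) t := by
  have h := (S.isLab_up hz (l := t) (by simp)).eval_zero S.one_le S.a_ne_zero (Nat.zero_le p)
  rw [eval_symbolPoly] at h
  have h1 : (t : ℂ) * up z 0 t ^ (j + 1) = up z 0 t ^ j +
      ∑ k ∈ Finset.range (p + 1), (a k : ℂ) * up z 0 t ^ (j + 1 + k) := by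
    have h2 : ∑ k ∈ Finset.range (p + 1), (a k : ℂ) * up z 0 t ^ (j + 1 + k) =
        up z 0 t ^ j * ∑ k ∈ Finset.range (p + 1), (a k : ℂ) * up z 0 t ^ (k + 1) := by
      rw [Finset.mul_sum]
      exact Finset.sum_congr rfl fun k _ => by ring
    rw [h2]
    linear_combination -(up z 0 t ^ j) * h
  have h3 := congrArg Complex.im h1
  simp only [Complex.add_im, Complex.im_sum, Complex.im_ofReal_mul] at h3
  simp only [J]
  rw [← mul_div_assoc, mul_neg, h3, neg_add, add_div, ← Finset.sum_neg_distrib, Finset.sum_div]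
  congr 1
  exact Finset.sum_congr rfl fun k _ => by ring

theorem integrable_J_mul_eval (S : CritSetup a p x s) (hz : IsRootLabelling a p z) (P : ℝ[X]) (j : ℕ) :
    Integrable fun t => J z j t * P.eval t := by
  rcases Nat.eq_zero_or_pos j with rfl | hj
  · simp [J_zero]
  · exact S.integrable_J_smul hz P.continuous.continuousOn hj

theorem moment_sub (S : CritSetup a p x s) (hz : IsRootLabelling a p z) (P R : ℝ[X]) (j : ℕ) :
    moment z (P - R) j = moment z P j - moment z R j := by
  simp only [moment, eval_sub, mul_sub]
  exact integral_sub (S.integrable_J_mul_eval hz P j) (S.integrable_J_mul_eval hz R j)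

theorem moment_sum (S : CritSetup a p x s) (hz : IsRootLabelling a p z) {ι : Type*} (T : Finset ι)
    (P : ι → ℝ[X]) (j : ℕ) : moment z (∑ i ∈ T, P i) j = ∑ i ∈ T, moment z (P i) j := by
  simp only [moment, eval_finsetSum, Finset.mul_sum]
  exact integral_finsetSum _ fun i _ => S.integrable_J_mul_eval hz (P i) j

theorem moment_X_mul (S : CritSetup a p x s) (hz : IsRootLabelling a p z) (P : ℝ[X]) (j : ℕ) :
    moment z (X * P) (j + 1) =
      moment z P j + ∑ k ∈ Finset.range (p + 1), a k * moment z P (j + 1 + k) := by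
  simp only [moment, ← integral_const_mul]
  rw [← integral_finsetSum _ fun k _ => (S.integrable_J_mul_eval hz P (j + 1 + k)).const_mul (a k),
    ← integral_add (S.integrable_J_mul_eval hz P j)
      (integrable_finsetSum _ fun k _ => (S.integrable_J_mul_eval hz P (j + 1 + k)).const_mul (a k))]
  refine integral_congr_ae (Eventually.of_forall fun t => ?_)
  simp only [eval_mul, eval_X]
  rw [← mul_assoc, mul_comm _ t, S.mul_J hz, add_mul, Finset.sum_mul]
  congr 1
  exact Finset.sum_congr rfl fun k _ => by ring

/-- For `j ≥ 2` the power `z_0^j` is `O(|l|^{-2})`, so its boundary integral vanishes by Cauchy's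
theorem. -/
theorem moment_one (S : CritSetup a p x s) (hz : IsRootLabelling a p z) {j : ℕ} (hj : 2 ≤ j) :
    moment z 1 j = 0 := by
  obtain ⟨C, hb⟩ := S.exists_norm_up_zero_pow_le hz (k := j) (η := 2) (by exact_mod_cast hj)
  obtain ⟨h1, h2⟩ := integral_eq_zero_of_decay one_lt_two
    ((S.differentiableOn_up hz (Nat.zero_le p)).pow j) ((S.continuous_up hz (Nat.zero_le p)).pow j)
    fun l _ => hb l
  have h3 := integral_im h1
  rw [h2] at h3
  simp only [moment, J, eval_one, mul_one]
  rw [integral_div, integral_neg]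
  have h4 : ∫ t : ℝ, (up z 0 t ^ j).im = 0 := h3
  rw [h4, neg_zero, zero_div]

/-- Multiplication by the variable acts on moments by the transpose of the recurrence. In the
inductive step the terms with `a_k` cancel in pairs, because the moments of `Q_n` at index `i + 1 +
k` and of `Q_{n-k}` at index `i + 1` are nonzero under the same condition. -/
theorem moment_Q (S : CritSetup a p x s) (hz : IsRootLabelling a p z) (n : ℕ) :
    ∀ j, moment z (Q a p n) j = if j = n + 1 then moment z 1 1 else 0 := by
  induction n using Nat.strong_induction_on with
  | _ n ih =>
    intro j
    cases n with
    | zero =>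
      rw [Q_zero]
      rcases j with _ | _ | j
      · simp [moment_zero]
      · simp
      · simp [S.moment_one hz (show 2 ≤ j + 1 + 1 by omega)]
    | succ n =>
      cases j with
      | zero => simp [moment_zero]
      | succ i =>
        rw [Q_succ, S.moment_sub hz, S.moment_X_mul hz, S.moment_sum hz, ih n (by omega) i,
          add_sub_assoc, ← Finset.sum_sub_distrib, Finset.sum_eq_zero, add_zero]
        · simp
        · intro k _
          rw [ih n (by omega)]
          have hC : ∀ (c : ℝ) (P : ℝ[X]), moment z (C c * P) (i + 1) = c * moment z P (i + 1) := by
            intro c P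
            simp only [moment, eval_mul, eval_C, ← integral_const_mul]
            exact integral_congr_ae (Eventually.of_forall fun t => by ring)
          by_cases hk : k ≤ n
          · rw [if_pos hk, hC, ih (n - k) (by omega), ← mul_sub]
            by_cases hi : i + k = n
            · rw [if_pos (by omega), if_pos (by omega), sub_self, mul_zero]
            · rw [if_neg (by omega), if_neg (by omega), sub_self, mul_zero]
          · rw [if_neg hk, if_neg (by omega)]
            simp [moment]

/-- A factor `X` replaces the index `j` by `j - 1, …, j + p`; after `k` factors the index is still
at most `n`, where the moments of `Q_n` vanish. -/
theorem moment_X_pow_mul_Q (S : CritSetup a p x s) (hz : IsRootLabelling a p z) (n k : ℕ) :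
    ∀ j, j + k * p ≤ n → moment z (X ^ k * Q a p n) j = 0 := by
  induction k with
  | zero =>
    intro j hj
    rw [pow_zero, one_mul, S.moment_Q hz, if_neg (by omega)]
  | succ k ih =>
    intro j hj
    cases j with
    | zero => exact moment_zero _ _
    | succ i =>
      have h1 : (k + 1) * p = k * p + p := by ring
      rw [pow_succ', mul_assoc, S.moment_X_mul hz, ih i (by omega), zero_add]
      refine Finset.sum_eq_zero fun m hm => ?_
      rw [Finset.mem_range] at hm
      rw [ih _ (by omega), mul_zero]

theorem add_mul_le_of_lt_multiIndex {p n j k : ℕ} (hj : j ≤ p) (hk : k < multiIndex p n j) :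
    j + k * p ≤ n := by
  have h1 := Nat.div_add_mod n p
  rw [multiIndex] at hk
  split_ifs at hk with h
  · have h2 : k * p ≤ n / p * p := Nat.mul_le_mul_right p (by omega)
    rw [mul_comm p] at h1
    omega
  · have h2 : (k + 1) * p ≤ n / p * p := Nat.mul_le_mul_right p (by omega)
    rw [mul_comm p] at h1
    rw [add_mul, one_mul] at h2
    omega

theorem integral_σ_eq_zero (S : CritSetup a p x s) (hz : IsRootLabelling a p z) (n : ℕ) {j : ℕ}
    (hj : j ∈ Finset.Icc 1 p) {k : ℕ} (hk : k < multiIndex p n j) :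
    ∫ᵛ t, t ^ k * (Q a p n).eval t ∂<•(σ z (branchPt a p x) j) = 0 := by
  rw [Finset.mem_Icc] at hj
  have hle := add_mul_le_of_lt_multiIndex hj.2 hk
  obtain ⟨m, rfl⟩ := Nat.exists_eq_add_of_le' hj.1
  obtain ⟨c, -, hc⟩ := S.nikishinDensity_one_eq hz (m := m) (by omega)
  have hN : ∀ t, nikishinDensity z (branchPt a p x) m 1 t • (t ^ k * (Q a p n).eval t) =
      ∑ i ∈ Finset.range (m + 1), c i * (J z (i + 1) t * (X ^ k * Q a p n).eval t) := by
    intro t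
    rw [hc, Finset.sum_apply, smul_eq_mul, Finset.sum_mul]
    refine Finset.sum_congr rfl fun i _ => ?_
    simp only [Pi.smul_apply, smul_eq_mul, eval_mul, eval_pow, eval_X]
    ring
  have hI := fun i (_ : i ∈ Finset.range (m + 1)) =>
    (S.integrable_J_mul_eval hz (X ^ k * Q a p n) (i + 1)).const_mul (c i)
  rw [σ, Nat.add_sub_cancel, integral_withDensityᵥ (S.integrable_nikishinDensity hz (by omega))
    (Continuous.aestronglyMeasurable (by fun_prop)) (by simpa only [hN] using integrable_finsetSum _ hI)]
  simp only [hN]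
  rw [integral_finsetSum _ hI]
  refine Finset.sum_eq_zero fun i hi => ?_
  rw [Finset.mem_range] at hi
  rw [integral_const_mul]
  have := S.moment_X_pow_mul_Q hz n k (i + 1) (by omega)
  rw [moment] at this
  rw [this, mul_zero]

end CritSetup

/-! ### Auxiliary functions for the zeros of `Q_n` -/

/-- The coefficient of `X^n` in `(z_0 - X) ⋯ (z_{j-1} - X) ∑ Q_n X^n`, which is
`z_0 ⋯ z_{j-1} h_n(1/z_j, …, 1/z_p)`. -/
def E (a : ℕ → ℝ) (p : ℕ) (z : ℕ → ℂ → ℂ) : ℕ → ℕ → ℂ → ℂ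
  | 0, n, l => QC a p n l
  | j + 1, 0, l => up z j l * E a p z j 0 l
  | j + 1, n + 1, l => up z j l * E a p z j (n + 1) l - E a p z j n l

theorem QC_ofReal (a : ℕ → ℝ) (p n : ℕ) (v : ℝ) : QC a p n v = ((Q a p n).eval v : ℝ) := by
  rw [QC, eval_map_algebraMap]
  exact aeval_algebraMap_apply_eq_algebraMap_eval v (Q a p n)

theorem mk_E (a : ℕ → ℝ) (p : ℕ) (z : ℕ → ℂ → ℂ) (j : ℕ) (l : ℂ) :
    PowerSeries.mk (fun n => E a p z j n l) = (∏ i ∈ Finset.range j,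
      (PowerSeries.C (up z i l) - PowerSeries.X)) * PowerSeries.mk fun n => QC a p n l := by
  induction j with
  | zero => simp [E]
  | succ j ih =>
    rw [Finset.prod_range_succ, mul_right_comm, ← ih]
    ext n
    rw [mul_sub, map_sub, mul_comm _ (PowerSeries.C _), PowerSeries.coeff_C_mul]
    cases n with
    | zero => simp [E]
    | succ n => rw [PowerSeries.coeff_succ_mul_X]; simp [E]

namespace CritSetup

variable {a x : ℕ → ℝ} {p : ℕ} {s : ℝ} {z : ℕ → ℂ → ℂ}

theorem continuous_E (S : CritSetup a p x s) (hz : IsRootLabelling a p z) {j : ℕ} (hj : j ≤ p + 1)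
    (n : ℕ) : Continuous (E a p z j n) := by
  induction j generalizing n with
  | zero => exact Polynomial.continuous _
  | succ j ih =>
    have h := S.continuous_up hz (show j ≤ p by omega)
    cases n with
    | zero => exact h.mul (ih (by omega) 0)
    | succ n => exact (h.mul (ih (by omega) (n + 1))).sub (ih (by omega) n)

theorem differentiableOn_E (S : CritSetup a p x s) (hz : IsRootLabelling a p z) {j : ℕ}
    (hj : j ≤ p + 1) (n : ℕ) : DifferentiableOn ℂ (E a p z j n) upperHP := by
  induction j generalizing n with
  | zero => exact (Polynomial.differentiable _).differentiableOn
  | succ j ih =>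
    have h := S.differentiableOn_up hz (show j ≤ p by omega)
    cases n with
    | zero => exact h.mul (ih (by omega) 0)
    | succ n => exact (h.mul (ih (by omega) (n + 1))).sub (ih (by omega) n)

/-- By its generating function, `E` is symmetric in the first `j` roots, which conjugation permutes.
-/
theorem E_im_eq_zero (S : CritSetup a p x s) (hz : IsRootLabelling a p z) {v : ℝ} {j : ℕ}
    (hj : j ≤ p + 1) (h : 1 ≤ j → j ≤ p → (v : ℂ) ∉ Γ z j) (n : ℕ) : (E a p z j n v).im = 0 := by
  have h1 := congrArg (fun M => (Multiset.map
    (fun u => (PowerSeries.C u - PowerSeries.X : PowerSeries ℂ)) M).prod) (S.map_conj_up hz hj h)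
  simp only [Multiset.map_map] at h1
  have h2 : (∏ i ∈ Finset.range j, (PowerSeries.C (up z i v) - PowerSeries.X : PowerSeries ℂ)) =
    ∏ i ∈ Finset.range j, (PowerSeries.C ((starRingEnd ℂ) (up z i v)) - PowerSeries.X) := h1
  have h3 := congrArg (PowerSeries.map (starRingEnd ℂ)) (mk_E a p z j v)
  rw [map_mul, map_prod] at h3
  simp only [map_sub, PowerSeries.map_C, PowerSeries.map_X] at h3
  have h4 : PowerSeries.map (starRingEnd ℂ) (PowerSeries.mk fun n => QC a p n v) =
      PowerSeries.mk fun n => QC a p n v := by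
    ext m; simp [QC_ofReal]
  rw [← h2, h4, ← mk_E] at h3
  rw [← Complex.conj_eq_iff_im]
  simpa using congrArg (PowerSeries.coeff n) h3

/-- In `z_k E_{k,n} - E_{k,n-1}` the functions `E_k` are real on `Γ_{k+1}`, so only `Im z_k`
contributes. -/
theorem E_im (S : CritSetup a p x s) (hz : IsRootLabelling a p z) {k : ℕ} (hk : k < p) (n : ℕ)
    (v : ℝ) : (E a p z (k + 1) n v).im = -Real.pi * (dens z (k + 1) v * (E a p z k n v).re) := by
  by_cases h : (v : ℂ) ∈ Γ z (k + 1)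
  · have h2 := fun n => S.E_im_eq_zero hz (show k ≤ p + 1 by omega) (S.notMem_Γ_pred hz hk h) n
    have h3 : dens z (k + 1) v = -(up z k v).im / Real.pi :=
      Set.indicator_of_mem (show v ∈ ΓReal z (k + 1) from h) _
    have h4 : (E a p z (k + 1) n v).im = (up z k v).im * (E a p z k n v).re := by
      cases n with
      | zero => rw [E, Complex.mul_im, h2]; ring
      | succ n => rw [E, Complex.sub_im, Complex.mul_im, h2, h2]; ring
    rw [h3, h4]
    field_simp
  · have h3 : dens z (k + 1) v = 0 :=
      Set.indicator_of_notMem (show v ∉ ΓReal z (k + 1) from h) _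
    rw [h3, S.E_im_eq_zero hz (by omega) fun _ _ => h]
    ring

/-- The series `∑ Q_n X^n` is the inverse of the product of all `1 - X / z_i`; the factors with `i <
j` cancel against `z_i - X`. -/
theorem E_eq_prod_mul_hs (S : CritSetup a p x s) (hz : IsRootLabelling a p z) {l : ℂ} (hl : 0 ≤ l.im)
    {j m : ℕ} (hj : j + m = p + 1) (n : ℕ) : E a p z j n l =
      (∏ i ∈ Finset.range j, up z i l) * hs (fun i => (up z (j + i) l)⁻¹) m n := by
  have hL := S.isLab_up hz hl
  have h1 := symbolPoly_mul_mk_QC a p l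
  rw [hL.coe_eq_prod S.one_le S.a_ne_zero, ← hj, Finset.prod_range_add] at h1
  have h2 := prod_mul_mk_hs (fun i => (up z (j + i) l)⁻¹) m
  have h3 : ∏ i ∈ Finset.range j, (PowerSeries.C (up z i l) - PowerSeries.X) =
      PowerSeries.C (∏ i ∈ Finset.range j, up z i l) *
        ∏ i ∈ Finset.range j, (1 - PowerSeries.C (up z i l)⁻¹ * PowerSeries.X) := by
    rw [map_prod, ← Finset.prod_mul_distrib]
    refine Finset.prod_congr rfl fun i hi => ?_
    have := hL.ne_zero S.one_le S.a_ne_zero (i := i) (by rw [Finset.mem_range] at hi; omega)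
    rw [mul_sub, mul_one, ← mul_assoc, ← map_mul, mul_inv_cancel₀ this, map_one, one_mul]
  have h4 : PowerSeries.mk (fun n => E a p z j n l) = PowerSeries.C (∏ i ∈ Finset.range j, up z i l) *
      PowerSeries.mk (hs (fun i => (up z (j + i) l)⁻¹) m) := by
    rw [mk_E, h3]
    linear_combination (PowerSeries.C (∏ i ∈ Finset.range j, up z i l)) *
      PowerSeries.mk (hs (fun i => (up z (j + i) l)⁻¹) m) * h1 -
      (PowerSeries.C (∏ i ∈ Finset.range j, up z i l)) * (∏ i ∈ Finset.range j,
        (1 - PowerSeries.C (up z i l)⁻¹ * PowerSeries.X)) *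
        (PowerSeries.mk fun n => QC a p n l) * h2
  have h5 := congrArg (PowerSeries.coeff n) h4
  rw [PowerSeries.coeff_C_mul] at h5
  simpa using h5

/-- With `L = 1 + |l|`, the first root is `O(1/L)`, the next `k` are `O(L^{1/p})`, and the `n`
reciprocals in each monomial are `O(L^{-1/p})`. -/
theorem exists_norm_E_le (S : CritSetup a p x s) (hz : IsRootLabelling a p z) {k : ℕ} (hk : k < p)
    (n : ℕ) : ∃ C, ∀ l ∈ upperHP,
      ‖E a p z (k + 1) n l‖ ≤ C * (1 + ‖l‖) ^ (-(1 + ((n : ℝ) - k) / p)) := by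
  obtain ⟨K₀, hK₀, h0⟩ := exists_norm_first_le (a := a) (p := p) S.a_ne_zero S.one_le
  obtain ⟨K₁, hK₁, h1⟩ := S.exists_norm_up_le hz
  obtain ⟨K₂, hK₂, h2⟩ := exists_le_norm_pow (a := a) (p := p) S.a_ne_zero S.one_le
  have hp0 : (0 : ℝ) < p := by have := S.one_le; positivity
  refine ⟨K₀ * K₁ ^ k * (2 ^ (p - k + n) * (K₂ ^ (1 / p : ℝ)) ^ n), fun l hl => ?_⟩
  set L := 1 + ‖l‖ with hL
  have hL0 : 0 < L := by positivity
  have hlab := S.isLab_up hz (l := l) (le_of_lt hl)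
  have hfirst : ‖up z 0 l‖ ≤ K₀ * L ^ (-1 : ℝ) := by
    have := h0 l _ hlab
    rw [Real.rpow_neg_one, ← div_eq_mul_inv, le_div_iff₀ hL0]; linarith
  have hprod : ‖∏ i ∈ Finset.range (k + 1), up z i l‖ ≤ (K₁ * L ^ (1 / p : ℝ)) ^ k *
      (K₀ * L ^ (-1 : ℝ)) := by
    rw [Finset.prod_range_succ', norm_mul, norm_prod]
    refine mul_le_mul ?_ hfirst (norm_nonneg _) (by positivity)
    rw [← Finset.card_range k, ← Finset.prod_const, Finset.card_range]
    exact Finset.prod_le_prod (fun i _ => norm_nonneg _) fun i hi =>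
      h1 l (i + 1) (by rw [Finset.mem_range] at hi; omega)
  have hw : ∀ i < p - k, ‖(up z (k + 1 + i) l)⁻¹‖ ≤ K₂ ^ (1 / p : ℝ) * L ^ (-(1 / p) : ℝ) := by
    intro i hi
    have h3 := h2 l _ hlab (k + 1 + i) (by omega) (by omega)
    have h4 : 0 < ‖up z (k + 1 + i) l‖ := norm_pos_iff.2
      (hlab.ne_zero S.one_le S.a_ne_zero (i := k + 1 + i) (by omega))
    have h5 := Real.rpow_le_rpow hL0.le h3 (show (0 : ℝ) ≤ 1 / p by positivity)
    rw [Real.mul_rpow hK₂.le (by positivity), one_div, Real.pow_rpow_inv_natCast h4.le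
      (by have := S.one_le; omega)] at h5
    rw [norm_inv, Real.rpow_neg hL0.le, ← div_eq_mul_inv, le_div_iff₀ (by positivity), one_div,
      inv_mul_le_iff₀ h4]
    linarith
  have hhs := norm_hs_le (fun i => (up z (k + 1 + i) l)⁻¹) (p - k) n (by positivity) hw
  rw [S.E_eq_prod_mul_hs hz (le_of_lt hl) (show k + 1 + (p - k) = p + 1 by omega), norm_mul]
  refine (mul_le_mul hprod hhs (norm_nonneg _) (by positivity)).trans (le_of_eq ?_)
  have hexp : L ^ (-(1 + ((n : ℝ) - k) / p)) =
      (L ^ (1 / p : ℝ)) ^ k * L ^ (-1 : ℝ) * (L ^ (-(1 / p) : ℝ)) ^ n := by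
    rw [← Real.rpow_mul_natCast hL0.le, ← Real.rpow_mul_natCast hL0.le, ← Real.rpow_add hL0,
      ← Real.rpow_add hL0]
    congr 1
    field_simp
    ring
  rw [hexp]
  ring

/-- Cauchy's theorem for `l^m E_{k+1}`: the condition on `m` makes the decay faster than `1/|l|`,
and the imaginary part of the boundary integral is the asserted one. -/
theorem integral_pow_mul_E (S : CritSetup a p x s) (hz : IsRootLabelling a p z) {k m n : ℕ} (hk : k < p)
    (hm : k + 1 + m * p ≤ n) :
    Integrable (fun t : ℝ => t ^ m * (dens z (k + 1) t * (E a p z k n t).re)) ∧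
      ∫ t : ℝ, t ^ m * (dens z (k + 1) t * (E a p z k n t).re) = 0 := by
  obtain ⟨C, hC⟩ := S.exists_norm_E_le hz hk n
  have hp0 : (0 : ℝ) < p := by have := S.one_le; positivity
  have hη : 1 < (1 + ((n : ℝ) - k) / p) - m := by
    have h1 : (k : ℝ) + 1 + m * p ≤ n := by exact_mod_cast hm
    have h2 : (m : ℝ) < ((n : ℝ) - k) / p := by rw [lt_div_iff₀ hp0]; linarith
    linarith
  obtain ⟨h1, h2⟩ := integral_eq_zero_of_decay (G := fun l => l ^ m * E a p z (k + 1) n l) (C := C) hη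
    ((differentiableOn_id.pow m).mul (S.differentiableOn_E hz (by omega) n))
    ((continuous_pow m).mul (S.continuous_E hz (by omega) n)) fun l hl => by
      have hL : (0 : ℝ) < 1 + ‖l‖ := by positivity
      rw [norm_mul, norm_pow]
      have h3 : (1 + ‖l‖) ^ (-((1 + ((n : ℝ) - k) / p) - m)) =
          (1 + ‖l‖) ^ m * (1 + ‖l‖) ^ (-(1 + ((n : ℝ) - k) / p)) := by
        rw [← Real.rpow_natCast, ← Real.rpow_add hL]; congr 1; ring
      rw [h3, mul_left_comm]
      exact mul_le_mul (pow_le_pow_left₀ (norm_nonneg _) (by linarith) m) (hC l hl) (norm_nonneg _)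
        (by positivity)
  have him : ∀ t : ℝ, ((t : ℂ) ^ m * E a p z (k + 1) n t).im =
      -Real.pi * (t ^ m * (dens z (k + 1) t * (E a p z k n t).re)) := by
    intro t
    rw [← Complex.ofReal_pow, Complex.im_ofReal_mul, S.E_im hz hk]; ring
  have h3 : Integrable fun t : ℝ => ((t : ℂ) ^ m * E a p z (k + 1) n t).im := h1.im
  have h4 : ∫ t : ℝ, ((t : ℂ) ^ m * E a p z (k + 1) n t).im = 0 := by
    have := integral_im h1
    rw [h2] at this
    simpa using this
  have hpi : -Real.pi ≠ 0 := neg_ne_zero.2 Real.pi_ne_zero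
  simp only [him] at h3 h4
  rw [integral_const_mul, mul_eq_zero, or_iff_right hpi] at h4
  refine ⟨?_, h4⟩
  simpa only [inv_mul_cancel_left₀ hpi] using h3.const_mul (-Real.pi)⁻¹

/-- Cauchy's formula at a real point off `Γ_{k+1}`. A zero of `E_{k+1}` there becomes an additional
orthogonality relation, against `1 / (t - v)`. -/
theorem E_re_eq_integral (S : CritSetup a p x s) (hz : IsRootLabelling a p z) {k n : ℕ} (hk : k < p)
    {v : ℝ} (hv : (v : ℂ) ∉ Γ z (k + 1)) :
    Integrable (fun t : ℝ => dens z (k + 1) t * (E a p z k n t).re / (t - v)) ∧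
      (E a p z (k + 1) n v).re = -∫ t : ℝ, dens z (k + 1) t * (E a p z k n t).re / (t - v) := by
  obtain ⟨C, hC⟩ := S.exists_norm_E_le hz hk n
  obtain ⟨hθ, hθ1⟩ := S.one_div_mem
  have hp0 : (0 : ℝ) < p := by have := S.one_le; positivity
  have hb : ∀ l ∈ upperHP, ‖E a p z (k + 1) n l‖ ≤ C * (1 + ‖l‖) ^ (-(1 / p : ℝ)) := by
    intro l hl
    have hC0 : 0 ≤ C := nonneg_of_mul_nonneg_left ((norm_nonneg _).trans (hC l hl))
      (Real.rpow_pos_of_pos (by positivity) _)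
    refine (hC l hl).trans (mul_le_mul_of_nonneg_left (Real.rpow_le_rpow_of_exponent_le
      (by linarith [norm_nonneg l]) ?_) hC0)
    have h1 : (k : ℝ) + 1 ≤ p := by exact_mod_cast hk
    rw [neg_le_neg_iff, one_add_div hp0.ne', div_le_div_iff_of_pos_right hp0]
    linarith [(Nat.cast_nonneg n : (0 : ℝ) ≤ n)]
  have hcont := S.continuous_E hz (show k + 1 ≤ p + 1 by omega) n
  obtain ⟨δ, hδ, hball⟩ := S.exists_ball_compl hz hk hv
  obtain ⟨h1, h2⟩ := cauchy_formula_real hθ hθ1 (S.differentiableOn_E hz (by omega) n)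
    (fun l => norm_le_majorant hθ hb (l := l)) (fun t _ => tendsto_vertical hcont t) hδ (fun t ht =>
      S.E_im_eq_zero hz (by omega) (fun _ _ => hball t ht) n) (tendsto_vertical hcont v)
  have him : ∀ t : ℝ, (E a p z (k + 1) n t).im / (t - v) =
      -Real.pi * (dens z (k + 1) t * (E a p z k n t).re / (t - v)) := by
    intro t; rw [S.E_im hz hk]; ring
  have hpi : -Real.pi ≠ 0 := neg_ne_zero.2 Real.pi_ne_zero
  simp only [him] at h1 h2
  refine ⟨by simpa only [inv_mul_cancel_left₀ hpi] using h1.const_mul (-Real.pi)⁻¹, ?_⟩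
  rw [h2, integral_const_mul, ← Complex.ofReal_inv, ← Complex.ofReal_mul, Complex.ofReal_re]
  field_simp

end CritSetup

/-! ### Zeros of functions orthogonal to polynomials -/

theorem exists_sign_of_ne_zero {I : Set ℝ} (hI : IsPreconnected I) {f : ℝ → ℝ} (hf : ContinuousOn f I)
    (h : ∀ t ∈ I, f t ≠ 0) : ∃ ε : ℝ, (ε = 1 ∨ ε = -1) ∧ ∀ t ∈ I, 0 < ε * f t := by
  by_cases hpos : ∀ t ∈ I, 0 < f t
  · exact ⟨1, Or.inl rfl, fun t ht => by simpa using hpos t ht⟩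
  · push Not at hpos
    obtain ⟨u, hu, hu'⟩ := hpos
    refine ⟨-1, Or.inr rfl, fun t ht => ?_⟩
    by_contra hcon
    obtain ⟨v, hv, hv'⟩ := hI.intermediate_value hu ht hf ⟨hu', by linarith⟩
    exact h v hv hv'

/-- A polynomial that changes sign exactly where a function with finitely many zeros does. -/
theorem exists_sign_polynomial {f : ℝ → ℝ} (Z : Finset ℝ) : ∀ I : Set ℝ, I.OrdConnected →
    ContinuousOn f I → (∀ t ∈ Z, f t = 0) → (∀ t ∈ I, f t = 0 → t ∈ Z) →
    ∃ T : ℝ[X], T.natDegree ≤ Z.card ∧ (∀ t, T.eval t = 0 → t ∈ Z) ∧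
      (∀ t, (∀ c ∈ Z, c < t) → 0 < T.eval t) ∧
      ∃ ε : ℝ, (ε = 1 ∨ ε = -1) ∧ ∀ t ∈ I, 0 ≤ ε * (T.eval t * f t) := by
  induction Z using Finset.induction_on_max with
  | empty =>
    intro I hI hf _ h
    obtain ⟨ε, hε, h1⟩ := exists_sign_of_ne_zero hI.isPreconnected hf
      fun t ht h0 => Finset.notMem_empty _ (h t ht h0)
    exact ⟨1, by simp, by simp, by simp, ε, hε, fun t ht => by simpa using (h1 t ht).le⟩
  | insert c Z hc ih =>
    intro I hI hf hZ h
    have hcZ : c ∉ Z := fun h => lt_irrefl _ (hc c h)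
    obtain ⟨T, hT1, hT2, hT3, e, he, hT4⟩ := ih (I ∩ Set.Iio c) (hI.inter Set.ordConnected_Iio)
      (hf.mono Set.inter_subset_left) (fun t ht => hZ t (Finset.mem_insert_of_mem ht)) fun t ht h0 => by
        rcases Finset.mem_insert.1 (h t ht.1 h0) with h1 | h1
        · exact absurd h1 (ne_of_lt ht.2)
        · exact h1
    obtain ⟨d, hd, hd'⟩ := exists_sign_of_ne_zero (hI.inter (Set.ordConnected_Ioi (a := c))).isPreconnected
      (hf.mono Set.inter_subset_left) fun t ht h0 => by
        have h2 : c < t := ht.2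
        rcases Finset.mem_insert.1 (h t ht.1 h0) with h1 | h1
        · exact h2.ne' h1
        · exact lt_asymm h2 (hc t h1)
    have hfc : f c = 0 := hZ c (Finset.mem_insert_self _ _)
    have hpos : ∀ t, c < t → 0 < T.eval t := fun t ht => hT3 t fun c' hc' => (hc c' hc').trans ht
    have hcard : Z.card ≤ (insert c Z).card := Finset.card_le_card (Finset.subset_insert _ _)
    -- The largest zero `c` of `f` becomes a zero of `T` only if `f` changes sign across it relative
    -- to `T`.
    by_cases hed : e = d
    · refine ⟨T, hT1.trans hcard, fun t ht => Finset.mem_insert_of_mem (hT2 t ht),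
        fun t ht => hpos t (ht c (Finset.mem_insert_self _ _)), e, he, fun t ht => ?_⟩
      rcases lt_trichotomy t c with h1 | h1 | h1
      · exact hT4 t ⟨ht, h1⟩
      · rw [h1, hfc]; simp
      · have := _root_.mul_pos (hpos t h1) (hd' t ⟨ht, h1⟩)
        rw [hed]; linarith
    · have hde : d = -e := by
        rcases he with rfl | rfl <;> rcases hd with rfl | rfl <;> simp_all
      refine ⟨T * (X - C c), ?_, fun t ht => ?_, fun t ht => ?_, d, hd, fun t ht => ?_⟩
      · rw [Finset.card_insert_of_notMem hcZ]
        exact natDegree_mul_le.trans (add_le_add hT1 (natDegree_X_sub_C_le c))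
      · rw [eval_mul, mul_eq_zero] at ht
        rcases ht with ht | ht
        · exact Finset.mem_insert_of_mem (hT2 t ht)
        · rw [eval_sub, eval_X, eval_C, sub_eq_zero] at ht
          rw [ht]; exact Finset.mem_insert_self _ _
      · have h1 := ht c (Finset.mem_insert_self _ _)
        rw [eval_mul, eval_sub, eval_X, eval_C]
        exact _root_.mul_pos (hpos t h1) (by linarith)
      · rw [eval_mul, eval_sub, eval_X, eval_C]
        rcases lt_trichotomy t c with h1 | h1 | h1
        · have := mul_nonneg (hT4 t ⟨ht, h1⟩) (show 0 ≤ c - t by linarith)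
          rw [hde]; linarith
        · rw [h1, hfc]; simp
        · have := mul_nonneg (_root_.mul_pos (hpos t h1) (hd' t ⟨ht, h1⟩)).le
            (show 0 ≤ t - c by linarith)
          linarith

/-- The classical argument: with fewer than `N` zeros, a polynomial of degree less than `N` with the
sign changes of `f` makes the integrand of constant sign, so its vanishing integral forces `f = 0`
almost everywhere on `I`. -/
theorem exists_zeros_of_orthogonal {I : Set ℝ} (hIo : IsOpen I) (hIc : I.OrdConnected)
    (hne : I.Nonempty) {f w : ℝ → ℝ} (hf : ContinuousOn f I) {ε : ℝ} (hw : ∀ t ∈ I, 0 < ε * w t)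
    (hw0 : ∀ t ∉ I, w t = 0) {N : ℕ}
    (h : ∀ R : ℝ[X], R.natDegree < N → Integrable (fun t => R.eval t * (w t * f t)) ∧
      ∫ t, R.eval t * (w t * f t) = 0) :
    ∃ Z : Finset ℝ, Z.card = N ∧ ∀ t ∈ Z, t ∈ I ∧ f t = 0 := by
  by_cases hfin : {t | t ∈ I ∧ f t = 0}.Finite
  · rcases le_or_gt N hfin.toFinset.card with hN | hN
    · obtain ⟨Z, hZ, hcard⟩ := Finset.exists_subset_card_eq hN
      exact ⟨Z, hcard, fun t ht => by simpa using hZ ht⟩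
    · exfalso
      obtain ⟨T, hT1, hT2, -, δ, hδ, hT4⟩ := exists_sign_polynomial hfin.toFinset I hIc hf
        (fun t ht => ((Set.Finite.mem_toFinset hfin).1 ht).2)
        fun t ht h0 => (Set.Finite.mem_toFinset hfin).2 ⟨ht, h0⟩
      obtain ⟨h1, h2⟩ := h T (hT1.trans_lt hN)
      have hnn : ∀ t, 0 ≤ ε * δ * (T.eval t * (w t * f t)) := by
        intro t
        by_cases ht : t ∈ I
        · have := mul_nonneg (hw t ht).le (hT4 t ht)
          linarith
        · simp [hw0 t ht]
      have hεδ : ε * δ ≠ 0 := by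
        obtain ⟨t, ht⟩ := hne
        refine mul_ne_zero ?_ (by rcases hδ with rfl | rfl <;> norm_num)
        rintro rfl
        simpa using hw t ht
      have h3 : ∫ t, ε * δ * (T.eval t * (w t * f t)) = 0 := by rw [integral_const_mul, h2, mul_zero]
      rw [integral_eq_zero_iff_of_nonneg hnn (h1.const_mul _)] at h3
      have h4 : ∀ᵐ t : ℝ, t ∉ I := by
        filter_upwards [h3, compl_mem_ae_iff.2 (hfin.measure_zero volume)] with t ht1 ht2 ht
        have hft : f t ≠ 0 := fun h0 => ht2 ⟨ht, h0⟩
        have hwt : w t ≠ 0 := fun h0 => by simpa [h0] using hw t ht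
        have hTt : T.eval t ≠ 0 := fun h0 => ht2 ((Set.Finite.mem_toFinset hfin).1 (hT2 t h0))
        exact mul_ne_zero hεδ (mul_ne_zero hTt (mul_ne_zero hwt hft)) ht1
      exact (hIo.measure_pos volume hne).ne' (by simpa [ae_iff] using h4)
  · obtain ⟨Z, hZ, hcard⟩ := Set.Infinite.exists_subset_card_eq hfin N
    exact ⟨Z, hcard, fun t ht => hZ ht⟩

/-- Division by the nodal polynomial and partial fractions write its quotient into `R` as a
polynomial of degree less than `n` (when `n > 0`), or zero, plus multiples of `1 / (t - τ)`. Since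
`φ` vanishes on `Z`, the conventional value of a quotient at a node is harmless. -/
theorem integral_div_nodal {φ : ℝ → ℝ} {Z : Finset ℝ} {n : ℕ}
    (h1 : ∀ k < n, Integrable (fun t => t ^ k * φ t) ∧ ∫ t, t ^ k * φ t = 0)
    (h2 : ∀ τ ∈ Z, φ τ = 0 ∧ Integrable (fun t => φ t / (t - τ)) ∧ ∫ t, φ t / (t - τ) = 0)
    {R : ℝ[X]} (hR : R.natDegree < n + Z.card) :
    Integrable (fun t => R.eval t * (φ t / (Lagrange.nodal Z id).eval t)) ∧
      ∫ t, R.eval t * (φ t / (Lagrange.nodal Z id).eval t) = 0 := by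
  set N : ℝ[X] := Lagrange.nodal Z id with hN
  have hm : N.Monic := Lagrange.nodal_monic
  set D := R /ₘ N with hD
  set R₀ := R %ₘ N with hR₀
  have hR₀' : R₀ = Lagrange.interpolate Z id fun i => R₀.eval i :=
    Lagrange.eq_interpolate (Function.injective_id.injOn) (by
      rw [← Lagrange.degree_nodal (s := Z) (v := id)]; exact degree_modByMonic_lt R hm)
  have hDn : ∀ t, D.eval t = ∑ i ∈ Finset.range n, D.coeff i * t ^ i := by
    intro t
    have h3 : N.natDegree = Z.card := Lagrange.natDegree_nodal
    by_cases hlt : R.natDegree < N.natDegree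
    · have : D = 0 := (divByMonic_eq_zero_iff hm).2 (degree_lt_degree hlt)
      simp [this]
    · refine eval_eq_sum_range' ?_ t
      rw [hD, natDegree_divByMonic _ hm]
      omega
  set W : ℝ → ℝ := fun τ => Lagrange.nodalWeight Z id τ * R₀.eval τ with hW
  have hpt : ∀ t, R.eval t * (φ t / N.eval t) = ∑ i ∈ Finset.range n, D.coeff i * (t ^ i * φ t) +
      ∑ τ ∈ Z, W τ * (φ t / (t - τ)) := by
    intro t
    by_cases ht : t ∈ Z
    · simp [(h2 t ht).1]
    · have h0 : N.eval t ≠ 0 := by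
        rw [hN, Lagrange.eval_nodal, Finset.prod_ne_zero_iff]
        intro τ hτ
        rw [sub_ne_zero]; rintro rfl; exact ht hτ
      have h3 : R.eval t = R₀.eval t + N.eval t * D.eval t := by
        rw [← eval_mul, ← eval_add, modByMonic_add_div R N]
      have h4 : R₀.eval t = N.eval t * ∑ τ ∈ Z, W τ * (t - τ)⁻¹ := by
        conv_lhs => rw [hR₀']
        rw [Lagrange.eval_interpolate_not_at_node _ fun i hi => by rintro rfl; exact ht hi]
        congr 1
        exact Finset.sum_congr rfl fun τ _ => by simp only [hW, id]; ring
      have h5 : ∀ A B : ℝ, (N.eval t * A + N.eval t * B) * (φ t / N.eval t) = B * φ t + A * φ t := by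
        intro A B; field_simp; ring
      rw [h3, h4, hDn, h5, Finset.sum_mul, Finset.sum_mul]
      congr 1
      · exact Finset.sum_congr rfl fun i _ => by ring
      · exact Finset.sum_congr rfl fun i _ => by ring
  have hI1 := integrable_finsetSum (Finset.range n) fun i hi =>
    (h1 i (Finset.mem_range.1 hi)).1.const_mul (D.coeff i)
  have hI2 := integrable_finsetSum Z fun τ hτ => (h2 τ hτ).2.1.const_mul (W τ)
  simp only [hpt]
  refine ⟨hI1.add hI2, ?_⟩
  rw [integral_add hI1 hI2, integral_finsetSum _ fun i hi =>
    (h1 i (Finset.mem_range.1 hi)).1.const_mul (D.coeff i),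
    integral_finsetSum _ fun τ hτ => (h2 τ hτ).2.1.const_mul (W τ), Finset.sum_eq_zero,
    Finset.sum_eq_zero, add_zero]
  · intro τ hτ; rw [integral_const_mul, (h2 τ hτ).2.2, mul_zero]
  · intro i hi; rw [integral_const_mul, (h1 i (Finset.mem_range.1 hi)).2, mul_zero]

/-! ### The zeros of `Q_n` -/

theorem monic_Q (a : ℕ → ℝ) (p n : ℕ) : (Q a p n).Monic ∧ (Q a p n).natDegree = n := by
  induction n using Nat.strong_induction_on with
  | _ n ih =>
    cases n with
    | zero => rw [Q_zero]; exact ⟨monic_one, natDegree_one⟩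
    | succ n =>
      obtain ⟨h1, h2⟩ := ih n (by omega)
      have h3 : (X * Q a p n).Monic := monic_X.mul h1
      have h4 : (X * Q a p n).natDegree = n + 1 := by
        rw [natDegree_X_mul h1.ne_zero, h2]
      have h5 : (∑ k ∈ Finset.range (p + 1),
          if k ≤ n then C (a k) * Q a p (n - k) else 0).natDegree ≤ n := by
        refine natDegree_sum_le_of_forall_le _ _ fun k _ => ?_
        split_ifs
        · refine (natDegree_C_mul_le _ _).trans ?_
          rw [(ih (n - k) (by omega)).2]; omega
        · simp
      rw [Q_succ]
      exact ⟨h3.sub_of_left (degree_lt_degree (by omega)), by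
        rw [natDegree_sub_eq_left_of_natDegree_lt (by omega), h4]⟩

theorem sum_multiIndex {p : ℕ} (hp : 1 ≤ p) (n : ℕ) :
    ∑ j ∈ Finset.Ico 1 (p + 1), multiIndex p n j = n := by
  have h1 : (Finset.Ico 1 (p + 1)).filter (fun j => j ≤ n % p) = Finset.Ico 1 (n % p + 1) := by
    ext j
    have := Nat.mod_lt n hp
    simp only [Finset.mem_filter, Finset.mem_Ico]
    omega
  simp only [multiIndex, Finset.sum_add_distrib, Finset.sum_const, Nat.card_Ico]
  rw [← Finset.card_filter, h1, Nat.card_Ico, smul_eq_mul, Nat.add_sub_cancel, Nat.add_sub_cancel]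
  exact Nat.div_add_mod n p

theorem roots_eq_of_zeros {P : ℝ[X]} {n : ℕ} (hP : P.Monic) (hn : P.natDegree = n) {Z : Finset ℝ}
    (hcard : Z.card = n) (hZ : ∀ t ∈ Z, P.eval t = 0) :
    (P.map (algebraMap ℝ ℂ)).roots = Z.val.map fun t : ℝ => (t : ℂ) := by
  have h1 : (P.map (algebraMap ℝ ℂ)) ≠ 0 := (hP.map _).ne_zero
  symm
  refine Multiset.eq_of_le_of_card_le ((Multiset.le_iff_subset
    (Z.nodup.map Complex.ofReal_injective)).2 fun w hw => ?_) ?_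
  · obtain ⟨t, ht, rfl⟩ := Multiset.mem_map.1 hw
    rw [mem_roots h1, IsRoot.def, eval_map_algebraMap]
    have := aeval_algebraMap_apply_eq_algebraMap_eval (A := ℂ) t P
    rw [hZ t ht, map_zero] at this
    exact this
  · rw [Multiset.card_map]
    refine (card_roots' _).trans ?_
    rw [hP.natDegree_map, hn]
    exact hcard.ge

namespace CritSetup

variable {a x : ℕ → ℝ} {p : ℕ} {s : ℝ} {z : ℕ → ℂ → ℂ}

theorem ordConnected_interior (S : CritSetup a p x s) (hz : IsRootLabelling a p z) {k : ℕ} (hk : k < p) :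
    (interior (ΓReal z (k + 1))).OrdConnected ∧ (interior (ΓReal z (k + 1))).Nonempty := by
  have hmul : ∀ e u v t : ℝ, (e = 1 ∨ e = -1) → t ∈ Set.Icc u v →
      min (e * u) (e * v) ≤ e * t ∧ e * t ≤ max (e * u) (e * v) := by
    rintro e u v t (rfl | rfl) ⟨h1, h2⟩
    · exact ⟨(min_le_left _ _).trans (by linarith), le_trans (by linarith) (le_max_right _ _)⟩
    · exact ⟨(min_le_right _ _).trans (by linarith), le_trans (by linarith) (le_max_left _ _)⟩
  rcases Nat.eq_zero_or_pos k with rfl | hk0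
  · have hI := S.mem_interior_one_iff hz
    refine ⟨⟨fun u hu v hv t ht => ?_⟩, ⟨(branchPt a p x (p + 1) + branchPt a p x 1) / 2, ?_⟩⟩
    · obtain ⟨h1, h2⟩ := hmul s u v t S.sign ht
      have hu := (hI u).1 hu
      have hv := (hI v).1 hv
      exact (hI t).2 ⟨(lt_min hu.1 hv.1).trans_le h1, h2.trans_lt (max_lt hu.2 hv.2)⟩
    · have := (S.mem_Γ_one_iff hz).1
      exact (hI _).2 ⟨by linarith, by linarith⟩
  · obtain ⟨e, he', he⟩ := S.exists_sign_curv (m := k + 1) (Finset.mem_Icc.2 ⟨by omega, by omega⟩)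
    have hI := S.mem_interior_iff hz (show 2 ≤ k + 1 by omega) (by omega) he
    refine ⟨⟨fun u hu v hv t ht => ?_⟩, ⟨branchPt a p x (k + 1) - e, ?_⟩⟩
    · have h1 := (hmul e u v t he' ht).2
      have hu := (hI u).1 hu
      have hv := (hI v).1 hv
      rw [mul_sub, sub_neg] at hu hv
      rw [hI, mul_sub, sub_neg]
      exact h1.trans_lt (max_lt hu hv)
    · rw [hI]
      rcases he' with h' | h' <;> rw [h'] <;> norm_num

/-- Zeros of `E_{k+1}` off `Γ_{k+1}` produce additional zeros of `E_k` on `Γ_{k+1}`. -/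
theorem exists_zeros_E (S : CritSetup a p x s) (hz : IsRootLabelling a p z) (n : ℕ) {k : ℕ} (hk : k < p)
    {Z : Finset ℝ} (hZ : ∀ t ∈ Z, (t : ℂ) ∉ Γ z (k + 1) ∧ (E a p z (k + 1) n t).re = 0) :
    ∃ Z' : Finset ℝ, Z'.card = multiIndex p n (k + 1) + Z.card ∧
      ∀ t ∈ Z', t ∈ interior (ΓReal z (k + 1)) ∧ (E a p z k n t).re = 0 := by
  obtain ⟨hI, hne⟩ := S.ordConnected_interior hz hk
  have hNne : ∀ t ∈ interior (ΓReal z (k + 1)), (Lagrange.nodal Z id).eval t ≠ 0 := by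
    intro t ht
    rw [Lagrange.eval_nodal, Finset.prod_ne_zero_iff]
    intro τ hτ
    rw [sub_ne_zero]
    rintro rfl
    exact (hZ _ hτ).1 (show t ∈ ΓReal z (k + 1) from interior_subset ht)
  obtain ⟨δ, hδ, hδ'⟩ := exists_sign_of_ne_zero hI.isPreconnected
    (Lagrange.nodal Z id).continuous.continuousOn hNne
  -- The sign combines that of `dens`, opposite to `imSign`, with the sign `δ` of the nodal
  -- polynomial, whose zeros lie off `Γ_{k+1}`.
  refine exists_zeros_of_orthogonal isOpen_interior hI hne (f := fun t : ℝ => (E a p z k n t).re)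
    (w := fun t => dens z (k + 1) t / (Lagrange.nodal Z id).eval t) (ε := -(imSign z k * δ))
    (Continuous.continuousOn ?_) (fun t ht => ?_) (fun t ht => ?_) fun R hR => ?_
  · exact Complex.continuous_re.comp ((S.continuous_E hz (by omega) n).comp Complex.continuous_ofReal)
  · have h1 := S.imSign_mul_dens_neg hz hk ht
    have h2 := hδ' t ht
    have h3 : -(imSign z k * δ) * (dens z (k + 1) t / (Lagrange.nodal Z id).eval t) =
        -(imSign z k * dens z (k + 1) t) / (δ * (Lagrange.nodal Z id).eval t) := by
      have hδ0 : δ * δ = 1 := by rcases hδ with rfl | rfl <;> norm_num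
      have := hNne t ht
      have hδ1 : δ ≠ 0 := by rintro rfl; simp at hδ0
      field_simp
      linear_combination -(imSign z k * dens z (k + 1) t) * hδ0
    rw [h3]
    exact div_pos (by linarith) h2
  · simp [S.dens_eq_zero hz hk ht]
  · have h := integral_div_nodal (φ := fun t => dens z (k + 1) t * (E a p z k n t).re) (Z := Z)
      (fun m hm => S.integral_pow_mul_E hz hk (add_mul_le_of_lt_multiIndex (by omega) hm))
      (fun τ hτ => by
        obtain ⟨h1, h2⟩ := S.E_re_eq_integral hz hk (n := n) (hZ τ hτ).1
        refine ⟨?_, h1, ?_⟩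
        · rw [dens, Set.indicator_of_notMem (show τ ∉ ΓReal z (k + 1) from (hZ τ hτ).1), zero_mul]
        · rw [(hZ τ hτ).2] at h2; linarith) hR
    simpa only [div_mul_eq_mul_div] using h

/-- The descent starts at `k = p - 1` without extra zeros. Zeros found inside `Γ_{k+2}` are off
`Γ_{k+1}` by disjointness, so they add relations for the next function; at `k = 0` this function is
`Q_n`. -/
theorem exists_zeros_E_descending (S : CritSetup a p x s) (hz : IsRootLabelling a p z) (n d : ℕ) :
    ∀ k, k + d + 1 = p → ∃ Z : Finset ℝ, Z.card = ∑ j ∈ Finset.Ico (k + 1) (p + 1), multiIndex p n j ∧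
      ∀ t ∈ Z, t ∈ interior (ΓReal z (k + 1)) ∧ (E a p z k n t).re = 0 := by
  induction d with
  | zero =>
    intro k hk
    obtain ⟨Z, h1, h2⟩ := S.exists_zeros_E hz n (k := k) (Z := ∅) (by omega) (by simp)
    refine ⟨Z, ?_, h2⟩
    rw [h1, ← hk]; simp
  | succ d ih =>
    intro k hk
    obtain ⟨Z, h1, h2⟩ := ih (k + 1) (by omega)
    obtain ⟨Z', h3, h4⟩ := S.exists_zeros_E hz n (k := k) (Z := Z) (by omega) fun t ht =>
      ⟨fun h => S.Γ_disjoint hz (by omega) h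
        (show t ∈ ΓReal z (k + 2) from interior_subset (h2 t ht).1), (h2 t ht).2⟩
    refine ⟨Z', ?_, h4⟩
    rw [h3, h1, Finset.sum_eq_sum_Ico_succ_bot (show k + 1 < p + 1 by omega)]

theorem exists_roots_Q (S : CritSetup a p x s) (hz : IsRootLabelling a p z) (n : ℕ) :
    ∃ Z : Finset ℝ, Z.card = n ∧ (∀ t ∈ Z, t ∈ interior (ΓReal z 1)) ∧
      ((Q a p n).map (algebraMap ℝ ℂ)).roots = Z.val.map fun t : ℝ => (t : ℂ) := by
  have hp := S.one_le
  obtain ⟨Z, h1, h2⟩ := S.exists_zeros_E_descending hz n (p - 1) 0 (by omega)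
  rw [zero_add, sum_multiIndex hp] at h1
  refine ⟨Z, h1, fun t ht => (h2 t ht).1, roots_eq_of_zeros (monic_Q a p n).1 (monic_Q a p n).2 h1
    fun t ht => ?_⟩
  have h3 := (h2 t ht).2
  rwa [E, QC_ofReal, Complex.ofReal_re] at h3

end CritSetup

end ConstRec

end

/-! ### Assembly of the theorem. -/

theorem mainTheorem2 (p : ℕ) (hp : 2 ≤ p) (a x : ℕ → ℝ)
    (hq : ConstRec.q a p = ∏ k ∈ Finset.Icc 1 (p + 1), (X - C (x k)))
    (hx : ConstRec.NegCase p x ∨ ConstRec.PosCase p x)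
    (z : ℕ → ℂ → ℂ) (hz : ConstRec.IsRootLabelling a p z) :
    -- i)
    (ConstRec.NegCase p x →
      ConstRec.branchPt a p x 1 < ConstRec.branchPt a p x (p + 1) ∧
      ConstRec.Γ z 1 = (fun t : ℝ => (t : ℂ)) ''
        Set.Icc (ConstRec.branchPt a p x 1) (ConstRec.branchPt a p x (p + 1))) ∧
    (ConstRec.PosCase p x →
      ConstRec.branchPt a p x (p + 1) < ConstRec.branchPt a p x 1 ∧
      ConstRec.Γ z 1 = (fun t : ℝ => (t : ℂ)) ''
        Set.Icc (ConstRec.branchPt a p x (p + 1)) (ConstRec.branchPt a p x 1)) ∧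
    (∀ k ∈ Finset.Icc 2 p,
      (IsLocalMax (ConstRec.r a p) (x k) ∨ IsLocalMin (ConstRec.r a p) (x k)) ∧
      (IsLocalMax (ConstRec.r a p) (x k) →
        ConstRec.Γ z k = (fun t : ℝ => (t : ℂ)) '' Set.Ici (ConstRec.branchPt a p x k)) ∧
      (IsLocalMin (ConstRec.r a p) (x k) →
        ConstRec.Γ z k = (fun t : ℝ => (t : ℂ)) '' Set.Iic (ConstRec.branchPt a p x k))) ∧
    -- the system `(σ_1, …, σ_p)` is well defined
    ConstRec.IsNikishinSystem p z (ConstRec.branchPt a p x) ∧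
    -- ii) and iii)
    (∃ (μ : ℕ → SignedMeasure ℝ) (c : ℕ → ℕ → ℝ),
      (∀ k ∈ Finset.Icc 1 p,
        μ k ≪ᵥ (volume : Measure ℝ).toENNRealVectorMeasure ∧
        (μ k).totalVariation (ConstRec.ΓReal z 1)ᶜ = 0 ∧
        (∀ l ∈ resolventSet ℂ (ConstRec.toeplitzOp a p),
          l ∉ ConstRec.Γ z 1 ∧ ConstRec.g a p k l = ConstRec.cauchyTransform (μ k) l) ∧
        (∀ l ∉ ConstRec.Γ z 1, z 0 l ^ k = ConstRec.cauchyTransform (μ k) l)) ∧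
      (∀ j ∈ Finset.Icc 1 p, c j j = 1 ∧
        μ j = ∑ k ∈ Finset.Icc 1 j, c j k • ConstRec.σ z (ConstRec.branchPt a p x) k)) ∧
    -- iv)
    (∀ n : ℕ,
      (∀ j ∈ Finset.Icc 1 p, ∀ k < ConstRec.multiIndex p n j,
        ∫ᵛ t, t ^ k * (ConstRec.Q a p n).eval t
          ∂<•(ConstRec.σ z (ConstRec.branchPt a p x) j) = 0) ∧
      ((ConstRec.Q a p n).map (algebraMap ℝ ℂ)).roots.card = n ∧
      ((ConstRec.Q a p n).map (algebraMap ℝ ℂ)).roots.Nodup ∧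
      ∀ w ∈ ((ConstRec.Q a p n).map (algebraMap ℝ ℂ)).roots,
        ∃ t ∈ interior (ConstRec.ΓReal z 1), w = (t : ℂ)) := by
  obtain ⟨s, S⟩ : ∃ s, ConstRec.CritSetup a p x s := by
    rcases hx with h | h
    · exact ⟨-1, h.critSetup hp hq⟩
    · exact ⟨1, h.critSetup hp hq⟩
  refine ⟨fun h => ?_, fun h => ?_, fun k hk => ?_, S.isNikishinSystem hz, ?_, fun n => ⟨fun j hj k hk =>
    S.integral_σ_eq_zero hz n hj hk, ?_⟩⟩
  · have S' := ConstRec.NegCase.critSetup hp h hq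
    obtain ⟨h1, h2⟩ := S'.mem_Γ_one_iff hz
    refine ⟨by linarith, S'.Γ_eq_image hz le_rfl S'.one_le fun v => (h2 v).trans ?_⟩
    rw [Set.mem_Icc]
    constructor <;> rintro ⟨h3, h4⟩ <;> constructor <;> linarith
  · have S' := ConstRec.PosCase.critSetup hp h hq
    obtain ⟨h1, h2⟩ := S'.mem_Γ_one_iff hz
    refine ⟨by linarith, S'.Γ_eq_image hz le_rfl S'.one_le fun v => (h2 v).trans ?_⟩
    rw [Set.mem_Icc]
    constructor <;> rintro ⟨h3, h4⟩ <;> constructor <;> linarith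
  · rw [Finset.mem_Icc] at hk
    exact S.localExtr_and_Γ hz hk.1 hk.2
  · choose! c hc hc' using fun j (hj : j ∈ Finset.Icc 1 p) => S.exists_measure_eq_sum hz hj
    refine ⟨fun k => volume.withDensityᵥ (ConstRec.J z k), c, fun k hk => ?_, fun j hj =>
      ⟨hc j hj, hc' j hj⟩⟩
    have hk1 := (Finset.mem_Icc.1 hk).1
    refine ⟨Measure.withDensityᵥ_absolutelyContinuous _ _,
      ConstRec.totalVariation_withDensityᵥ_eq_zero (S.integrable_J hz hk1)
        (S.isCompact_ΓReal_one hz).isClosed.measurableSet.compl fun t ht => S.J_eq_zero hz hk1 ht,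
      fun l hl => ?_, fun l hl => S.cauchyTransform_withDensityᵥ_J hz hk1 hl⟩
    obtain ⟨h1, h2⟩ := ConstRec.notMem_Γ_and_g_eq S.one_le S.a_ne_zero hz hl
    exact ⟨h1, (h2 k hk1).trans (S.cauchyTransform_withDensityᵥ_J hz hk1 h1)⟩
  · obtain ⟨Z, h1, h2, h3⟩ := S.exists_roots_Q hz n
    rw [h3]
    refine ⟨by rw [Multiset.card_map]; exact h1, Z.nodup.map Complex.ofReal_injective, fun w hw => ?_⟩
    obtain ⟨t, ht, rfl⟩ := Multiset.mem_map.1 hw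
    exact ⟨t, h2 t ht, rfl⟩
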